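/- Let $m,n\ge 0$, $p\ge 1$ be integers, $0<k_1<\dots<k_p<k_{p+1}=+\infty$, $1/\kappa_i=1/k_i-1/k_{i+1}$ (so $\kappa_p=k_p$), and let $\theta=(\theta_1,\dots,\theta_p)\in\mathbb R^p$ be a multidirection, i.e. $|\theta_i-\theta_{i+1}|\le \pi/(2\kappa_i)$ for $1\le i\le p-1$. **Definitions.** Let $\Omega$ be an open set in some $\mathbb C^d$ and, for $\varepsilon>0$, let $S(\theta_j,\varepsilon)=\{\xi:|\arg \xi-\theta_j|<\varepsilon\}$, a sector in the universal covering of $\mathbb C\setminus\{0\}$. $\mathrm{Exp}(\kappa,S\times\Omega)$ is the set of $\psi(\xi,Y)$ holomorphic on $S\times\Omega$ for which there are $M,c>0$ with $|\psi(\xi,Y)|\le Me^{c|\xi|^\kappa}$ for all $\xi\in S$, $|\xi|\ge1$, $Y\in\Omega$. For $k<k'$ and $1/\kappa=1/k-1/k'$, the acceleration operator $\mathscr A_{k',k}=\mathscr B_{k'}\mathscr L_{k}$ (Laplace transform of level $k$ followed by Borel transform of level $k'$), extended to functions $\psi$ of exponential order $\kappa$ that are $O(|\xi|^{s-k})$,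 $s>0$, at $\xi = 0$, is $$(\mathscr A_{k',k}\psi)(\xi)=\xi^{-k'}\int_{0}^{\infty e^{i\varphi}}\psi(\eta)\,C\big((\eta/\xi)^k\big)\,d\eta^{k},\qquad C(z)=\frac1{2\pi i}\int_{1-i\infty}^{1+i\infty}e^{\sigma-z\sigma^{k/k'}}\,d\sigma ,$$ for $|\xi|$ small and $|\arg\xi-\varphi|<\pi/(2\kappa)$, where the direction $\varphi$ of the ray may vary in the sector of $\psi$. A formal series $\widetilde f(t,Y)=\sum_{N\ge0}a_N(Y)t^N$ with $a_N\in\mathscr O(\Omega)$ is *$\mathbf k$-multisummable in the multidirection $\theta$ in $\Omega$* if there are $\varepsilon_1,\dots,\varepsilon_p>0$, $r_0>0$ and functions $f^j\in\mathrm{Exp}(\kappa_j,S(\theta_j,\varepsilon_j)\times\Omega)$ $(1\le j\le p)$ such that * $\sum_{N\ge1}a_N(Y)\,\xi^{N-1}/\Gamma(N/k_1)$ converges to a holomorphic function on $\{|\xi|<r_0\}\times\Omega$, and $f^1(\xi,Y)$ continues $\sum_{N\ge1}a_N(Y)\,\xi^{N-k_1}/\Gamma(N/k_1)$ from $\{0<|\xi|<r_0\}$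 to $S(\theta_1,\varepsilon_1)\times\Omega$; * for $2\le j\le p$, $f^{j}$ continues $\mathscr A_{k_j,k_{j-1}}f^{j-1}$ (the integrals being taken along rays in $S(\theta_{j-1},\varepsilon_{j-1})$) to $S(\theta_j,\varepsilon_j)\times\Omega$. (The constant term $a_0$ only has to be holomorphic in $\Omega$.) **Theorem.** Let $R_0,R_1>0$, $\Omega_0=\{x\in\mathbb C^n:|x|<R_0\}$, $\Omega=\Omega_0\times\{(U,P)\in\mathbb C^m\times\mathbb C^{mn}:|U|<R_1,|P|<R_1\}$ (maximum norms), and let $\widetilde f_i(t,x,U,P)=\sum_{N\ge0} f_{i,N}(x,U,P)t^N$, $1\le i\le m$, be $\mathbf k$-multisummable in the multidirection $\theta$ in $\Omega$. Then the Cauchy problem $$\partial_tu_i=\widetilde f_i(t,x,U,\nabla_xU),\quad u_i(0,x)=0,\qquad 1\le i\le m,\quad U=(u_1,\dots,u_m),\ \nabla_xU=(\partial_{x_j}u_i)_{i,j},$$ has a formal power series solution $\widetilde u_i(t,x)=\sum_{N\ge1}u_{i,N}(x)t^N$ with coefficients $u_{i,N}\in\mathscr O(\Omega_0)$, this solution is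 unique, and, writing $\widetilde u_i=t\,\widetilde v_i$, there is $r\in(0,R_0]$ such that $\widetilde v_1,\dots,\widetilde v_m$ are $\mathbf k$-multisummable in the same multidirection $\theta$ in $\omega_0=\{x\in\mathbb C^n:|x|<r\}$. -/

import Mathlib

noncomputable section

/-- The sector `{ξ : |arg ξ - θ| < ε}` of the universal covering of `ℂ \ {0}`, in the global
logarithmic coordinate `ζ = log ξ`: a point `ξ` of the covering is `exp ζ`, `arg ξ` is `ζ.im`,
`|ξ|` is `exp ζ.re`, and the branch of `ξ ^ s` on the covering is `exp (s * ζ)`. -/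
def logSector (θ ε : ℝ) : Set ℂ := {ζ : ℂ | |ζ.im - θ| < ε}

/-- `Exp(κ, S × Ω)`, with `S` the sector of bisecting direction `θ` and half-opening `ε`: functions
holomorphic on `S × Ω` (written in the logarithmic coordinate of `S`) with
`|f(ξ, Y)| ≤ M exp (c |ξ| ^ κ)` for `|ξ| ≥ 1`, uniformly in `Y ∈ Ω`. -/
def InExp {E : Type*} [NormedAddCommGroup E] [NormedSpace ℂ E]
    (κ θ ε : ℝ) (Ω : Set E) (f : ℂ × E → ℂ) : Prop :=
  DifferentiableOn ℂ f (logSector θ ε ×ˢ Ω) ∧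
    ∃ M c : ℝ, 0 < M ∧ 0 < c ∧ ∀ ζ ∈ logSector θ ε, 0 ≤ ζ.re → ∀ Y ∈ Ω,
      ‖f (ζ, Y)‖ ≤ M * Real.exp (c * Real.exp (κ * ζ.re))

/-- The acceleration kernel for levels `k₁ < k₂`, as a function of `w = log (η / ξ)`.
The `k₂`-Borel transform, in `t`, of `t ↦ exp (-(η / t) ^ k₁)` is
`(2πi)⁻¹ ∫ exp ((ξ / t) ^ k₂) exp (-(η / t) ^ k₁) d(t ^ (-k₂))`; in the variable
`σ = (ξ / t) ^ k₂` it equals `ξ ^ (-k₂)` times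
`(2πi)⁻¹ ∫ exp (σ - (η / ξ) ^ k₁ σ ^ (k₁ / k₂)) dσ`, which is taken here on the line `Re σ = 1`.
The integral converges absolutely for `|arg (η / ξ)| < (π / 2) (1 / k₁ - 1 / k₂)`. -/
def accelKernel (k₁ k₂ : ℝ) (w : ℂ) : ℂ :=
  (2 * (Real.pi : ℂ))⁻¹ * ∫ y : ℝ,
    Complex.exp ((1 + (y : ℂ) * Complex.I) -
      Complex.exp ((k₁ : ℂ) * w) * (1 + (y : ℂ) * Complex.I) ^ ((k₁ : ℂ) / (k₂ : ℂ)))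

/-- The `(k₂, k₁)`-acceleration operator on the ray `arg η = φ`, evaluated at `ξ = exp ζ`:
the Borel transform of level `k₂` composed with the Laplace transform of level `k₁`, after the
interchange of the two integrations, which extends it to functions of exponential order `κ`,
`1 / κ = 1 / k₁ - 1 / k₂`:
`ξ ^ (-k₂) ∫_{arg η = φ} f(η) C((η / ξ) ^ k₁) d(η ^ k₁)`. Here `η = exp (s + iφ)`, `s ∈ ℝ`. -/
def accel (k₁ k₂ φ : ℝ) (f : ℂ → ℂ) (ζ : ℂ) : ℂ :=
  Complex.exp (-(k₂ : ℂ) * ζ) * ∫ s : ℝ,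
    f ((s : ℂ) + (φ : ℂ) * Complex.I) *
      accelKernel k₁ k₂ ((s : ℂ) + (φ : ℂ) * Complex.I - ζ) *
      ((k₁ : ℂ) * Complex.exp ((k₁ : ℂ) * ((s : ℂ) + (φ : ℂ) * Complex.I)))

/-- The function `g` on the sector `(θ₂, ε₂)` continues the `(k₂, k₁)`-acceleration of the function
`f` on the sector `(θ₁, ε₁)`: for every ray `arg η = φ` in the first sector and every direction
`ψ = arg ξ` in the second one with `|ψ - φ| < π / (2κ)`, `1 / κ = 1 / k₁ - 1 / k₂`, the
acceleration integral of `f` along `arg η = φ` is equal to `g(ξ, Y)` when `|ξ|` is small. -/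
def IsAcceleration {E : Type*} (k₁ k₂ θ₁ ε₁ θ₂ ε₂ : ℝ) (Ω : Set E) (f g : ℂ × E → ℂ) : Prop :=
  ∀ φ ψ : ℝ, |φ - θ₁| < ε₁ → |ψ - θ₂| < ε₂ → |ψ - φ| < Real.pi / 2 * (k₁⁻¹ - k₂⁻¹) →
    ∀ Y ∈ Ω, ∀ᶠ s : ℝ in Filter.atBot,
      g ((s : ℂ) + (ψ : ℂ) * Complex.I, Y) =
        accel k₁ k₂ φ (fun η => f (η, Y)) ((s : ℂ) + (ψ : ℂ) * Complex.I)

/-- The numbers `κ_i`: `1 / κ_i = 1 / k_i - 1 / k_{i+1}`, and `κ_p = k_p` for the last level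
(that is, `k_{p+1} = +∞`). There are `p = q + 1` levels. -/
def levelOrder {q : ℕ} (k : Fin (q + 1) → ℝ) : Fin (q + 1) → ℝ :=
  Fin.snoc (α := fun _ => ℝ) (fun i : Fin q => ((k i.castSucc)⁻¹ - (k i.succ)⁻¹)⁻¹)
    (k (Fin.last q))

/-- `θ` is a multidirection for the levels `k`: `|θ_i - θ_{i+1}| ≤ π / (2κ_i)`. -/
def IsMultidirection {q : ℕ} (k θ : Fin (q + 1) → ℝ) : Prop :=
  ∀ i : Fin q, |θ i.castSucc - θ i.succ| ≤ Real.pi / (2 * levelOrder k i.castSucc)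

/-- The formal series `∑ a_n(Y) t ^ n` with coefficients in `𝒪(Ω)` is `k`-multisummable in the
multidirection `θ` in `Ω`. The definition is applied to the series without its constant term, so
only `a_1, a_2, …` enter after the first line. The function `F j`, on the sector
`|arg ξ - θ_j| < ε_j`, is the `j`-th function of the chain; the first one is
`ξ ^ (1 - k_1) h(ξ, Y)` near `0`, where `h` is the sum of
`ξ ^ (k_1 - 1)` times the formal `k_1`-Borel transform `∑_{n ≥ 1} a_n(Y) ξ ^ (n - k_1) / Γ(n / k_1)`,
and each of the others is the acceleration of the preceding one. -/
def IsMultisummable {E : Type*} [NormedAddCommGroup E] [NormedSpace ℂ E] {q : ℕ}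
    (k θ : Fin (q + 1) → ℝ) (Ω : Set E) (a : ℕ → E → ℂ) : Prop :=
  (∀ n, DifferentiableOn ℂ (a n) Ω) ∧
  ∃ (ε : Fin (q + 1) → ℝ) (F : Fin (q + 1) → ℂ × E → ℂ),
    (∀ j, 0 < ε j) ∧
    (∃ (r : ℝ) (h : ℂ × E → ℂ), 0 < r ∧
      DifferentiableOn ℂ h (Metric.ball (0 : ℂ) r ×ˢ Ω) ∧
      (∀ ξ ∈ Metric.ball (0 : ℂ) r, ∀ Y ∈ Ω,
        HasSum (fun n : ℕ => a (n + 1) Y / (Real.Gamma (((n : ℝ) + 1) / k 0) : ℂ) * ξ ^ n)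
          (h (ξ, Y))) ∧
      (∀ ζ ∈ logSector (θ 0) (ε 0), Real.exp ζ.re < r → ∀ Y ∈ Ω,
        F 0 (ζ, Y) = Complex.exp ((1 - (k 0 : ℂ)) * ζ) * h (Complex.exp ζ, Y))) ∧
    (∀ j, InExp (levelOrder k j) (θ j) (ε j) Ω (F j)) ∧
    (∀ j : Fin q, IsAcceleration (k j.castSucc) (k j.succ) (θ j.castSucc) (ε j.castSucc)
      (θ j.succ) (ε j.succ) Ω (F j.castSucc) (F j.succ))

/-- The coefficient of `t ^ N` in the formal series `∑ f_n(Z(t)) t ^ n`, where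
`Z(t) = ∑ Z_j t ^ j` is a formal series and every `f_n` is holomorphic near `Z_0`: the coefficient
of `t ^ l` in `f_n(Z(t))` is the `l`-th Taylor coefficient at `t = 0` of `f_n` along a truncation
of `Z` of order at least `l`. -/
def formalSubst {E : Type*} [NormedAddCommGroup E] [NormedSpace ℂ E]
    (f : ℕ → E → ℂ) (Z : ℕ → E) (N : ℕ) : ℂ :=
  ∑ n ∈ Finset.range (N + 1), ((Nat.factorial (N - n) : ℕ) : ℂ)⁻¹ *
    iteratedDeriv (N - n) (fun t : ℂ => f n (∑ j ∈ Finset.range (N + 1), t ^ j • Z j)) 0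

/-- The coefficient of `t ^ j` in the formal series `(x, U(t, x), ∇_x U(t, x))`, where
`U = (u_1, …, u_m)`, `u_i = ∑ u_{i,j}(x) t ^ j`. -/
def jetCoeff {m n : ℕ} (u : Fin m → ℕ → (Fin n → ℂ) → ℂ) (x : Fin n → ℂ) (j : ℕ) :
    (Fin n → ℂ) × (Fin m → ℂ) × (Fin m → Fin n → ℂ) :=
  (if j = 0 then x else 0, fun i => u i j x,
    fun i l => fderiv ℂ (u i j) x (Pi.single l 1))

/-- `u_i = ∑ u_{i,N}(x) t ^ N` (`1 ≤ i ≤ m`), with coefficients in `𝒪(Ω₀)`, is a formal solution of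
the Cauchy problem `∂_t u_i = f_i(t, x, U, ∇_x U)`, `u_i(0, x) = 0`, where
`f_i = ∑ f_{i,N}(x, U, P) t ^ N`. -/
structure IsFormalSolution {m n : ℕ} (Ω₀ : Set (Fin n → ℂ))
    (f : Fin m → ℕ → (Fin n → ℂ) × (Fin m → ℂ) × (Fin m → Fin n → ℂ) → ℂ)
    (u : Fin m → ℕ → (Fin n → ℂ) → ℂ) : Prop where
  holomorphic : ∀ (i : Fin m) (N : ℕ), DifferentiableOn ℂ (u i N) Ω₀
  initial : ∀ i : Fin m, ∀ x ∈ Ω₀, u i 0 x = 0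
  equation : ∀ (i : Fin m) (N : ℕ), ∀ x ∈ Ω₀,
    ((N : ℂ) + 1) * u i (N + 1) x = formalSubst (f i) (jetCoeff u x) N

end

/-! ### Holomorphy in several variables: Cauchy estimates, parameter integrals, directional
derivatives. -/

section SeveralVariables

open MeasureTheory Filter Topology Set Metric
open scoped Interval

variable {E : Type*} [NormedAddCommGroup E] [NormedSpace ℂ E]

/-! Attach to a series its chain: its coefficients together with the Borel functions of all levels.
Chains can be multiplied (Cauchy product of coefficients, convolution at each level), integrated in
`t` and differentiated in the parameters, and each of these operations commutes with the
accelerations linking consecutive levels. The equation can therefore be solved once, in the algebra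
of chains. The solution is multisummable as soon as the estimates sum, and no convolution equation
has to be continued level by level.

Compatibility with acceleration. Along rays, in the variables `X = |η| ^ k₁` and `Y = |ξ| ^ k₂`,
acceleration is an integral transform whose kernel is a complex stable density of index `α = k₁ /
k₂`, the inverse Laplace transform of `exp (-x p ^ α)`. This symbol is multiplicative in `x`, so the
densities form a convolution semigroup (`stableDensity_convolution`) and the transform respects
convolution (`stableTransform_convolution`, `accel_levelConv`). Moving the line of integration shows
that the kernel decays like `exp (-ρ |η / ξ| ^ κ)`, which is what functions of exponential order `κ`
require.

Estimates. At a level `k` the weight of grade `l` is `|ξ| ^ (l - k) / Γ(l / k) * exp (c |ξ| ^ κ)`.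
By the Beta integral, and because `k ≤ κ`, the convolution of the weights of grades `l` and `l'` is
at most the weight of grade `l + l'`, with constant `1` (`expWeight_conv`). The bounds `Good l B`
are thus multiplicative in `B` and additive in `l` (`Good.mul`). The operation `dil` gains `1 / (l +
1)`, and derivatives in the parameters obey Cauchy's estimate (`GoodOn.dirDeriv`).

The equation. Each right-hand side is a constant term plus a chain of grade `1`
(`eventually_goodOn_baseChain`). Taylor expansion at `(x, 0, 0)` gives `u = ∑ U_l`, with `U_l` of
grade `l + 1` determined by the earlier ones. As in the Cauchy-Kovalevskaya theorem, the loss from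
`∂_x` is measured by powers of `(R - ‖x‖)⁻¹` and is paid for by `1 / (l + 1)`; a scalar majorant
grows only geometrically (`exists_majorant_solution`). The factors `1 / Γ(l / k)` make a geometric
sum of weights converge to a weight of grade `1` with larger `c` (`exists_sum_weight_bound`), so the
total is multisummable (`isMultisummable_of_graded`).

Identification. The coefficients of the total satisfy the recursion of the formal problem
(`isJetSolution_total`). This recursion has exactly one solution, so the total is the formal
solution. -/

lemma differentiableOn_line {f : E → ℂ} {x v : E} {s : Set ℂ} {U : Set E}
    (hf : DifferentiableOn ℂ f U) (hs : ∀ z ∈ s, x + z • v ∈ U) :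
    DifferentiableOn ℂ (fun z : ℂ => f (x + z • v)) s :=
  hf.comp (by fun_prop) hs

lemma norm_lineDeriv_le {f : E → ℂ} {x v : E} {δ C : ℝ} {U : Set E}
    (hδ : 0 < δ) (hf : DifferentiableOn ℂ f U) (hx : ∀ z : ℂ, ‖z‖ ≤ δ → x + z • v ∈ U)
    (hC : ∀ z : ℂ, ‖z‖ = δ → ‖f (x + z • v)‖ ≤ C) : ‖lineDeriv ℂ f x v‖ ≤ C / δ := by
  refine Complex.norm_deriv_le_of_forall_mem_sphere_norm_le (f := fun z : ℂ => f (x + z • v)) hδ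
    ?_ ?_
  · refine DifferentiableOn.diffContOnCl ?_
    rw [closure_ball _ hδ.ne']
    exact differentiableOn_line hf fun z hz => hx z (by simpa using hz)
  · intro z hz
    exact hC z (by simpa using hz)

/-- Cauchy's estimate on each complex line through `x`. The slice has radius `δ / (2 * ‖v‖)` so that
the closed disc stays inside the open ball; hence the factor `2`. -/
lemma norm_fderiv_le {f : E → ℂ} {x : E} {δ C : ℝ} (hδ : 0 < δ) (hC0 : 0 ≤ C)
    (hf : DifferentiableOn ℂ f (ball x δ)) (hC : ∀ y ∈ ball x δ, ‖f y‖ ≤ C) :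
    ‖fderiv ℂ f x‖ ≤ 2 * C / δ := by
  have hd : DifferentiableAt ℂ f x := hf.differentiableAt (ball_mem_nhds x hδ)
  refine ContinuousLinearMap.opNorm_le_bound _ (by positivity) fun v => ?_
  rw [← hd.lineDeriv_eq_fderiv]
  rcases eq_or_ne v 0 with rfl | hv
  · simp [lineDeriv]
  have hv' : 0 < ‖v‖ := norm_pos_iff.2 hv
  have hmem : ∀ z : ℂ, ‖z‖ ≤ δ / (2 * ‖v‖) → x + z • v ∈ ball x δ := by
    intro z hz
    rw [mem_ball, dist_eq_norm, add_sub_cancel_left, norm_smul]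
    calc ‖z‖ * ‖v‖ ≤ δ / (2 * ‖v‖) * ‖v‖ := by gcongr
      _ = δ / 2 := by field_simp
      _ < δ := by linarith
  refine (norm_lineDeriv_le (by positivity) hf hmem
    fun z hz => hC _ (hmem z hz.le)).trans (le_of_eq ?_)
  field_simp

/-- A directional derivative is a limit of difference quotients along the steps `1 / (n + 1)`, and
`fderiv` is a finite combination of directional derivatives in a basis. The sequence starts at a
late index because measurability is assumed only near `x`. -/
lemma aestronglyMeasurable_fderiv [FiniteDimensional ℂ E] {T : Type*} [MeasurableSpace T]
    {μ : Measure T} {x : E} {G : E → T → ℂ}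
    (hm : ∀ᶠ y in 𝓝 x, AEStronglyMeasurable (G y) μ)
    (hd : ∀ᵐ t ∂μ, DifferentiableAt ℂ (fun y => G y t) x) :
    AEStronglyMeasurable (fun t => fderiv ℂ (fun y => G y t) x) μ := by
  let b := Module.finBasis ℂ E
  have key : ∀ v : E, AEStronglyMeasurable (fun t => fderiv ℂ (fun y => G y t) x v) μ := by
    intro v
    obtain ⟨δ, hδ, hball⟩ := Metric.eventually_nhds_iff_ball.1 hm
    have h0 : Tendsto (fun n : ℕ => (1 / ((n : ℝ) + 1))) atTop (𝓝 0) :=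
      tendsto_one_div_add_atTop_nhds_zero_nat
    have h0c : Tendsto (fun n : ℕ => (((1 / ((n : ℝ) + 1) : ℝ) : ℂ))) atTop (𝓝 0) := by
      have := (Complex.continuous_ofReal.tendsto 0).comp h0
      simpa [Function.comp_def] using this
    have hx : Tendsto (fun n : ℕ => x + (((1 / ((n : ℝ) + 1) : ℝ) : ℂ)) • v) atTop (𝓝 x) := by
      have := (h0c.smul_const v).const_add x
      simpa using this
    obtain ⟨N, hN⟩ := Filter.eventually_atTop.1 (hx.eventually (ball_mem_nhds x hδ))
    refine aestronglyMeasurable_of_tendsto_ae atTop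
      (f := fun (n : ℕ) t => (((((n + N : ℕ) : ℝ) + 1 : ℝ)) : ℂ) •
        (G (x + (((1 / (((n + N : ℕ) : ℝ) + 1) : ℝ) : ℂ)) • v) t - G x t)) ?_ ?_
    · intro n
      exact ((hball _ (hN (n + N) (Nat.le_add_left N n))).sub
        (hball x (mem_ball_self hδ))).const_smul (((((n + N : ℕ) : ℝ) + 1 : ℝ)) : ℂ)
    · filter_upwards [hd] with t ht
      have h1 := ht.hasFDerivAt.hasLineDerivAt v
      have h2 := (hasDerivAt_iff_tendsto_slope.1 (h1 : HasDerivAt _ _ _))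
      have h3 : Tendsto (fun n : ℕ => (((1 / (((n + N : ℕ) : ℝ) + 1) : ℝ) : ℂ))) atTop
          (𝓝[≠] 0) := by
        refine tendsto_nhdsWithin_iff.2 ⟨h0c.comp (tendsto_add_atTop_nat N), ?_⟩
        refine Eventually.of_forall fun n => ?_
        simp only [mem_compl_iff, mem_singleton_iff, Complex.ofReal_eq_zero]
        positivity
      refine (h2.comp h3).congr fun n => ?_
      simp only [Function.comp, slope, vsub_eq_sub, sub_zero, zero_smul, add_zero]
      congr 1
      rw [← Complex.ofReal_inv, one_div, inv_inv]
  have heq : (fun t => fderiv ℂ (fun y => G y t) x) = fun t =>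
      ∑ i, (fderiv ℂ (fun y => G y t) x (b i)) •
        (LinearMap.toContinuousLinearMap (b.coord i) : E →L[ℂ] ℂ) := by
    funext t
    refine ContinuousLinearMap.coe_injective (b.ext fun j => ?_)
    simp [Finsupp.single_apply, Finset.sum_ite_eq]
  rw [heq]
  exact Finset.aestronglyMeasurable_fun_sum _ fun i _ => (key (b i)).smul_const _

/-- Differentiation under the integral sign for holomorphic integrands with an integrable bound. -/
theorem hasFDerivAt_integral_of_holomorphic [FiniteDimensional ℂ E] {T : Type*}
    [MeasurableSpace T] {μ : Measure T} {x : E} {U : Set E} (hU : U ∈ 𝓝 x) {G : E → T → ℂ}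
    {b : T → ℝ} (hm : ∀ y ∈ U, AEStronglyMeasurable (G y) μ)
    (hd : ∀ᵐ t ∂μ, DifferentiableOn ℂ (fun y => G y t) U)
    (hb : ∀ᵐ t ∂μ, ∀ y ∈ U, ‖G y t‖ ≤ b t) (hi : Integrable b μ) :
    Integrable (fun t => fderiv ℂ (fun y => G y t) x) μ ∧
    HasFDerivAt (fun y => ∫ t, G y t ∂μ) (∫ t, fderiv ℂ (fun y => G y t) x ∂μ) x := by
  obtain ⟨δ, hδ, hball⟩ := Metric.mem_nhds_iff.1 hU
  have hx : x ∈ U := mem_of_mem_nhds hU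
  have hbd : ∀ᵐ t ∂μ, ∀ y ∈ ball x (δ / 2), ‖fderiv ℂ (fun y => G y t) y‖ ≤ 2 * b t / (δ / 2) := by
    filter_upwards [hd, hb] with t ht hbt y hy
    have hsub : ball y (δ / 2) ⊆ U := by
      refine (ball_subset_ball' ?_).trans hball
      have := mem_ball.1 hy
      linarith
    exact norm_fderiv_le (by positivity) ((norm_nonneg _).trans (hbt x hx)) (ht.mono hsub)
      fun z hz => hbt z (hsub hz)
  have hmeas : AEStronglyMeasurable (fun t => fderiv ℂ (fun y => G y t) x) μ := by
    refine aestronglyMeasurable_fderiv ?_ ?_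
    · filter_upwards [hU] with y hy using hm y hy
    · filter_upwards [hd] with t ht using ht.differentiableAt hU
  have hbi : Integrable (fun t => 2 * b t / (δ / 2)) μ := (hi.const_mul 2).div_const _
  refine ⟨hbi.mono' hmeas ?_, ?_⟩
  · filter_upwards [hbd] with t ht using ht x (mem_ball_self (by positivity))
  refine hasFDerivAt_integral_of_dominated_of_fderiv_le (s := ball x (δ / 2))
    (bound := fun t => 2 * b t / (δ / 2)) (ball_mem_nhds x (by positivity)) ?_ ?_ ?_ hbd ?_ ?_
  · filter_upwards [hU] with y hy using hm y hy
  · exact hi.mono' (hm x hx) (by filter_upwards [hb] with t ht using ht x hx)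
  · exact hmeas
  · exact hbi
  · filter_upwards [hd] with t ht y hy
    refine (ht.differentiableAt ?_).hasFDerivAt
    exact mem_of_superset (isOpen_ball.mem_nhds hy)
      ((ball_subset_ball (by linarith)).trans hball)

theorem differentiableOn_integral_of_holomorphic [FiniteDimensional ℂ E] {T : Type*}
    [MeasurableSpace T] {μ : Measure T} {U : Set E} {G : E → T → ℂ}
    (hm : ∀ y ∈ U, AEStronglyMeasurable (G y) μ)
    (hd : ∀ᵐ t ∂μ, DifferentiableOn ℂ (fun y => G y t) U)
    (hb : ∀ x ∈ U, ∃ V ∈ 𝓝 x, V ⊆ U ∧ ∃ b : T → ℝ, Integrable b μ ∧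
      ∀ᵐ t ∂μ, ∀ y ∈ V, ‖G y t‖ ≤ b t) :
    DifferentiableOn ℂ (fun y => ∫ t, G y t ∂μ) U := by
  intro x hx
  obtain ⟨V, hV, hVU, b, hi, hbV⟩ := hb x hx
  refine (hasFDerivAt_integral_of_holomorphic hV (fun y hy => hm y (hVU hy)) ?_ hbV
    hi).2.differentiableAt.differentiableWithinAt
  filter_upwards [hd] with t ht using ht.mono hVU

/-- Directional derivatives commute with integration of a dominated holomorphic family. -/
theorem hasDerivAt_integral_line {T : Type*} [MeasurableSpace T] {μ : Measure T} {δ : ℝ}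
    (hδ : 0 < δ) {G : ℂ → T → ℂ} {b : T → ℝ}
    (hm : ∀ z ∈ ball (0 : ℂ) δ, AEStronglyMeasurable (G z) μ)
    (hd : ∀ᵐ t ∂μ, DifferentiableOn ℂ (fun z => G z t) (ball (0 : ℂ) δ))
    (hb : ∀ᵐ t ∂μ, ∀ z ∈ ball (0 : ℂ) δ, ‖G z t‖ ≤ b t) (hi : Integrable b μ) :
    deriv (fun z => ∫ t, G z t ∂μ) 0 = ∫ t, deriv (fun z => G z t) 0 ∂μ := by
  obtain ⟨h1, h2⟩ := hasFDerivAt_integral_of_holomorphic (ball_mem_nhds 0 hδ) hm hd hb hi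
  rw [h2.hasDerivAt.deriv, ContinuousLinearMap.integral_apply h1]
  rfl

/-- A locally normally convergent series of holomorphic functions is holomorphic. -/
theorem differentiableOn_tsum_of_locally_bounded {ι : Type*} {U : Set E} (hU : IsOpen U)
    {f : ι → E → ℂ} (hf : ∀ i, DifferentiableOn ℂ (f i) U)
    (hb : ∀ x ∈ U, ∃ V ∈ 𝓝 x, ∃ u : ι → ℝ, Summable u ∧ ∀ i, ∀ y ∈ V, ‖f i y‖ ≤ u i) :
    DifferentiableOn ℂ (fun y => ∑' i, f i y) U := by
  intro x hx
  obtain ⟨V, hV, u, hu, huV⟩ := hb x hx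
  obtain ⟨δ, hδ, hball⟩ := Metric.mem_nhds_iff.1 (inter_mem hV (hU.mem_nhds hx))
  have hxV : x ∈ V := mem_of_mem_nhds hV
  let _ : NormedSpace ℝ E := NormedSpace.restrictScalars ℝ ℂ E
  refine ((hasFDerivAt_tsum_of_isPreconnected (𝕜 := ℂ) (u := fun i => 2 * u i / (δ / 2))
    (s := ball x (δ / 2)) (x₀ := x) (x := x) (f' := fun i y => fderiv ℂ (f i) y)
    ((hu.mul_left 2).div_const _) isOpen_ball (convex_ball x _).isPreconnected ?_ ?_
    (mem_ball_self (by positivity)) ?_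
    (mem_ball_self (by positivity))).differentiableAt).differentiableWithinAt
  · intro i y hy
    exact ((hf i).differentiableAt (hU.mem_nhds (hball (ball_subset_ball (by linarith) hy)).2)
      ).hasFDerivAt
  · intro i y hy
    have hsub : ball y (δ / 2) ⊆ V ∩ U := by
      refine (ball_subset_ball' ?_).trans hball
      have := mem_ball.1 hy
      linarith
    exact norm_fderiv_le (by positivity) ((norm_nonneg _).trans (huV i x hxV))
      ((hf i).mono fun z hz => (hsub hz).2) fun z hz => huV i z (hsub hz).1
  · exact Summable.of_norm_bounded hu fun i => huV i x hxV

lemma lineDeriv_eq_fderiv_of_open {U : Set E} (hU : IsOpen U) {f : E → ℂ}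
    (hf : DifferentiableOn ℂ f U) {x : E} (hx : x ∈ U) (v : E) :
    lineDeriv ℂ f x v = fderiv ℂ f x v :=
  (hf.differentiableAt (hU.mem_nhds hx)).lineDeriv_eq_fderiv

lemma lineDeriv_congr_of_eqOn {U : Set E} (hU : IsOpen U) {f g : E → ℂ} (h : EqOn f g U) {x : E}
    (hx : x ∈ U) (v : E) : lineDeriv ℂ f x v = lineDeriv ℂ g x v := by
  have hc : Continuous fun z : ℂ => x + z • v := by fun_prop
  refine Filter.EventuallyEq.deriv_eq ?_
  have : ∀ᶠ z in 𝓝 (0 : ℂ), x + z • v ∈ U :=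
    hc.continuousAt.eventually_mem (by simpa using hU.mem_nhds hx)
  filter_upwards [this] with z hz using h hz

/-- On a small circle in the direction `v`, uniformly near `x`, the points stay in `U`. -/
lemma exists_circle_nhds {U : Set E} (hU : IsOpen U) {x : E} (hx : x ∈ U) (v : E) :
    ∃ δ > 0, ∃ r > 0, ∀ y ∈ ball x r, ∀ z : ℂ, ‖z‖ ≤ δ → y + z • v ∈ U := by
  obtain ⟨r, hr, hball⟩ := Metric.isOpen_iff.1 hU x hx
  refine ⟨r / (2 * (‖v‖ + 1)), by positivity, r / 2, by positivity, fun y hy z hz => hball ?_⟩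
  rw [mem_ball, dist_eq_norm]
  have h1 : ‖z • v‖ ≤ r / 2 := by
    rw [norm_smul]
    calc ‖z‖ * ‖v‖ ≤ r / (2 * (‖v‖ + 1)) * (‖v‖ + 1) := by gcongr; linarith
      _ = r / 2 := by field_simp
  have h2 : ‖y - x‖ < r / 2 := by simpa [dist_eq_norm] using hy
  calc ‖y + z • v - x‖ = ‖(y - x) + z • v‖ := by congr 1; abel
    _ ≤ ‖y - x‖ + ‖z • v‖ := norm_add_le _ _
    _ < r := by linarith

/-- Cauchy's formula on a circle in the direction `v`. It turns the directional derivative into a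
parameter integral, whose holomorphy in `y` then follows by domination. -/
lemma lineDeriv_eq_circle {U : Set E} {f : E → ℂ} (hf : DifferentiableOn ℂ f U) {y v : E}
    {δ : ℝ} (hδ : 0 < δ) (h : ∀ z : ℂ, ‖z‖ ≤ δ → y + z • v ∈ U) :
    lineDeriv ℂ f y v = ∫ t in Ι (0 : ℝ) (2 * Real.pi),
      (2 * Real.pi * Complex.I)⁻¹ * (deriv (circleMap 0 δ) t * (((circleMap 0 δ t) ^ 2)⁻¹ *
        f (y + circleMap 0 δ t • v))) := by
  have hd : DifferentiableOn ℂ (fun z : ℂ => f (y + z • v)) (closedBall 0 δ) :=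
    differentiableOn_line hf fun z hz => h z (by simpa using hz)
  have h1 := DifferentiableOn.deriv_eq_smul_circleIntegral hδ hd
  rw [circleIntegral, intervalIntegral.intervalIntegral_eq_integral_uIoc,
    if_pos Real.two_pi_pos.le, one_smul, smul_eq_mul] at h1
  rw [integral_const_mul, eq_inv_mul_iff_mul_eq₀ Complex.two_pi_I_ne_zero, lineDeriv, ← h1]
  simp only [sub_zero, smul_eq_mul, one_div]

/-- Directional derivatives of holomorphic functions are holomorphic. -/
theorem differentiableOn_lineDeriv [FiniteDimensional ℂ E] {U : Set E} (hU : IsOpen U)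
    {f : E → ℂ} (hf : DifferentiableOn ℂ f U) (v : E) :
    DifferentiableOn ℂ (fun y => lineDeriv ℂ f y v) U := by
  intro x hx
  obtain ⟨δ, hδ, r, hr, hmem⟩ := exists_circle_nhds hU hx v
  obtain ⟨W, hW, hWb⟩ : ∃ W ∈ 𝓝 x, ∃ C : ℝ, ∀ y ∈ W, y ∈ ball x r ∧ ∀ z : ℂ, ‖z‖ = δ →
      ‖f (y + z • v)‖ ≤ C := by
    have hcont : ContinuousOn (fun p : E × ℂ => f (p.1 + p.2 • v))
        (ball x r ×ˢ sphere (0 : ℂ) δ) := by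
      refine hf.continuousOn.comp (by fun_prop) fun p hp => hmem _ hp.1 _ ?_
      simpa using (mem_sphere.1 hp.2).le
    have : ProperSpace E := FiniteDimensional.proper ℂ E
    have hK : IsCompact (closedBall x (r / 2) ×ˢ sphere (0 : ℂ) δ) :=
      (isCompact_closedBall _ _).prod (isCompact_sphere _ _)
    obtain ⟨C, hC⟩ := hK.exists_bound_of_continuousOn
      (hcont.mono (prod_mono (closedBall_subset_ball (by linarith)) le_rfl))
    refine ⟨ball x (r / 2), ball_mem_nhds x (by positivity), C, fun y hy =>
      ⟨ball_subset_ball (by linarith) hy, fun z hz => hC (y, z) ⟨ball_subset_closedBall hy, ?_⟩⟩⟩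
    simpa using hz
  obtain ⟨C, hC⟩ := hWb
  have hcm : ∀ t, ‖circleMap 0 δ t‖ = δ := fun t => by
    rw [circleMap_zero]; simp [abs_of_pos hδ]
  have key := (hasFDerivAt_integral_of_holomorphic (x := x) (U := W) hW
    (μ := volume.restrict (Ι (0 : ℝ) (2 * Real.pi)))
    (G := fun y t => (2 * Real.pi * Complex.I)⁻¹ * (deriv (circleMap 0 δ) t *
      (((circleMap 0 δ t) ^ 2)⁻¹ * f (y + circleMap 0 δ t • v))))
    (b := fun _ => ‖(2 * Real.pi * Complex.I)⁻¹‖ * (δ * ((δ ^ 2)⁻¹ * C))) ?_ ?_ ?_ ?_).2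
  · refine (key.differentiableAt.congr_of_eventuallyEq ?_).differentiableWithinAt
    filter_upwards [hW] with y hy
    exact lineDeriv_eq_circle hf hδ (hmem y (hC y hy).1)
  · intro y hy
    refine Continuous.aestronglyMeasurable ?_
    have h1 : Continuous fun t => f (y + circleMap 0 δ t • v) := by
      refine hf.continuousOn.comp_continuous (by fun_prop) fun t => hmem y (hC y hy).1 _ (hcm t).le
    have h2 : Continuous fun t => ((circleMap 0 δ t) ^ 2)⁻¹ := by
      refine Continuous.inv₀ (by fun_prop) fun t => ?_
      have := hcm t
      intro h
      rw [pow_eq_zero_iff two_ne_zero] at h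
      rw [h, norm_zero] at this
      linarith
    have h3 : Continuous (deriv (circleMap 0 δ)) := by
      have : deriv (circleMap 0 δ) = fun t => circleMap 0 δ t * Complex.I := by
        funext t; simp
      rw [this]; fun_prop
    exact continuous_const.mul (h3.mul (h2.mul h1))
  · refine Eventually.of_forall fun t => ?_
    have : DifferentiableOn ℂ (fun y => f (y + circleMap 0 δ t • v)) W :=
      hf.comp (by fun_prop) fun y hy => hmem y (hC y hy).1 _ (hcm t).le
    exact ((this.const_mul _).const_mul _).const_mul _
  · refine Eventually.of_forall fun t y hy => ?_
    rw [norm_mul, norm_mul, norm_mul, norm_inv (circleMap 0 δ t ^ 2), norm_pow, hcm]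
    have : ‖deriv (circleMap 0 δ) t‖ = δ := by
      simp [abs_of_pos hδ]
    rw [this]
    gcongr
    exact (hC y hy).2 _ (hcm t)
  · have : IsFiniteMeasure (volume.restrict (Ι (0 : ℝ) (2 * Real.pi))) :=
      ⟨by rw [Measure.restrict_apply_univ, uIoc_of_le Real.two_pi_pos.le]; simp [ENNReal.mul_lt_top]⟩
    exact integrable_const _

/-- Directional derivatives of holomorphic functions commute. -/
theorem lineDeriv_comm [FiniteDimensional ℂ E] {U : Set E} (hU : IsOpen U) {f : E → ℂ}
    (hf : DifferentiableOn ℂ f U) {x : E} (hx : x ∈ U) (v w : E) :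
    lineDeriv ℂ (fun y => lineDeriv ℂ f y v) x w = lineDeriv ℂ (fun y => lineDeriv ℂ f y w) x v := by
  -- The coordinates of `fderiv` in a basis are directional derivatives, hence holomorphic; the
  -- symmetry of the second derivative then applies.
  have hdf : DifferentiableOn ℂ (fderiv ℂ f) U := by
    intro y hy
    let b := Module.finBasis ℂ E
    have heq : (fun t => fderiv ℂ f t) = fun t => ∑ i, (fderiv ℂ f t (b i)) •
        (LinearMap.toContinuousLinearMap (b.coord i) : E →L[ℂ] ℂ) := by
      funext t
      refine ContinuousLinearMap.coe_injective (b.ext fun j => ?_)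
      simp [Finsupp.single_apply, Finset.sum_ite_eq]
    have h1 : ∀ i, DifferentiableOn ℂ (fun t => fderiv ℂ f t (b i)) U := fun i =>
      (differentiableOn_lineDeriv hU hf (b i)).congr fun t ht =>
        (lineDeriv_eq_fderiv_of_open hU hf ht _).symm
    have : DifferentiableOn ℂ (fun t => fderiv ℂ f t) U := by
      rw [heq]
      exact DifferentiableOn.fun_sum fun i _ => (h1 i).smul_const _
    exact this y hy
  have hx2 : HasFDerivAt (fderiv ℂ f) (fderiv ℂ (fderiv ℂ f) x) x :=
    (hdf.differentiableAt (hU.mem_nhds hx)).hasFDerivAt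
  have hsymm := second_derivative_symmetric_of_eventually (𝕜 := ℂ) (f := f) (f' := fderiv ℂ f)
    (f'' := fderiv ℂ (fderiv ℂ f) x) (x := x) (by
      filter_upwards [hU.mem_nhds hx] with y hy
      exact (hf.differentiableAt (hU.mem_nhds hy)).hasFDerivAt) hx2 v w
  have h3 : ∀ v w : E, lineDeriv ℂ (fun y => lineDeriv ℂ f y v) x w
      = fderiv ℂ (fderiv ℂ f) x w v := by
    intro v w
    rw [lineDeriv_congr_of_eqOn hU (g := fun y => fderiv ℂ f y v)
      (fun y hy => lineDeriv_eq_fderiv_of_open hU hf hy v) hx]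
    have h4 : HasFDerivAt (fun y => fderiv ℂ f y v)
        ((fderiv ℂ (fderiv ℂ f) x).flip v) x := by
      simpa using hx2.clm_apply (hasFDerivAt_const v x)
    rw [h4.differentiableAt.lineDeriv_eq_fderiv, h4.fderiv]
    rfl
  rw [h3, h3, hsymm]

end SeveralVariables

noncomputable section

open MeasureTheory Filter Topology Set Metric
open scoped Interval

/-! ### The line integral behind the acceleration kernel. -/

section StableKernel

lemma integrable_rpow_mul_exp_neg_abs {A α s : ℝ} (hA : 0 < A) (hα : 0 < α) (hs : -1 < s) :
    Integrable (fun y : ℝ => |y| ^ s * Real.exp (-A * |y| ^ α)) := by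
  have h := integrableOn_rpow_mul_exp_neg_mul_rpow hs hα hA
  have h2 : IntegrableOn (fun y : ℝ => |y| ^ s * Real.exp (-A * |y| ^ α)) (Ioi 0) :=
    h.congr_fun (fun y hy => by simp only [abs_of_pos (mem_Ioi.1 hy)]) measurableSet_Ioi
  have h3 : IntegrableOn (fun y : ℝ => |y| ^ s * Real.exp (-A * |y| ^ α)) (Iic 0) := by
    rw [← Measure.map_neg_eq_self (volume : Measure ℝ)]
    let m : MeasurableEmbedding fun x : ℝ => -x := (Homeomorph.neg ℝ).measurableEmbedding
    rw [m.integrableOn_map_iff]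
    simp_rw [Function.comp_def, abs_neg, neg_preimage, neg_Iic, neg_zero]
    exact Iff.mpr integrableOn_Ici_iff_integrableOn_Ioi h2
  rw [← integrableOn_univ, ← Iic_union_Ioi (a := (0 : ℝ))]
  exact h3.union h2

lemma integrable_exp_neg_abs_rpow {A α : ℝ} (hA : 0 < A) (hα : 0 < α) :
    Integrable (fun y : ℝ => Real.exp (-A * |y| ^ α)) := by
  simpa using integrable_rpow_mul_exp_neg_abs (s := 0) hA hα (by norm_num)

/-- The lower bound for `cos` governing the decay of `exp (-x p ^ α)` for `arg x = χ`,
`|arg p| < π / 2`. -/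
def cosGap (α χ : ℝ) : ℝ := Real.cos (|χ| + Real.pi * α / 2)

lemma cosGap_pos {α χ : ℝ} (hα : 0 < α) (hχ : |χ| + Real.pi * α / 2 < Real.pi / 2) :
    0 < cosGap α χ := by
  refine Real.cos_pos_of_mem_Ioo ⟨?_, hχ⟩
  have := abs_nonneg χ
  have := Real.pi_pos
  have : 0 < Real.pi * α / 2 := by positivity
  linarith

/-- The argument of `exp u * p ^ α` is `u.im + α * arg p`, where `|arg p| < π / 2`. It stays within
`|u.im| + π α / 2 < π / 2`, and there the cosine is at least `cosGap`. -/
lemma le_re_mul_cpow {α : ℝ} (hα : 0 < α) {u p : ℂ}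
    (hu : |u.im| + Real.pi * α / 2 < Real.pi / 2) (hp : 0 < p.re) :
    cosGap α u.im * Real.exp u.re * ‖p‖ ^ α ≤ (Complex.exp u * p ^ (α : ℂ)).re := by
  have hp0 : p ≠ 0 := fun h => by simp [h] at hp
  have hnp : 0 < ‖p‖ := norm_pos_iff.2 hp0
  have harg : |p.arg| < Real.pi / 2 := Complex.abs_arg_lt_pi_div_two_iff.2 (Or.inl hp)
  have h1 : Complex.exp u * p ^ (α : ℂ) = Complex.exp (u + α * Complex.log p) := by
    rw [Complex.cpow_def_of_ne_zero hp0, ← Complex.exp_add, mul_comm (Complex.log p)]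
  have h2 : (u + α * Complex.log p).re = u.re + α * Real.log ‖p‖ := by
    simp [Complex.log_re]
  have h3 : (u + α * Complex.log p).im = u.im + α * p.arg := by
    simp [Complex.log_im]
  rw [h1, Complex.exp_re, h2, h3, Real.exp_add, mul_comm α (Real.log _),
    ← Real.rpow_def_of_pos hnp]
  have h4 : |u.im + α * p.arg| ≤ |u.im| + Real.pi * α / 2 := by
    refine (abs_add_le _ _).trans ?_
    rw [abs_mul, abs_of_pos hα]
    nlinarith
  have h5 : cosGap α u.im ≤ Real.cos (u.im + α * p.arg) := by
    rw [← Real.cos_abs (u.im + α * p.arg)]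
    refine Real.cos_le_cos_of_nonneg_of_le_pi (abs_nonneg _) ?_ h4
    linarith [Real.pi_pos]
  calc cosGap α u.im * Real.exp u.re * ‖p‖ ^ α
      = Real.exp u.re * ‖p‖ ^ α * cosGap α u.im := by ring
    _ ≤ _ := by gcongr

/-- The integral `∫ exp (p Y - x p ^ α) dy` along the line `p = c + i y`. -/
def lineInt (α : ℝ) (c Y : ℝ) (x : ℂ) : ℂ :=
  ∫ y : ℝ, Complex.exp (((c : ℂ) + y * Complex.I) * Y - x * ((c : ℂ) + y * Complex.I) ^ (α : ℂ))

lemma norm_exp_sub_le {α : ℝ} (hα : 0 < α) {u p : ℂ} (Y : ℝ)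
    (hu : |u.im| + Real.pi * α / 2 < Real.pi / 2) (hp : 0 < p.re) :
    ‖Complex.exp (p * Y - Complex.exp u * p ^ (α : ℂ))‖
      ≤ Real.exp (p.re * Y) * Real.exp (-(cosGap α u.im * Real.exp u.re) * ‖p‖ ^ α) := by
  rw [Complex.norm_exp, ← Real.exp_add]
  refine Real.exp_le_exp.2 ?_
  have := le_re_mul_cpow hα hu hp
  simp only [Complex.sub_re, Complex.mul_re p, Complex.ofReal_re, Complex.ofReal_im, mul_zero,
    sub_zero]
  linarith

lemma norm_line_ge_abs (c y : ℝ) : |y| ≤ ‖(c : ℂ) + y * Complex.I‖ := by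
  simpa using Complex.abs_im_le_norm ((c : ℂ) + y * Complex.I)

lemma norm_line_ge (c y : ℝ) : c ≤ ‖(c : ℂ) + y * Complex.I‖ := by
  simpa using Complex.re_le_norm ((c : ℂ) + y * Complex.I)

lemma continuous_line_cpow {c : ℝ} (hc : 0 < c) (α : ℂ) :
    Continuous fun y : ℝ => ((c : ℂ) + y * Complex.I) ^ α := by
  refine Continuous.cpow (by fun_prop) continuous_const fun y => Or.inl ?_
  simpa using hc

lemma continuous_lineInt_integrand {α c : ℝ} (hc : 0 < c) (Y : ℝ) (x : ℂ) :
    Continuous fun y : ℝ => Complex.exp (((c : ℂ) + y * Complex.I) * Y -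
      x * ((c : ℂ) + y * Complex.I) ^ (α : ℂ)) := by
  have := continuous_line_cpow hc (α : ℂ)
  fun_prop

/-- The decay in `‖p‖ ^ α` is split into halves: one is kept as `c ^ α`, for smallness when the
abscissa grows, the other as `|y| ^ α`, for integrability. -/
lemma norm_lineInt_integrand_le {α : ℝ} (hα : 0 < α) {u : ℂ} {c : ℝ} (hc : 0 < c) (Y y : ℝ)
    (hu : |u.im| + Real.pi * α / 2 < Real.pi / 2) :
    ‖Complex.exp (((c : ℂ) + y * Complex.I) * Y -
      Complex.exp u * ((c : ℂ) + y * Complex.I) ^ (α : ℂ))‖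
      ≤ Real.exp (c * Y) * (Real.exp (-(cosGap α u.im * Real.exp u.re / 2) * c ^ α) *
        Real.exp (-(cosGap α u.im * Real.exp u.re / 2) * |y| ^ α)) := by
  have hs := cosGap_pos hα hu
  have h1 := norm_exp_sub_le hα (p := (c : ℂ) + y * Complex.I) Y hu (by simpa using hc)
  refine h1.trans ?_
  have h2 : ((c : ℂ) + y * Complex.I).re = c := by simp
  rw [h2, ← Real.exp_add (-_ * _)]
  gcongr
  have h3 : |y| ^ α ≤ ‖(c : ℂ) + y * Complex.I‖ ^ α := by
    gcongr; exact norm_line_ge_abs c y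
  have h4 : c ^ α ≤ ‖(c : ℂ) + y * Complex.I‖ ^ α := by
    gcongr; exact norm_line_ge c y
  have h5 : 0 < cosGap α u.im * Real.exp u.re := by positivity
  nlinarith

lemma integrable_lineInt {α : ℝ} (hα : 0 < α) {u : ℂ} {c : ℝ} (hc : 0 < c) (Y : ℝ)
    (hu : |u.im| + Real.pi * α / 2 < Real.pi / 2) :
    Integrable fun y : ℝ => Complex.exp (((c : ℂ) + y * Complex.I) * Y -
      Complex.exp u * ((c : ℂ) + y * Complex.I) ^ (α : ℂ)) := by
  have hs := cosGap_pos hα hu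
  refine Integrable.mono' (((integrable_exp_neg_abs_rpow (A := cosGap α u.im * Real.exp u.re / 2)
    (by positivity) hα).const_mul _).const_mul _)
    (continuous_lineInt_integrand hc Y _).aestronglyMeasurable
    (Eventually.of_forall fun y => norm_lineInt_integrand_le hα hc Y y hu)

lemma norm_lineInt_le {α : ℝ} (hα : 0 < α) {u : ℂ} {c : ℝ} (hc : 0 < c) (Y : ℝ)
    (hu : |u.im| + Real.pi * α / 2 < Real.pi / 2) :
    ‖lineInt α c Y (Complex.exp u)‖ ≤
      Real.exp (c * Y) * (Real.exp (-(cosGap α u.im * Real.exp u.re / 2) * c ^ α) *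
        ∫ y : ℝ, Real.exp (-(cosGap α u.im * Real.exp u.re / 2) * |y| ^ α)) := by
  have hs := cosGap_pos hα hu
  rw [← integral_const_mul, ← integral_const_mul]
  exact norm_integral_le_of_norm_le (((integrable_exp_neg_abs_rpow
    (A := cosGap α u.im * Real.exp u.re / 2) (by positivity) hα).const_mul _).const_mul _)
    (Eventually.of_forall fun y => norm_lineInt_integrand_le hα hc Y y hu)

/-- The line integral does not depend on the abscissa. -/
lemma lineInt_eq {α : ℝ} (hα : 0 < α) (hα1 : α < 1) {u : ℂ} {c c' : ℝ} (hc : 0 < c)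
    (hc' : 0 < c') (Y : ℝ) (hu : |u.im| + Real.pi * α / 2 < Real.pi / 2) :
    lineInt α c Y (Complex.exp u) = lineInt α c' Y (Complex.exp u) := by
  set S : ℝ := cosGap α u.im * Real.exp u.re with hS
  have hSpos : 0 < S := mul_pos (cosGap_pos hα hu) (Real.exp_pos _)
  let F : ℂ → ℝ → ℂ := fun w y => Complex.exp ((w + y * Complex.I) * Y -
      Complex.exp u * (w + y * Complex.I) ^ (α : ℂ))
  -- As a function of a complex abscissa the integral is holomorphic in the right half plane, and
  -- translation invariance of Lebesgue measure makes it invariant under imaginary shifts. Its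
  -- derivative therefore vanishes, which replaces a contour argument.
  let H : ℂ → ℂ := fun w => ∫ y : ℝ, F w y
  let U : Set ℂ := {w | 0 < w.re}
  have hUo : IsOpen U := isOpen_lt continuous_const Complex.continuous_re
  have hre : ∀ (w : ℂ) (y : ℝ), (w + y * Complex.I).re = w.re := by intro w y; simp
  have hFd : ∀ y : ℝ, DifferentiableOn ℂ (fun w => F w y) U := by
    intro y
    have : DifferentiableOn ℂ (fun w : ℂ => (w + y * Complex.I) ^ (α : ℂ)) U := by
      intro w hw
      refine DifferentiableAt.differentiableWithinAt ?_
      refine DifferentiableAt.cpow (by fun_prop) (by fun_prop) (Or.inl ?_)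
      rw [hre]; exact hw
    exact (((differentiableOn_id.add_const _).mul_const _).sub (this.const_mul _)).cexp
  have hcont : ∀ w ∈ U, Continuous (F w) := by
    intro w hw
    have : Continuous fun y : ℝ => (w + y * Complex.I) ^ (α : ℂ) := by
      refine Continuous.cpow (by fun_prop) continuous_const fun y => Or.inl ?_
      rw [hre]; exact hw
    fun_prop
  have hHd : DifferentiableOn ℂ H U := by
    refine differentiableOn_integral_of_holomorphic
      (fun w hw => (hcont w hw).aestronglyMeasurable) (Eventually.of_forall hFd) ?_
    intro w₀ hw₀
    refine ⟨ball w₀ 1 ∩ U, inter_mem (ball_mem_nhds _ one_pos) (hUo.mem_nhds hw₀),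
      inter_subset_right, fun y => Real.exp ((w₀.re + 1) * |Y|) *
        (Real.exp S * Real.exp (-S * |y + w₀.im| ^ α)), ?_, ?_⟩
    · refine Integrable.const_mul (Integrable.const_mul ?_ _) _
      exact (integrable_exp_neg_abs_rpow hSpos hα).comp_add_right w₀.im
    · refine Eventually.of_forall fun y w hw => ?_
      have hwre : 0 < w.re := hw.2
      have hn := norm_exp_sub_le hα (p := w + y * Complex.I) Y hu (by rw [hre]; exact hwre)
      refine hn.trans ?_
      change _ ≤ Real.exp ((w₀.re + 1) * |Y|) * (Real.exp S * Real.exp (-S * |y + w₀.im| ^ α))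
      rw [hre, ← Real.exp_add S]
      have hd : ‖w - w₀‖ < 1 := by simpa [dist_eq_norm] using hw.1
      have h1 : |w.re - w₀.re| ≤ 1 := by
        simpa using (Complex.abs_re_le_norm (w - w₀)).trans hd.le
      have h2 : |w.im - w₀.im| ≤ 1 := by
        simpa using (Complex.abs_im_le_norm (w - w₀)).trans hd.le
      have h3 : w.re * Y ≤ (w₀.re + 1) * |Y| := by
        calc w.re * Y ≤ w.re * |Y| := by gcongr; exact le_abs_self Y
          _ ≤ _ := by gcongr; linarith [abs_le.1 h1]
      -- Subadditivity of `t ↦ t ^ α` for `α < 1` makes the bound uniform for `w` near `w₀`, at the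
      -- price of the factor `exp S`.
      have h4 : |y + w₀.im| ^ α ≤ ‖w + y * Complex.I‖ ^ α + 1 := by
        have him : |w.im + y| ≤ ‖w + y * Complex.I‖ := by
          simpa using Complex.abs_im_le_norm (w + y * Complex.I)
        calc |y + w₀.im| ^ α ≤ (‖w + y * Complex.I‖ + 1) ^ α := by
              gcongr
              calc |y + w₀.im| = |(w.im + y) - (w.im - w₀.im)| := by congr 1; ring
                _ ≤ |w.im + y| + |w.im - w₀.im| := abs_sub _ _
                _ ≤ _ := by linarith
          _ ≤ ‖w + y * Complex.I‖ ^ α + 1 ^ α :=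
              Real.rpow_add_le_add_rpow (norm_nonneg _) zero_le_one hα.le hα1.le
          _ = _ := by rw [Real.one_rpow]
      gcongr
      nlinarith
  have htrans : ∀ (w : ℂ) (τ : ℝ), H (w + τ * Complex.I) = H w := by
    intro w τ
    have : ∀ y : ℝ, F (w + τ * Complex.I) y = F w (y + τ) := by
      intro y
      simp only [F]
      have : w + τ * Complex.I + y * Complex.I = w + ((y + τ : ℝ) : ℂ) * Complex.I := by
        push_cast; ring
      rw [this]
    simp only [H, this]
    exact integral_add_right_eq_self (F w) τ
  have hderiv : EqOn (deriv H) 0 U := by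
    intro w hw
    have hd : HasDerivAt H (deriv H w) w := (hHd.differentiableAt (hUo.mem_nhds hw)).hasDerivAt
    have h1 : HasDerivAt (fun τ : ℝ => w + τ * Complex.I) Complex.I 0 := by
      simpa using (((hasDerivAt_id (0 : ℝ)).ofReal_comp).mul_const Complex.I).const_add w
    have h2 : HasDerivAt (fun τ : ℝ => H (w + τ * Complex.I)) (deriv H w * Complex.I) 0 := by
      refine HasDerivAt.comp (0 : ℝ) (h₂ := H) ?_ h1
      simpa using hd
    have h3 : HasDerivAt (fun τ : ℝ => H (w + τ * Complex.I)) 0 0 := by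
      simp only [htrans]
      exact hasDerivAt_const _ _
    have h4 := h2.unique h3
    simpa using h4
  have hpre : IsPreconnected U :=
    (convex_halfSpace_re_gt 0).isPreconnected
  have := hUo.eqOn_of_deriv_eq hpre hHd (differentiableOn_const (H (c' : ℂ))) (fun w hw => by
    simpa using hderiv hw) (show (c' : ℂ) ∈ U by simpa [U] using hc') rfl
  exact this (show (c : ℂ) ∈ U by simpa [U] using hc)

/-- For `Y ≤ 0` the factor `exp (c Y)` stays bounded, so letting the abscissa tend to infinity
forces the integral to vanish. -/
lemma lineInt_eq_zero {α : ℝ} (hα : 0 < α) (hα1 : α < 1) {u : ℂ} {c : ℝ} (hc : 0 < c)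
    {Y : ℝ} (hY : Y ≤ 0) (hu : |u.im| + Real.pi * α / 2 < Real.pi / 2) :
    lineInt α c Y (Complex.exp u) = 0 := by
  have hs := cosGap_pos hα hu
  set A := cosGap α u.im * Real.exp u.re / 2 with hA
  have hApos : 0 < A := by positivity
  set J := ∫ y : ℝ, Real.exp (-A * |y| ^ α)
  have hJ : 0 ≤ J := integral_nonneg fun y => (Real.exp_pos _).le
  have hlim : Tendsto (fun c' : ℝ => Real.exp (-A * c' ^ α) * J) atTop (𝓝 (0 * J)) := by
    refine Tendsto.mul_const _ (Real.tendsto_exp_atBot.comp ?_)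
    exact (tendsto_rpow_atTop hα).const_mul_atTop_of_neg (by linarith)
  rw [zero_mul] at hlim
  refine norm_le_zero_iff.1 (ge_of_tendsto hlim ?_)
  filter_upwards [eventually_gt_atTop 0] with c' hc'
  rw [lineInt_eq hα hα1 hc hc' Y hu]
  refine (norm_lineInt_le hα hc' Y hu).trans ?_
  calc _ ≤ 1 * (Real.exp (-A * c' ^ α) * J) := by
        gcongr
        rw [Real.exp_le_one_iff]
        exact mul_nonpos_of_nonneg_of_nonpos hc'.le hY
    _ = _ := one_mul _

/-- Scaling the integration variable by `Y`: up to the Jacobian, only the combination `x Y ^ (-α)`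
matters. -/
lemma lineInt_scale {α c Y : ℝ} (hY : 0 < Y) (u : ℂ) :
    lineInt α c Y (Complex.exp u) =
      (Y : ℂ)⁻¹ * lineInt α (c * Y) 1 (Complex.exp (u - α * Real.log Y)) := by
  have h1 := Measure.integral_comp_mul_left (fun y : ℝ => Complex.exp
    ((((c * Y : ℝ) : ℂ) + y * Complex.I) * (1 : ℝ) - Complex.exp (u - α * Real.log Y) *
      (((c * Y : ℝ) : ℂ) + y * Complex.I) ^ (α : ℂ))) Y
  unfold lineInt
  rw [abs_of_pos (inv_pos.2 hY), Complex.real_smul, Complex.ofReal_inv] at h1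
  rw [← h1]
  congr 1
  funext y
  congr 1
  have h2 : (((c * Y : ℝ) : ℂ) + (Y * y : ℝ) * Complex.I) = (Y : ℂ) * (c + y * Complex.I) := by
    push_cast; ring
  rw [h2, Complex.ofReal_one, mul_one, mul_comm (Y : ℂ) (_ + _)]
  congr 1
  rw [mul_comm (_ + _) (Y : ℂ)]
  -- The sign of `c` is not prescribed, so the base of the power may vanish; both sides then agree
  -- by the conventions for powers of `0`.
  rcases eq_or_ne ((c : ℂ) + y * Complex.I) 0 with h0 | h0
  · rcases eq_or_ne (α : ℂ) 0 with ha | ha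
    · simp [h0, ha]
    · simp [h0, Complex.zero_cpow ha]
  have hY0 : (Y : ℂ) ≠ 0 := by exact_mod_cast hY.ne'
  rw [Complex.cpow_def_of_ne_zero h0, Complex.cpow_def_of_ne_zero (mul_ne_zero hY0 h0),
    Complex.log_ofReal_mul hY h0, ← Complex.exp_add, ← Complex.exp_add]
  congr 1
  ring

end StableKernel
end

noncomputable section

open MeasureTheory Filter Topology Set Metric
open scoped Interval FourierTransform Convolution

/-! ### Complex stable densities: decay, Fourier inversion, semigroup property. -/

section StableDensity

lemma integral_abs_rpow_mul_exp {A α : ℝ} (hA : 0 < A) (hα : 0 < α) :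
    ∫ y : ℝ, |y| ^ (α - 1) * Real.exp (-A * |y| ^ α) = 2 / (α * A) := by
  rw [integral_comp_abs (f := fun y => y ^ (α - 1) * Real.exp (-A * y ^ α)),
    integral_rpow_mul_exp_neg_mul_rpow hα (by linarith) hA]
  have h1 : (α - 1 + 1) / α = 1 := by field_simp; ring
  have h2 : -(α - 1 + 1) / α = -1 := by rw [neg_div, h1]
  rw [h1, h2, Real.Gamma_one, Real.rpow_neg_one]
  field_simp

/-- Integration by parts gives a bound which is uniform as the kernel variable tends to `0`. -/
lemma norm_lineInt_one_le {α : ℝ} (hα : 0 < α) (hα1 : α < 1) {u : ℂ} {c : ℝ} (hc : 0 < c)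
    (hu : |u.im| + Real.pi * α / 2 < Real.pi / 2) :
    ‖lineInt α c 1 (Complex.exp u)‖ ≤ 4 / cosGap α u.im *
      Real.exp (c - cosGap α u.im * Real.exp u.re / 2 * c ^ α) := by
  have hs := cosGap_pos hα hu
  set A := cosGap α u.im * Real.exp u.re / 2 with hA
  have hApos : 0 < A := by positivity
  let p : ℝ → ℂ := fun y => (c : ℂ) + y * Complex.I
  let g : ℝ → ℂ := fun y => Complex.exp (p y * (1 : ℝ) - Complex.exp u * p y ^ (α : ℂ))
  have hpre : ∀ y, (p y).re = c := fun y => by simp [p]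
  have hp0 : ∀ y, p y ∈ Complex.slitPlane := fun y => Or.inl (by rw [hpre]; exact hc)
  have hpd : ∀ y, HasDerivAt p Complex.I y := fun y => by
    simpa [p] using ((hasDerivAt_id y).ofReal_comp.mul_const Complex.I).const_add (c : ℂ)
  have hpowd : ∀ y, HasDerivAt (fun y => p y ^ (α : ℂ))
      ((α : ℂ) * p y ^ ((α : ℂ) - 1) * Complex.I) y := fun y =>
    (HasDerivAt.comp_ofReal (e := fun z : ℂ => ((c : ℂ) + z * Complex.I) ^ (α : ℂ)) (by
      have h1 : HasDerivAt (fun z : ℂ => (c : ℂ) + z * Complex.I) Complex.I (y : ℂ) := by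
        simpa using ((hasDerivAt_id (y : ℂ)).mul_const Complex.I).const_add (c : ℂ)
      exact h1.cpow_const (hp0 y)))
  let B : ℝ → ℂ := fun y => g y * (Complex.exp u * ((α : ℂ) * p y ^ ((α : ℂ) - 1)))
  -- The integral of the derivative of `g` vanishes, so the integral of `g` equals that of `B`. The
  -- factor `exp u.re` in `B` cancels the `1 / A` coming from its integral, so nothing degenerates
  -- as `u.re → -∞`.
  have hgd : ∀ y, HasDerivAt g (Complex.I * g y - Complex.I * B y) y := fun y => by
    have := (((hpd y).mul_const ((1 : ℝ) : ℂ)).sub ((hpowd y).const_mul (Complex.exp u))).cexp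
    refine this.congr_deriv ?_
    simp only [g, B, Complex.ofReal_one, mul_one, Pi.sub_apply]
    ring
  have hgi : Integrable g := integrable_lineInt hα hc 1 hu
  have hnp : ∀ y, 0 < ‖p y‖ := fun y => norm_pos_iff.2 (Complex.slitPlane_ne_zero (hp0 y))
  have hBbound : ∀ᵐ y : ℝ, ‖B y‖ ≤ Real.exp c * Real.exp (-A * c ^ α) * (Real.exp u.re * α) *
      (|y| ^ (α - 1) * Real.exp (-A * |y| ^ α)) := by
    have h0 : ∀ᵐ y : ℝ, y ≠ 0 := by
      simp [ae_iff, measure_singleton]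
    filter_upwards [h0] with y hy
    have h1 : ‖g y‖ ≤ Real.exp (c * 1) * (Real.exp (-A * c ^ α) * Real.exp (-A * |y| ^ α)) :=
      norm_lineInt_integrand_le hα hc 1 y hu
    have h2 : ‖p y ^ ((α : ℂ) - 1)‖ ≤ |y| ^ (α - 1) := by
      have : (α : ℂ) - 1 = ((α - 1 : ℝ) : ℂ) := by push_cast; ring
      rw [this, Complex.norm_cpow_real]
      exact Real.rpow_le_rpow_of_nonpos (abs_pos.2 hy) (norm_line_ge_abs c y) (by linarith)
    have h3 : ‖B y‖ = ‖g y‖ * (Real.exp u.re * (α * ‖p y ^ ((α : ℂ) - 1)‖)) := by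
      simp only [B, norm_mul, Complex.norm_exp, Complex.norm_real, Real.norm_eq_abs,
        abs_of_pos hα]
    rw [h3]
    calc _ ≤ Real.exp (c * 1) * (Real.exp (-A * c ^ α) * Real.exp (-A * |y| ^ α)) *
          (Real.exp u.re * (α * |y| ^ (α - 1))) := by gcongr
      _ = _ := by rw [mul_one]; ring
  have hBdom := (integrable_rpow_mul_exp_neg_abs (s := α - 1) hApos hα (by linarith)).const_mul
    (Real.exp c * Real.exp (-A * c ^ α) * (Real.exp u.re * α))
  have hBc : Continuous B := by
    have h1 : Continuous fun y => p y ^ ((α : ℂ) - 1) := continuous_line_cpow hc _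
    have h2 : Continuous g := continuous_lineInt_integrand hc 1 _
    exact h2.mul (continuous_const.mul (continuous_const.mul h1))
  have hBi : Integrable B := hBdom.mono' hBc.aestronglyMeasurable hBbound
  have hzero := integral_eq_zero_of_hasDerivAt_of_integrable hgd
    ((hgi.const_mul _).sub (hBi.const_mul _)) hgi
  have heq : ∫ y, g y = ∫ y, B y := by
    rw [integral_sub (hgi.const_mul _) (hBi.const_mul _), integral_const_mul, integral_const_mul,
      ← mul_sub, mul_eq_zero] at hzero
    exact sub_eq_zero.1 (hzero.resolve_left Complex.I_ne_zero)
  change ‖∫ y, g y‖ ≤ _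
  rw [heq]
  refine (norm_integral_le_of_norm_le hBdom hBbound).trans (le_of_eq ?_)
  rw [integral_const_mul, integral_abs_rpow_mul_exp hApos hα, sub_eq_add_neg, Real.exp_add,
    neg_mul, hA]
  field_simp
  ring

/-- The decay rate of the acceleration kernel in the direction `χ`. -/
def kernelRate (α χ : ℝ) : ℝ := (cosGap α χ / 4) ^ (1 / (1 - α))

lemma kernelRate_pos {α χ : ℝ} (hα : 0 < α) (hχ : |χ| + Real.pi * α / 2 < Real.pi / 2) :
    0 < kernelRate α χ :=
  Real.rpow_pos_of_pos (by have := cosGap_pos hα hχ; positivity) _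

/-- Choice of the abscissa by steepest descent: `c` solves `cosGap / 4 * exp u.re * c ^ α = c`, so
the exponent `c - cosGap / 2 * exp u.re * c ^ α` equals `-c`. -/
lemma norm_lineInt_one_one_le {α : ℝ} (hα : 0 < α) (hα1 : α < 1) {u : ℂ}
    (hu : |u.im| + Real.pi * α / 2 < Real.pi / 2) :
    ‖lineInt α 1 1 (Complex.exp u)‖ ≤ 4 / cosGap α u.im *
      Real.exp (-kernelRate α u.im * Real.exp (u.re / (1 - α))) := by
  have hs := cosGap_pos hα hu
  have h1α : 0 < 1 - α := by linarith
  set c := kernelRate α u.im * Real.exp (u.re / (1 - α)) with hc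
  have hcpos : 0 < c := mul_pos (kernelRate_pos hα hu) (Real.exp_pos _)
  rw [lineInt_eq hα hα1 one_pos hcpos 1 hu]
  refine (norm_lineInt_one_le hα hα1 hcpos hu).trans (le_of_eq ?_)
  congr 2
  have hc2 : c = (cosGap α u.im / 4 * Real.exp u.re) ^ (1 / (1 - α)) := by
    rw [hc, kernelRate, Real.mul_rpow (by positivity) (Real.exp_pos _).le, ← Real.exp_mul]
    congr 2
    ring
  have h2 : c ^ α * (cosGap α u.im / 4 * Real.exp u.re) = c := by
    have h3 : (cosGap α u.im / 4 * Real.exp u.re) = c ^ (1 - α) := by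
      rw [hc2, ← Real.rpow_mul (by positivity), one_div, inv_mul_cancel₀ h1α.ne', Real.rpow_one]
    rw [h3, ← Real.rpow_add hcpos]
    simp
  rw [neg_mul, ← hc]
  linear_combination -2 * h2

/-- The (complex) stable density: the inverse Laplace transform of `exp (-x p ^ α)`,
`x = X e ^ {iχ}`. -/
def stableDensity (α χ X Y : ℝ) : ℂ :=
  (2 * (Real.pi : ℂ))⁻¹ * lineInt α 1 Y (Complex.exp ((Real.log X : ℂ) + χ * Complex.I))

variable {α χ : ℝ}

lemma dir_im (χ t : ℝ) : ((t : ℂ) + χ * Complex.I).im = χ := by simp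
lemma dir_re (χ t : ℝ) : ((t : ℂ) + χ * Complex.I).re = t := by simp

lemma stableDensity_of_nonpos (hα : 0 < α) (hα1 : α < 1)
    (hχ : |χ| + Real.pi * α / 2 < Real.pi / 2) (X : ℝ) {Y : ℝ} (hY : Y ≤ 0) :
    stableDensity α χ X Y = 0 := by
  rw [stableDensity, lineInt_eq_zero hα hα1 one_pos hY (by rwa [dir_im]), mul_zero]

/-- Self-similarity of stable laws: `X` and `Y` enter only through `X Y ^ (-α)`, so bounds are
needed at `Y = 1` only. -/
lemma stableDensity_scale (hα : 0 < α) (hα1 : α < 1)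
    (hχ : |χ| + Real.pi * α / 2 < Real.pi / 2) (X : ℝ) {Y : ℝ} (hY : 0 < Y) :
    stableDensity α χ X Y = (Y : ℂ)⁻¹ * ((2 * (Real.pi : ℂ))⁻¹ *
      lineInt α 1 1 (Complex.exp (((Real.log X - α * Real.log Y : ℝ) : ℂ) + χ * Complex.I))) := by
  have h2 : (Real.log X : ℂ) + χ * Complex.I - α * Real.log Y
      = ((Real.log X - α * Real.log Y : ℝ) : ℂ) + χ * Complex.I := by
    push_cast; ring
  rw [stableDensity, lineInt_scale hY, h2,
    lineInt_eq hα hα1 (c := 1 * Y) (c' := 1) (by simpa using hY) one_pos 1 (by rwa [dir_im])]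
  ring

lemma norm_two_pi_inv_le : ‖(2 * (Real.pi : ℂ))⁻¹‖ ≤ 1 := by
  rw [norm_inv, norm_mul, Complex.norm_real, Real.norm_eq_abs, abs_of_pos Real.pi_pos]
  simp only [Complex.norm_ofNat]
  exact inv_le_one_of_one_le₀ (by nlinarith [Real.two_le_pi])

/-- For `α = k₁ / k₂`, `X = |η| ^ k₁` and `Y = |ξ| ^ k₂` the exponent is a multiple of `|η / ξ| ^
κ`: the kernel outweighs growth of order `κ` in `η` when `|ξ|` is small. -/
lemma norm_stableDensity_le (hα : 0 < α) (hα1 : α < 1)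
    (hχ : |χ| + Real.pi * α / 2 < Real.pi / 2) {X Y : ℝ} (hX : 0 < X) (hY : 0 < Y) :
    ‖stableDensity α χ X Y‖ ≤ 4 / cosGap α χ * Y⁻¹ *
      Real.exp (-kernelRate α χ * (X ^ (1 / (1 - α)) * Y ^ (-(α / (1 - α))))) := by
  have hs := cosGap_pos hα hχ
  rw [stableDensity_scale hα hα1 hχ X hY, norm_mul, norm_mul]
  have h1 := norm_lineInt_one_one_le hα hα1
    (u := ((Real.log X - α * Real.log Y : ℝ) : ℂ) + χ * Complex.I) (by rwa [dir_im])
  rw [dir_im, dir_re] at h1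
  have h2 : Real.exp ((Real.log X - α * Real.log Y) / (1 - α))
      = X ^ (1 / (1 - α)) * Y ^ (-(α / (1 - α))) := by
    rw [Real.rpow_def_of_pos hX, Real.rpow_def_of_pos hY, ← Real.exp_add]
    congr 1; ring
  rw [h2] at h1
  calc _ ≤ Y⁻¹ * (1 * (4 / cosGap α χ *
        Real.exp (-kernelRate α χ * (X ^ (1 / (1 - α)) * Y ^ (-(α / (1 - α))))))) := by
        gcongr
        · rw [norm_inv, Complex.norm_real, Real.norm_eq_abs, abs_of_pos hY]
        · exact norm_two_pi_inv_le
    _ = _ := by ring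

/-- The symbol `exp (-x p ^ α)` on the line `p = 1 + 2πi v`. -/
def stableSymbol (α : ℝ) (x : ℂ) (v : ℝ) : ℂ :=
  Complex.exp (-(x * ((1 : ℝ) + ((2 * Real.pi * v : ℝ) : ℂ) * Complex.I) ^ (α : ℂ)))

lemma continuous_stableSymbol (α : ℝ) (x : ℂ) : Continuous (stableSymbol α x) := by
  have := (continuous_lineInt_integrand (α := α) one_pos 0 x).comp
    (continuous_const.mul continuous_id : Continuous fun v : ℝ => 2 * Real.pi * v)
  refine this.congr fun v => ?_
  simp [stableSymbol]

lemma integrable_stableSymbol (hα : 0 < α) {u : ℂ}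
    (hu : |u.im| + Real.pi * α / 2 < Real.pi / 2) :
    Integrable (stableSymbol α (Complex.exp u)) := by
  have := (integrable_lineInt hα one_pos 0 hu).comp_mul_left' (R := 2 * Real.pi)
    (by positivity)
  refine this.congr (Eventually.of_forall fun v => ?_)
  simp [stableSymbol]

/-- On the line `p = 1 + 2πi v` the factor `exp (p Y)` is `exp Y` times a Fourier character.
Multiplying by `exp (-Y)` yields an inverse Fourier transform, so inversion and the convolution
theorem become available. -/
lemma exp_neg_mul_stableDensity (α χ X Y : ℝ) :
    (Real.exp (-Y) : ℂ) * stableDensity α χ X Y =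
      𝓕⁻ (stableSymbol α (Complex.exp ((Real.log X : ℂ) + χ * Complex.I))) Y := by
  set x := Complex.exp ((Real.log X : ℂ) + χ * Complex.I)
  have h1 := Measure.integral_comp_mul_left (fun y : ℝ => Complex.exp
    ((((1 : ℝ) : ℂ) + y * Complex.I) * Y - x * (((1 : ℝ) : ℂ) + y * Complex.I) ^ (α : ℂ)))
    (2 * Real.pi)
  rw [abs_of_pos (by positivity), Complex.real_smul] at h1
  have h2 : stableDensity α χ X Y = ((2 * Real.pi)⁻¹ : ℝ) * ∫ y : ℝ, Complex.exp
    ((((1 : ℝ) : ℂ) + y * Complex.I) * Y - x * (((1 : ℝ) : ℂ) + y * Complex.I) ^ (α : ℂ)) := by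
    simp [stableDensity, lineInt, x]
  rw [h2, ← h1, Real.fourierInv_eq', ← integral_const_mul]
  congr 1
  funext v
  rw [stableSymbol, smul_eq_mul, ← Complex.exp_add, Complex.ofReal_exp, ← Complex.exp_add]
  congr 1
  simp
  ring

/-- Moving the abscissa from `1` to `1 / 2` lets `exp (-Y)` win over `exp (Y / 2)`; for `Y ≤ 0` the
density vanishes. -/
lemma exists_norm_exp_mul_stableDensity_le (hα : 0 < α) (hα1 : α < 1)
    (hχ : |χ| + Real.pi * α / 2 < Real.pi / 2) (X : ℝ) :
    ∃ C : ℝ, ∀ Y : ℝ, ‖(Real.exp (-Y) : ℂ) * stableDensity α χ X Y‖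
      ≤ (Ioi (0 : ℝ)).indicator (fun Y => C * Real.exp (-(1 / 2) * Y)) Y := by
  obtain ⟨C, hC⟩ : ∃ C : ℝ, C = (Real.exp (-(cosGap α χ * Real.exp (Real.log X) / 2) *
    (1 / 2 : ℝ) ^ α) * ∫ y : ℝ, Real.exp (-(cosGap α χ * Real.exp (Real.log X) / 2) *
    |y| ^ α)) := ⟨_, rfl⟩
  refine ⟨C, fun Y => ?_⟩
  rcases le_or_gt Y 0 with hY | hY
  · rw [stableDensity_of_nonpos hα hα1 hχ X hY]
    simp [not_lt.2 hY]
  rw [indicator_of_mem (mem_Ioi.2 hY)]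
  have h1 := norm_lineInt_le hα (c := 1 / 2) (by norm_num) Y
    (u := (Real.log X : ℂ) + χ * Complex.I) (by rwa [dir_im])
  rw [dir_im, dir_re, ← hC] at h1
  rw [stableDensity, lineInt_eq hα hα1 one_pos (c' := 1 / 2) (by norm_num) Y (by rwa [dir_im]),
    norm_mul, norm_mul]
  calc _ ≤ Real.exp (-Y) * (1 * (Real.exp (1 / 2 * Y) * C)) := by
        gcongr
        · rw [Complex.norm_real, Real.norm_eq_abs, abs_of_pos (Real.exp_pos _)]
        · exact norm_two_pi_inv_le
    _ = C * (Real.exp (-Y) * Real.exp (1 / 2 * Y)) := by ring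
    _ = _ := by rw [← Real.exp_add]; congr 2; ring

lemma continuous_fourierInv_stableSymbol (hα : 0 < α) {u : ℂ}
    (hu : |u.im| + Real.pi * α / 2 < Real.pi / 2) :
    Continuous (𝓕⁻ (stableSymbol α (Complex.exp u))) := by
  have : 𝓕⁻ (stableSymbol α (Complex.exp u)) =
      fun Y => 𝓕 (stableSymbol α (Complex.exp u)) (-Y) := by
    funext Y; rw [Real.fourierInv_eq_fourier_neg]
  rw [this]
  exact (VectorFourier.fourierIntegral_continuous Real.continuous_fourierChar
    (by exact continuous_inner) (integrable_stableSymbol hα hu)).comp continuous_neg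

lemma integrable_fourierInv_stableSymbol (hα : 0 < α) (hα1 : α < 1)
    (hχ : |χ| + Real.pi * α / 2 < Real.pi / 2) (X : ℝ) :
    Integrable (𝓕⁻ (stableSymbol α (Complex.exp ((Real.log X : ℂ) + χ * Complex.I)))) := by
  obtain ⟨C, hC⟩ := exists_norm_exp_mul_stableDensity_le hα hα1 hχ X
  refine Integrable.mono' (g := (Ioi (0 : ℝ)).indicator (fun Y => C * Real.exp (-(1 / 2) * Y)))
    ?_ (continuous_fourierInv_stableSymbol hα (by rwa [dir_im])).aestronglyMeasurable
    (Eventually.of_forall fun Y => ?_)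
  · rw [integrable_indicator_iff measurableSet_Ioi]
    exact (exp_neg_integrableOn_Ioi 0 (by norm_num)).const_mul C
  · rw [← exp_neg_mul_stableDensity]
    exact hC Y

lemma fourier_fourierInv_stableSymbol (hα : 0 < α) (hα1 : α < 1)
    (hχ : |χ| + Real.pi * α / 2 < Real.pi / 2) (X : ℝ) :
    𝓕 (𝓕⁻ (stableSymbol α (Complex.exp ((Real.log X : ℂ) + χ * Complex.I)))) =
      stableSymbol α (Complex.exp ((Real.log X : ℂ) + χ * Complex.I)) := by
  refine Continuous.fourier_fourierInv_eq (continuous_stableSymbol _ _)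
    (integrable_stableSymbol hα (by rwa [dir_im])) ?_
  have := (integrable_fourierInv_stableSymbol hα hα1 hχ X).comp_neg
  refine this.congr (Eventually.of_forall fun Y => ?_)
  simp [Real.fourierInv_eq_fourier_neg]

/-- The Laplace transform at `1` of the stable density. -/
lemma integral_exp_neg_mul_stableDensity (hα : 0 < α) (hα1 : α < 1)
    (hχ : |χ| + Real.pi * α / 2 < Real.pi / 2) (X : ℝ) :
    ∫ Y : ℝ, (Real.exp (-Y) : ℂ) * stableDensity α χ X Y =
      Complex.exp (-Complex.exp ((Real.log X : ℂ) + χ * Complex.I)) := by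
  have h := congrFun (fourier_fourierInv_stableSymbol hα hα1 hχ X) 0
  rw [Real.fourier_real_eq] at h
  simp only [mul_zero, neg_zero, AddChar.map_zero_eq_one, one_smul] at h
  simp only [exp_neg_mul_stableDensity]
  rw [h]
  simp [stableSymbol]

/-- The semigroup property of the stable densities. -/
theorem stableDensity_convolution (hα : 0 < α) (hα1 : α < 1)
    (hχ : |χ| + Real.pi * α / 2 < Real.pi / 2) {X₁ X₂ : ℝ} (hX₁ : 0 < X₁) (hX₂ : 0 < X₂) (Y : ℝ) :
    ∫ Y₁ : ℝ, stableDensity α χ X₁ Y₁ * stableDensity α χ X₂ (Y - Y₁) =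
      stableDensity α χ (X₁ + X₂) Y := by
  have hdir : ∀ X : ℝ, |((Real.log X : ℂ) + χ * Complex.I).im| + Real.pi * α / 2 < Real.pi / 2 :=
    fun X => by rwa [dir_im]
  set x : ℝ → ℂ := fun X => Complex.exp ((Real.log X : ℂ) + χ * Complex.I) with hx
  -- Additivity of `x` in `X` makes the symbol `exp (-x p ^ α)` multiplicative: this is the source
  -- of the semigroup property.
  have hx3 : x (X₁ + X₂) = x X₁ + x X₂ := by
    simp only [hx, Complex.exp_add, ← Complex.ofReal_exp, Real.exp_log hX₁, Real.exp_log hX₂,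
      Real.exp_log (add_pos hX₁ hX₂), Complex.ofReal_add]
    ring
  have hi : ∀ X, Integrable (𝓕⁻ (stableSymbol α (x X))) := fun X =>
    integrable_fourierInv_stableSymbol hα hα1 hχ X
  have hcont : ∀ X, Continuous (𝓕⁻ (stableSymbol α (x X))) := fun X =>
    continuous_fourierInv_stableSymbol hα (hdir X)
  let w := 𝓕⁻ (stableSymbol α (x X₁)) ⋆[ContinuousLinearMap.mul ℂ ℂ] 𝓕⁻ (stableSymbol α (x X₂))
  have hFw : 𝓕 w = stableSymbol α (x (X₁ + X₂)) := by
    funext v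
    rw [Real.fourier_mul_convolution_eq (hi X₁) (hi X₂),
      fourier_fourierInv_stableSymbol hα hα1 hχ X₁, fourier_fourierInv_stableSymbol hα hα1 hχ X₂]
    change stableSymbol α (x X₁) v * stableSymbol α (x X₂) v = _
    rw [stableSymbol, stableSymbol, stableSymbol, ← Complex.exp_add, hx3]
    congr 1
    ring
  have hbdd : BddAbove (range fun Y => ‖𝓕⁻ (stableSymbol α (x X₂)) Y‖) := by
    obtain ⟨C, hC⟩ := exists_norm_exp_mul_stableDensity_le hα hα1 hχ X₂
    refine ⟨max C 0, ?_⟩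
    rintro _ ⟨Y, rfl⟩
    have := hC Y
    rw [exp_neg_mul_stableDensity] at this
    refine this.trans ?_
    by_cases hY : Y ∈ Ioi (0 : ℝ)
    · rw [indicator_of_mem hY]
      have h0 : 0 ≤ C * Real.exp (-(1 / 2) * Y) := by
        refine (norm_nonneg _).trans (this.trans ?_)
        rw [indicator_of_mem hY]
      have h1 : 0 ≤ C := nonneg_of_mul_nonneg_left h0 (Real.exp_pos _)
      have h2 : Real.exp (-(1 / 2) * Y) ≤ 1 := Real.exp_le_one_iff.2 (by
        have := mem_Ioi.1 hY; linarith)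
      exact (mul_le_of_le_one_right h1 h2).trans (le_max_left _ _)
    · rw [indicator_of_notMem hY]
      exact le_max_right _ _
  have hwc : Continuous w :=
    hbdd.continuous_convolution_right_of_integrable _ (hi X₁) (hcont X₂)
  have hwi : Integrable w := (hi X₁).integrable_convolution _ (hi X₂)
  have hw : 𝓕⁻ (stableSymbol α (x (X₁ + X₂))) = w := by
    rw [← hFw]
    refine Continuous.fourierInv_fourier_eq hwc hwi ?_
    rw [hFw]
    exact integrable_stableSymbol hα (hdir _)
  have h := congrFun hw Y
  rw [← exp_neg_mul_stableDensity] at h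
  have h2 : w Y = (Real.exp (-Y) : ℂ) *
      ∫ Y₁ : ℝ, stableDensity α χ X₁ Y₁ * stableDensity α χ X₂ (Y - Y₁) := by
    rw [← integral_const_mul]
    change ∫ t, 𝓕⁻ (stableSymbol α (x X₁)) t * 𝓕⁻ (stableSymbol α (x X₂)) (Y - t) = _
    congr 1
    funext t
    rw [← exp_neg_mul_stableDensity, ← exp_neg_mul_stableDensity]
    -- The normalizing exponential is a character, so it passes through the convolution.
    have : (Real.exp (-Y) : ℂ) = (Real.exp (-t) : ℂ) * (Real.exp (-(Y - t)) : ℂ) := by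
      rw [← Complex.ofReal_mul, ← Real.exp_add]; congr 2; ring
    rw [this]
    ring
  rw [h2] at h
  exact (mul_left_cancel₀ (by exact_mod_cast (Real.exp_pos _).ne') h).symm

end StableDensity
end

noncomputable section

open MeasureTheory Filter Topology Set Metric
open scoped Interval

/-! ### Beta and Gamma integrals, exponential substitution, identity theorem. -/

section BetaIntegral

lemma hasBetaIntegral {p q X : ℝ} (hp : 0 < p) (hq : 0 < q) (hX : 0 < X) :
    IntegrableOn (fun t : ℝ => t ^ (p - 1) * (X - t) ^ (q - 1)) (Ioo 0 X) ∧
    ∫ t in Ioo 0 X, t ^ (p - 1) * (X - t) ^ (q - 1) =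
      X ^ (p + q - 1) * (Real.Gamma p * Real.Gamma q / Real.Gamma (p + q)) := by
  have hval := Complex.betaIntegral_scaled (p : ℂ) (q : ℂ) hX
  rw [Complex.betaIntegral_eq_Gamma_mul_div _ _ (by simpa) (by simpa),
    intervalIntegral.integral_of_le hX.le, integral_Ioc_eq_integral_Ioo] at hval
  have hcongr : EqOn (fun t : ℝ => (t : ℂ) ^ ((p : ℂ) - 1) * ((X : ℂ) - t) ^ ((q : ℂ) - 1))
      (fun t : ℝ => ((t ^ (p - 1) * (X - t) ^ (q - 1) : ℝ) : ℂ)) (Ioo 0 X) := by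
    intro t ht
    have h1 : (0 : ℝ) ≤ X - t := by linarith [ht.2]
    change (t : ℂ) ^ ((p : ℂ) - 1) * ((X : ℂ) - t) ^ ((q : ℂ) - 1) =
      ((t ^ (p - 1) * (X - t) ^ (q - 1) : ℝ) : ℂ)
    rw [Complex.ofReal_mul, Complex.ofReal_cpow ht.1.le, Complex.ofReal_cpow h1]
    push_cast
    rfl
  rw [setIntegral_congr_fun measurableSet_Ioo hcongr, integral_complex_ofReal] at hval
  have hval' : ((∫ t in Ioo 0 X, t ^ (p - 1) * (X - t) ^ (q - 1) : ℝ) : ℂ) =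
      ((X ^ (p + q - 1) * (Real.Gamma p * Real.Gamma q / Real.Gamma (p + q)) : ℝ) : ℂ) := by
    rw [hval]
    rw [Complex.ofReal_mul, Complex.ofReal_cpow hX.le, Complex.ofReal_div, Complex.ofReal_mul,
      ← Complex.Gamma_ofReal, ← Complex.Gamma_ofReal, ← Complex.Gamma_ofReal]
    push_cast
    rfl
  have hval2 := Complex.ofReal_injective hval'
  refine ⟨?_, hval2⟩
  -- The value just computed is positive, whereas the integral of a non-integrable function is `0`
  -- by convention.
  by_contra hni
  rw [integral_undef hni] at hval2
  have : 0 < X ^ (p + q - 1) * (Real.Gamma p * Real.Gamma q / Real.Gamma (p + q)) := by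
    have := Real.Gamma_pos_of_pos hp
    have := Real.Gamma_pos_of_pos hq
    have := Real.Gamma_pos_of_pos (add_pos hp hq)
    positivity
  linarith

end BetaIntegral

section ExpSubstitution

variable {F : Type*} [NormedAddCommGroup F] [NormedSpace ℝ F]

lemma image_exp_mul {k : ℝ} (hk : 0 < k) : (fun s : ℝ => Real.exp (k * s)) '' univ = Ioi 0 := by
  ext y
  simp only [image_univ, mem_range, mem_Ioi]
  constructor
  · rintro ⟨s, rfl⟩; exact Real.exp_pos _
  · intro hy
    refine ⟨Real.log y / k, ?_⟩
    rw [mul_div_cancel₀ _ hk.ne', Real.exp_log hy]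

lemma hasDerivWithinAt_exp_mul (k s : ℝ) :
    HasDerivWithinAt (fun s : ℝ => Real.exp (k * s)) (k * Real.exp (k * s)) univ s := by
  have := ((hasDerivAt_id s).const_mul k).exp
  refine (this.congr_deriv ?_).hasDerivWithinAt
  simp [mul_comm]

lemma injOn_exp_mul {k : ℝ} (hk : 0 < k) : InjOn (fun s : ℝ => Real.exp (k * s)) univ := by
  intro s _ t _ h
  exact mul_left_cancel₀ hk.ne' (Real.exp_injective h)

lemma integral_exp_substitution {k : ℝ} (hk : 0 < k) (g : ℝ → F) :
    ∫ s : ℝ, (k * Real.exp (k * s)) • g (Real.exp (k * s)) = ∫ X in Ioi (0 : ℝ), g X := by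
  rw [← image_exp_mul hk, integral_image_eq_integral_abs_deriv_smul MeasurableSet.univ
    (fun s _ => hasDerivWithinAt_exp_mul k s) (injOn_exp_mul hk), setIntegral_univ]
  congr 1
  funext s
  rw [abs_of_pos (by positivity)]

lemma integrable_exp_substitution {k : ℝ} (hk : 0 < k) (g : ℝ → F) :
    Integrable (fun s : ℝ => (k * Real.exp (k * s)) • g (Real.exp (k * s))) ↔
      IntegrableOn g (Ioi 0) := by
  rw [← image_exp_mul hk, integrableOn_image_iff_integrableOn_abs_deriv_smul MeasurableSet.univ
    (fun s _ => hasDerivWithinAt_exp_mul k s) (injOn_exp_mul hk), integrableOn_univ]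
  refine integrable_congr (Eventually.of_forall fun s => ?_)
  simp only
  rw [abs_of_pos (by positivity)]

end ExpSubstitution

section IdentityTheorem

lemma frequently_of_real_line {z₀ : ℂ} {p : ℂ → Prop}
    (h : ∀ᶠ t : ℝ in 𝓝 0, p (z₀ + t)) : ∃ᶠ z in 𝓝[≠] z₀, p z := by
  have ht : Tendsto (fun t : ℝ => z₀ + (t : ℂ)) (𝓝[≠] 0) (𝓝[≠] z₀) := by
    refine tendsto_nhdsWithin_iff.2 ⟨?_, ?_⟩
    · have : Continuous fun t : ℝ => z₀ + (t : ℂ) := by fun_prop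
      have h2 := this.tendsto 0
      simp only [Complex.ofReal_zero, add_zero] at h2
      exact h2.mono_left nhdsWithin_le_nhds
    · filter_upwards [self_mem_nhdsWithin] with t ht
      simpa using ht
  exact ht.frequently (h.filter_mono nhdsWithin_le_nhds).frequently

/-- Two holomorphic functions on a connected open set which agree on a short horizontal segment
agree everywhere. -/
lemma eqOn_of_eq_on_segment {U : Set ℂ} (hU : IsOpen U) (hpre : IsPreconnected U) {f g : ℂ → ℂ}
    (hf : DifferentiableOn ℂ f U) (hg : DifferentiableOn ℂ g U) {z₀ : ℂ} (hz₀ : z₀ ∈ U)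
    (h : ∀ᶠ t : ℝ in 𝓝 0, f (z₀ + t) = g (z₀ + t)) : EqOn f g U :=
  (hf.analyticOnNhd hU).eqOn_of_preconnected_of_frequently_eq (hg.analyticOnNhd hU) hpre hz₀
    (frequently_of_real_line h)

/-- Both sides are holomorphic in `r` on the right half plane and agree at real points near `1`.
Complex `r` occurs below as `exp (iχ)`, the angle between two rays. -/
lemma integral_cpow_mul_cexp_neg_mul_Ioi {a : ℝ} (ha : 0 < a) {r : ℂ} (hr : 0 < r.re) :
    ∫ t : ℝ in Ioi 0, (t : ℂ) ^ ((a : ℂ) - 1) * Complex.exp (-(r * t)) =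
      (1 / r) ^ (a : ℂ) * Complex.Gamma a := by
  have hUo : IsOpen {w : ℂ | 0 < w.re} := isOpen_lt continuous_const Complex.continuous_re
  refine eqOn_of_eq_on_segment (U := {w : ℂ | 0 < w.re}) hUo
    (convex_halfSpace_re_gt 0).isPreconnected
    (f := fun r => ∫ t : ℝ in Ioi 0, (t : ℂ) ^ ((a : ℂ) - 1) * Complex.exp (-(r * t)))
    (g := fun r => (1 / r) ^ (a : ℂ) * Complex.Gamma a) ?_ ?_ (z₀ := 1) (by simp) ?_ hr
  · refine differentiableOn_integral_of_holomorphic (fun w _ => ?_)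
      (Eventually.of_forall fun t => by fun_prop) fun w hw => ?_
    · refine Measurable.aestronglyMeasurable ?_
      fun_prop
    · have hw : 0 < w.re := hw
      refine ⟨{z | w.re / 2 < z.re}, (isOpen_lt continuous_const Complex.continuous_re).mem_nhds
        (by simp only [mem_ofPred_eq]; linarith), fun z hz => ?_,
        fun t => t ^ (a - 1) * Real.exp (-(w.re / 2) * t ^ (1 : ℝ)), ?_, ?_⟩
      · simp only [mem_ofPred_eq] at hz ⊢; linarith
      · exact integrableOn_rpow_mul_exp_neg_mul_rpow (by linarith) one_pos (by linarith)
      · filter_upwards [ae_restrict_mem measurableSet_Ioi] with t ht z hz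
        have ht : 0 < t := ht
        have hz : w.re / 2 < z.re := hz
        have e : (a : ℂ) - 1 = ((a - 1 : ℝ) : ℂ) := by push_cast; ring
        rw [norm_mul, e, ← Complex.ofReal_cpow ht.le, Complex.norm_real, Real.norm_eq_abs,
          abs_of_nonneg (Real.rpow_nonneg ht.le _), Complex.norm_exp, Real.rpow_one]
        gcongr
        simp only [Complex.neg_re, Complex.mul_re, Complex.ofReal_re, Complex.ofReal_im, mul_zero,
          sub_zero]
        nlinarith
  · intro w hw
    have hw : 0 < w.re := hw
    have hw0 : w ≠ 0 := fun h => by simp [h] at hw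
    refine DifferentiableAt.differentiableWithinAt (DifferentiableAt.mul_const ?_ _)
    refine DifferentiableAt.cpow ((differentiableAt_const _).div differentiableAt_id hw0)
      (differentiableAt_const _) (Or.inl ?_)
    rw [one_div, Complex.inv_re]
    exact div_pos hw (Complex.normSq_pos.2 hw0)
  · filter_upwards [lt_mem_nhds (show (-1 : ℝ) < 0 by norm_num)] with t ht
    have := Complex.integral_cpow_mul_exp_neg_mul_Ioi (a := a) (r := 1 + t) (by simpa)
      (by linarith)
    push_cast at this ⊢
    exact this

end IdentityTheorem

/-! ### The transform with stable kernel: bounds, convolutions, powers. -/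

section StableTransform

attribute [local irreducible] stableDensity lineInt

variable {α χ : ℝ}

lemma stronglyMeasurable_stableDensity (α χ : ℝ) :
    StronglyMeasurable fun p : ℝ × ℝ => stableDensity α χ p.1 p.2 := by
  unfold stableDensity lineInt
  refine StronglyMeasurable.const_mul ?_ _
  refine StronglyMeasurable.integral_prod_right (f := fun (p : ℝ × ℝ) (y : ℝ) =>
    Complex.exp ((((1 : ℝ) : ℂ) + y * Complex.I) * p.2 -
      Complex.exp ((Real.log p.1 : ℂ) + χ * Complex.I) *
      (((1 : ℝ) : ℂ) + y * Complex.I) ^ (α : ℂ))) ?_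
  refine Measurable.stronglyMeasurable ?_
  simp only [Function.uncurry_def]
  have h1 : Measurable fun y : ℝ => (((1 : ℝ) : ℂ) + y * Complex.I) ^ (α : ℂ) :=
    (continuous_line_cpow one_pos _).measurable
  have h2 : Measurable fun p : (ℝ × ℝ) × ℝ => (((1 : ℝ) : ℂ) + p.2 * Complex.I) ^ (α : ℂ) :=
    h1.comp measurable_snd
  fun_prop

/-- The integral transform with the stable densities as kernel. -/
def stableTransform (α χ : ℝ) (f : ℝ → ℂ) (Y : ℝ) : ℂ := ∫ X : ℝ, f X * stableDensity α χ X Y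

/-- `f` is supported on `X > 0` and bounded by `A X ^ (p - 1) exp (c X ^ b)`. -/
structure ExpBounded (b c p A : ℝ) (f : ℝ → ℂ) : Prop where
  meas : Measurable f
  zero : ∀ X ≤ 0, f X = 0
  bound : ∀ X, 0 < X → ‖f X‖ ≤ A * (X ^ (p - 1) * Real.exp (c * X ^ b))

lemma ExpBounded.nonneg {b c p A : ℝ} {f : ℝ → ℂ} (h : ExpBounded b c p A f) : 0 ≤ A := by
  have := (norm_nonneg _).trans (h.bound 1 one_pos)
  exact nonneg_of_mul_nonneg_left this (by positivity)

/-- The constant in the bound of the stable transform. -/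
def transformConst (α χ p : ℝ) : ℝ := 4 / cosGap α χ *
  ((kernelRate α χ / 2) ^ (-p * (1 - α)) * (1 - α) * Real.Gamma (p * (1 - α)))

/-- Half of the decay rate of the kernel absorbs the growth `exp (c X ^ (1 / (1 - α)))`, which is
what the smallness of `Y` expresses; the other half is left for integrability. -/
lemma ExpBounded.norm_mul_le (hα : 0 < α) (hα1 : α < 1)
    (hχ : |χ| + Real.pi * α / 2 < Real.pi / 2) {c p A : ℝ} {f : ℝ → ℂ}
    (hf : ExpBounded (1 / (1 - α)) c p A f) {Y : ℝ} (hY : 0 < Y)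
    (hcY : 2 * c * Y ^ (α / (1 - α)) ≤ kernelRate α χ) (X : ℝ) :
    ‖f X * stableDensity α χ X Y‖ ≤ (Ioi (0 : ℝ)).indicator (fun X =>
      A * (4 / cosGap α χ) * Y⁻¹ * (X ^ (p - 1) *
        Real.exp (-(kernelRate α χ / 2 * Y ^ (-(α / (1 - α)))) * X ^ (1 / (1 - α))))) X := by
  have hs := cosGap_pos hα hχ
  rcases le_or_gt X 0 with hX | hX
  · rw [hf.zero X hX, indicator_of_notMem (by simpa using hX)]; simp
  rw [indicator_of_mem (mem_Ioi.2 hX), norm_mul]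
  have h1 := hf.bound X hX
  have h2 := norm_stableDensity_le hα hα1 hχ hX hY
  have hA := hf.nonneg
  have h3 : c ≤ kernelRate α χ / 2 * Y ^ (-(α / (1 - α))) := by
    have h5 : 0 < Y ^ (α / (1 - α)) := Real.rpow_pos_of_pos hY _
    rw [Real.rpow_neg hY.le, ← div_eq_mul_inv, le_div_iff₀ h5]
    linarith
  calc _ ≤ (A * (X ^ (p - 1) * Real.exp (c * X ^ (1 / (1 - α))))) * (4 / cosGap α χ * Y⁻¹ *
        Real.exp (-kernelRate α χ * (X ^ (1 / (1 - α)) * Y ^ (-(α / (1 - α)))))) := by gcongr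
    _ = A * (4 / cosGap α χ) * Y⁻¹ * (X ^ (p - 1) * (Real.exp (c * X ^ (1 / (1 - α))) *
        Real.exp (-kernelRate α χ * (X ^ (1 / (1 - α)) * Y ^ (-(α / (1 - α))))))) := by ring
    _ ≤ _ := by
      rw [← Real.exp_add]
      gcongr
      have : 0 < X ^ (1 / (1 - α)) := Real.rpow_pos_of_pos hX _
      nlinarith

/-- What remains is a Gamma integral, and scaling produces `Y ^ (p α - 1)`. For `p = l / k₁` and `α
= k₁ / k₂` one has `p α = l / k₂`: the grade `l` is preserved from one level to the next. -/
lemma ExpBounded.transform (hα : 0 < α) (hα1 : α < 1)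
    (hχ : |χ| + Real.pi * α / 2 < Real.pi / 2) {c p A : ℝ} (hp : 0 < p) {f : ℝ → ℂ}
    (hf : ExpBounded (1 / (1 - α)) c p A f) {Y : ℝ} (hY : 0 < Y)
    (hcY : 2 * c * Y ^ (α / (1 - α)) ≤ kernelRate α χ) :
    Integrable (fun X => f X * stableDensity α χ X Y) ∧
    ∫ X, ‖f X * stableDensity α χ X Y‖ ≤ A * transformConst α χ p * Y ^ (p * α - 1) := by
  have h1α : 0 < 1 - α := by linarith
  have hρ := kernelRate_pos hα hχ
  have hlam : 0 < kernelRate α χ / 2 * Y ^ (-(α / (1 - α))) := by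
    have := Real.rpow_pos_of_pos hY (-(α / (1 - α)))
    positivity
  have hdom : Integrable ((Ioi (0 : ℝ)).indicator (fun X =>
      A * (4 / cosGap α χ) * Y⁻¹ * (X ^ (p - 1) *
        Real.exp (-(kernelRate α χ / 2 * Y ^ (-(α / (1 - α)))) * X ^ (1 / (1 - α)))))) := by
    rw [integrable_indicator_iff measurableSet_Ioi]
    exact (integrableOn_rpow_mul_exp_neg_mul_rpow (by linarith) (by positivity) hlam).const_mul _
  have hm : AEStronglyMeasurable (fun X => f X * stableDensity α χ X Y) := by
    refine (hf.meas.stronglyMeasurable.mul ?_).aestronglyMeasurable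
    exact (stronglyMeasurable_stableDensity α χ).comp_measurable
      (measurable_id.prodMk measurable_const)
  have hi := hdom.mono' hm (Eventually.of_forall (hf.norm_mul_le hα hα1 hχ hY hcY))
  refine ⟨hi, (integral_mono hi.norm hdom (hf.norm_mul_le hα hα1 hχ hY hcY)).trans
    (le_of_eq ?_)⟩
  rw [integral_indicator measurableSet_Ioi, integral_const_mul,
    integral_rpow_mul_exp_neg_mul_rpow (by positivity) (by linarith) hlam,
    Real.mul_rpow (by positivity) (Real.rpow_pos_of_pos hY _).le, ← Real.rpow_mul hY.le]
  have e1 : (p - 1 + 1) / (1 / (1 - α)) = p * (1 - α) := by field_simp; ring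
  have e2 : -(p - 1 + 1) / (1 / (1 - α)) = -p * (1 - α) := by rw [neg_div, e1, neg_mul]
  have e3 : -(α / (1 - α)) * (-p * (1 - α)) = p * α := by field_simp
  have e4 : Y ^ (p * α - 1) = Y ^ (p * α) * Y⁻¹ := by
    rw [Real.rpow_sub hY, Real.rpow_one, div_eq_mul_inv]
  rw [e1, e2, e3, e4, transformConst, one_div_one_div]
  ring

lemma stableTransform_of_nonpos (hα : 0 < α) (hα1 : α < 1)
    (hχ : |χ| + Real.pi * α / 2 < Real.pi / 2) (f : ℝ → ℂ) {Y : ℝ} (hY : Y ≤ 0) :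
    stableTransform α χ f Y = 0 := by
  simp [stableTransform, stableDensity_of_nonpos hα hα1 hχ _ hY]

lemma integral_shear (μ : ℝ × ℝ → ℂ) (h : Integrable fun z : ℝ × ℝ => μ (z.1, z.1 + z.2)) :
    Integrable μ ∧ ∫ z, μ z = ∫ z : ℝ × ℝ, μ (z.1, z.1 + z.2) := by
  have hmp : MeasurePreserving (fun z : ℝ × ℝ => (z.1, z.1 + z.2)) volume volume :=
    measurePreserving_prod_add volume volume
  have he : MeasurableEmbedding (fun z : ℝ × ℝ => (z.1, z.1 + z.2)) :=
    (MeasurableEquiv.shearAddRight ℝ).measurableEmbedding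
  exact ⟨(hmp.integrable_comp_emb he).1 h, (hmp.integral_comp he μ).symm⟩

lemma beta_indicator_integrable {p q Y : ℝ} (hp : 0 < p) (hq : 0 < q) (hY : 0 < Y) (C : ℝ) :
    Integrable ((Ioo 0 Y).indicator fun t : ℝ => C * (t ^ (p - 1) * (Y - t) ^ (q - 1))) := by
  rw [integrable_indicator_iff measurableSet_Ioo]
  exact (hasBetaIntegral hp hq hY).1.const_mul C

/-- The stable transform maps convolution products to convolution products. -/
theorem stableTransform_convolution (hα : 0 < α) (hα1 : α < 1)
    (hχ : |χ| + Real.pi * α / 2 < Real.pi / 2) {c p q A B : ℝ} (hc : 0 < c) (hp : 0 < p)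
    (hq : 0 < q) {f g : ℝ → ℂ}
    (hf : ExpBounded (1 / (1 - α)) c p A f) (hg : ExpBounded (1 / (1 - α)) c q B g)
    {Y : ℝ} (hY : 0 < Y) (hcY : 2 * c * Y ^ (α / (1 - α)) ≤ kernelRate α χ) :
    stableTransform α χ (fun X => ∫ X₁, f X₁ * g (X - X₁)) Y =
      ∫ Y₁, stableTransform α χ f Y₁ * stableTransform α χ g (Y - Y₁) := by
  have h1α : 0 < 1 - α := by linarith
  have hβ : 0 < α / (1 - α) := by positivity
  have hcY' : ∀ Y', 0 < Y' → Y' ≤ Y → 2 * c * Y' ^ (α / (1 - α)) ≤ kernelRate α χ := by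
    intro Y' h0 h1
    refine le_trans ?_ hcY
    gcongr
  have hSD := stronglyMeasurable_stableDensity α χ
  have hfm := hf.meas.stronglyMeasurable
  have hgm := hg.meas.stronglyMeasurable
  -- the triple integral
  let Θ : (ℝ × ℝ) × ℝ → ℂ := fun z =>
    (f z.1.1 * stableDensity α χ z.1.1 z.2) * (g z.1.2 * stableDensity α χ z.1.2 (Y - z.2))
  have hΘm : StronglyMeasurable Θ := by
    have m1 : Measurable fun z : (ℝ × ℝ) × ℝ => (z.1.1, z.2) := by fun_prop
    have m2 : Measurable fun z : (ℝ × ℝ) × ℝ => (z.1.2, Y - z.2) := by fun_prop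
    have m3 : Measurable fun z : (ℝ × ℝ) × ℝ => z.1.1 := by fun_prop
    have m4 : Measurable fun z : (ℝ × ℝ) × ℝ => z.1.2 := by fun_prop
    exact ((hfm.comp_measurable m3).mul (hSD.comp_measurable m1)).mul
      ((hgm.comp_measurable m4).mul (hSD.comp_measurable m2))
  have hΘout : ∀ Y₁ ∉ Ioo 0 Y, ∀ z, Θ (z, Y₁) = 0 := by
    intro Y₁ hY₁ z
    simp only [mem_Ioo, not_and_or, not_lt] at hY₁
    rcases hY₁ with h | h
    · simp [Θ, stableDensity_of_nonpos hα hα1 hχ _ h]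
    · simp [Θ, stableDensity_of_nonpos hα hα1 hχ _ (sub_nonpos.2 h)]
  -- For fixed `Y₁` the double integral factors and each factor is bounded by a power, so the outer
  -- integral is dominated by a Beta integrand on `(0, Y)`.
  have hΘi : Integrable Θ (volume.prod volume) := by
    rw [integrable_prod_iff' hΘm.aestronglyMeasurable]
    have hslice : ∀ Y₁, Integrable (fun z : ℝ × ℝ => Θ (z, Y₁)) := by
      intro Y₁
      by_cases hY₁ : Y₁ ∈ Ioo 0 Y
      · exact (hf.transform hα hα1 hχ hp hY₁.1 (hcY' _ hY₁.1 hY₁.2.le)).1.mul_prod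
          (hg.transform hα hα1 hχ hq (sub_pos.2 hY₁.2)
            (hcY' _ (sub_pos.2 hY₁.2) (by linarith [hY₁.1]))).1
      · simp only [hΘout Y₁ hY₁]
        exact integrable_zero _ _ _
    refine ⟨Eventually.of_forall hslice, ?_⟩
    refine Integrable.mono' (beta_indicator_integrable (p := p * α) (q := q * α) (by positivity)
      (by positivity) hY (A * transformConst α χ p * (B * transformConst α χ q))) ?_ ?_
    · exact (hΘm.norm.comp_measurable measurable_swap).integral_prod_right'.aestronglyMeasurable
    · refine Eventually.of_forall fun Y₁ => ?_
      rw [Real.norm_eq_abs, abs_of_nonneg (integral_nonneg fun _ => norm_nonneg _)]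
      by_cases hY₁ : Y₁ ∈ Ioo 0 Y
      · rw [indicator_of_mem hY₁]
        have e1 : (fun z : ℝ × ℝ => ‖Θ (z, Y₁)‖) = fun z : ℝ × ℝ =>
            ‖f z.1 * stableDensity α χ z.1 Y₁‖ * ‖g z.2 * stableDensity α χ z.2 (Y - Y₁)‖ := by
          funext z; simp only [Θ, norm_mul]
        rw [e1]
        have e2 := integral_prod_mul (μ := (volume : Measure ℝ)) (ν := (volume : Measure ℝ))
          (fun X => ‖f X * stableDensity α χ X Y₁‖)
          (fun X => ‖g X * stableDensity α χ X (Y - Y₁)‖)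
        rw [← Measure.volume_eq_prod] at e2
        rw [e2]
        have b1 := (hf.transform hα hα1 hχ hp hY₁.1 (hcY' _ hY₁.1 hY₁.2.le)).2
        have b2 := (hg.transform hα hα1 hχ hq (sub_pos.2 hY₁.2)
            (hcY' _ (sub_pos.2 hY₁.2) (by linarith [hY₁.1]))).2
        refine (mul_le_mul b1 b2 (integral_nonneg fun _ => norm_nonneg _)
          ((integral_nonneg fun _ => norm_nonneg _).trans b1)).trans (le_of_eq (by ring))
      · rw [indicator_of_notMem hY₁]
        simp [hΘout Y₁ hY₁]
  -- integrate over `Y₁` first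
  have hinner : ∀ z : ℝ × ℝ, ∫ Y₁, Θ (z, Y₁) =
      f z.1 * g z.2 * stableDensity α χ (z.1 + z.2) Y := by
    intro z
    rcases le_or_gt z.1 0 with h | h1
    · simp [Θ, hf.zero _ h]
    rcases le_or_gt z.2 0 with h | h2
    · simp [Θ, hg.zero _ h]
    rw [← stableDensity_convolution hα hα1 hχ h1 h2 Y, ← integral_const_mul]
    congr 1
    funext Y₁
    simp only [Θ]
    ring
  have hpair : Integrable fun z : ℝ × ℝ => f z.1 * g z.2 * stableDensity α χ (z.1 + z.2) Y := by
    have := hΘi.integral_prod_left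
    refine this.congr (Eventually.of_forall fun z => ?_)
    exact hinner z
  -- The shear `(X₁, X₂) ↦ (X₁, X₁ + X₂)` identifies the integral over pairs with the transform of
  -- the convolution.
  let Ξ : ℝ × ℝ → ℂ := fun z => f z.1 * g (z.2 - z.1) * stableDensity α χ z.2 Y
  have hΞ := integral_shear Ξ (by simpa [Ξ] using hpair)
  have e1 : stableTransform α χ (fun X => ∫ X₁, f X₁ * g (X - X₁)) Y
      = ∫ X, ∫ X₁, Ξ (X₁, X) := by
    unfold stableTransform
    congr 1
    funext X
    rw [← integral_mul_const]
  have e2 : ∫ X, ∫ X₁, Ξ (X₁, X) = ∫ z, Ξ z := by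
    rw [Measure.volume_eq_prod, integral_prod_symm]
    rw [← Measure.volume_eq_prod]; exact hΞ.1
  have e3 : ∫ z : ℝ × ℝ, Ξ (z.1, z.1 + z.2) = ∫ z : ℝ × ℝ, ∫ Y₁, Θ (z, Y₁) := by
    congr 1
    funext z
    rw [hinner]
    simp [Ξ]
  have e4 : ∫ z : ℝ × ℝ, ∫ Y₁, Θ (z, Y₁) = ∫ Y₁, ∫ z : ℝ × ℝ, Θ (z, Y₁) :=
    integral_integral_swap (f := fun (z : ℝ × ℝ) (Y₁ : ℝ) => Θ (z, Y₁)) hΘi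
  rw [e1, e2, hΞ.2, e3, e4]
  congr 1
  funext Y₁
  have e5 := integral_prod_mul (μ := (volume : Measure ℝ)) (ν := (volume : Measure ℝ))
          (fun X => f X * stableDensity α χ X Y₁) (fun X => g X * stableDensity α χ X (Y - Y₁))
  rw [← Measure.volume_eq_prod] at e5
  exact e5

/-- The stable transform of a power. -/
theorem stableTransform_rpow (hα : 0 < α) (hα1 : α < 1)
    (hχ : |χ| + Real.pi * α / 2 < Real.pi / 2) {a : ℝ} (ha : 0 < a) {Y : ℝ} (hY : 0 < Y) :
    ∫ X in Ioi (0 : ℝ), ((X ^ (a - 1) : ℝ) : ℂ) * stableDensity α χ X Y =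
      ((Real.Gamma a / Real.Gamma (a * α) * Y ^ (a * α - 1) : ℝ) : ℂ) *
        Complex.exp (-(χ * a * Complex.I)) := by
  have h1α : 0 < 1 - α := by linarith
  let f : ℝ → ℂ := (Ioi (0 : ℝ)).indicator fun X => ((X ^ (a - 1) : ℝ) : ℂ)
  have hf : ExpBounded (1 / (1 - α)) 0 a 1 f := by
    refine ⟨?_, fun X hX => indicator_of_notMem (by simpa using hX) _, fun X hX => ?_⟩
    · refine Measurable.indicator ?_ measurableSet_Ioi
      fun_prop
    · simp only [f, indicator_of_mem (mem_Ioi.2 hX)]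
      rw [Complex.norm_real, Real.norm_eq_abs, abs_of_nonneg (Real.rpow_nonneg hX.le _)]
      simp
  have hfi : ∀ Y : ℝ, ∫ X in Ioi (0 : ℝ), ((X ^ (a - 1) : ℝ) : ℂ) * stableDensity α χ X Y =
      stableTransform α χ f Y := by
    intro Y
    rw [stableTransform, ← integral_indicator measurableSet_Ioi]
    congr 1
    funext X
    by_cases hX : X ∈ Ioi (0 : ℝ) <;> simp [f, hX]
  have hρ := kernelRate_pos hα hχ
  have hT := fun {Y : ℝ} (hY : 0 < Y) => hf.transform hα hα1 hχ ha hY (by simpa using hρ.le)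
  -- homogeneity
  have hscale : ∀ Y : ℝ, 0 < Y → stableTransform α χ f Y =
      ((Y ^ (a * α - 1) : ℝ) : ℂ) * stableTransform α χ f 1 := by
    intro Y hY
    rw [← hfi, ← hfi]
    have hr : 0 < Y ^ α := Real.rpow_pos_of_pos hY _
    have := integral_comp_mul_left_Ioi (fun X => ((X ^ (a - 1) : ℝ) : ℂ) * stableDensity α χ X Y)
      0 hr
    rw [mul_zero] at this
    have h2 : ∫ X in Ioi (0 : ℝ), ((X ^ (a - 1) : ℝ) : ℂ) * stableDensity α χ X Y =
        (Y ^ α : ℝ) • ∫ X in Ioi (0 : ℝ), (((Y ^ α * X) ^ (a - 1) : ℝ) : ℂ) *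
          stableDensity α χ (Y ^ α * X) Y := by
      rw [this, smul_smul, mul_inv_cancel₀ hr.ne', one_smul]
    rw [h2, Complex.real_smul, ← integral_const_mul, ← integral_const_mul]
    refine setIntegral_congr_fun measurableSet_Ioi fun X hX => ?_
    have hX : 0 < X := hX
    rw [stableDensity_scale hα hα1 hχ _ hY, stableDensity_scale hα hα1 hχ X one_pos,
      Real.log_mul hr.ne' hX.ne', Real.log_rpow hY, Real.log_one,
      Real.mul_rpow hr.le hX.le, ← Real.rpow_mul hY.le]
    have e1 : α * Real.log Y + Real.log X - α * Real.log Y = Real.log X - α * 0 := by ring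
    rw [e1]
    have e2 : ((Y ^ (a * α - 1) : ℝ) : ℂ) =
        ((Y ^ α : ℝ) : ℂ) * ((Y ^ (α * (a - 1)) : ℝ) : ℂ) * (Y : ℂ)⁻¹ := by
      rw [← Complex.ofReal_inv, ← Complex.ofReal_mul, ← Complex.ofReal_mul,
        ← Real.rpow_neg_one Y, ← Real.rpow_add hY, ← Real.rpow_add hY]
      congr 2
      ring
    rw [e2]
    push_cast
    ring
  -- Laplace transform at `1`
  have hLap : ∫ Y : ℝ, (Real.exp (-Y) : ℂ) * stableTransform α χ f Y =
      ((Real.Gamma a : ℝ) : ℂ) * Complex.exp (-(χ * a * Complex.I)) := by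
    let Θ : ℝ × ℝ → ℂ := fun z => f z.1 * ((Real.exp (-z.2) : ℂ) * stableDensity α χ z.1 z.2)
    have hΘm : StronglyMeasurable Θ := by
      have m1 : Measurable fun z : ℝ × ℝ => (Real.exp (-z.2) : ℂ) := by fun_prop
      exact (hf.meas.stronglyMeasurable.comp_measurable measurable_fst).mul
        (m1.stronglyMeasurable.mul (stronglyMeasurable_stableDensity α χ))
    have hΘi : Integrable Θ (volume.prod volume) := by
      rw [integrable_prod_iff' hΘm.aestronglyMeasurable]
      have hpt : ∀ X Y, Θ (X, Y) = (Real.exp (-Y) : ℂ) * (f X * stableDensity α χ X Y) := by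
        intro X Y; simp only [Θ]; ring
      constructor
      · refine Eventually.of_forall fun Y => ?_
        simp only [hpt]
        rcases le_or_gt Y 0 with hY | hY
        · simp [stableDensity_of_nonpos hα hα1 hχ _ hY]
        · exact (hT hY).1.const_mul _
      · refine Integrable.mono' (g := (Ioi (0 : ℝ)).indicator fun Y =>
          transformConst α χ a * (Y ^ (a * α - 1) * Real.exp (-1 * Y ^ (1 : ℝ)))) ?_ ?_ ?_
        · rw [integrable_indicator_iff measurableSet_Ioi]
          refine (integrableOn_rpow_mul_exp_neg_mul_rpow ?_ one_pos one_pos).const_mul _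
          have : 0 < a * α := by positivity
          linarith
        · exact (hΘm.norm.comp_measurable measurable_swap).integral_prod_right'.aestronglyMeasurable
        · refine Eventually.of_forall fun Y => ?_
          rw [Real.norm_eq_abs, abs_of_nonneg (integral_nonneg fun _ => norm_nonneg _)]
          simp only [hpt, norm_mul (Real.exp (-Y) : ℂ), integral_const_mul]
          rcases le_or_gt Y 0 with hY | hY
          · rw [indicator_of_notMem (by simpa using hY)]
            simp [stableDensity_of_nonpos hα hα1 hχ _ hY]
          · rw [indicator_of_mem (mem_Ioi.2 hY), Complex.norm_real, Real.norm_eq_abs,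
              abs_of_pos (Real.exp_pos _)]
            calc _ ≤ Real.exp (-Y) * (1 * transformConst α χ a * Y ^ (a * α - 1)) := by
                  gcongr; exact (hT hY).2
              _ = _ := by rw [Real.rpow_one]; ring_nf
    have e1 : ∫ Y : ℝ, (Real.exp (-Y) : ℂ) * stableTransform α χ f Y
        = ∫ Y, ∫ X, Θ (X, Y) := by
      congr 1
      funext Y
      rw [stableTransform, ← integral_const_mul]
      congr 1
      funext X
      simp only [Θ]; ring
    rw [e1, ← integral_integral_swap (f := fun X Y => Θ (X, Y)) hΘi]
    have e2 : ∀ X, ∫ Y, Θ (X, Y) = (Ioi (0 : ℝ)).indicator (fun X : ℝ =>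
        (X : ℂ) ^ ((a : ℂ) - 1) * Complex.exp (-(Complex.exp (χ * Complex.I) * X))) X := by
      intro X
      simp only [Θ, integral_const_mul, integral_exp_neg_mul_stableDensity hα hα1 hχ]
      by_cases hX : X ∈ Ioi (0 : ℝ)
      · simp only [f, indicator_of_mem hX]
        have hX0 : 0 < X := hX
        rw [Complex.exp_add, ← Complex.ofReal_exp, Real.exp_log hX0,
          Complex.ofReal_cpow hX0.le, mul_comm (X : ℂ)]
        push_cast
        rfl
      · simp [f, indicator_of_notMem hX]
    simp only [e2]
    have hre : 0 < (Complex.exp (χ * Complex.I)).re := by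
      rw [Complex.exp_re]
      simp only [Complex.mul_re, Complex.ofReal_re, Complex.I_re, mul_zero, Complex.ofReal_im,
        Complex.I_im, mul_one, sub_self, Real.exp_zero, Complex.mul_im, add_zero, one_mul]
      have := Real.pi_pos
      have h0 : 0 < Real.pi * α / 2 := by positivity
      have := abs_lt.1 (show |χ| < Real.pi / 2 by linarith)
      exact Real.cos_pos_of_mem_Ioo ⟨by linarith, this.2⟩
    rw [integral_indicator measurableSet_Ioi,
      integral_cpow_mul_cexp_neg_mul_Ioi ha hre]
    rw [one_div, ← Complex.exp_neg, Complex.cpow_def_of_ne_zero (Complex.exp_ne_zero _),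
      Complex.log_exp, Complex.Gamma_ofReal, mul_comm]
    · congr 2; ring
    · have := Real.pi_pos
      have := abs_lt.1 (show |χ| < Real.pi / 2 by
        have h0 : 0 < Real.pi * α / 2 := by positivity
        linarith)
      simp; linarith
    · have := Real.pi_pos
      have := abs_lt.1 (show |χ| < Real.pi / 2 by
        have h0 : 0 < Real.pi * α / 2 := by positivity
        linarith)
      simp; linarith
  -- By homogeneity the same Laplace integral is `Γ(a α)` times the value at `Y = 1`; comparing the
  -- two evaluations determines that value.
  have hLap2 : ∫ Y : ℝ, (Real.exp (-Y) : ℂ) * stableTransform α χ f Y =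
      ((Real.Gamma (a * α) : ℝ) : ℂ) * stableTransform α χ f 1 := by
    have e1 : (fun Y : ℝ => (Real.exp (-Y) : ℂ) * stableTransform α χ f Y) =
        (Ioi (0 : ℝ)).indicator fun Y =>
          (((Real.exp (-Y) * Y ^ (a * α - 1)) : ℝ) : ℂ) * stableTransform α χ f 1 := by
      funext Y
      by_cases hY : Y ∈ Ioi (0 : ℝ)
      · rw [indicator_of_mem hY, hscale Y hY]; push_cast; ring
      · rw [indicator_of_notMem hY, stableTransform_of_nonpos hα hα1 hχ f (by simpa using hY),
          mul_zero]
    rw [e1, integral_indicator measurableSet_Ioi, integral_mul_const, integral_complex_ofReal,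
      ← Real.Gamma_eq_integral (by positivity)]
  have hG : ((Real.Gamma (a * α) : ℝ) : ℂ) ≠ 0 := by
    exact_mod_cast (Real.Gamma_pos_of_pos (by positivity)).ne'
  have h1 : stableTransform α χ f 1 = ((Real.Gamma a : ℝ) : ℂ) / ((Real.Gamma (a * α) : ℝ) : ℂ) *
      Complex.exp (-(χ * a * Complex.I)) := by
    rw [hLap] at hLap2
    rw [div_mul_eq_mul_div, hLap2, mul_div_cancel_left₀ _ hG]
  rw [hfi, hscale Y hY, h1]
  push_cast
  ring

end StableTransform
end

noncomputable section

open MeasureTheory Filter Topology Set Metric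
open scoped Interval

/-! ### Acceleration as a stable transform along rays. -/

section Acceleration

variable {k₁ k₂ : ℝ}

/-- The exponential order `κ`, `1 / κ = 1 / k₁ - 1 / k₂`. -/
def accelOrder (k₁ k₂ : ℝ) : ℝ := (k₁⁻¹ - k₂⁻¹)⁻¹

/-- The decay rate of the acceleration kernel for an angle `δ` between the rays. -/
def accelRate (k₁ k₂ δ : ℝ) : ℝ := kernelRate (k₁ / k₂) (k₁ * δ)

lemma inv_sub_inv_pos (h1 : 0 < k₁) (h2 : k₁ < k₂) : 0 < k₁⁻¹ - k₂⁻¹ :=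
  sub_pos.2 (inv_strictAnti₀ h1 h2)

lemma accelOrder_pos (h1 : 0 < k₁) (h2 : k₁ < k₂) : 0 < accelOrder k₁ k₂ :=
  inv_pos.2 (inv_sub_inv_pos h1 h2)

lemma ratio_pos (h1 : 0 < k₁) (h2 : k₁ < k₂) : 0 < k₁ / k₂ := div_pos h1 (h1.trans h2)

lemma ratio_lt_one (h1 : 0 < k₁) (h2 : k₁ < k₂) : k₁ / k₂ < 1 :=
  (div_lt_one (h1.trans h2)).2 h2

/-- Dictionary with the stable kernel at `α = k₁ / k₂`: growth of order `κ` in `|η|` is growth with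
exponent `1 / (1 - α)` in `X = |η| ^ k₁`. -/
lemma accelOrder_div_left (h1 : 0 < k₁) (h2 : k₁ < k₂) :
    accelOrder k₁ k₂ / k₁ = 1 / (1 - k₁ / k₂) := by
  have h3 := h1.trans h2
  have : k₂ - k₁ ≠ 0 := by linarith
  have h4 : 1 - k₁ / k₂ = (k₂ - k₁) / k₂ := by field_simp
  have h5 : k₁⁻¹ - k₂⁻¹ = (k₂ - k₁) / (k₁ * k₂) := by field_simp
  rw [accelOrder, h4, h5]
  field_simp

lemma accelOrder_div_right (h1 : 0 < k₁) (h2 : k₁ < k₂) :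
    accelOrder k₁ k₂ / k₂ = (k₁ / k₂) / (1 - k₁ / k₂) := by
  have h3 := h1.trans h2
  have : accelOrder k₁ k₂ / k₂ = accelOrder k₁ k₂ / k₁ * (k₁ / k₂) := by field_simp
  rw [this, accelOrder_div_left h1 h2]
  ring

lemma le_accelOrder (h1 : 0 < k₁) (h2 : k₁ < k₂) : k₁ ≤ accelOrder k₁ k₂ := by
  have h3 := inv_sub_inv_pos h1 h2
  rw [accelOrder, le_inv_comm₀ h1 h3]
  have : 0 < k₂⁻¹ := inv_pos.2 (h1.trans h2)
  linarith

/-- Multiplied by `k₁`, the angular condition `|δ| < π / (2κ)` becomes the aperture condition of the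
stable kernel at `α = k₁ / k₂`. -/
lemma gap_aperture (h1 : 0 < k₁) (h2 : k₁ < k₂) {δ : ℝ}
    (hδ : |δ| < Real.pi / 2 * (k₁⁻¹ - k₂⁻¹)) :
    |k₁ * δ| + Real.pi * (k₁ / k₂) / 2 < Real.pi / 2 := by
  have h3 := h1.trans h2
  rw [abs_mul, abs_of_pos h1]
  have : k₁ * (Real.pi / 2 * (k₁⁻¹ - k₂⁻¹)) = Real.pi / 2 - Real.pi * (k₁ / k₂) / 2 := by
    field_simp
  have h4 := mul_lt_mul_of_pos_left hδ h1
  linarith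

lemma accelRate_pos (h1 : 0 < k₁) (h2 : k₁ < k₂) {δ : ℝ}
    (hδ : |δ| < Real.pi / 2 * (k₁⁻¹ - k₂⁻¹)) : 0 < accelRate k₁ k₂ δ :=
  kernelRate_pos (ratio_pos h1 h2) (gap_aperture h1 h2 hδ)

lemma accelKernel_eq_lineInt (k₁ k₂ : ℝ) (w : ℂ) : accelKernel k₁ k₂ w =
    (2 * (Real.pi : ℂ))⁻¹ * lineInt (k₁ / k₂) 1 1 (Complex.exp (k₁ * w)) := by
  simp [accelKernel, lineInt]

lemma im_ofReal_mul (k : ℝ) (w : ℂ) : ((k : ℂ) * w).im = k * w.im := by simp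
lemma re_ofReal_mul (k : ℝ) (w : ℂ) : ((k : ℂ) * w).re = k * w.re := by simp

lemma norm_accelKernel_le (h1 : 0 < k₁) (h2 : k₁ < k₂) {w : ℂ}
    (hw : |w.im| < Real.pi / 2 * (k₁⁻¹ - k₂⁻¹)) :
    ‖accelKernel k₁ k₂ w‖ ≤ 4 / cosGap (k₁ / k₂) (k₁ * w.im) *
      Real.exp (-accelRate k₁ k₂ w.im * Real.exp (accelOrder k₁ k₂ * w.re)) := by
  have h := norm_lineInt_one_one_le (ratio_pos h1 h2) (ratio_lt_one h1 h2) (u := k₁ * w)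
    (by rw [im_ofReal_mul]; exact gap_aperture h1 h2 hw)
  have e : (k₁ * w.re) / (1 - k₁ / k₂) = accelOrder k₁ k₂ * w.re := by
    have := accelOrder_div_left h1 h2
    rw [div_eq_iff h1.ne'] at this
    rw [this]; ring
  rw [im_ofReal_mul, re_ofReal_mul, e] at h
  rw [accelKernel_eq_lineInt, norm_mul]
  calc _ ≤ 1 * _ := mul_le_mul norm_two_pi_inv_le h (norm_nonneg _) zero_le_one
    _ = _ := by rw [one_mul]; rfl

lemma cosGap_anti {α χ χ₀ : ℝ} (hα : 0 < α) (hχ₀ : |χ₀| + Real.pi * α / 2 < Real.pi / 2)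
    (h : |χ| ≤ |χ₀|) : cosGap α χ₀ ≤ cosGap α χ := by
  have := Real.pi_pos
  refine Real.cos_le_cos_of_nonneg_of_le_pi (by positivity) (by linarith) (by linarith)

lemma kernelRate_anti {α χ χ₀ : ℝ} (hα : 0 < α) (hα1 : α < 1)
    (hχ₀ : |χ₀| + Real.pi * α / 2 < Real.pi / 2)
    (h : |χ| ≤ |χ₀|) : kernelRate α χ₀ ≤ kernelRate α χ := by
  have h1 := cosGap_anti hα hχ₀ h
  have h2 := cosGap_pos hα hχ₀
  have : 0 < 1 - α := by linarith
  unfold kernelRate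
  gcongr

/-- `cosGap` and the decay rate decrease with the angle, so the value at the largest angle `d`
serves for a whole strip. -/
lemma norm_accelKernel_le_of_le (h1 : 0 < k₁) (h2 : k₁ < k₂) {w : ℂ} {d : ℝ}
    (hd : d < Real.pi / 2 * (k₁⁻¹ - k₂⁻¹)) (hw : |w.im| ≤ d) {t : ℝ} (ht : t ≤ w.re) :
    ‖accelKernel k₁ k₂ w‖ ≤ 4 / cosGap (k₁ / k₂) (k₁ * d) *
      Real.exp (-accelRate k₁ k₂ d * Real.exp (accelOrder k₁ k₂ * t)) := by
  have hd0 : 0 ≤ d := (abs_nonneg _).trans hw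
  have hd' : |d| < Real.pi / 2 * (k₁⁻¹ - k₂⁻¹) := by rwa [abs_of_nonneg hd0]
  have hα := ratio_pos h1 h2
  have hap := gap_aperture h1 h2 hd'
  have hle : |k₁ * w.im| ≤ |k₁ * d| := by
    rw [abs_mul, abs_mul, abs_of_nonneg hd0]; gcongr
  have hc := cosGap_anti hα hap hle
  have hcp := cosGap_pos hα hap
  have hr : accelRate k₁ k₂ d ≤ accelRate k₁ k₂ w.im :=
    kernelRate_anti hα (ratio_lt_one h1 h2) hap hle
  have hrp := accelRate_pos h1 h2 hd'
  have ho := accelOrder_pos h1 h2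
  refine (norm_accelKernel_le h1 h2 (hw.trans_lt hd)).trans ?_
  gcongr ?_ * Real.exp ?_
  · gcongr
  · rw [neg_mul, neg_mul, neg_le_neg_iff]
    gcongr
    exact hrp.le.trans hr

lemma isOpen_strip (d : ℝ) : IsOpen {w : ℂ | |w.im| < d} :=
  isOpen_lt (by fun_prop) continuous_const

lemma differentiableOn_accelKernel (h1 : 0 < k₁) (h2 : k₁ < k₂) :
    DifferentiableOn ℂ (accelKernel k₁ k₂) {w | |w.im| < Real.pi / 2 * (k₁⁻¹ - k₂⁻¹)} := by
  have hα := ratio_pos h1 h2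
  have : accelKernel k₁ k₂ = fun w => (2 * (Real.pi : ℂ))⁻¹ *
      lineInt (k₁ / k₂) 1 1 (Complex.exp (k₁ * w)) := funext fun w => accelKernel_eq_lineInt k₁ k₂ w
  rw [this]
  refine DifferentiableOn.const_mul ?_ _
  unfold lineInt
  refine differentiableOn_integral_of_holomorphic (fun w _ => ?_)
      (Eventually.of_forall fun y => by fun_prop) fun w hw => ?_
  · exact (continuous_lineInt_integrand one_pos _ _).aestronglyMeasurable
  · obtain ⟨d, hd1, hd2⟩ := exists_between (show |w.im| < Real.pi / 2 * (k₁⁻¹ - k₂⁻¹) from hw)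
    have hd0 : 0 ≤ d := (abs_nonneg _).trans hd1.le
    have hap := gap_aperture h1 h2 (δ := d) (by rwa [abs_of_nonneg hd0])
    have hcp := cosGap_pos hα hap
    set A := cosGap (k₁ / k₂) (k₁ * d) * Real.exp (k₁ * (w.re - 1)) / 2 with hA
    refine ⟨{z | |z.im| < d} ∩ {z | w.re - 1 < z.re}, inter_mem
      ((isOpen_strip d).mem_nhds hd1) ((isOpen_lt continuous_const Complex.continuous_re).mem_nhds
        (by simp)), fun z hz => hz.1.trans hd2,
        fun y => Real.exp 1 * Real.exp (-A * |y| ^ (k₁ / k₂)), ?_, ?_⟩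
    · exact (integrable_exp_neg_abs_rpow (by positivity) hα).const_mul _
    · refine Eventually.of_forall fun y z hz => ?_
      have hz1 : |z.im| < d := hz.1
      have hz2 : w.re - 1 < z.re := hz.2
      have hle : |k₁ * z.im| ≤ |k₁ * d| := by
        rw [abs_mul, abs_mul, abs_of_nonneg hd0]; gcongr
      have hc := cosGap_anti hα hap hle
      refine (norm_lineInt_integrand_le hα one_pos 1 y (u := k₁ * z) ?_).trans ?_
      · rw [im_ofReal_mul]; exact gap_aperture h1 h2 (hz1.trans hd2)
      rw [im_ofReal_mul, re_ofReal_mul, mul_one]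
      have hA' : A ≤ cosGap (k₁ / k₂) (k₁ * z.im) * Real.exp (k₁ * z.re) / 2 := by
        rw [hA]; gcongr
        exact hcp.le.trans hc
      have hA0 : 0 < A := by positivity
      have e1 : Real.exp (-(cosGap (k₁ / k₂) (k₁ * z.im) * Real.exp (k₁ * z.re) / 2) *
          (1 : ℝ) ^ (k₁ / k₂)) ≤ 1 := by
        rw [Real.exp_le_one_iff, Real.one_rpow]; linarith
      calc _ ≤ Real.exp 1 * (1 * Real.exp (-A * |y| ^ (k₁ / k₂))) := by
            gcongr
        _ = _ := by rw [one_mul]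

/-- The weight of grade `l` at level `k`: `X ^ (l/k - 1) / Γ(l/k) * exp (c X ^ (κ/k))` at
`X = exp (k s)`. It vanishes for `l = 0` since `Γ(0) = 0` by convention. -/
def expWeight (k κ c : ℝ) (l : ℕ) (s : ℝ) : ℝ :=
  Real.exp ((l - k) * s) / Real.Gamma (l / k) * Real.exp (c * Real.exp (κ * s))

lemma expWeight_zero (k κ c s : ℝ) : expWeight k κ c 0 s = 0 := by
  simp [expWeight, Real.Gamma_zero]

lemma expWeight_nonneg {k : ℝ} (hk : 0 < k) (κ c : ℝ) (l : ℕ) (s : ℝ) :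
    0 ≤ expWeight k κ c l s := by
  have : 0 ≤ Real.Gamma (l / k) := Real.Gamma_nonneg_of_nonneg (by positivity)
  unfold expWeight
  positivity

/-- `f` is continuous along the ray `arg = φ` and bounded by `B` times the weight of grade `l`. -/
structure RayBounded (k κ c : ℝ) (l : ℕ) (φ B : ℝ) (f : ℂ → ℂ) : Prop where
  cont : Continuous fun s : ℝ => f (s + φ * Complex.I)
  bound : ∀ s : ℝ, ‖f (s + φ * Complex.I)‖ ≤ B * expWeight k κ c l s

/-- The function of the variable `X = |ξ| ^ k` associated with a function on the ray `arg = φ`. -/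
def rayFun (k φ : ℝ) (f : ℂ → ℂ) : ℝ → ℂ :=
  (Ioi (0 : ℝ)).indicator fun X =>
    f (((Real.log X / k : ℝ) : ℂ) + φ * Complex.I) * Complex.exp (k * φ * Complex.I)

lemma rayFun_of_nonpos (k φ : ℝ) (f : ℂ → ℂ) {X : ℝ} (hX : X ≤ 0) : rayFun k φ f X = 0 :=
  indicator_of_notMem (by simpa using hX) _

lemma rayFun_of_pos (k φ : ℝ) (f : ℂ → ℂ) {X : ℝ} (hX : 0 < X) : rayFun k φ f X =
    f (((Real.log X / k : ℝ) : ℂ) + φ * Complex.I) * Complex.exp (k * φ * Complex.I) :=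
  indicator_of_mem (mem_Ioi.2 hX) _

lemma norm_phase (t φ : ℝ) : ‖Complex.exp (t * φ * Complex.I)‖ = 1 := by
  rw [← Complex.ofReal_mul, Complex.norm_exp_ofReal_mul_I]

lemma eq_of_rayFun_eq {k φ : ℝ} (hk : 0 < k) {f g : ℂ → ℂ} {s : ℝ}
    (h : rayFun k φ f (Real.exp (k * s)) = rayFun k φ g (Real.exp (k * s))) :
    f (s + φ * Complex.I) = g (s + φ * Complex.I) := by
  rw [rayFun_of_pos _ _ _ (Real.exp_pos _), rayFun_of_pos _ _ _ (Real.exp_pos _), Real.log_exp,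
    mul_div_cancel_left₀ _ hk.ne'] at h
  exact mul_right_cancel₀ (Complex.exp_ne_zero _) h

lemma expWeight_log {k : ℝ} (hk : 0 < k) (κ c : ℝ) (l : ℕ) {X : ℝ} (hX : 0 < X) :
    expWeight k κ c l (Real.log X / k) =
      (Real.Gamma (l / k))⁻¹ * (X ^ ((l : ℝ) / k - 1) * Real.exp (c * X ^ (κ / k))) := by
  rw [expWeight, Real.rpow_def_of_pos hX, Real.rpow_def_of_pos hX]
  have e1 : ((l : ℝ) - k) * (Real.log X / k) = Real.log X * ((l : ℝ) / k - 1) := by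
    field_simp
  have e2 : κ * (Real.log X / k) = Real.log X * (κ / k) := by ring
  rw [e1, e2]
  ring

lemma RayBounded.expBounded {k κ c φ B : ℝ} {l : ℕ} {f : ℂ → ℂ} (hk : 0 < k)
    (hf : RayBounded k κ c l φ B f) :
    ExpBounded (κ / k) c (l / k) (B * (Real.Gamma (l / k))⁻¹) (rayFun k φ f) := by
  refine ⟨?_, fun X hX => rayFun_of_nonpos _ _ _ hX, fun X hX => ?_⟩
  · refine Measurable.indicator ?_ measurableSet_Ioi
    refine Measurable.mul_const ?_ _
    exact hf.cont.measurable.comp (Real.measurable_log.div_const k)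
  · rw [rayFun_of_pos _ _ _ hX, norm_mul, norm_phase, mul_one]
    refine (hf.bound _).trans (le_of_eq ?_)
    rw [expWeight_log hk κ c l hX]
    ring

/-- The integrand of the acceleration integral. -/
def accelIntegrand (k₁ k₂ φ : ℝ) (f : ℂ → ℂ) (ζ : ℂ) (s : ℝ) : ℂ :=
  f ((s : ℂ) + (φ : ℂ) * Complex.I) * accelKernel k₁ k₂ ((s : ℂ) + (φ : ℂ) * Complex.I - ζ) *
      ((k₁ : ℂ) * Complex.exp ((k₁ : ℂ) * ((s : ℂ) + (φ : ℂ) * Complex.I)))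

lemma accel_eq (k₁ k₂ φ : ℝ) (f : ℂ → ℂ) (ζ : ℂ) : accel k₁ k₂ φ f ζ =
    Complex.exp (-(k₂ : ℂ) * ζ) * ∫ s : ℝ, accelIntegrand k₁ k₂ φ f ζ s := rfl

lemma stableDensity_eq_accelKernel (h1 : 0 < k₁) (h2 : k₁ < k₂) {φ ψ : ℝ}
    (hgap : |ψ - φ| < Real.pi / 2 * (k₁⁻¹ - k₂⁻¹)) (X : ℝ) {Y : ℝ} (hY : 0 < Y) :
    stableDensity (k₁ / k₂) (k₁ * (φ - ψ)) X Y = (Y : ℂ)⁻¹ * accelKernel k₁ k₂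
      (((Real.log X / k₁ : ℝ) : ℂ) + φ * Complex.I -
        (((Real.log Y / k₂ : ℝ) : ℂ) + ψ * Complex.I)) := by
  have h3 := h1.trans h2
  rw [stableDensity_scale (ratio_pos h1 h2) (ratio_lt_one h1 h2)
    (gap_aperture h1 h2 (by rwa [abs_sub_comm])) X hY, accelKernel_eq_lineInt]
  congr 4
  have hk1 : (k₁ : ℂ) ≠ 0 := by exact_mod_cast h1.ne'
  have hk2 : (k₂ : ℂ) ≠ 0 := by exact_mod_cast h3.ne'
  push_cast
  field_simp
  ring

lemma accelIntegrand_substitution (h1 : 0 < k₁) (h2 : k₁ < k₂) {φ ψ : ℝ}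
    (hgap : |ψ - φ| < Real.pi / 2 * (k₁⁻¹ - k₂⁻¹)) (f : ℂ → ℂ) {Y : ℝ} (hY : 0 < Y) (s : ℝ) :
    accelIntegrand k₁ k₂ φ f (((Real.log Y / k₂ : ℝ) : ℂ) + ψ * Complex.I) s =
      (k₁ * Real.exp (k₁ * s)) • ((Y : ℂ) * (rayFun k₁ φ f (Real.exp (k₁ * s)) *
        stableDensity (k₁ / k₂) (k₁ * (φ - ψ)) (Real.exp (k₁ * s)) Y)) := by
  have hY0 : (Y : ℂ) ≠ 0 := by exact_mod_cast hY.ne'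
  rw [stableDensity_eq_accelKernel h1 h2 hgap _ hY, rayFun_of_pos _ _ _ (Real.exp_pos _),
    Real.log_exp, mul_div_cancel_left₀ _ h1.ne', accelIntegrand, Complex.real_smul]
  have e : Complex.exp ((k₁ : ℂ) * ((s : ℂ) + (φ : ℂ) * Complex.I)) =
      ((Real.exp (k₁ * s) : ℝ) : ℂ) * Complex.exp (k₁ * φ * Complex.I) := by
    rw [Complex.ofReal_exp, ← Complex.exp_add]
    congr 1; push_cast; ring
  rw [e]
  push_cast
  field_simp

/-- The phase `exp (i k φ)` built into `rayFun` is that of `d(η ^ k)` along the ray. With it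
acceleration becomes exactly the transform with stable kernel in real variables, and only the
difference `φ - ψ` of the directions remains. -/
lemma rayFun_accel (h1 : 0 < k₁) (h2 : k₁ < k₂) {φ ψ : ℝ}
    (hgap : |ψ - φ| < Real.pi / 2 * (k₁⁻¹ - k₂⁻¹)) (f : ℂ → ℂ) (Y : ℝ) :
    rayFun k₂ ψ (accel k₁ k₂ φ f) Y =
      stableTransform (k₁ / k₂) (k₁ * (φ - ψ)) (rayFun k₁ φ f) Y := by
  rcases le_or_gt Y 0 with hY | hY
  · rw [rayFun_of_nonpos _ _ _ hY, stableTransform_of_nonpos (ratio_pos h1 h2)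
      (ratio_lt_one h1 h2) (gap_aperture h1 h2 (by rwa [abs_sub_comm])) _ hY]
  have h3 := h1.trans h2
  have hk2 : (k₂ : ℂ) ≠ 0 := by exact_mod_cast h3.ne'
  have hY0 : (Y : ℂ) ≠ 0 := by exact_mod_cast hY.ne'
  rw [rayFun_of_pos _ _ _ hY, accel_eq]
  simp only [accelIntegrand_substitution h1 h2 hgap f hY]
  rw [integral_exp_substitution h1 (fun X => (Y : ℂ) * (rayFun k₁ φ f X *
    stableDensity (k₁ / k₂) (k₁ * (φ - ψ)) X Y)), integral_const_mul]
  have e1 : ∫ X in Ioi (0 : ℝ), rayFun k₁ φ f X * stableDensity (k₁ / k₂) (k₁ * (φ - ψ)) X Y =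
      stableTransform (k₁ / k₂) (k₁ * (φ - ψ)) (rayFun k₁ φ f) Y := by
    rw [stableTransform, ← integral_indicator measurableSet_Ioi]
    congr 1
    funext X
    by_cases hX : X ∈ Ioi (0 : ℝ)
    · rw [indicator_of_mem hX]
    · rw [indicator_of_notMem hX, rayFun_of_nonpos _ _ _ (by simpa using hX), zero_mul]
  have e2 : Complex.exp (-(k₂ : ℂ) * (((Real.log Y / k₂ : ℝ) : ℂ) + ψ * Complex.I)) =
      (Y : ℂ)⁻¹ * Complex.exp (-(k₂ * ψ * Complex.I)) := by
    have : -(k₂ : ℂ) * (((Real.log Y / k₂ : ℝ) : ℂ) + ψ * Complex.I) =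
        ((-Real.log Y : ℝ) : ℂ) + -(k₂ * ψ * Complex.I) := by
      push_cast; field_simp; ring
    rw [this, Complex.exp_add, ← Complex.ofReal_exp, Real.exp_neg, Real.exp_log hY,
      Complex.ofReal_inv]
  rw [e1, e2, Complex.exp_neg]
  have := Complex.exp_ne_zero (k₂ * ψ * Complex.I)
  field_simp

/-- The smallness condition on `s = log |ξ|` under which acceleration integrals converge. -/
lemma smallness (h1 : 0 < k₁) (h2 : k₁ < k₂) {c s R : ℝ}
    (hs : 2 * c * Real.exp (accelOrder k₁ k₂ * s) ≤ R) :
    2 * c * Real.exp (k₂ * s) ^ ((k₁ / k₂) / (1 - k₁ / k₂)) ≤ R := by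
  rw [← accelOrder_div_right h1 h2, ← Real.exp_mul]
  have h3 := h1.trans h2
  have : k₂ * s * (accelOrder k₁ k₂ / k₂) = accelOrder k₁ k₂ * s := by field_simp
  rwa [this]

lemma accelRate_symm (k₁ k₂ φ ψ : ℝ) :
    accelRate k₁ k₂ (ψ - φ) = kernelRate (k₁ / k₂) (k₁ * (φ - ψ)) := by
  unfold accelRate kernelRate cosGap
  rw [abs_mul, abs_mul, abs_sub_comm]

lemma RayBounded.integrable_accel (h1 : 0 < k₁) (h2 : k₁ < k₂) {φ ψ c B : ℝ} {l : ℕ}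
    (hl : l ≠ 0) {f : ℂ → ℂ} (hf : RayBounded k₁ (accelOrder k₁ k₂) c l φ B f)
    (hgap : |ψ - φ| < Real.pi / 2 * (k₁⁻¹ - k₂⁻¹)) {s : ℝ}
    (hs : 2 * c * Real.exp (accelOrder k₁ k₂ * s) ≤ accelRate k₁ k₂ (ψ - φ)) :
    Integrable (accelIntegrand k₁ k₂ φ f (s + ψ * Complex.I)) ∧
    ‖accel k₁ k₂ φ f (s + ψ * Complex.I)‖ ≤ B * (Real.Gamma (l / k₁))⁻¹ *
      transformConst (k₁ / k₂) (k₁ * (φ - ψ)) (l / k₁) * Real.exp ((l - k₂) * s) := by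
  have h3 := h1.trans h2
  have hY : 0 < Real.exp (k₂ * s) := Real.exp_pos _
  have hb := hf.expBounded h1
  rw [accelOrder_div_left h1 h2] at hb
  have hl' : (0 : ℝ) < l / k₁ := div_pos (by exact_mod_cast Nat.pos_of_ne_zero hl) h1
  have hT := hb.transform (ratio_pos h1 h2) (ratio_lt_one h1 h2) (χ := k₁ * (φ - ψ))
    (gap_aperture h1 h2 (by rwa [abs_sub_comm])) hl' hY
    (by rw [accelRate_symm] at hs; exact smallness h1 h2 hs)
  have hζ : ((Real.log (Real.exp (k₂ * s)) / k₂ : ℝ) : ℂ) = s := by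
    rw [Real.log_exp, mul_div_cancel_left₀ _ h3.ne']
  constructor
  · have e : accelIntegrand k₁ k₂ φ f (s + ψ * Complex.I) = fun t =>
        (k₁ * Real.exp (k₁ * t)) • ((Real.exp (k₂ * s) : ℂ) * (rayFun k₁ φ f (Real.exp (k₁ * t)) *
        stableDensity (k₁ / k₂) (k₁ * (φ - ψ)) (Real.exp (k₁ * t)) (Real.exp (k₂ * s)))) := by
      funext t
      rw [← accelIntegrand_substitution h1 h2 hgap f hY t, hζ]
    rw [e, integrable_exp_substitution h1 (fun X => (Real.exp (k₂ * s) : ℂ) * (rayFun k₁ φ f X *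
      stableDensity (k₁ / k₂) (k₁ * (φ - ψ)) X (Real.exp (k₂ * s))))]
    exact (hT.1.const_mul _).integrableOn
  · have e := rayFun_accel h1 h2 hgap f (Real.exp (k₂ * s))
    rw [rayFun_of_pos _ _ _ hY, hζ] at e
    have e2 : ‖accel k₁ k₂ φ f (s + ψ * Complex.I)‖ =
        ‖stableTransform (k₁ / k₂) (k₁ * (φ - ψ)) (rayFun k₁ φ f) (Real.exp (k₂ * s))‖ := by
      rw [← e, norm_mul, norm_phase, mul_one]
    rw [e2]
    refine (norm_integral_le_integral_norm _).trans (hT.2.trans (le_of_eq ?_))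
    rw [← Real.exp_mul]
    congr 2
    field_simp

/-- The convolution product of level `k`, in the logarithmic coordinate. -/
def levelConv (k : ℝ) (f g : ℂ → ℂ) (ζ : ℂ) : ℂ :=
  Complex.exp (k * ζ) * ∫ τ in Ioo (0 : ℝ) 1,
    f (ζ + ((Real.log τ / k : ℝ) : ℂ)) * g (ζ + ((Real.log (1 - τ) / k : ℝ) : ℂ))

/-- By the substitution `X₁ = X τ`, in the variable `X = |ξ| ^ k` the convolution of level `k` is
ordinary convolution on the half-line; the two phases come from the two factors. -/
lemma rayFun_levelConv {k : ℝ} (hk : 0 < k) (φ : ℝ) (f g : ℂ → ℂ) (X : ℝ) :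
    rayFun k φ (levelConv k f g) X = ∫ X₁, rayFun k φ f X₁ * rayFun k φ g (X - X₁) := by
  have hk' : (k : ℂ) ≠ 0 := by exact_mod_cast hk.ne'
  rcases le_or_gt X 0 with hX | hX
  · rw [rayFun_of_nonpos _ _ _ hX]
    symm
    refine integral_eq_zero_of_ae (Eventually.of_forall fun X₁ => ?_)
    rcases le_or_gt X₁ 0 with h | h
    · simp [rayFun_of_nonpos k φ f h]
    · simp [rayFun_of_nonpos k φ g (show X - X₁ ≤ 0 by linarith)]
  have hsc := Measure.integral_comp_mul_left
    (fun X₁ : ℝ => rayFun k φ f X₁ * rayFun k φ g (X - X₁)) X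
  rw [abs_of_pos (inv_pos.2 hX), Complex.real_smul] at hsc
  have hX0 : (X : ℂ) ≠ 0 := by exact_mod_cast hX.ne'
  have e1 : ∫ X₁, rayFun k φ f X₁ * rayFun k φ g (X - X₁) = (X : ℂ) *
      ∫ τ, rayFun k φ f (X * τ) * rayFun k φ g (X - X * τ) := by
    rw [hsc, Complex.ofReal_inv, mul_inv_cancel_left₀ hX0]
  have e2 : (fun τ => rayFun k φ f (X * τ) * rayFun k φ g (X - X * τ)) =
      (Ioo (0 : ℝ) 1).indicator fun τ => Complex.exp (k * φ * Complex.I) *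
        Complex.exp (k * φ * Complex.I) *
        (f ((((Real.log X / k : ℝ) : ℂ) + φ * Complex.I) + ((Real.log τ / k : ℝ) : ℂ)) *
        g ((((Real.log X / k : ℝ) : ℂ) + φ * Complex.I) + ((Real.log (1 - τ) / k : ℝ) : ℂ))) := by
    funext τ
    by_cases hτ : τ ∈ Ioo (0 : ℝ) 1
    · have h0 : 0 < 1 - τ := by linarith [hτ.2]
      have h1 : X - X * τ = X * (1 - τ) := by ring
      rw [indicator_of_mem hτ, h1, rayFun_of_pos _ _ _ (mul_pos hX hτ.1),
        rayFun_of_pos _ _ _ (mul_pos hX h0), Real.log_mul hX.ne' hτ.1.ne',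
        Real.log_mul hX.ne' h0.ne']
      have e3 : ∀ t : ℝ, ((((Real.log X + t) / k : ℝ)) : ℂ) + φ * Complex.I =
          (((Real.log X / k : ℝ) : ℂ) + φ * Complex.I) + ((t / k : ℝ) : ℂ) := by
        intro t; push_cast; ring
      rw [e3, e3]
      ring
    · rw [indicator_of_notMem hτ]
      simp only [mem_Ioo, not_and_or, not_lt] at hτ
      rcases hτ with h | h
      · rw [rayFun_of_nonpos k φ f (mul_nonpos_of_nonneg_of_nonpos hX.le h), zero_mul]
      · rw [rayFun_of_nonpos k φ g (show X - X * τ ≤ 0 by nlinarith), mul_zero]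
  rw [e1, e2, integral_indicator measurableSet_Ioo, integral_const_mul, rayFun_of_pos _ _ _ hX,
    levelConv]
  have e4 : Complex.exp (k * (((Real.log X / k : ℝ) : ℂ) + φ * Complex.I)) =
      (X : ℂ) * Complex.exp (k * φ * Complex.I) := by
    have : (k : ℂ) * (((Real.log X / k : ℝ) : ℂ) + φ * Complex.I) =
        ((Real.log X : ℝ) : ℂ) + k * φ * Complex.I := by
      push_cast; field_simp
    rw [this, Complex.exp_add, ← Complex.ofReal_exp, Real.exp_log hX]
  rw [e4]
  ring

/-- Acceleration maps convolution products to convolution products. -/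
theorem accel_levelConv (h1 : 0 < k₁) (h2 : k₁ < k₂) {φ ψ c B B' : ℝ} {l l' : ℕ}
    (hl : l ≠ 0) (hl' : l' ≠ 0) (hc : 0 < c) {f g : ℂ → ℂ}
    (hf : RayBounded k₁ (accelOrder k₁ k₂) c l φ B f)
    (hg : RayBounded k₁ (accelOrder k₁ k₂) c l' φ B' g)
    (hgap : |ψ - φ| < Real.pi / 2 * (k₁⁻¹ - k₂⁻¹)) {s : ℝ}
    (hs : 2 * c * Real.exp (accelOrder k₁ k₂ * s) ≤ accelRate k₁ k₂ (ψ - φ)) :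
    accel k₁ k₂ φ (levelConv k₁ f g) (s + ψ * Complex.I) =
      levelConv k₂ (accel k₁ k₂ φ f) (accel k₁ k₂ φ g) (s + ψ * Complex.I) := by
  have h3 := h1.trans h2
  refine eq_of_rayFun_eq h3 ?_
  have hbf := hf.expBounded h1
  have hbg := hg.expBounded h1
  rw [accelOrder_div_left h1 h2] at hbf hbg
  rw [rayFun_accel h1 h2 hgap, rayFun_levelConv h3]
  have e : rayFun k₁ φ (levelConv k₁ f g) =
      fun X => ∫ X₁, rayFun k₁ φ f X₁ * rayFun k₁ φ g (X - X₁) :=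
    funext fun X => rayFun_levelConv h1 φ f g X
  rw [e, stableTransform_convolution (ratio_pos h1 h2) (ratio_lt_one h1 h2)
    (gap_aperture h1 h2 (by rwa [abs_sub_comm])) hc
    (div_pos (by exact_mod_cast Nat.pos_of_ne_zero hl) h1)
    (div_pos (by exact_mod_cast Nat.pos_of_ne_zero hl') h1) hbf hbg (Real.exp_pos _)
    (by rw [accelRate_symm] at hs; exact smallness h1 h2 hs)]
  simp only [rayFun_accel h1 h2 hgap]

/-- The Borel transform of level `k` of the series `t`. -/
def borelVar (k : ℝ) (ζ : ℂ) : ℂ :=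
  Complex.exp ((1 - (k : ℂ)) * ζ) / (Real.Gamma (1 / k) : ℂ)

lemma rayFun_borelVar {k : ℝ} (hk : 0 < k) (φ : ℝ) {X : ℝ} (hX : 0 < X) :
    rayFun k φ (borelVar k) X =
      ((X ^ (1 / k - 1) : ℝ) : ℂ) * Complex.exp (φ * Complex.I) / (Real.Gamma (1 / k) : ℂ) := by
  have hk' : (k : ℂ) ≠ 0 := by exact_mod_cast hk.ne'
  rw [rayFun_of_pos _ _ _ hX, borelVar, Real.rpow_def_of_pos hX, Complex.ofReal_exp,
    ← Complex.exp_add, div_mul_eq_mul_div, ← Complex.exp_add]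
  congr 2
  push_cast
  field_simp
  ring

/-- On a ray this is the transform of the power `X ^ (1 / k₁ - 1)`. Its Gamma quotient exchanges
`Γ(1 / k₁)` for `Γ(1 / k₂)`, and its phase turns the direction `φ` into `ψ`. -/
theorem accel_borelVar (h1 : 0 < k₁) (h2 : k₁ < k₂) {φ ψ : ℝ}
    (hgap : |ψ - φ| < Real.pi / 2 * (k₁⁻¹ - k₂⁻¹)) (s : ℝ) :
    accel k₁ k₂ φ (borelVar k₁) (s + ψ * Complex.I) = borelVar k₂ (s + ψ * Complex.I) := by
  have h3 := h1.trans h2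
  have hk1 : (k₁ : ℂ) ≠ 0 := by exact_mod_cast h1.ne'
  refine eq_of_rayFun_eq h3 ?_
  set Y := Real.exp (k₂ * s)
  have hY : 0 < Y := Real.exp_pos _
  have hap := gap_aperture h1 h2 (δ := φ - ψ) (by rwa [abs_sub_comm])
  rw [rayFun_accel h1 h2 hgap, rayFun_borelVar h3 ψ hY]
  have e1 : stableTransform (k₁ / k₂) (k₁ * (φ - ψ)) (rayFun k₁ φ (borelVar k₁)) Y =
      Complex.exp (φ * Complex.I) / (Real.Gamma (1 / k₁) : ℂ) *
      ∫ X in Ioi (0 : ℝ), ((X ^ (1 / k₁ - 1) : ℝ) : ℂ) *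
        stableDensity (k₁ / k₂) (k₁ * (φ - ψ)) X Y := by
    rw [stableTransform, ← integral_const_mul, ← integral_indicator measurableSet_Ioi]
    congr 1
    funext X
    by_cases hX : X ∈ Ioi (0 : ℝ)
    · rw [indicator_of_mem hX, rayFun_borelVar h1 φ hX]
      ring
    · rw [indicator_of_notMem hX, rayFun_of_nonpos _ _ _ (by simpa using hX), zero_mul]
  rw [e1, stableTransform_rpow (ratio_pos h1 h2) (ratio_lt_one h1 h2) hap (by positivity) hY]
  have e2 : 1 / k₁ * (k₁ / k₂) = 1 / k₂ := by field_simp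
  have e3 : -(((k₁ * (φ - ψ) : ℝ) : ℂ) * ((1 / k₁ : ℝ) : ℂ) * Complex.I) =
      ψ * Complex.I - φ * Complex.I := by
    push_cast; field_simp; ring
  rw [e2, e3, Complex.exp_sub]
  have g1 : (Real.Gamma (1 / k₁) : ℂ) ≠ 0 := by
    exact_mod_cast (Real.Gamma_pos_of_pos (by positivity)).ne'
  have g2 : (Real.Gamma (1 / k₂) : ℂ) ≠ 0 := by
    exact_mod_cast (Real.Gamma_pos_of_pos (by positivity)).ne'
  have := Complex.exp_ne_zero (φ * Complex.I)
  push_cast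
  field_simp

end Acceleration
end

noncomputable section

open MeasureTheory Filter Topology Set Metric
open scoped Interval

/-! ### Holomorphy of dominated integrals and series; sectors. -/

section DominatedFamilies

variable {E : Type*} [NormedAddCommGroup E] [NormedSpace ℂ E]

/-- A bound that is the product of a continuous factor in `y` and an integrable one in `t` is
locally dominated. -/
theorem differentiableOn_integral_of_norm_le_mul [FiniteDimensional ℂ E] {T : Type*}
    [MeasurableSpace T] {μ : Measure T} {U : Set E} (hU : IsOpen U) {G : E → T → ℂ}
    {Φ : E → ℝ} {b : T → ℝ} (hm : ∀ y ∈ U, AEStronglyMeasurable (G y) μ)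
    (hd : ∀ᵐ t ∂μ, DifferentiableOn ℂ (fun y => G y t) U) (hΦ : ContinuousOn Φ U)
    (hi : Integrable b μ) (hb0 : ∀ᵐ t ∂μ, 0 ≤ b t)
    (hb : ∀ᵐ t ∂μ, ∀ y ∈ U, ‖G y t‖ ≤ Φ y * b t) :
    DifferentiableOn ℂ (fun y => ∫ t, G y t ∂μ) U := by
  refine differentiableOn_integral_of_holomorphic hm hd fun x hx => ?_
  have h1 : ∀ᶠ y in 𝓝 x, Φ y < Φ x + 1 :=
    (hΦ.continuousAt (hU.mem_nhds hx)).eventually_lt_const (by linarith)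
  refine ⟨U ∩ {y | Φ y < Φ x + 1}, inter_mem (hU.mem_nhds hx) h1, inter_subset_left,
    fun t => (Φ x + 1) * b t, hi.const_mul _, ?_⟩
  filter_upwards [hb, hb0] with t ht ht0 y hy
  have h2 : Φ y < Φ x + 1 := hy.2
  exact (ht y hy.1).trans (by gcongr)

theorem differentiableOn_tsum_of_norm_le_mul {ι : Type*} {U : Set E} (hU : IsOpen U)
    {f : ι → E → ℂ} (hf : ∀ i, DifferentiableOn ℂ (f i) U) {Φ : E → ℝ} {u : ι → ℝ}
    (hΦ : ContinuousOn Φ U) (hu : Summable u) (hu0 : ∀ i, 0 ≤ u i)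
    (hb : ∀ i, ∀ y ∈ U, ‖f i y‖ ≤ Φ y * u i) :
    DifferentiableOn ℂ (fun y => ∑' i, f i y) U := by
  refine differentiableOn_tsum_of_locally_bounded hU hf fun x hx => ?_
  have h1 : ∀ᶠ y in 𝓝 x, Φ y < Φ x + 1 :=
    (hΦ.continuousAt (hU.mem_nhds hx)).eventually_lt_const (by linarith)
  refine ⟨U ∩ {y | Φ y < Φ x + 1}, inter_mem (hU.mem_nhds hx) h1,
    fun i => (Φ x + 1) * u i, hu.mul_left _, fun i y hy => ?_⟩
  have h2 : Φ y < Φ x + 1 := hy.2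
  have h3 := hu0 i
  exact (hb i y hy.1).trans (mul_le_mul_of_nonneg_right h2.le h3)

end DominatedFamilies

section Sector

lemma isOpen_logSector (θ ε : ℝ) : IsOpen (logSector θ ε) :=
  isOpen_lt (by fun_prop) continuous_const

lemma convex_logSector (θ ε : ℝ) : Convex ℝ (logSector θ ε) := by
  have : logSector θ ε = Complex.im ⁻¹' (ball θ ε) := by
    ext z; simp [logSector, Real.dist_eq]
  rw [this]
  exact (convex_ball θ ε).linear_preimage Complex.imLm

lemma add_ofReal_mem_logSector {θ ε : ℝ} {ζ : ℂ} (h : ζ ∈ logSector θ ε) (t : ℝ) :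
    ζ + t ∈ logSector θ ε := by
  simpa [logSector] using h

lemma ray_mem_logSector {θ ε φ : ℝ} (h : |φ - θ| < ε) (s : ℝ) :
    (s : ℂ) + φ * Complex.I ∈ logSector θ ε := by
  simpa [logSector] using h

end Sector

/-! ### Graded weights: convolution and the operation dividing the `n`-th coefficient by `n + 1`. -/

section Weights

variable {k κ c : ℝ}

lemma continuous_expWeight (k κ c : ℝ) (l : ℕ) : Continuous (expWeight k κ c l) := by
  unfold expWeight; fun_prop

/-- The Borel transform of level `k` of the monomial `t ^ n`. -/
def borelMono (k : ℝ) (n : ℕ) (ζ : ℂ) : ℂ :=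
  Complex.exp (((n : ℂ) - k) * ζ) / (Real.Gamma (n / k) : ℂ)

lemma borelMono_one (k : ℝ) : borelMono k 1 = borelVar k := by
  funext ζ; simp [borelMono, borelVar]

lemma borelMono_zero (k : ℝ) (ζ : ℂ) : borelMono k 0 ζ = 0 := by
  simp [borelMono, Real.Gamma_zero]

lemma differentiable_borelMono (k : ℝ) (n : ℕ) : Differentiable ℂ (borelMono k n) := by
  unfold borelMono; fun_prop

lemma norm_borelMono (hk : 0 < k) (κ : ℝ) (n : ℕ) (ζ : ℂ) :
    ‖borelMono k n ζ‖ = expWeight k κ 0 n ζ.re := by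
  have h0 : 0 ≤ Real.Gamma (n / k) := Real.Gamma_nonneg_of_nonneg (by positivity)
  rw [borelMono, norm_div, Complex.norm_exp, Complex.norm_real, Real.norm_of_nonneg h0, expWeight]
  simp

lemma expWeight_shift_le (hk : 0 < k) (hκ : 0 ≤ κ) (hc : 0 ≤ c) (l : ℕ) (s : ℝ) {σ : ℝ}
    (hσ : σ ≤ 0) :
    expWeight k κ c l (s + σ) ≤ Real.exp ((l - k) * σ) * expWeight k κ c l s := by
  have h0 : 0 ≤ Real.Gamma (l / k) := Real.Gamma_nonneg_of_nonneg (by positivity)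
  unfold expWeight
  rw [mul_add, Real.exp_add]
  calc Real.exp ((l - k) * s) * Real.exp ((l - k) * σ) / Real.Gamma (l / k) *
        Real.exp (c * Real.exp (κ * (s + σ))) ≤
        Real.exp ((l - k) * s) * Real.exp ((l - k) * σ) / Real.Gamma (l / k) *
        Real.exp (c * Real.exp (κ * s)) := by
        gcongr; linarith
    _ = _ := by ring

lemma exp_mul_log_div (hk : 0 < k) (a s : ℝ) {τ : ℝ} (hτ : 0 < τ) :
    Real.exp (a * (s + Real.log τ / k)) = Real.exp (a * s) * τ ^ (a / k) := by
  rw [Real.rpow_def_of_pos hτ, ← Real.exp_add]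
  congr 1; field_simp

/-- Since `κ / k ≥ 1`, one has `τ ^ (κ / k) + (1 - τ) ^ (κ / k) ≤ 1`, so the two exponential factors
multiply to at most the one at full radius. This is the use of `k ≤ κ`. -/
lemma expWeight_mul_le (hk : 0 < k) (hκ : k ≤ κ) (hc : 0 ≤ c) (l l' : ℕ) (s : ℝ) {τ : ℝ}
    (hτ : τ ∈ Ioo (0 : ℝ) 1) :
    expWeight k κ c l (s + Real.log τ / k) * expWeight k κ c l' (s + Real.log (1 - τ) / k) ≤
      Real.exp ((l - k) * s) * Real.exp ((l' - k) * s) * Real.exp (c * Real.exp (κ * s)) /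
        (Real.Gamma (l / k) * Real.Gamma (l' / k)) *
        (τ ^ ((l : ℝ) / k - 1) * (1 - τ) ^ ((l' : ℝ) / k - 1)) := by
  have h0 : 0 ≤ Real.Gamma (l / k) := Real.Gamma_nonneg_of_nonneg (by positivity)
  have h0' : 0 ≤ Real.Gamma (l' / k) := Real.Gamma_nonneg_of_nonneg (by positivity)
  have hτ0 := hτ.1
  have hτ1 : 0 < 1 - τ := by linarith [hτ.2]
  have hb : 1 ≤ κ / k := (one_le_div hk).2 hκ
  have e1 : ∀ l : ℕ, ((l : ℝ) - k) / k = l / k - 1 := fun l => by field_simp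
  unfold expWeight
  rw [exp_mul_log_div hk _ _ hτ0, exp_mul_log_div hk _ _ hτ1, exp_mul_log_div hk _ _ hτ0,
    exp_mul_log_div hk _ _ hτ1, e1, e1]
  have p1 : τ ^ (κ / k) ≤ τ := by
    simpa using Real.rpow_le_rpow_of_exponent_ge hτ0 hτ.2.le hb
  have p2 : (1 - τ) ^ (κ / k) ≤ 1 - τ := by
    simpa using Real.rpow_le_rpow_of_exponent_ge hτ1 (by linarith) hb
  have p3 : Real.exp (c * (Real.exp (κ * s) * τ ^ (κ / k))) *
      Real.exp (c * (Real.exp (κ * s) * (1 - τ) ^ (κ / k))) ≤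
      Real.exp (c * Real.exp (κ * s)) := by
    rw [← Real.exp_add, Real.exp_le_exp, ← mul_add, ← mul_add]
    have : Real.exp (κ * s) * (τ ^ (κ / k) + (1 - τ) ^ (κ / k)) ≤ Real.exp (κ * s) * 1 := by
      gcongr; linarith
    rw [mul_one] at this
    gcongr
  have q1 := Real.rpow_nonneg hτ0.le ((l : ℝ) / k - 1)
  have q2 := Real.rpow_nonneg hτ1.le ((l' : ℝ) / k - 1)
  calc _ = Real.exp ((l - k) * s) * Real.exp ((l' - k) * s) /
        (Real.Gamma (l / k) * Real.Gamma (l' / k)) *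
        (τ ^ ((l : ℝ) / k - 1) * (1 - τ) ^ ((l' : ℝ) / k - 1)) *
        (Real.exp (c * (Real.exp (κ * s) * τ ^ (κ / k))) *
      Real.exp (c * (Real.exp (κ * s) * (1 - τ) ^ (κ / k)))) := by ring
    _ ≤ Real.exp ((l - k) * s) * Real.exp ((l' - k) * s) /
        (Real.Gamma (l / k) * Real.Gamma (l' / k)) *
        (τ ^ ((l : ℝ) / k - 1) * (1 - τ) ^ ((l' : ℝ) / k - 1)) *
        Real.exp (c * Real.exp (κ * s)) := by gcongr
    _ = _ := by ring

lemma beta_unit (hk : 0 < k) {l l' : ℕ} (hl : l ≠ 0) (hl' : l' ≠ 0) :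
    IntegrableOn (fun τ : ℝ => τ ^ ((l : ℝ) / k - 1) * (1 - τ) ^ ((l' : ℝ) / k - 1)) (Ioo 0 1) ∧
    ∫ τ in Ioo (0 : ℝ) 1, τ ^ ((l : ℝ) / k - 1) * (1 - τ) ^ ((l' : ℝ) / k - 1) =
      Real.Gamma (l / k) * Real.Gamma (l' / k) / Real.Gamma (((l + l' : ℕ) : ℝ) / k) := by
  have := hasBetaIntegral (p := l / k) (q := l' / k)
    (div_pos (by exact_mod_cast Nat.pos_of_ne_zero hl) hk)
    (div_pos (by exact_mod_cast Nat.pos_of_ne_zero hl') hk) one_pos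
  refine ⟨this.1, this.2.trans ?_⟩
  rw [Real.one_rpow, one_mul, Nat.cast_add, add_div]

/-- The Beta integral yields exactly the required quotient of Gamma values: weights are
submultiplicative for convolution with constant `1`, so no constant accumulates in repeated
products. -/
lemma expWeight_conv (hk : 0 < k) (hκ : k ≤ κ) (hc : 0 ≤ c) {l l' : ℕ} (hl : l ≠ 0)
    (hl' : l' ≠ 0) (s : ℝ) :
    IntegrableOn (fun τ : ℝ => expWeight k κ c l (s + Real.log τ / k) *
      expWeight k κ c l' (s + Real.log (1 - τ) / k)) (Ioo 0 1) ∧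
    Real.exp (k * s) * ∫ τ in Ioo (0 : ℝ) 1, expWeight k κ c l (s + Real.log τ / k) *
      expWeight k κ c l' (s + Real.log (1 - τ) / k) ≤ expWeight k κ c (l + l') s := by
  obtain ⟨hi, hv⟩ := beta_unit hk hl hl'
  have g1 : 0 < Real.Gamma (l / k) := Real.Gamma_pos_of_pos
    (div_pos (by exact_mod_cast Nat.pos_of_ne_zero hl) hk)
  have g2 : 0 < Real.Gamma (l' / k) := Real.Gamma_pos_of_pos
    (div_pos (by exact_mod_cast Nat.pos_of_ne_zero hl') hk)
  set C := Real.exp ((l - k) * s) * Real.exp ((l' - k) * s) * Real.exp (c * Real.exp (κ * s)) /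
        (Real.Gamma (l / k) * Real.Gamma (l' / k)) with hC
  have hle : ∀ τ ∈ Ioo (0 : ℝ) 1, expWeight k κ c l (s + Real.log τ / k) *
      expWeight k κ c l' (s + Real.log (1 - τ) / k) ≤
      C * (τ ^ ((l : ℝ) / k - 1) * (1 - τ) ^ ((l' : ℝ) / k - 1)) :=
    fun τ hτ => expWeight_mul_le hk hκ hc l l' s hτ
  have hint : IntegrableOn (fun τ : ℝ => expWeight k κ c l (s + Real.log τ / k) *
      expWeight k κ c l' (s + Real.log (1 - τ) / k)) (Ioo 0 1) := by
    refine Integrable.mono' (hi.const_mul C) ?_ ?_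
    · refine Measurable.aestronglyMeasurable ?_
      have h1 := (continuous_expWeight k κ c l).measurable
      have h2 := (continuous_expWeight k κ c l').measurable
      exact (h1.comp (by fun_prop)).mul (h2.comp (by fun_prop))
    · refine ae_restrict_of_forall_mem measurableSet_Ioo fun τ hτ => ?_
      rw [Real.norm_of_nonneg (mul_nonneg (expWeight_nonneg hk _ _ _ _)
        (expWeight_nonneg hk _ _ _ _))]
      exact hle τ hτ
  refine ⟨hint, ?_⟩
  calc _ ≤ Real.exp (k * s) * ∫ τ in Ioo (0 : ℝ) 1,
        C * (τ ^ ((l : ℝ) / k - 1) * (1 - τ) ^ ((l' : ℝ) / k - 1)) := by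
        exact mul_le_mul_of_nonneg_left (setIntegral_mono_on hint (hi.const_mul C)
          measurableSet_Ioo hle) (Real.exp_pos _).le
    _ = expWeight k κ c (l + l') s := by
        rw [integral_const_mul, hv, hC, expWeight]
        have e : Real.exp ((((l + l' : ℕ) : ℝ) - k) * s) = Real.exp (k * s) *
            (Real.exp ((l - k) * s) * Real.exp ((l' - k) * s)) := by
          rw [← Real.exp_add, ← Real.exp_add]
          congr 1; push_cast; ring
        rw [e]
        field_simp

lemma norm_levelConv_le (hk : 0 < k) (hκ : k ≤ κ) (hc : 0 ≤ c) {l l' : ℕ} (hl : l ≠ 0)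
    (hl' : l' ≠ 0) {f g : ℂ → ℂ} {ζ : ℂ} {B B' : ℝ} (hB : 0 ≤ B)
    (hf : ∀ t : ℝ, ‖f (ζ + t)‖ ≤ B * expWeight k κ c l (ζ.re + t))
    (hg : ∀ t : ℝ, ‖g (ζ + t)‖ ≤ B' * expWeight k κ c l' (ζ.re + t)) :
    ‖levelConv k f g ζ‖ ≤ B * B' * expWeight k κ c (l + l') ζ.re := by
  obtain ⟨h1, h2⟩ := expWeight_conv hk hκ hc hl hl' ζ.re
  have hB' : 0 ≤ B' := by
    have := (norm_nonneg _).trans (hg 0)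
    by_contra hneg
    have hw : 0 < expWeight k κ c l' (ζ.re + (0 : ℝ)) := by
      have g2 : 0 < Real.Gamma (l' / k) := Real.Gamma_pos_of_pos
        (div_pos (by exact_mod_cast Nat.pos_of_ne_zero hl') hk)
      unfold expWeight; positivity
    nlinarith
  rw [levelConv, norm_mul, Complex.norm_exp, im_ofReal_mul k ζ |> fun _ => re_ofReal_mul k ζ]
  calc _ ≤ Real.exp (k * ζ.re) * ∫ τ in Ioo (0 : ℝ) 1, B * B' *
        (expWeight k κ c l (ζ.re + Real.log τ / k) *
          expWeight k κ c l' (ζ.re + Real.log (1 - τ) / k)) := by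
        gcongr
        refine norm_integral_le_of_norm_le (h1.const_mul _) (Eventually.of_forall fun τ => ?_)
        rw [norm_mul]
        calc _ ≤ (B * expWeight k κ c l (ζ.re + Real.log τ / k)) *
            (B' * expWeight k κ c l' (ζ.re + Real.log (1 - τ) / k)) :=
              mul_le_mul (hf _) (hg _) (norm_nonneg _) ((norm_nonneg _).trans (hf _))
          _ = _ := by ring
    _ = B * B' * (Real.exp (k * ζ.re) * ∫ τ in Ioo (0 : ℝ) 1,
        (expWeight k κ c l (ζ.re + Real.log τ / k) *
          expWeight k κ c l' (ζ.re + Real.log (1 - τ) / k))) := by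
        rw [integral_const_mul]; ring
    _ ≤ _ := by gcongr

lemma levelConv_borelMono (hk : 0 < k) {i j : ℕ} (hi : i ≠ 0) (hj : j ≠ 0) (ζ : ℂ) :
    levelConv k (borelMono k i) (borelMono k j) ζ = borelMono k (i + j) ζ := by
  obtain ⟨_, hv⟩ := beta_unit hk hi hj
  have hk' : (k : ℂ) ≠ 0 := by exact_mod_cast hk.ne'
  have g1 : 0 < Real.Gamma (i / k) := Real.Gamma_pos_of_pos
    (div_pos (by exact_mod_cast Nat.pos_of_ne_zero hi) hk)
  have g2 : 0 < Real.Gamma (j / k) := Real.Gamma_pos_of_pos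
    (div_pos (by exact_mod_cast Nat.pos_of_ne_zero hj) hk)
  have g1' : (Real.Gamma (i / k) : ℂ) ≠ 0 := by exact_mod_cast g1.ne'
  have g2' : (Real.Gamma (j / k) : ℂ) ≠ 0 := by exact_mod_cast g2.ne'
  have e1 : ∀ (n : ℕ) (τ : ℝ), 0 < τ → Complex.exp (((n : ℂ) - k) * (ζ + ((Real.log τ / k : ℝ) : ℂ)))
      = Complex.exp (((n : ℂ) - k) * ζ) * ((τ ^ ((n : ℝ) / k - 1) : ℝ) : ℂ) := by
    intro n τ hτ
    rw [Real.rpow_def_of_pos hτ, Complex.ofReal_exp, ← Complex.exp_add]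
    congr 1; push_cast; field_simp
  have e2 : ∫ τ in Ioo (0 : ℝ) 1, borelMono k i (ζ + ((Real.log τ / k : ℝ) : ℂ)) *
      borelMono k j (ζ + ((Real.log (1 - τ) / k : ℝ) : ℂ)) =
      ∫ τ in Ioo (0 : ℝ) 1, (Complex.exp (((i : ℂ) - k) * ζ) * Complex.exp (((j : ℂ) - k) * ζ) /
        ((Real.Gamma (i / k) : ℂ) * (Real.Gamma (j / k) : ℂ))) *
        ((τ ^ ((i : ℝ) / k - 1) * (1 - τ) ^ ((j : ℝ) / k - 1) : ℝ) : ℂ) := by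
    refine setIntegral_congr_fun measurableSet_Ioo fun τ hτ => ?_
    have hτ1 : 0 < 1 - τ := by linarith [hτ.2]
    simp only [borelMono]
    rw [e1 i τ hτ.1, e1 j (1 - τ) hτ1]
    push_cast
    ring
  rw [levelConv, e2, integral_const_mul, integral_complex_ofReal, hv, borelMono]
  have e : Complex.exp ((((i + j : ℕ) : ℂ) - k) * ζ) = Complex.exp (k * ζ) *
      (Complex.exp (((i : ℂ) - k) * ζ) * Complex.exp (((j : ℂ) - k) * ζ)) := by
    rw [← Complex.exp_add, ← Complex.exp_add]
    congr 1; push_cast; ring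
  rw [e]
  push_cast
  field_simp

/-- The Borel transform of level `k` of `∑ a_n t ^ n / (n + 1)`, in terms of that of
`∑ a_n t ^ n`. -/
def levelDil (k : ℝ) (f : ℂ → ℂ) (ζ : ℂ) : ℂ :=
  ∫ σ in Iic (0 : ℝ), Complex.exp ((k + 1) * σ) * f (ζ + σ)

lemma integral_exp_grade (l : ℕ) : IntegrableOn (fun σ : ℝ => Real.exp ((l + 1) * σ)) (Iic 0) ∧
    ∫ σ in Iic (0 : ℝ), Real.exp ((l + 1) * σ) = 1 / (l + 1) := by
  have h : (0 : ℝ) < l + 1 := by positivity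
  refine ⟨integrableOn_exp_mul_Iic h 0, ?_⟩
  rw [integral_exp_mul_Iic h 0]; simp

lemma norm_dil_integrand_le (hk : 0 < k) (hκ : 0 ≤ κ) (hc : 0 ≤ c) {l : ℕ} {f : ℂ → ℂ} {ζ : ℂ}
    {B : ℝ} (hB : 0 ≤ B) (hf : ∀ t : ℝ, ‖f (ζ + t)‖ ≤ B * expWeight k κ c l (ζ.re + t))
    {σ : ℝ} (hσ : σ ≤ 0) : ‖Complex.exp ((k + 1) * σ) * f (ζ + σ)‖ ≤
      B * expWeight k κ c l ζ.re * Real.exp ((l + 1) * σ) := by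
  have e : ((k : ℂ) + 1) * σ = (((k + 1) * σ : ℝ) : ℂ) := by push_cast; ring
  rw [norm_mul, e, Complex.norm_exp_ofReal]
  calc _ ≤ Real.exp ((k + 1) * σ) * (B * (Real.exp ((l - k) * σ) * expWeight k κ c l ζ.re)) := by
        gcongr
        exact (hf σ).trans (by gcongr; exact expWeight_shift_le hk hκ hc l _ hσ)
    _ = B * expWeight k κ c l ζ.re * (Real.exp ((k + 1) * σ) * Real.exp ((l - k) * σ)) := by ring
    _ = _ := by
        rw [← Real.exp_add]; congr 2; ring

/-- A weight of grade `l` contributes `exp ((l - k) σ)`; against `exp ((k + 1) σ)` there remains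
`exp ((l + 1) σ)`, of integral `1 / (l + 1)`. This gain later pays for the derivative in `x`. -/
lemma norm_levelDil_le (hk : 0 < k) (hκ : 0 ≤ κ) (hc : 0 ≤ c) {l : ℕ} {f : ℂ → ℂ} {ζ : ℂ}
    {B : ℝ} (hB : 0 ≤ B) (hf : ∀ t : ℝ, ‖f (ζ + t)‖ ≤ B * expWeight k κ c l (ζ.re + t)) :
    ‖levelDil k f ζ‖ ≤ B / (l + 1) * expWeight k κ c l ζ.re := by
  obtain ⟨h1, h2⟩ := integral_exp_grade l
  refine (norm_integral_le_of_norm_le (h1.const_mul _) (ae_restrict_of_forall_mem measurableSet_Iic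
    fun σ hσ => norm_dil_integrand_le hk hκ hc hB hf hσ)).trans ?_
  rw [integral_const_mul, h2]
  exact le_of_eq (by ring)

lemma levelDil_borelMono (k : ℝ) (n : ℕ) (ζ : ℂ) :
    levelDil k (borelMono k n) ζ = borelMono k n ζ / (n + 1) := by
  have e : ∀ σ : ℝ, Complex.exp ((k + 1) * σ) * borelMono k n (ζ + σ) =
      borelMono k n ζ * Complex.exp ((n + 1) * σ) := by
    intro σ
    have : Complex.exp ((k + 1) * σ) * Complex.exp (((n : ℂ) - k) * (ζ + σ)) =
        Complex.exp (((n : ℂ) - k) * ζ) * Complex.exp ((n + 1) * σ) := by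
      rw [← Complex.exp_add, ← Complex.exp_add]; congr 1; ring
    simp only [borelMono]
    rw [← mul_div_assoc, this]; ring
  have h : 0 < ((n : ℂ) + 1).re := by simp; positivity
  have := integral_exp_mul_complex_Iic h 0
  simp only [levelDil, e]
  rw [integral_const_mul, this]
  simp [div_eq_mul_inv]

variable {E : Type*} [NormedAddCommGroup E] [NormedSpace ℂ E]

lemma differentiableOn_section {θ ε : ℝ} {Ω : Set E} {f : ℂ × E → ℂ}
    (hf : DifferentiableOn ℂ f (logSector θ ε ×ˢ Ω)) {Y : E} (hY : Y ∈ Ω) :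
    DifferentiableOn ℂ (fun ζ => f (ζ, Y)) (logSector θ ε) :=
  hf.comp (by fun_prop) fun _ hζ => ⟨hζ, hY⟩

lemma continuous_ray {θ ε : ℝ} {f : ℂ → ℂ} (hf : ContinuousOn f (logSector θ ε)) {ζ : ℂ}
    (hζ : ζ ∈ logSector θ ε) : Continuous fun t : ℝ => f (ζ + t) :=
  hf.comp_continuous (by fun_prop) fun t => add_ofReal_mem_logSector hζ t

lemma differentiableOn_levelDil [FiniteDimensional ℂ E] (hk : 0 < k) (hκ : 0 ≤ κ) (hc : 0 ≤ c) {l : ℕ} {θ ε : ℝ}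
    {Ω : Set E} (hΩ : IsOpen Ω) {f : ℂ × E → ℂ}
    (hf : DifferentiableOn ℂ f (logSector θ ε ×ˢ Ω)) {B : E → ℝ} (hB : ContinuousOn B Ω)
    (hB0 : ∀ Y ∈ Ω, 0 ≤ B Y)
    (hfB : ∀ ζ ∈ logSector θ ε, ∀ Y ∈ Ω, ‖f (ζ, Y)‖ ≤ B Y * expWeight k κ c l ζ.re) :
    DifferentiableOn ℂ (fun p : ℂ × E => levelDil k (fun ζ => f (ζ, p.2)) p.1)
      (logSector θ ε ×ˢ Ω) := by
  obtain ⟨h1, h2⟩ := integral_exp_grade l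
  refine differentiableOn_integral_of_norm_le_mul ((isOpen_logSector θ ε).prod hΩ)
    (Φ := fun p => B p.2 * expWeight k κ c l p.1.re) (b := fun σ => Real.exp ((l + 1) * σ))
    (fun p hp => ?_) (Eventually.of_forall fun σ => ?_) ?_ h1
    (Eventually.of_forall fun σ => (Real.exp_pos _).le)
    (ae_restrict_of_forall_mem measurableSet_Iic fun σ hσ p hp => ?_)
  · have := continuous_ray (differentiableOn_section hf hp.2).continuousOn hp.1
    exact (Continuous.mul (by fun_prop) this).aestronglyMeasurable
  · refine DifferentiableOn.mul (by fun_prop) ?_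
    exact hf.comp (f := fun p : ℂ × E => (p.1 + (σ : ℂ), p.2)) (by fun_prop)
      fun p hp => ⟨add_ofReal_mem_logSector hp.1 σ, hp.2⟩
  · refine (hB.comp continuousOn_snd fun p hp => hp.2).mul (Continuous.continuousOn ?_)
    exact (continuous_expWeight k κ c l).comp (by fun_prop)
  · refine norm_dil_integrand_le (f := fun ζ => f (ζ, p.2)) hk hκ hc (hB0 _ hp.2) (fun t => ?_) hσ
    have := hfB (p.1 + t) (add_ofReal_mem_logSector hp.1 t) _ hp.2
    simpa using this

lemma differentiableOn_levelConv [FiniteDimensional ℂ E] (hk : 0 < k) (hκ : k ≤ κ) (hc : 0 ≤ c) {l l' : ℕ} (hl : l ≠ 0)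
    (hl' : l' ≠ 0) {θ ε : ℝ}
    {Ω : Set E} (hΩ : IsOpen Ω) {f g : ℂ × E → ℂ}
    (hf : DifferentiableOn ℂ f (logSector θ ε ×ˢ Ω))
    (hg : DifferentiableOn ℂ g (logSector θ ε ×ˢ Ω)) {B B' : E → ℝ} (hB : ContinuousOn B Ω)
    (hB' : ContinuousOn B' Ω) (hB0 : ∀ Y ∈ Ω, 0 ≤ B Y) (hB0' : ∀ Y ∈ Ω, 0 ≤ B' Y)
    (hfB : ∀ ζ ∈ logSector θ ε, ∀ Y ∈ Ω, ‖f (ζ, Y)‖ ≤ B Y * expWeight k κ c l ζ.re)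
    (hgB : ∀ ζ ∈ logSector θ ε, ∀ Y ∈ Ω, ‖g (ζ, Y)‖ ≤ B' Y * expWeight k κ c l' ζ.re) :
    DifferentiableOn ℂ (fun p : ℂ × E => levelConv k (fun ζ => f (ζ, p.2))
      (fun ζ => g (ζ, p.2)) p.1) (logSector θ ε ×ˢ Ω) := by
  obtain ⟨h1, h2⟩ := beta_unit hk hl hl'
  refine DifferentiableOn.mul (by fun_prop) ?_
  refine differentiableOn_integral_of_norm_le_mul ((isOpen_logSector θ ε).prod hΩ)
    (Φ := fun p => B p.2 * B' p.2 * (Real.exp ((l - k) * p.1.re) * Real.exp ((l' - k) * p.1.re) *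
      Real.exp (c * Real.exp (κ * p.1.re)) / (Real.Gamma (l / k) * Real.Gamma (l' / k))))
    (fun p hp => ?_) (Eventually.of_forall fun τ => ?_) ?_ h1
    (ae_restrict_of_forall_mem measurableSet_Ioo fun τ hτ => ?_)
    (ae_restrict_of_forall_mem measurableSet_Ioo fun τ hτ p hp => ?_)
  · have c1 := continuous_ray (differentiableOn_section hf hp.2).continuousOn hp.1
    have c2 := continuous_ray (differentiableOn_section hg hp.2).continuousOn hp.1
    refine Measurable.aestronglyMeasurable ?_
    exact (c1.measurable.comp (Real.measurable_log.div_const k)).mul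
      (c2.measurable.comp ((Real.measurable_log.comp (measurable_const.sub measurable_id)).div_const
        k))
  · refine DifferentiableOn.mul ?_ ?_
    · exact hf.comp (f := fun p : ℂ × E => (p.1 + ((Real.log τ / k : ℝ) : ℂ), p.2)) (by fun_prop)
        fun p hp => ⟨add_ofReal_mem_logSector hp.1 _, hp.2⟩
    · exact hg.comp (f := fun p : ℂ × E => (p.1 + ((Real.log (1 - τ) / k : ℝ) : ℂ), p.2))
        (by fun_prop) fun p hp => ⟨add_ofReal_mem_logSector hp.1 _, hp.2⟩
  · refine ((hB.comp continuousOn_snd fun p hp => hp.2).mul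
      (hB'.comp continuousOn_snd fun p hp => hp.2)).mul (Continuous.continuousOn ?_)
    fun_prop
  · exact mul_nonneg (Real.rpow_nonneg hτ.1.le _) (Real.rpow_nonneg (by linarith [hτ.2]) _)
  · have b1 := hfB (p.1 + ((Real.log τ / k : ℝ) : ℂ)) (add_ofReal_mem_logSector hp.1 _) _ hp.2
    have b2 := hgB (p.1 + ((Real.log (1 - τ) / k : ℝ) : ℂ)) (add_ofReal_mem_logSector hp.1 _) _ hp.2
    rw [Complex.add_re, Complex.ofReal_re] at b1 b2
    have b3 := expWeight_mul_le hk hκ hc l l' p.1.re hτ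
    have h0 := hB0 _ hp.2
    have h0' := hB0' _ hp.2
    rw [norm_mul]
    calc _ ≤ (B p.2 * expWeight k κ c l (p.1.re + Real.log τ / k)) *
          (B' p.2 * expWeight k κ c l' (p.1.re + Real.log (1 - τ) / k)) :=
          mul_le_mul b1 b2 (norm_nonneg _) ((norm_nonneg _).trans b1)
      _ = B p.2 * B' p.2 * (expWeight k κ c l (p.1.re + Real.log τ / k) *
          expWeight k κ c l' (p.1.re + Real.log (1 - τ) / k)) := by ring
      _ ≤ _ := (mul_le_mul_of_nonneg_left b3 (mul_nonneg h0 h0')).trans (le_of_eq (by ring))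

end Weights
end

noncomputable section

open MeasureTheory Filter Topology Set Metric
open scoped Interval

/-! ### Acceleration of series, derivatives and integrals; analytic continuation of the identity. -/

section AccelAnalysis

variable {k₁ k₂ : ℝ}

lemma norm_accelIntegrand (h1 : 0 < k₁) (k₂ φ : ℝ) (f : ℂ → ℂ) (ζ : ℂ) (t : ℝ) :
    ‖accelIntegrand k₁ k₂ φ f ζ t‖ = ‖f (t + φ * Complex.I)‖ *
      (‖accelKernel k₁ k₂ (t + φ * Complex.I - ζ)‖ * (k₁ * Real.exp (k₁ * t))) := by
  rw [accelIntegrand, norm_mul, norm_mul, norm_mul, Complex.norm_real, Complex.norm_exp,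
    Real.norm_of_nonneg h1.le, mul_assoc]
  congr 4
  simp

lemma ray_gap {φ : ℝ} {ζ : ℂ} {d : ℝ} (h : |ζ.im - φ| < d) (t : ℝ) :
    |((t : ℂ) + φ * Complex.I - ζ).im| < d := by
  simpa [abs_sub_comm] using h

lemma continuous_accelKernel_ray (h1 : 0 < k₁) (h2 : k₁ < k₂) {φ : ℝ} {ζ : ℂ}
    (hgap : |ζ.im - φ| < Real.pi / 2 * (k₁⁻¹ - k₂⁻¹)) :
    Continuous fun t : ℝ => accelKernel k₁ k₂ (t + φ * Complex.I - ζ) :=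
  (differentiableOn_accelKernel h1 h2).continuousOn.comp_continuous (by fun_prop)
    fun t => ray_gap hgap t

lemma RayBounded.continuous_accelIntegrand (h1 : 0 < k₁) (h2 : k₁ < k₂) {φ κ c B : ℝ} {l : ℕ}
    {f : ℂ → ℂ} (hf : RayBounded k₁ κ c l φ B f) {ζ : ℂ}
    (hgap : |ζ.im - φ| < Real.pi / 2 * (k₁⁻¹ - k₂⁻¹)) :
    Continuous (accelIntegrand k₁ k₂ φ f ζ) := by
  unfold accelIntegrand
  exact (hf.cont.mul (continuous_accelKernel_ray h1 h2 hgap)).mul (by fun_prop)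

/-- The general integrability statement is applied to the weight itself, regarded as a function on
the ray. -/
lemma integrable_expWeight_mul_kernel (h1 : 0 < k₁) (h2 : k₁ < k₂) {φ ψ c : ℝ} {l : ℕ}
    (hl : l ≠ 0) (hgap : |ψ - φ| < Real.pi / 2 * (k₁⁻¹ - k₂⁻¹)) {s : ℝ}
    (hs : 2 * c * Real.exp (accelOrder k₁ k₂ * s) ≤ accelRate k₁ k₂ (ψ - φ)) :
    Integrable fun t : ℝ => expWeight k₁ (accelOrder k₁ k₂) c l t *
      (‖accelKernel k₁ k₂ (t + φ * Complex.I - (s + ψ * Complex.I))‖ *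
        (k₁ * Real.exp (k₁ * t))) := by
  have hf : RayBounded k₁ (accelOrder k₁ k₂) c l φ 1
      (fun z => (expWeight k₁ (accelOrder k₁ k₂) c l z.re : ℂ)) := by
    refine ⟨?_, fun t => ?_⟩
    · exact Complex.continuous_ofReal.comp ((continuous_expWeight _ _ _ _).comp (by fun_prop))
    · rw [Complex.norm_real, Real.norm_of_nonneg (expWeight_nonneg h1 _ _ _ _)]
      simp
  refine (hf.integrable_accel h1 h2 hl hgap hs).1.norm.congr (Eventually.of_forall fun t => ?_)
  simp only
  rw [norm_accelIntegrand h1, Complex.norm_real, Real.norm_of_nonneg (expWeight_nonneg h1 _ _ _ _)]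
  simp

lemma RayBounded.norm_accelIntegrand_le (h1 : 0 < k₁) (k₂ : ℝ) {φ κ c B : ℝ} {l : ℕ}
    {f : ℂ → ℂ} (hf : RayBounded k₁ κ c l φ B f) (ζ : ℂ) (t : ℝ) :
    ‖accelIntegrand k₁ k₂ φ f ζ t‖ ≤ B * (expWeight k₁ κ c l t *
      (‖accelKernel k₁ k₂ (t + φ * Complex.I - ζ)‖ * (k₁ * Real.exp (k₁ * t)))) := by
  rw [norm_accelIntegrand h1, ← mul_assoc B]
  have := hf.bound t
  gcongr

/-- Dominated convergence. The sum of the dominating functions is again bounded by a weight, hence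
integrable against the kernel. -/
lemma hasSum_accel (h1 : 0 < k₁) (h2 : k₁ < k₂) {φ ψ c B : ℝ} {l : ℕ} (hl : l ≠ 0)
    {f : ℕ → ℂ → ℂ} {F : ℂ → ℂ} (hc : ∀ n, Continuous fun s : ℝ => f n (s + φ * Complex.I))
    {b : ℕ → ℝ → ℝ} (hfb : ∀ n t, ‖f n ((t : ℝ) + φ * Complex.I)‖ ≤ b n t)
    (hb : ∀ t, Summable fun n => b n t)
    (hbB : ∀ t, ∑' n, b n t ≤ B * expWeight k₁ (accelOrder k₁ k₂) c l t)
    (hbm : Measurable fun t => ∑' n, b n t)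
    (hF : ∀ t : ℝ, HasSum (fun n => f n (t + φ * Complex.I)) (F (t + φ * Complex.I)))
    (hgap : |ψ - φ| < Real.pi / 2 * (k₁⁻¹ - k₂⁻¹)) {s : ℝ}
    (hs : 2 * c * Real.exp (accelOrder k₁ k₂ * s) ≤ accelRate k₁ k₂ (ψ - φ)) :
    HasSum (fun n => accel k₁ k₂ φ (f n) (s + ψ * Complex.I))
      (accel k₁ k₂ φ F (s + ψ * Complex.I)) := by
  have hgap' : |((s : ℂ) + ψ * Complex.I).im - φ| < Real.pi / 2 * (k₁⁻¹ - k₂⁻¹) := by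
    simpa using hgap
  have hK := continuous_accelKernel_ray h1 h2 hgap'
  have hW := (integrable_expWeight_mul_kernel h1 h2 hl hgap hs).const_mul B
  have hb0 : ∀ n t, 0 ≤ b n t := fun n t => (norm_nonneg _).trans (hfb n t)
  refine HasSum.mul_left _ (hasSum_integral_of_dominated_convergence (fun n t => b n t *
      (‖accelKernel k₁ k₂ (t + φ * Complex.I - (s + ψ * Complex.I))‖ * (k₁ * Real.exp (k₁ * t))))
    (fun n => ?_) (fun n => Eventually.of_forall fun t => ?_)
    (Eventually.of_forall fun t => (hb t).mul_right _) ?_ (Eventually.of_forall fun t => ?_))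
  · exact (((hc n).mul hK).mul (by fun_prop)).aestronglyMeasurable
  · have := norm_accelIntegrand h1 k₂ φ (f n) (s + ψ * Complex.I) t
    rw [accelIntegrand] at this
    rw [this]
    have := hfb n t
    gcongr
  · simp only [tsum_mul_right]
    refine hW.mono' ?_ (Eventually.of_forall fun t => ?_)
    · exact (hbm.mul (hK.norm.measurable.mul (by fun_prop))).aestronglyMeasurable
    · have h0 : 0 ≤ ∑' n, b n t := tsum_nonneg fun n => hb0 n t
      rw [Real.norm_of_nonneg (by positivity), ← mul_assoc B]
      have := hbB t
      gcongr
  · exact ((hF t).mul_right _).mul_right _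

lemma deriv_accel (h1 : 0 < k₁) (h2 : k₁ < k₂) {φ ψ c B δ : ℝ} {l : ℕ} (hl : l ≠ 0)
    (hδ : 0 < δ) {G : ℂ → ℂ → ℂ}
    (hG : ∀ z ∈ ball (0 : ℂ) δ, RayBounded k₁ (accelOrder k₁ k₂) c l φ B (G z))
    (hd : ∀ t : ℝ, DifferentiableOn ℂ (fun z => G z (t + φ * Complex.I)) (ball 0 δ))
    (hgap : |ψ - φ| < Real.pi / 2 * (k₁⁻¹ - k₂⁻¹)) {s : ℝ}
    (hs : 2 * c * Real.exp (accelOrder k₁ k₂ * s) ≤ accelRate k₁ k₂ (ψ - φ)) :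
    deriv (fun z => accel k₁ k₂ φ (G z) (s + ψ * Complex.I)) 0 =
      accel k₁ k₂ φ (fun η => deriv (fun z => G z η) 0) (s + ψ * Complex.I) := by
  have hgap' : |((s : ℂ) + ψ * Complex.I).im - φ| < Real.pi / 2 * (k₁⁻¹ - k₂⁻¹) := by
    simpa using hgap
  have hm : (0 : ℂ) ∈ ball (0 : ℂ) δ := mem_ball_self hδ
  have key := hasDerivAt_integral_line (μ := volume) hδ
    (G := fun z t => accelIntegrand k₁ k₂ φ (G z) (s + ψ * Complex.I) t)
    (fun z hz => ((hG z hz).continuous_accelIntegrand h1 h2 hgap').aestronglyMeasurable)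
    (Eventually.of_forall fun t => by
      unfold accelIntegrand
      exact ((hd t).mul_const _).mul_const _)
    (Eventually.of_forall fun t z hz => (hG z hz).norm_accelIntegrand_le h1 k₂ _ t)
    ((integrable_expWeight_mul_kernel h1 h2 hl hgap hs).const_mul B)
  simp only [accel_eq]
  rw [deriv_const_mul_field, key]
  congr 2
  funext t
  simp only [accelIntegrand]
  rw [deriv_mul_const_field, deriv_mul_const_field]

/-- Acceleration commutes with `∑ a_n t ^ n ↦ ∑ a_n t ^ n / (n + 1)`. -/
theorem accel_levelDil (h1 : 0 < k₁) (h2 : k₁ < k₂) {φ ψ c B : ℝ} {l : ℕ} (hl : l ≠ 0)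
    (hc : 0 ≤ c) (hB : 0 ≤ B) {f : ℂ → ℂ}
    (hf : RayBounded k₁ (accelOrder k₁ k₂) c l φ B f)
    (hgap : |ψ - φ| < Real.pi / 2 * (k₁⁻¹ - k₂⁻¹)) {s : ℝ}
    (hs : 2 * c * Real.exp (accelOrder k₁ k₂ * s) ≤ accelRate k₁ k₂ (ψ - φ)) :
    accel k₁ k₂ φ (levelDil k₁ f) (s + ψ * Complex.I) =
      levelDil k₂ (accel k₁ k₂ φ f) (s + ψ * Complex.I) := by
  set ζ : ℂ := s + ψ * Complex.I with hζ
  have hgap' : |ζ.im - φ| < Real.pi / 2 * (k₁⁻¹ - k₂⁻¹) := by simpa [hζ] using hgap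
  have hK := continuous_accelKernel_ray h1 h2 hgap'
  have hκ := (accelOrder_pos h1 h2).le
  let P : ℝ → ℂ := fun t => accelKernel k₁ k₂ (t + φ * Complex.I - ζ) *
    ((k₁ : ℂ) * Complex.exp ((k₁ : ℂ) * (t + φ * Complex.I)))
  have hP : Continuous P := hK.mul (by fun_prop)
  have hPn : ∀ t, ‖P t‖ = ‖accelKernel k₁ k₂ (t + φ * Complex.I - ζ)‖ *
      (k₁ * Real.exp (k₁ * t)) := by
    intro t
    have := norm_accelIntegrand h1 k₂ φ (fun _ => 1) ζ t
    rw [accelIntegrand, norm_one, one_mul, one_mul] at this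
    exact this
  let G : ℝ → ℝ → ℂ := fun t σ =>
    Complex.exp ((k₁ + 1) * σ) * f (t + φ * Complex.I + σ) * P t
  have hfc : Continuous fun p : ℝ × ℝ => f ((p.1 : ℂ) + φ * Complex.I + p.2) := by
    have := hf.cont.comp (continuous_fst.add continuous_snd : Continuous fun p : ℝ × ℝ => p.1 + p.2)
    refine this.congr fun p => ?_
    simp only [Function.comp, Pi.add_apply]
    congr 1; push_cast; ring
  have hGc : Continuous (Function.uncurry G) := by
    refine Continuous.mul (Continuous.mul (by fun_prop) hfc) (hP.comp continuous_fst)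
  have hGi : Integrable (Function.uncurry G)
      ((volume : Measure ℝ).prod (volume.restrict (Iic (0 : ℝ)))) := by
    have hi := (((integrable_expWeight_mul_kernel h1 h2 hl hgap hs).const_mul B).mul_prod
      (integral_exp_grade l).1)
    refine hi.mono' hGc.aestronglyMeasurable ?_
    have hm : MeasurableSet {p : ℝ × ℝ | p.2 ∈ Iic (0 : ℝ)} := measurable_snd measurableSet_Iic
    have : ∀ᵐ p ∂((volume : Measure ℝ).prod (volume.restrict (Iic (0 : ℝ)))), p.2 ∈ Iic (0 : ℝ) := by
      have h := Measure.quasiMeasurePreserving_snd (μ := (volume : Measure ℝ))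
        (ν := volume.restrict (Iic (0 : ℝ)))
      exact h.ae (ae_restrict_mem measurableSet_Iic)
    filter_upwards [this] with p hp
    have hd := norm_dil_integrand_le h1 hκ hc (l := l) (f := f) (ζ := p.1 + φ * Complex.I) hB
      (fun t => by
        have := hf.bound (p.1 + t)
        have e : ((p.1 + t : ℝ) : ℂ) + φ * Complex.I = p.1 + φ * Complex.I + t := by
          push_cast; ring
        rw [e] at this
        simpa using this) hp
    simp only [Function.uncurry, G]
    rw [norm_mul, hPn]
    calc _ ≤ (B * expWeight k₁ (accelOrder k₁ k₂) c l ((p.1 : ℂ) + φ * Complex.I).re *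
          Real.exp ((l + 1) * p.2)) * (‖accelKernel k₁ k₂ (p.1 + φ * Complex.I - ζ)‖ *
          (k₁ * Real.exp (k₁ * p.1))) := by gcongr
      _ = _ := by simp; ring
  have e1 : ∀ t : ℝ, accelIntegrand k₁ k₂ φ (levelDil k₁ f) ζ t = ∫ σ in Iic (0 : ℝ), G t σ := by
    intro t
    rw [accelIntegrand, mul_assoc, levelDil, ← integral_mul_const]
  -- The kernel depends only on `η / ξ`, so shifting `t` transfers the dilation from `η` to `ξ`. The
  -- leftover factor `exp σ` combines with `exp (-k₂ ζ)` to give the exponent `k₂ + 1` in place of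
  -- `k₁ + 1`.
  have e2 : ∀ σ : ℝ, ∫ t, G t σ = Complex.exp σ * ∫ t, accelIntegrand k₁ k₂ φ f (ζ + σ) t := by
    intro σ
    rw [← integral_sub_right_eq_self (fun t => G t σ) σ, ← integral_const_mul]
    congr 1
    funext t
    have a1 : ((t - σ : ℝ) : ℂ) + φ * Complex.I + σ = t + φ * Complex.I := by push_cast; ring
    have a2 : ((t - σ : ℝ) : ℂ) + φ * Complex.I - ζ = t + φ * Complex.I - (ζ + σ) := by
      push_cast; ring
    have a3 : Complex.exp ((k₁ + 1) * σ) *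
        Complex.exp ((k₁ : ℂ) * (((t - σ : ℝ) : ℂ) + φ * Complex.I)) =
        Complex.exp σ * Complex.exp ((k₁ : ℂ) * (t + φ * Complex.I)) := by
      rw [← Complex.exp_add, ← Complex.exp_add]; congr 1; push_cast; ring
    simp only [G, P, accelIntegrand]
    rw [a1, a2]
    calc _ = f (t + φ * Complex.I) * accelKernel k₁ k₂ (t + φ * Complex.I - (ζ + σ)) * k₁ *
          (Complex.exp ((k₁ + 1) * σ) *
            Complex.exp ((k₁ : ℂ) * (((t - σ : ℝ) : ℂ) + φ * Complex.I))) := by ring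
      _ = _ := by rw [a3]; ring
  rw [accel_eq]
  simp only [e1]
  rw [integral_integral_swap hGi, levelDil, ← integral_const_mul]
  congr 1
  funext σ
  rw [e2, accel_eq]
  have a4 : Complex.exp (-(k₂ : ℂ) * ζ) * Complex.exp σ =
      Complex.exp ((k₂ + 1) * σ) * Complex.exp (-(k₂ : ℂ) * (ζ + σ)) := by
    rw [← Complex.exp_add, ← Complex.exp_add]; congr 1; ring
  rw [← mul_assoc, a4, mul_assoc]

lemma integrable_exp_mul_exp_neg_exp {a κ A : ℝ} (ha : 0 < a) (hκ : 0 < κ) (hA : 0 < A) :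
    Integrable fun t : ℝ => Real.exp (a * t) * Real.exp (-A * Real.exp (κ * t)) := by
  have h := integrableOn_rpow_mul_exp_neg_mul_rpow (s := a / κ - 1) (p := 1) (b := A)
    (by have := div_pos ha hκ; linarith) one_pos hA
  have h2 := (integrable_exp_substitution hκ _).2 h
  refine (h2.const_mul κ⁻¹).congr (Eventually.of_forall fun t => ?_)
  simp only [Real.rpow_one, smul_eq_mul]
  rw [← Real.exp_mul]
  have e : Real.exp (a * t) = Real.exp (κ * t) * Real.exp (κ * t * (a / κ - 1)) := by
    rw [← Real.exp_add]; congr 1; field_simp; ring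
  rw [e]
  field_simp

lemma differentiableOn_accel (h1 : 0 < k₁) (h2 : k₁ < k₂) {φ c B d σ : ℝ} {l : ℕ} (hl : l ≠ 0)
    {f : ℂ → ℂ} (hf : RayBounded k₁ (accelOrder k₁ k₂) c l φ B f)
    (hd : d < Real.pi / 2 * (k₁⁻¹ - k₂⁻¹))
    (hσ : c * Real.exp (accelOrder k₁ k₂ * σ) < accelRate k₁ k₂ d) :
    DifferentiableOn ℂ (accel k₁ k₂ φ f) {ζ | |ζ.im - φ| < d ∧ ζ.re < σ} := by
  have hκ := accelOrder_pos h1 h2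
  have ho : IsOpen {ζ : ℂ | |ζ.im - φ| < d ∧ ζ.re < σ} :=
    (isOpen_logSector φ d).inter (isOpen_lt Complex.continuous_re continuous_const)
  refine DifferentiableOn.mul (by fun_prop) ?_
  -- The decay rate left after subtracting the growth `c`, at the worst angle `d` and the largest
  -- modulus `exp σ`.
  set A := accelRate k₁ k₂ d * Real.exp (-(accelOrder k₁ k₂ * σ)) - c with hA
  have hA0 : 0 < A := by
    have : c = c * Real.exp (accelOrder k₁ k₂ * σ) * Real.exp (-(accelOrder k₁ k₂ * σ)) := by
      rw [mul_assoc, ← Real.exp_add]; simp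
    rw [hA, sub_pos, this]
    gcongr
  set C := B * ((Real.Gamma (l / k₁))⁻¹ * (4 / cosGap (k₁ / k₂) (k₁ * d)) * k₁) with hC
  have hint : Integrable fun t : ℝ => Real.exp (l * t) *
      Real.exp (-A * Real.exp (accelOrder k₁ k₂ * t)) :=
    integrable_exp_mul_exp_neg_exp (by exact_mod_cast Nat.pos_of_ne_zero hl) hκ hA0
  have hmain : ∀ (t : ℝ), ∀ ζ ∈ {ζ : ℂ | |ζ.im - φ| < d ∧ ζ.re < σ},
      ‖accelIntegrand k₁ k₂ φ f ζ t‖ ≤ C * (Real.exp (l * t) *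
      Real.exp (-A * Real.exp (accelOrder k₁ k₂ * t))) := by
    intro t ζ hζ
    have hB0 := (norm_nonneg _).trans (hf.bound t)
    have hk := norm_accelKernel_le_of_le h1 h2 (w := t + φ * Complex.I - ζ) (t := t - σ) hd
      (ray_gap hζ.1 t).le (by have := hζ.2; simp; linarith)
    refine (hf.norm_accelIntegrand_le h1 k₂ ζ t).trans ?_
    rw [← mul_assoc B]
    calc _ ≤ B * expWeight k₁ (accelOrder k₁ k₂) c l t * (4 / cosGap (k₁ / k₂) (k₁ * d) *
        Real.exp (-accelRate k₁ k₂ d * Real.exp (accelOrder k₁ k₂ * (t - σ))) *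
        (k₁ * Real.exp (k₁ * t))) := by gcongr
      _ = C * ((Real.exp ((l - k₁) * t) * Real.exp (k₁ * t)) *
        (Real.exp (c * Real.exp (accelOrder k₁ k₂ * t)) *
        Real.exp (-accelRate k₁ k₂ d * Real.exp (accelOrder k₁ k₂ * (t - σ))))) := by
          rw [hC, expWeight]; ring
      _ = _ := by
        rw [← Real.exp_add, ← Real.exp_add]
        congr 3
        · ring
        · have : Real.exp (accelOrder k₁ k₂ * (t - σ)) = Real.exp (accelOrder k₁ k₂ * t) *
            Real.exp (-(accelOrder k₁ k₂ * σ)) := by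
            rw [← Real.exp_add]; congr 1; ring
          rw [this, hA]; ring
  refine differentiableOn_integral_of_holomorphic (fun ζ hζ => ?_)
    (Eventually.of_forall fun t => ?_) fun ζ hζ => ⟨_, ho.mem_nhds hζ, subset_rfl, _,
      hint.const_mul C, Eventually.of_forall fun t y hy => hmain t y hy⟩
  · exact (hf.continuous_accelIntegrand h1 h2 (hζ.1.trans hd)).aestronglyMeasurable
  · refine DifferentiableOn.mul_const (DifferentiableOn.const_mul ?_ _) _
    exact (differentiableOn_accelKernel h1 h2).comp (by fun_prop)
      fun ζ hζ => ray_gap (hζ.1.trans hd) t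

/-- A holomorphic function which is the acceleration of `f` near the origin along one ray is so
on the whole domain where the acceleration integral is controlled. -/
theorem eq_accel_of_eventually (h1 : 0 < k₁) (h2 : k₁ < k₂) {φ c B d σ θ ε : ℝ} {l : ℕ}
    (hl : l ≠ 0) {f g : ℂ → ℂ} (hf : RayBounded k₁ (accelOrder k₁ k₂) c l φ B f)
    (hg : DifferentiableOn ℂ g (logSector θ ε))
    (hd : d < Real.pi / 2 * (k₁⁻¹ - k₂⁻¹))
    (hσ : c * Real.exp (accelOrder k₁ k₂ * σ) < accelRate k₁ k₂ d) {ψ : ℝ}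
    (hψ : |ψ - θ| < ε) (hψφ : |ψ - φ| < d)
    (hev : ∀ᶠ s : ℝ in atBot, g (s + ψ * Complex.I) = accel k₁ k₂ φ f (s + ψ * Complex.I))
    {ζ : ℂ} (hζ : ζ ∈ logSector θ ε) (hζφ : |ζ.im - φ| < d) (hζσ : ζ.re < σ) :
    g ζ = accel k₁ k₂ φ f ζ := by
  have ho : IsOpen {ζ : ℂ | |ζ.im - φ| < d ∧ ζ.re < σ} :=
    (isOpen_logSector φ d).inter (isOpen_lt Complex.continuous_re continuous_const)
  have hcv : Convex ℝ {ζ : ℂ | |ζ.im - φ| < d ∧ ζ.re < σ} :=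
    (convex_logSector φ d).inter (convex_halfSpace_re_lt σ)
  obtain ⟨s₀, hs₀⟩ := eventually_atBot.1 hev
  -- Far enough along the ray for the points `s₁ + t`, `|t| < 1`, to stay where the identity is
  -- already known.
  set s₁ := min s₀ σ - 1
  refine eqOn_of_eq_on_segment ((isOpen_logSector θ ε).inter ho)
    ((convex_logSector θ ε).inter hcv).isPreconnected (hg.mono inter_subset_left)
    ((differentiableOn_accel h1 h2 hl hf hd hσ).mono inter_subset_right)
    (z₀ := s₁ + ψ * Complex.I) ⟨ray_mem_logSector hψ _, ?_⟩ ?_ ⟨hζ, hζφ, hζσ⟩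
  · have : s₁ < σ := by have := min_le_right s₀ σ; simp only [s₁]; linarith
    simpa using ⟨hψφ, this⟩
  · filter_upwards [Metric.ball_mem_nhds (0 : ℝ) one_pos] with t ht
    have h3 : |t| < 1 := by simpa using ht
    have h4 : s₁ + t ≤ s₀ := by
      have := min_le_left s₀ σ
      have := abs_lt.1 h3
      simp only [s₁]; linarith
    have h5 := hs₀ _ h4
    have e : ((s₁ + t : ℝ) : ℂ) + ψ * Complex.I = s₁ + ψ * Complex.I + t := by push_cast; ring
    rwa [e] at h5

end AccelAnalysis
end

/-! ### Chains and their graded bounds. -/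

noncomputable section

open MeasureTheory Filter Topology Set Metric
open scoped Interval

lemma hasSum_antidiagonal {g : ℕ × ℕ → ℂ} {a : ℂ} (h : HasSum g a) :
    HasSum (fun n => ∑ p ∈ Finset.HasAntidiagonal.antidiagonal n, g p) a := by
  have h1 := (Finset.HasAntidiagonal.sigmaAntidiagonalEquivProd (A := ℕ)).hasSum_iff.2 h
  have h2 := h1.sigma fun n => hasSum_fintype _
  have e : (fun n => ∑ p ∈ Finset.HasAntidiagonal.antidiagonal n, g p) = fun n =>
      ∑ p : Finset.HasAntidiagonal.antidiagonal n,
        (g ∘ Finset.HasAntidiagonal.sigmaAntidiagonalEquivProd) ⟨n, p⟩ := by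
    funext n
    exact (Finset.sum_coe_sort (Finset.HasAntidiagonal.antidiagonal n) g).symm
  rw [e]
  exact h2

/-- The multilevel Borel data of a formal series: its coefficients and the functions attached to
the successive levels. -/
abbrev Chain (q : ℕ) := (ℕ → ℂ) × (Fin (q + 1) → ℂ → ℂ)

/-- Levels, sectors, exponential type and radius common to a family of chains. -/
structure SectorData (q : ℕ) where
  k : Fin (q + 1) → ℝ
  θ : Fin (q + 1) → ℝ
  ε : Fin (q + 1) → ℝ
  c : ℝ
  lam : ℝ
  k_pos : 0 < k 0
  k_mono : StrictMono k
  c_pos : 0 < c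

namespace SectorData

variable {q : ℕ} (P : SectorData q)

lemma pos (j : Fin (q + 1)) : 0 < P.k j := P.k_pos.trans_le (P.k_mono.monotone (Fin.zero_le j))

lemma lt (j : Fin q) : P.k j.castSucc < P.k j.succ := P.k_mono Fin.castSucc_lt_succ

def sector (j : Fin (q + 1)) : Set ℂ := logSector (P.θ j) (P.ε j)

def order (j : Fin (q + 1)) : ℝ := levelOrder P.k j

lemma order_castSucc (j : Fin q) :
    P.order j.castSucc = accelOrder (P.k j.castSucc) (P.k j.succ) := by
  simp [order, levelOrder, accelOrder]

lemma le_order (j : Fin (q + 1)) : P.k j ≤ P.order j := by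
  refine Fin.lastCases ?_ (fun i => ?_) j
  · simp [order, levelOrder]
  · rw [order_castSucc]
    exact le_accelOrder (P.pos _) (P.lt i)

lemma order_nonneg (j : Fin (q + 1)) : 0 ≤ P.order j := (P.pos j).le.trans (P.le_order j)

def weight (j : Fin (q + 1)) (l : ℕ) (s : ℝ) : ℝ := expWeight (P.k j) (P.order j) P.c l s

lemma weight_nonneg (j : Fin (q + 1)) (l : ℕ) (s : ℝ) : 0 ≤ P.weight j l s :=
  expWeight_nonneg (P.pos j) _ _ _ _

lemma weight_zero (j : Fin (q + 1)) (s : ℝ) : P.weight j 0 s = 0 := expWeight_zero _ _ _ _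

/-- The modulus of the Borel transform of first level of `t ^ n`. -/
def monoWeight (n : ℕ) (s : ℝ) : ℝ := expWeight (P.k 0) (P.k 0) 0 n s

lemma monoWeight_nonneg (n : ℕ) (s : ℝ) : 0 ≤ P.monoWeight n s := expWeight_nonneg P.k_pos _ _ _ _

lemma norm_mono (n : ℕ) (ζ : ℂ) : ‖borelMono (P.k 0) n ζ‖ = P.monoWeight n ζ.re :=
  norm_borelMono P.k_pos _ _ _

lemma monoWeight_pos {n : ℕ} (hn : n ≠ 0) (s : ℝ) : 0 < P.monoWeight n s := by
  have : 0 < Real.Gamma (n / P.k 0) := Real.Gamma_pos_of_pos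
    (div_pos (by exact_mod_cast Nat.pos_of_ne_zero hn) P.k_pos)
  unfold monoWeight expWeight
  positivity

/-- Shrinking the radius from `exp t` to `exp s` produces a geometric factor; it converts a termwise
bound at one radius into normal convergence at a smaller one. -/
lemma monoWeight_shift (n : ℕ) (s t : ℝ) :
    P.monoWeight n s = P.monoWeight n t * (Real.exp (-P.k 0 * (s - t)) * Real.exp (s - t) ^ n) := by
  have : Real.exp ((n - P.k 0) * s) = Real.exp ((n - P.k 0) * t) *
      (Real.exp (-P.k 0 * (s - t)) * Real.exp (s - t) ^ n) := by
    rw [← Real.exp_nat_mul, ← Real.exp_add, ← Real.exp_add]; congr 1; ring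
  unfold monoWeight expWeight
  rw [this]; simp; ring

/-- `e` is the Borel data of a series of order at least `l`, with bound `B`. -/
structure Good (l : ℕ) (B : ℝ) (e : Chain q) : Prop where
  nonneg : 0 ≤ B
  coef_eq_zero : ∀ n < l, e.1 n = 0
  norm_coef_zero : ‖e.1 0‖ ≤ B
  sum_le : ∀ s < P.lam, ∀ T : Finset ℕ,
    ∑ n ∈ T, ‖e.1 n‖ * P.monoWeight n s ≤ B * P.weight 0 l s
  holo : ∀ j, DifferentiableOn ℂ (e.2 j) (P.sector j)
  norm_le : ∀ j, ∀ ζ ∈ P.sector j, ‖e.2 j ζ‖ ≤ B * P.weight j l ζ.re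
  hasSum : ∀ ζ ∈ P.sector 0, ζ.re < P.lam →
    HasSum (fun n => e.1 n * borelMono (P.k 0) n ζ) (e.2 0 ζ)
  -- The identity is required on an explicit region depending only on the common data, not merely
  -- for small `|ξ|`, so that it passes to infinite sums of chains.
  accel_eq : ∀ (j : Fin q) (φ ψ s : ℝ), |φ - P.θ j.castSucc| < P.ε j.castSucc →
    |ψ - P.θ j.succ| < P.ε j.succ →
    |ψ - φ| < Real.pi / 2 * ((P.k j.castSucc)⁻¹ - (P.k j.succ)⁻¹) →
    2 * P.c * Real.exp (accelOrder (P.k j.castSucc) (P.k j.succ) * s) ≤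
      accelRate (P.k j.castSucc) (P.k j.succ) (ψ - φ) →
    e.2 j.succ (s + ψ * Complex.I) =
      accel (P.k j.castSucc) (P.k j.succ) φ (e.2 j.castSucc) (s + ψ * Complex.I)

namespace Good

variable {P} {l l' : ℕ} {B B' : ℝ} {e e' : Chain q}

lemma cont (h : P.Good l B e) (j : Fin (q + 1)) : ContinuousOn (e.2 j) (P.sector j) :=
  (h.holo j).continuousOn

lemma norm_shift_le (h : P.Good l B e) {j : Fin (q + 1)} {ζ : ℂ} (hζ : ζ ∈ P.sector j) (t : ℝ) :
    ‖e.2 j (ζ + t)‖ ≤ B * expWeight (P.k j) (P.order j) P.c l (ζ.re + t) := by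
  have := h.norm_le j (ζ + t) (add_ofReal_mem_logSector hζ t)
  rwa [Complex.add_re, Complex.ofReal_re] at this

lemma rayBounded (h : P.Good l B e) (j : Fin q) {φ : ℝ}
    (hφ : |φ - P.θ j.castSucc| < P.ε j.castSucc) :
    RayBounded (P.k j.castSucc) (accelOrder (P.k j.castSucc) (P.k j.succ)) P.c l φ B
      (e.2 j.castSucc) := by
  refine ⟨(h.cont j.castSucc).comp_continuous (by fun_prop) fun t => ray_mem_logSector hφ t,
    fun s => ?_⟩
  have := h.norm_le j.castSucc _ (ray_mem_logSector hφ s)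
  rw [weight, order_castSucc] at this
  simpa using this

/-- The weight of grade `0` vanishes because `Γ(0) = 0` by convention. A good chain of grade `0`
thus has no Borel part on its sectors and is a constant series, bounded through `norm_coef_zero`. -/
lemma brl_eq_zero (h : P.Good 0 B e) (j : Fin (q + 1)) {ζ : ℂ} (hζ : ζ ∈ P.sector j) :
    e.2 j ζ = 0 := by
  have := h.norm_le j ζ hζ
  rw [weight_zero, mul_zero] at this
  exact norm_le_zero_iff.1 this

lemma coef_eq_zero_of_pos (h : P.Good 0 B e) {n : ℕ} (hn : n ≠ 0) : e.1 n = 0 := by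
  have := h.sum_le (P.lam - 1) (by linarith) {n}
  rw [weight_zero, mul_zero, Finset.sum_singleton] at this
  have h2 := P.monoWeight_pos hn (P.lam - 1)
  have h3 : ‖e.1 n‖ ≤ 0 := nonpos_of_mul_nonpos_left this h2
  exact norm_le_zero_iff.1 h3

lemma coef_zero (h : P.Good l B e) (hl : l ≠ 0) : e.1 0 = 0 :=
  h.coef_eq_zero 0 (Nat.pos_of_ne_zero hl)

lemma integrable_accel (h : P.Good l B e) (j : Fin q) {φ ψ s : ℝ}
    (hφ : |φ - P.θ j.castSucc| < P.ε j.castSucc)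
    (hgap : |ψ - φ| < Real.pi / 2 * ((P.k j.castSucc)⁻¹ - (P.k j.succ)⁻¹))
    (hs : 2 * P.c * Real.exp (accelOrder (P.k j.castSucc) (P.k j.succ) * s) ≤
      accelRate (P.k j.castSucc) (P.k j.succ) (ψ - φ)) :
    Integrable (accelIntegrand (P.k j.castSucc) (P.k j.succ) φ (e.2 j.castSucc)
      (s + ψ * Complex.I)) := by
  rcases eq_or_ne l 0 with rfl | hl
  · have : accelIntegrand (P.k j.castSucc) (P.k j.succ) φ (e.2 j.castSucc)
      (s + ψ * Complex.I) = fun _ => 0 := by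
      funext t
      rw [accelIntegrand, h.brl_eq_zero _ (ray_mem_logSector hφ t), zero_mul, zero_mul]
    rw [this]
    exact integrable_zero _ _ _
  · exact ((h.rayBounded j hφ).integrable_accel (P.pos _) (P.lt j) hl hgap hs).1

lemma mono (h : P.Good l B e) (hB : B ≤ B') : P.Good l B' e where
  nonneg := h.nonneg.trans hB
  coef_eq_zero := h.coef_eq_zero
  norm_coef_zero := h.norm_coef_zero.trans hB
  sum_le s hs T := (h.sum_le s hs T).trans
    (mul_le_mul_of_nonneg_right hB (P.weight_nonneg _ _ _))
  holo := h.holo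
  norm_le j ζ hζ := (h.norm_le j ζ hζ).trans
    (mul_le_mul_of_nonneg_right hB (P.weight_nonneg _ _ _))
  hasSum := h.hasSum
  accel_eq := h.accel_eq

lemma accel_congr {k₁ k₂ φ θ ε : ℝ} {f g : ℂ → ℂ} (h : EqOn f g (logSector θ ε))
    (hφ : |φ - θ| < ε) : accel k₁ k₂ φ f = accel k₁ k₂ φ g := by
  funext ζ
  rw [_root_.accel_eq, _root_.accel_eq]
  congr 2
  funext t
  rw [accelIntegrand, accelIntegrand, h (ray_mem_logSector hφ t)]

lemma congr (h : P.Good l B e) (h1 : ∀ n, e'.1 n = e.1 n)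
    (h2 : ∀ j, EqOn (e'.2 j) (e.2 j) (P.sector j)) : P.Good l B e' where
  nonneg := h.nonneg
  coef_eq_zero n hn := by rw [h1, h.coef_eq_zero n hn]
  norm_coef_zero := by rw [h1]; exact h.norm_coef_zero
  sum_le s hs T := by simp only [h1]; exact h.sum_le s hs T
  holo j := (h.holo j).congr (h2 j)
  norm_le j ζ hζ := by rw [h2 j hζ]; exact h.norm_le j ζ hζ
  hasSum ζ hζ hs := by simp only [h1]; rw [h2 0 hζ]; exact h.hasSum ζ hζ hs
  accel_eq j φ ψ s hφ hψ hgap hs := by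
    rw [h2 j.succ (ray_mem_logSector hψ s), accel_congr (h2 j.castSucc) hφ]
    exact h.accel_eq j φ ψ s hφ hψ hgap hs

lemma zero (l : ℕ) : P.Good l 0 (0 : Chain q) where
  nonneg := le_rfl
  coef_eq_zero n hn := rfl
  norm_coef_zero := by simp
  sum_le s hs T := by simp
  holo j := differentiableOn_const _
  norm_le j ζ hζ := by simp
  hasSum ζ hζ hs := by simp
  accel_eq j φ ψ s hφ hψ hgap hs := by simp [accel]

lemma add (h : P.Good l B e) (h' : P.Good l B' e') : P.Good l (B + B') (e + e') where
  nonneg := add_nonneg h.nonneg h'.nonneg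
  coef_eq_zero n hn := by
    change e.1 n + e'.1 n = 0
    rw [h.coef_eq_zero n hn, h'.coef_eq_zero n hn, add_zero]
  norm_coef_zero := (norm_add_le _ _).trans (add_le_add h.norm_coef_zero h'.norm_coef_zero)
  sum_le s hs T := by
    calc _ ≤ ∑ n ∈ T, (‖e.1 n‖ * P.monoWeight n s + ‖e'.1 n‖ * P.monoWeight n s) := by
          refine Finset.sum_le_sum fun n _ => ?_
          rw [← add_mul]
          exact mul_le_mul_of_nonneg_right (norm_add_le _ _) (P.monoWeight_nonneg _ _)
      _ ≤ _ := by
          rw [Finset.sum_add_distrib, add_mul]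
          exact add_le_add (h.sum_le s hs T) (h'.sum_le s hs T)
  holo j := (h.holo j).add (h'.holo j)
  norm_le j ζ hζ := by
    rw [add_mul]
    exact (norm_add_le _ _).trans (add_le_add (h.norm_le j ζ hζ) (h'.norm_le j ζ hζ))
  hasSum ζ hζ hs := by
    simp only [Prod.fst_add, Prod.snd_add, Pi.add_apply, add_mul]
    exact (h.hasSum ζ hζ hs).add (h'.hasSum ζ hζ hs)
  accel_eq j φ ψ s hφ hψ hgap hs := by
    change e.2 j.succ _ + e'.2 j.succ _ = _
    rw [h.accel_eq j φ ψ s hφ hψ hgap hs, h'.accel_eq j φ ψ s hφ hψ hgap hs, _root_.accel_eq,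
      _root_.accel_eq, _root_.accel_eq, ← mul_add, ← integral_add (h.integrable_accel j hφ hgap hs)
      (h'.integrable_accel j hφ hgap hs)]
    congr 2
    funext t
    simp only [accelIntegrand, Prod.snd_add, Pi.add_apply]
    ring

lemma smul (h : P.Good l B e) (a : ℂ) : P.Good l (‖a‖ * B) (a • e) where
  nonneg := mul_nonneg (norm_nonneg _) h.nonneg
  coef_eq_zero n hn := by
    change a * e.1 n = 0
    rw [h.coef_eq_zero n hn, mul_zero]
  norm_coef_zero := by
    change ‖a * e.1 0‖ ≤ _
    rw [norm_mul]
    exact mul_le_mul_of_nonneg_left h.norm_coef_zero (norm_nonneg _)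
  sum_le s hs T := by
    calc _ = ‖a‖ * ∑ n ∈ T, ‖e.1 n‖ * P.monoWeight n s := by
          rw [Finset.mul_sum]
          refine Finset.sum_congr rfl fun n _ => ?_
          change ‖a * e.1 n‖ * _ = _
          rw [norm_mul]; ring
      _ ≤ _ := by
          rw [mul_assoc]
          exact mul_le_mul_of_nonneg_left (h.sum_le s hs T) (norm_nonneg _)
  holo j := (h.holo j).const_smul a
  norm_le j ζ hζ := by
    change ‖a * e.2 j ζ‖ ≤ _
    rw [norm_mul, mul_assoc]
    exact mul_le_mul_of_nonneg_left (h.norm_le j ζ hζ) (norm_nonneg _)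
  hasSum ζ hζ hs := by
    have := (h.hasSum ζ hζ hs).mul_left a
    simp only [← mul_assoc] at this
    exact this
  accel_eq j φ ψ s hφ hψ hgap hs := by
    change a * e.2 j.succ _ = _
    rw [h.accel_eq j φ ψ s hφ hψ hgap hs, _root_.accel_eq,
      _root_.accel_eq, mul_left_comm, ← integral_const_mul]
    congr 2
    funext t
    simp only [accelIntegrand, Prod.smul_snd, Pi.smul_apply, smul_eq_mul]
    ring

end Good

end SectorData

end

/-! ### Products, integration and elementary chains. -/

noncomputable section

open MeasureTheory Filter Topology Set Metric
open scoped Interval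

lemma tsum_mul_pairs {f g : ℕ → ℂ} {a b : ℂ} (hf : HasSum f a) (hg : HasSum g b) :
    ∑' p : ℕ × ℕ, f p.1 * g p.2 = a * b :=
  (hf.mul hg (summable_mul_of_summable_norm hf.summable.norm hg.summable.norm)).tsum_eq

namespace Chain

variable {q : ℕ}

/-- The product of two chains, the first one without constant term. -/
def mul (k : Fin (q + 1) → ℝ) (e e' : Chain q) : Chain q :=
  (fun n => ∑ p ∈ Finset.HasAntidiagonal.antidiagonal n, e.1 p.1 * e'.1 p.2,
    fun j ζ => e'.1 0 * e.2 j ζ + levelConv (k j) (e.2 j) (e'.2 j) ζ)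

/-- The operation `∑ a_n t ^ n ↦ ∑ a_n t ^ n / (n + 1)`. -/
def dil (k : Fin (q + 1) → ℝ) (e : Chain q) : Chain q :=
  (fun n => e.1 n / (n + 1), fun j => levelDil (k j) (e.2 j))

/-- The series `t`. -/
def var (k : Fin (q + 1) → ℝ) : Chain q :=
  (fun n => if n = 1 then 1 else 0, fun j => borelVar (k j))

/-- The constant series. -/
def const (q : ℕ) (a : ℂ) : Chain q := (fun n => if n = 0 then a else 0, 0)

end Chain

lemma expWeight_zero_const (k κ κ' : ℝ) (l : ℕ) (s : ℝ) :
    expWeight k κ 0 l s = expWeight k κ' 0 l s := by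
  simp [expWeight]

namespace SectorData

variable {q : ℕ} (P : SectorData q)

/-- Obtained by taking moduli in the convolution identity for Borel monomials. It bounds the weights
of degree `i + j` when coefficients are multiplied. -/
lemma monoWeight_conv {i j : ℕ} (hi : i ≠ 0) (hj : j ≠ 0) (s : ℝ) :
    P.monoWeight (i + j) s ≤ Real.exp (P.k 0 * s) * ∫ τ in Ioo (0 : ℝ) 1,
      P.monoWeight i (s + Real.log τ / P.k 0) * P.monoWeight j (s + Real.log (1 - τ) / P.k 0) := by
  have h1 := P.norm_mono (i + j) (s : ℂ)
  rw [Complex.ofReal_re] at h1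
  rw [← h1, ← levelConv_borelMono P.k_pos hi hj, levelConv, norm_mul, Complex.norm_exp,
    re_ofReal_mul, Complex.ofReal_re]
  refine mul_le_mul_of_nonneg_left ?_ (Real.exp_pos _).le
  refine norm_integral_le_of_norm_le (expWeight_conv P.k_pos le_rfl le_rfl hi hj s).1
    (Eventually.of_forall fun τ => ?_)
  rw [norm_mul, P.norm_mono, P.norm_mono]
  simp [monoWeight]

namespace Good

variable {P} {l l' : ℕ} {B B' : ℝ} {e e' : Chain q}

lemma const (a : ℂ) : P.Good 0 ‖a‖ (Chain.const q a) where
  nonneg := norm_nonneg _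
  coef_eq_zero n hn := by omega
  norm_coef_zero := by simp [Chain.const]
  sum_le s hs T := by
    rw [weight_zero, mul_zero]
    refine Finset.sum_nonpos fun n _ => ?_
    by_cases hn : n = 0
    · simp [hn, monoWeight, expWeight_zero]
    · simp [Chain.const, hn]
  holo j := differentiableOn_const _
  norm_le j ζ hζ := by simp [Chain.const, weight_zero]
  hasSum ζ hζ hs := by
    have : (fun n => (Chain.const q a).1 n * borelMono (P.k 0) n ζ) = fun _ => 0 := by
      funext n
      by_cases hn : n = 0
      · simp [hn, borelMono_zero]
      · simp [Chain.const, hn]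
    rw [this]
    exact hasSum_zero
  accel_eq j φ ψ s hφ hψ hgap hs := by simp [accel, Chain.const]

lemma var : P.Good 1 1 (Chain.var P.k) where
  nonneg := zero_le_one
  coef_eq_zero n hn := by simp [Chain.var, Nat.lt_one_iff.1 hn]
  norm_coef_zero := by simp [Chain.var]
  sum_le s hs T := by
    have h1 : ∀ n, ‖(Chain.var P.k).1 n‖ * P.monoWeight n s =
        if n = 1 then P.monoWeight 1 s else 0 := by
      intro n
      by_cases hn : n = 1 <;> simp [Chain.var, hn]
    simp only [h1]
    rw [Finset.sum_ite_eq', one_mul]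
    have h2 : P.monoWeight 1 s ≤ P.weight 0 1 s := by
      unfold monoWeight
      rw [expWeight_zero_const _ _ (P.order 0)]
      have h0 : 0 ≤ Real.Gamma ((1 : ℕ) / P.k 0) :=
        Real.Gamma_nonneg_of_nonneg (div_nonneg (by simp) P.k_pos.le)
      have hc := P.c_pos
      unfold weight expWeight
      gcongr
    split_ifs
    · exact h2
    · exact P.weight_nonneg _ _ _
  holo j := by
    have := (differentiable_borelMono (P.k j) 1).differentiableOn (s := P.sector j)
    rwa [borelMono_one] at this
  norm_le j ζ hζ := by
    have h := norm_borelMono (P.pos j) (P.order j) 1 ζ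
    rw [borelMono_one] at h
    have h0 : 0 ≤ Real.Gamma ((1 : ℕ) / P.k j) :=
      Real.Gamma_nonneg_of_nonneg (div_nonneg (by simp) (P.pos j).le)
    have hc := P.c_pos
    refine h.le.trans ?_
    rw [one_mul]
    unfold weight expWeight
    gcongr
  hasSum ζ hζ hs := by
    have : (fun n => (Chain.var P.k).1 n * borelMono (P.k 0) n ζ) =
        fun n => if n = 1 then borelVar (P.k 0) ζ else 0 := by
      funext n
      by_cases hn : n = 1
      · simp [Chain.var, hn, borelMono_one]
      · simp [Chain.var, hn]
    rw [this]
    exact hasSum_ite_eq 1 _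
  accel_eq j φ ψ s hφ hψ hgap hs := (accel_borelVar (P.pos _) (P.lt j) hgap s).symm

lemma dil (h : P.Good l B e) : P.Good l (B / (l + 1)) (Chain.dil P.k e) where
  nonneg := div_nonneg h.nonneg (by positivity)
  coef_eq_zero n hn := by simp [Chain.dil, h.coef_eq_zero n hn]
  norm_coef_zero := by
    rcases eq_or_ne l 0 with rfl | hl
    · simpa [Chain.dil] using h.norm_coef_zero
    · have := h.nonneg
      simp only [Chain.dil, h.coef_zero hl, zero_div, norm_zero]
      positivity
  sum_le s hs T := by
    rw [div_mul_eq_mul_div, le_div_iff₀ (by positivity), Finset.sum_mul]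
    refine (Finset.sum_le_sum fun n _ => ?_).trans (h.sum_le s hs T)
    rcases lt_or_ge n l with hn | hn
    · simp [Chain.dil, h.coef_eq_zero n hn]
    · have h1 : ‖(Chain.dil P.k e).1 n‖ * (l + 1) ≤ ‖e.1 n‖ := by
        have e1 : ‖(n : ℂ) + 1‖ = n + 1 := by
          have : ((n : ℂ) + 1) = (((n : ℝ) + 1 : ℝ) : ℂ) := by push_cast; ring
          rw [this, Complex.norm_real, Real.norm_of_nonneg (by positivity)]
        simp only [Chain.dil, norm_div, e1]
        rw [div_mul_eq_mul_div, div_le_iff₀ (by positivity)]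
        have : (l : ℝ) ≤ n := by exact_mod_cast hn
        gcongr
      calc _ = ‖(Chain.dil P.k e).1 n‖ * (l + 1) * P.monoWeight n s := by ring
        _ ≤ _ := mul_le_mul_of_nonneg_right h1 (P.monoWeight_nonneg _ _)
  holo j := by
    have := differentiableOn_levelDil (P.pos j) (P.order_nonneg j) P.c_pos.le (l := l)
      (θ := P.θ j) (ε := P.ε j) (E := ℂ) isOpen_univ (f := fun p => e.2 j p.1)
      ((h.holo j).comp differentiableOn_fst fun p hp => hp.1) (B := fun _ => B)
      continuousOn_const (fun _ _ => h.nonneg) (fun ζ hζ _ _ => h.norm_le j ζ hζ)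
    exact this.comp (f := fun ζ : ℂ => (ζ, (0 : ℂ))) (by fun_prop) fun ζ hζ => ⟨hζ, mem_univ _⟩
  norm_le j ζ hζ := norm_levelDil_le (P.pos j) (P.order_nonneg j) P.c_pos.le h.nonneg
    (h.norm_shift_le hζ)
  hasSum ζ hζ hs := by
    rcases eq_or_ne l 0 with rfl | hl
    · have e1 : ∀ n, (Chain.dil P.k e).1 n * borelMono (P.k 0) n ζ = 0 := by
        intro n
        rcases eq_or_ne n 0 with rfl | hn
        · rw [borelMono_zero, mul_zero]
        · simp [Chain.dil, h.coef_eq_zero_of_pos hn]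
      have e2 : (Chain.dil P.k e).2 0 ζ = 0 := by
        simp only [Chain.dil, levelDil]
        refine integral_eq_zero_of_ae (Eventually.of_forall fun σ => ?_)
        simp [h.brl_eq_zero 0 (add_ofReal_mem_logSector hζ σ)]
      simp only [e1, e2]
      exact hasSum_zero
    have hint : ∀ n : ℕ, IntegrableOn (fun σ : ℝ => Complex.exp ((P.k 0 + 1) * σ) *
        (e.1 n * borelMono (P.k 0) n (ζ + σ))) (Iic 0) := by
      intro n
      refine Integrable.mono' (((integral_exp_grade n).1.const_mul
        (‖e.1 n‖ * P.monoWeight n ζ.re))) ?_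
        (ae_restrict_of_forall_mem measurableSet_Iic fun σ hσ => ?_)
      · have := (differentiable_borelMono (P.k 0) n).continuous
        exact Continuous.aestronglyMeasurable (by fun_prop)
      · refine norm_dil_integrand_le (k := P.k 0) (κ := P.k 0) (c := 0) (l := n)
          (f := fun z => e.1 n * borelMono (P.k 0) n z) P.k_pos P.k_pos.le le_rfl
          (norm_nonneg _) (fun t => ?_) hσ
        rw [norm_mul, P.norm_mono, Complex.add_re, Complex.ofReal_re]
        rfl
    -- Termwise integration is legitimate because the absolute partial sums at `ζ + σ` are bounded
    -- by a weight, which is integrable in `σ ≤ 0`.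
    have key : HasSum (fun n : ℕ => ∫ σ in Iic (0 : ℝ), Complex.exp ((P.k 0 + 1) * σ) *
        (e.1 n * borelMono (P.k 0) n (ζ + σ))) (∫ σ in Iic (0 : ℝ), ∑' n : ℕ,
        Complex.exp ((P.k 0 + 1) * σ) * (e.1 n * borelMono (P.k 0) n (ζ + σ))) := by
      refine hasSum_integral_of_summable_integral_norm hint ?_
      refine summable_of_sum_le (c := B * P.weight 0 l ζ.re * (1 / (l + 1)))
        (fun n => integral_nonneg fun _ => norm_nonneg _) fun T => ?_
      rw [← integral_finsetSum _ fun n _ => (hint n).norm, ← (integral_exp_grade l).2,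
        ← integral_const_mul]
      refine setIntegral_mono_on (integrable_finsetSum _ fun n _ => (hint n).norm)
        ((integral_exp_grade l).1.const_mul _) measurableSet_Iic fun σ hσ => ?_
      have hσ0 : σ ≤ 0 := hσ
      have e1 : ((P.k 0 : ℂ) + 1) * σ = (((P.k 0 + 1) * σ : ℝ) : ℂ) := by push_cast; ring
      simp only [norm_mul, P.norm_mono]
      rw [← Finset.mul_sum, e1, Complex.norm_exp_ofReal, Complex.add_re, Complex.ofReal_re]
      calc _ ≤ Real.exp ((P.k 0 + 1) * σ) * (B * P.weight 0 l (ζ.re + σ)) := by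
            gcongr
            exact h.sum_le _ (by linarith) T
        _ ≤ Real.exp ((P.k 0 + 1) * σ) * (B * (Real.exp ((l - P.k 0) * σ) *
            P.weight 0 l ζ.re)) := by
            have := h.nonneg
            gcongr
            exact expWeight_shift_le P.k_pos (P.order_nonneg 0) P.c_pos.le l _ hσ0
        _ = B * P.weight 0 l ζ.re *
            (Real.exp ((P.k 0 + 1) * σ) * Real.exp ((l - P.k 0) * σ)) := by ring
        _ = _ := by
            rw [← Real.exp_add]; congr 2; ring
    have e3 : ∀ n : ℕ, ∫ σ in Iic (0 : ℝ), Complex.exp ((P.k 0 + 1) * σ) *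
        (e.1 n * borelMono (P.k 0) n (ζ + σ)) = (Chain.dil P.k e).1 n * borelMono (P.k 0) n ζ := by
      intro n
      have := levelDil_borelMono (P.k 0) n ζ
      rw [levelDil] at this
      simp only [mul_left_comm _ (e.1 n)]
      rw [integral_const_mul, this]
      simp only [Chain.dil]; ring
    have e4 : ∫ σ in Iic (0 : ℝ), ∑' n : ℕ,
        Complex.exp ((P.k 0 + 1) * σ) * (e.1 n * borelMono (P.k 0) n (ζ + σ)) =
        (Chain.dil P.k e).2 0 ζ := by
      refine setIntegral_congr_fun measurableSet_Iic fun σ hσ => ?_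
      have hσ0 : σ ≤ 0 := hσ
      exact ((h.hasSum _ (add_ofReal_mem_logSector hζ σ)
        (by simp; linarith)).mul_left _).tsum_eq
    simp only [e3, e4] at key
    exact key
  accel_eq j φ ψ s hφ hψ hgap hs := by
    -- The integral defining `levelDil` only uses smaller moduli, which remain in the region where
    -- the acceleration identity holds.
    have hr : ∀ σ : ℝ, σ ≤ 0 → e.2 j.succ (s + ψ * Complex.I + σ) = accel (P.k j.castSucc)
        (P.k j.succ) φ (e.2 j.castSucc) (s + ψ * Complex.I + σ) := by
      intro σ hσ
      have e1 : (s : ℂ) + ψ * Complex.I + σ = ((s + σ : ℝ) : ℂ) + ψ * Complex.I := by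
        push_cast; ring
      rw [e1]
      refine h.accel_eq j φ ψ _ hφ hψ hgap (le_trans ?_ hs)
      have := accelOrder_pos (P.pos _) (P.lt j)
      have := P.c_pos
      gcongr
      linarith
    have e2 : (Chain.dil P.k e).2 j.succ (s + ψ * Complex.I) = levelDil (P.k j.succ)
        (accel (P.k j.castSucc) (P.k j.succ) φ (e.2 j.castSucc)) (s + ψ * Complex.I) := by
      refine setIntegral_congr_fun measurableSet_Iic fun σ hσ => ?_
      rw [hr σ hσ]
    rw [e2]
    rcases eq_or_ne l 0 with rfl | hl
    · have h0 : ∀ t : ℝ, e.2 j.castSucc (t + φ * Complex.I) = 0 := fun t =>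
        h.brl_eq_zero _ (ray_mem_logSector hφ t)
      have h1 : accel (P.k j.castSucc) (P.k j.succ) φ (e.2 j.castSucc) = fun _ => 0 := by
        funext ζ; simp [accel, h0]
      have h2 : ∀ t : ℝ, levelDil (P.k j.castSucc) (e.2 j.castSucc) (t + φ * Complex.I) = 0 := by
        intro t
        refine integral_eq_zero_of_ae (Eventually.of_forall fun σ => ?_)
        simp [h.brl_eq_zero _ (add_ofReal_mem_logSector (ray_mem_logSector hφ t) σ)]
      rw [h1]
      have h3 : levelDil (P.k j.succ) (fun _ => 0) (s + ψ * Complex.I) = 0 := by simp [levelDil]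
      rw [h3]
      simp only [accel, Chain.dil, h2]
      simp
    · exact (accel_levelDil (P.pos _) (P.lt j) hl P.c_pos.le h.nonneg (h.rayBounded j hφ)
        hgap hs).symm

/-- A second factor of grade `0` is a constant series, so the product is multiplication by the
scalar `e'.1 0`. -/
lemma mul_const (h : P.Good l B e) (h' : P.Good 0 B' e') :
    P.Good l (B * B') (Chain.mul P.k e e') := by
  refine ((h.smul (e'.1 0)).mono (B' := B * B') ?_).congr (fun n => ?_) fun j ζ hζ => ?_
  · rw [mul_comm]
    exact mul_le_mul_of_nonneg_left h'.norm_coef_zero h.nonneg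
  · change ∑ p ∈ Finset.HasAntidiagonal.antidiagonal n, e.1 p.1 * e'.1 p.2 = e'.1 0 * e.1 n
    rw [Finset.sum_eq_single (n, 0)]
    · ring
    · rintro ⟨a, b⟩ hab hne
      have hb : b ≠ 0 := by
        rintro rfl
        simp only [Finset.HasAntidiagonal.mem_antidiagonal, add_zero] at hab
        exact hne (by rw [hab])
      simp [h'.coef_eq_zero_of_pos hb]
    · intro hn
      simp at hn
  · have h0 : levelConv (P.k j) (e.2 j) (e'.2 j) ζ = 0 := by
      rw [levelConv, integral_eq_zero_of_ae, mul_zero]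
      refine Eventually.of_forall fun τ => ?_
      simp only [h'.brl_eq_zero j (add_ofReal_mem_logSector hζ _), mul_zero]
      rfl
    change e'.1 0 * e.2 j ζ + levelConv (P.k j) (e.2 j) (e'.2 j) ζ = e'.1 0 * e.2 j ζ
    rw [h0, add_zero]

/-- The terms of the product of the first-level Borel expansions. -/
lemma integrable_monoWeight_conv (e e' : Chain q) (s : ℝ) (p : ℕ × ℕ) :
    IntegrableOn (fun τ => ‖e.1 p.1‖ * P.monoWeight p.1 (s + Real.log τ / P.k 0) *
      (‖e'.1 p.2‖ * P.monoWeight p.2 (s + Real.log (1 - τ) / P.k 0))) (Ioo 0 1) := by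
  rcases eq_or_ne p.1 0 with h1 | h1
  · simp [h1, monoWeight, expWeight_zero]
  rcases eq_or_ne p.2 0 with h2 | h2
  · simp [h2, monoWeight, expWeight_zero]
  refine ((expWeight_conv P.k_pos le_rfl le_rfl h1 h2 s).1.const_mul
    (‖e.1 p.1‖ * ‖e'.1 p.2‖)).congr (Eventually.of_forall fun τ => ?_)
  simp only [monoWeight]
  ring

/-- A finite set of pairs lies in a rectangle, over which the sum factors. Each factor is bounded by
`sum_le` at a smaller radius, and the resulting weights are convolved. -/
lemma sum_integral_conv_le (h : P.Good l B e) (h' : P.Good l' B' e') (hl : l ≠ 0) (hl' : l' ≠ 0)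
    {s : ℝ} (hs : s < P.lam) (T : Finset (ℕ × ℕ)) :
    Real.exp (P.k 0 * s) * ∑ p ∈ T, ∫ τ in Ioo (0 : ℝ) 1,
      ‖e.1 p.1‖ * P.monoWeight p.1 (s + Real.log τ / P.k 0) *
      (‖e'.1 p.2‖ * P.monoWeight p.2 (s + Real.log (1 - τ) / P.k 0)) ≤
      B * B' * P.weight 0 (l + l') s := by
  classical
  obtain ⟨w1, w2⟩ := expWeight_conv P.k_pos (P.le_order 0) P.c_pos.le hl hl' s
  set T1 := T.image Prod.fst
  set T2 := T.image Prod.snd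
  have hsub : T ⊆ T1 ×ˢ T2 := fun p hp =>
    Finset.mem_product.2 ⟨Finset.mem_image_of_mem _ hp, Finset.mem_image_of_mem _ hp⟩
  have hnn : ∀ (p : ℕ × ℕ) (τ : ℝ),
      0 ≤ ‖e.1 p.1‖ * P.monoWeight p.1 (s + Real.log τ / P.k 0) *
      (‖e'.1 p.2‖ * P.monoWeight p.2 (s + Real.log (1 - τ) / P.k 0)) := fun p τ =>
    mul_nonneg (mul_nonneg (norm_nonneg _) (P.monoWeight_nonneg _ _))
      (mul_nonneg (norm_nonneg _) (P.monoWeight_nonneg _ _))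
  have hlog : ∀ τ ∈ Ioo (0 : ℝ) 1, s + Real.log τ / P.k 0 < P.lam := by
    intro τ hτ
    have : Real.log τ / P.k 0 ≤ 0 := div_nonpos_of_nonpos_of_nonneg
      (Real.log_nonpos hτ.1.le hτ.2.le) P.k_pos.le
    linarith
  have hle : ∑ p ∈ T, ∫ τ in Ioo (0 : ℝ) 1,
      ‖e.1 p.1‖ * P.monoWeight p.1 (s + Real.log τ / P.k 0) *
      (‖e'.1 p.2‖ * P.monoWeight p.2 (s + Real.log (1 - τ) / P.k 0)) ≤
      ∫ τ in Ioo (0 : ℝ) 1, B * B' * (P.weight 0 l (s + Real.log τ / P.k 0) *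
        P.weight 0 l' (s + Real.log (1 - τ) / P.k 0)) := by
    refine (Finset.sum_le_sum_of_subset_of_nonneg hsub fun p _ _ =>
      integral_nonneg fun τ => hnn p τ).trans ?_
    rw [← integral_finsetSum _ fun p _ => integrable_monoWeight_conv e e' s p]
    refine setIntegral_mono_on (integrable_finsetSum _ fun p _ =>
      integrable_monoWeight_conv e e' s p) (w1.const_mul _) measurableSet_Ioo fun τ hτ => ?_
    have hτ' : 1 - τ ∈ Ioo (0 : ℝ) 1 := ⟨by linarith [hτ.2], by linarith [hτ.1]⟩
    rw [Finset.sum_product]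
    have e1 : ∑ x ∈ T1, ∑ y ∈ T2, ‖e.1 x‖ * P.monoWeight x (s + Real.log τ / P.k 0) *
        (‖e'.1 y‖ * P.monoWeight y (s + Real.log (1 - τ) / P.k 0)) =
        (∑ x ∈ T1, ‖e.1 x‖ * P.monoWeight x (s + Real.log τ / P.k 0)) *
        ∑ y ∈ T2, ‖e'.1 y‖ * P.monoWeight y (s + Real.log (1 - τ) / P.k 0) := by
      rw [Finset.sum_mul_sum]
    rw [e1]
    calc _ ≤ (B * P.weight 0 l (s + Real.log τ / P.k 0)) *
          (B' * P.weight 0 l' (s + Real.log (1 - τ) / P.k 0)) :=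
          mul_le_mul (h.sum_le _ (hlog τ hτ) T1) (h'.sum_le _ (hlog _ hτ') T2)
            (Finset.sum_nonneg fun y _ => mul_nonneg (norm_nonneg _) (P.monoWeight_nonneg _ _))
            (mul_nonneg h.nonneg (P.weight_nonneg _ _ _))
      _ = _ := by ring
  rw [integral_const_mul] at hle
  calc _ ≤ Real.exp (P.k 0 * s) * (B * B' * ∫ τ in Ioo (0 : ℝ) 1,
        P.weight 0 l (s + Real.log τ / P.k 0) *
        P.weight 0 l' (s + Real.log (1 - τ) / P.k 0)) :=
        mul_le_mul_of_nonneg_left hle (Real.exp_pos _).le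
    _ = B * B' * (Real.exp (P.k 0 * s) * ∫ τ in Ioo (0 : ℝ) 1,
        P.weight 0 l (s + Real.log τ / P.k 0) *
        P.weight 0 l' (s + Real.log (1 - τ) / P.k 0)) := by ring
    _ ≤ _ := mul_le_mul_of_nonneg_left w2 (mul_nonneg h.nonneg h'.nonneg)

lemma sum_pairs_le (h : P.Good l B e) (h' : P.Good l' B' e') (hl : l ≠ 0) (hl' : l' ≠ 0)
    {s : ℝ} (hs : s < P.lam) (T : Finset (ℕ × ℕ)) :
    ∑ p ∈ T, ‖e.1 p.1‖ * ‖e'.1 p.2‖ * P.monoWeight (p.1 + p.2) s ≤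
      B * B' * P.weight 0 (l + l') s := by
  refine le_trans ?_ (h.sum_integral_conv_le h' hl hl' hs T)
  rw [Finset.mul_sum]
  refine Finset.sum_le_sum fun p _ => ?_
  rcases eq_or_ne p.1 0 with h1 | h1
  · simp [h1, h.coef_zero hl]
  rcases eq_or_ne p.2 0 with h2 | h2
  · simp [h2, h'.coef_zero hl']
  have h3 := mul_le_mul_of_nonneg_left (P.monoWeight_conv h1 h2 s)
    (mul_nonneg (norm_nonneg (e.1 p.1)) (norm_nonneg (e'.1 p.2)))
  refine h3.trans (le_of_eq ?_)
  rw [mul_left_comm, ← integral_const_mul]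
  congr 2
  funext τ
  ring

/-- The two convergent expansions are multiplied under the convolution integral and integrated term
by term; each pair of monomials convolves to the monomial of the total degree. -/
lemma hasSum_conv (h : P.Good l B e) (h' : P.Good l' B' e') (hl : l ≠ 0) (hl' : l' ≠ 0)
    {ζ : ℂ} (hζ : ζ ∈ P.sector 0) (hs : ζ.re < P.lam) :
    HasSum (fun p : ℕ × ℕ => e.1 p.1 * e'.1 p.2 * borelMono (P.k 0) (p.1 + p.2) ζ)
      (levelConv (P.k 0) (e.2 0) (e'.2 0) ζ) := by
  have hζτ : ∀ τ ∈ Ioo (0 : ℝ) 1, (ζ + ((Real.log τ / P.k 0 : ℝ) : ℂ)).re < P.lam := by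
    intro τ hτ
    have : Real.log τ / P.k 0 ≤ 0 := div_nonpos_of_nonpos_of_nonneg
      (Real.log_nonpos hτ.1.le hτ.2.le) P.k_pos.le
    rw [Complex.add_re, Complex.ofReal_re]
    linarith
  let F : ℕ × ℕ → ℝ → ℂ := fun p τ =>
    e.1 p.1 * borelMono (P.k 0) p.1 (ζ + ((Real.log τ / P.k 0 : ℝ) : ℂ)) *
      (e'.1 p.2 * borelMono (P.k 0) p.2 (ζ + ((Real.log (1 - τ) / P.k 0 : ℝ) : ℂ)))
  have hFn : ∀ p τ, ‖F p τ‖ = ‖e.1 p.1‖ * P.monoWeight p.1 (ζ.re + Real.log τ / P.k 0) *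
    (‖e'.1 p.2‖ * P.monoWeight p.2 (ζ.re + Real.log (1 - τ) / P.k 0)) := by
    intro p τ
    simp only [F, norm_mul, P.norm_mono, Complex.add_re, Complex.ofReal_re]
  have hFm : ∀ p, Measurable (F p) := by
    intro p
    have m1 := (differentiable_borelMono (P.k 0) p.1).continuous.measurable
    have m2 := (differentiable_borelMono (P.k 0) p.2).continuous.measurable
    refine Measurable.mul (measurable_const.mul (m1.comp ?_)) (measurable_const.mul (m2.comp ?_))
    · exact measurable_const.add
        (Complex.measurable_ofReal.comp (Real.measurable_log.div_const _))
    · exact measurable_const.add (Complex.measurable_ofReal.comp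
        ((Real.measurable_log.comp (measurable_const.sub measurable_id)).div_const _))
  have hFi : ∀ p, IntegrableOn (F p) (Ioo 0 1) := fun p =>
    (integrable_monoWeight_conv e e' ζ.re p).mono' (hFm p).aestronglyMeasurable
      (Eventually.of_forall fun τ => (hFn p τ).le)
  have hsum : Summable fun p => ∫ τ in Ioo (0 : ℝ) 1, ‖F p τ‖ := by
    refine summable_of_sum_le (c := (Real.exp (P.k 0 * ζ.re))⁻¹ *
      (B * B' * P.weight 0 (l + l') ζ.re))
      (fun p => integral_nonneg fun _ => norm_nonneg _) fun T => ?_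
    rw [le_inv_mul_iff₀ (Real.exp_pos _)]
    simp only [hFn]
    exact h.sum_integral_conv_le h' hl hl' hs T
  have key := (hasSum_integral_of_summable_integral_norm hFi hsum).mul_left
    (Complex.exp (P.k 0 * ζ))
  have e1 : ∀ p : ℕ × ℕ, Complex.exp (P.k 0 * ζ) * ∫ τ in Ioo (0 : ℝ) 1, F p τ =
      e.1 p.1 * e'.1 p.2 * borelMono (P.k 0) (p.1 + p.2) ζ := by
    intro p
    rcases eq_or_ne p.1 0 with h1 | h1
    · simp [F, h1, h.coef_zero hl]
    rcases eq_or_ne p.2 0 with h2 | h2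
    · simp [F, h2, h'.coef_zero hl']
    have e3 : ∫ τ in Ioo (0 : ℝ) 1, F p τ = e.1 p.1 * e'.1 p.2 * ∫ τ in Ioo (0 : ℝ) 1,
        borelMono (P.k 0) p.1 (ζ + ((Real.log τ / P.k 0 : ℝ) : ℂ)) *
        borelMono (P.k 0) p.2 (ζ + ((Real.log (1 - τ) / P.k 0 : ℝ) : ℂ)) := by
      rw [← integral_const_mul]
      congr 1
      funext τ
      simp only [F]
      ring
    rw [← levelConv_borelMono P.k_pos h1 h2, levelConv, e3]
    ring
  have e2 : ∫ τ in Ioo (0 : ℝ) 1, ∑' p, F p τ = ∫ τ in Ioo (0 : ℝ) 1,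
      e.2 0 (ζ + ((Real.log τ / P.k 0 : ℝ) : ℂ)) *
      e'.2 0 (ζ + ((Real.log (1 - τ) / P.k 0 : ℝ) : ℂ)) := by
    refine setIntegral_congr_fun measurableSet_Ioo fun τ hτ => ?_
    have hτ' : 1 - τ ∈ Ioo (0 : ℝ) 1 := ⟨by linarith [hτ.2], by linarith [hτ.1]⟩
    have s1 := h.hasSum _ (add_ofReal_mem_logSector hζ (Real.log τ / P.k 0)) (hζτ τ hτ)
    have s2 := h'.hasSum _ (add_ofReal_mem_logSector hζ (Real.log (1 - τ) / P.k 0)) (hζτ _ hτ')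
    exact tsum_mul_pairs s1 s2
  simp only [e1, e2] at key
  exact key

/-- `accel_levelConv` gives the convolution of the accelerations. At the points entering that
convolution the moduli are smaller, so these accelerations agree with the functions of the next
level. -/
lemma accel_conv (h : P.Good l B e) (h' : P.Good l' B' e') (hl : l ≠ 0) (hl' : l' ≠ 0)
    (j : Fin q) {φ ψ s : ℝ} (hφ : |φ - P.θ j.castSucc| < P.ε j.castSucc)
    (hψ : |ψ - P.θ j.succ| < P.ε j.succ)
    (hgap : |ψ - φ| < Real.pi / 2 * ((P.k j.castSucc)⁻¹ - (P.k j.succ)⁻¹))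
    (hs : 2 * P.c * Real.exp (accelOrder (P.k j.castSucc) (P.k j.succ) * s) ≤
      accelRate (P.k j.castSucc) (P.k j.succ) (ψ - φ)) :
    levelConv (P.k j.succ) (e.2 j.succ) (e'.2 j.succ) (s + ψ * Complex.I) =
      accel (P.k j.castSucc) (P.k j.succ) φ
        (levelConv (P.k j.castSucc) (e.2 j.castSucc) (e'.2 j.castSucc)) (s + ψ * Complex.I) := by
  rw [accel_levelConv (P.pos _) (P.lt j) hl hl' P.c_pos (h.rayBounded j hφ)
    (h'.rayBounded j hφ) hgap hs, levelConv, levelConv]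
  congr 1
  refine setIntegral_congr_fun measurableSet_Ioo fun τ hτ => ?_
  have hr : ∀ (τ : ℝ), τ ∈ Ioo (0 : ℝ) 1 → ∀ {l B e}, P.Good l B e →
      e.2 j.succ (s + ψ * Complex.I + ((Real.log τ / P.k j.succ : ℝ) : ℂ)) =
      accel (P.k j.castSucc) (P.k j.succ) φ (e.2 j.castSucc)
        (s + ψ * Complex.I + ((Real.log τ / P.k j.succ : ℝ) : ℂ)) := by
    intro τ hτ l B e h
    have e1 : (s : ℂ) + ψ * Complex.I + ((Real.log τ / P.k j.succ : ℝ) : ℂ) =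
        ((s + Real.log τ / P.k j.succ : ℝ) : ℂ) + ψ * Complex.I := by
      push_cast; ring
    rw [e1]
    refine h.accel_eq j φ ψ _ hφ hψ hgap (le_trans ?_ hs)
    have := accelOrder_pos (P.pos _) (P.lt j)
    have := P.c_pos
    have : Real.log τ / P.k j.succ ≤ 0 := div_nonpos_of_nonpos_of_nonneg
      (Real.log_nonpos hτ.1.le hτ.2.le) (P.pos _).le
    gcongr
    linarith
  have hτ' : 1 - τ ∈ Ioo (0 : ℝ) 1 := ⟨by linarith [hτ.2], by linarith [hτ.1]⟩
  rw [hr τ hτ h, hr _ hτ' h']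

lemma mul_pos_grade (h : P.Good l B e) (h' : P.Good l' B' e') (hl : l ≠ 0) (hl' : l' ≠ 0) :
    P.Good (l + l') (B * B') (Chain.mul P.k e e') := by
  have hb : ∀ j ζ, (Chain.mul P.k e e').2 j ζ = levelConv (P.k j) (e.2 j) (e'.2 j) ζ := by
    intro j ζ
    simp only [Chain.mul, h'.coef_zero hl', zero_mul, zero_add]
  refine ⟨mul_nonneg h.nonneg h'.nonneg, fun n hn => ?_, ?_, fun s hs T => ?_, fun j => ?_,
    fun j ζ hζ => ?_, fun ζ hζ hs => ?_, fun j φ ψ s hφ hψ hgap hs => ?_⟩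
  · change ∑ p ∈ Finset.HasAntidiagonal.antidiagonal n, e.1 p.1 * e'.1 p.2 = 0
    refine Finset.sum_eq_zero fun p hp => ?_
    have := Finset.HasAntidiagonal.mem_antidiagonal.1 hp
    rcases lt_or_ge p.1 l with h1 | h1
    · rw [h.coef_eq_zero _ h1, zero_mul]
    · rw [h'.coef_eq_zero _ (by omega), mul_zero]
  · simp [Chain.mul, h.coef_zero hl, mul_nonneg h.nonneg h'.nonneg]
  · classical
    have hdis : Set.PairwiseDisjoint (T : Set ℕ) (fun n : ℕ =>
        Finset.HasAntidiagonal.antidiagonal n) := by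
      intro a _ b _ hab
      refine Finset.disjoint_left.2 fun p hp hp' => hab ?_
      rw [← Finset.HasAntidiagonal.mem_antidiagonal.1 hp,
        ← Finset.HasAntidiagonal.mem_antidiagonal.1 hp']
    have := h.sum_pairs_le h' hl hl' hs (T.biUnion fun n => Finset.HasAntidiagonal.antidiagonal n)
    rw [Finset.sum_biUnion hdis] at this
    refine (Finset.sum_le_sum fun n _ => ?_).trans this
    calc _ ≤ (∑ p ∈ Finset.HasAntidiagonal.antidiagonal n, ‖e.1 p.1‖ * ‖e'.1 p.2‖) *
          P.monoWeight n s := by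
          refine mul_le_mul_of_nonneg_right ?_ (P.monoWeight_nonneg _ _)
          change ‖∑ p ∈ Finset.HasAntidiagonal.antidiagonal n, e.1 p.1 * e'.1 p.2‖ ≤ _
          refine (norm_sum_le _ _).trans (le_of_eq ?_)
          simp only [norm_mul]
      _ = _ := by
          rw [Finset.sum_mul]
          refine Finset.sum_congr rfl fun p hp => ?_
          rw [Finset.HasAntidiagonal.mem_antidiagonal.1 hp]
  · have := differentiableOn_levelConv (P.pos j) (P.le_order j) P.c_pos.le hl hl'
      (θ := P.θ j) (ε := P.ε j) (E := ℂ) isOpen_univ (f := fun p => e.2 j p.1)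
      (g := fun p => e'.2 j p.1)
      ((h.holo j).comp differentiableOn_fst fun p hp => hp.1)
      ((h'.holo j).comp differentiableOn_fst fun p hp => hp.1) (B := fun _ => B)
      (B' := fun _ => B') continuousOn_const continuousOn_const (fun _ _ => h.nonneg)
      (fun _ _ => h'.nonneg) (fun ζ hζ _ _ => h.norm_le j ζ hζ)
      (fun ζ hζ _ _ => h'.norm_le j ζ hζ)
    have h2 := this.comp (s := P.sector j) (f := fun ζ : ℂ => (ζ, (0 : ℂ))) (by fun_prop)
      fun ζ hζ => ⟨hζ, mem_univ _⟩
    exact h2.congr fun ζ hζ => hb j ζ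
  · rw [hb]
    exact norm_levelConv_le (P.pos j) (P.le_order j) P.c_pos.le hl hl' h.nonneg
      (h.norm_shift_le hζ) (h'.norm_shift_le hζ)
  · rw [hb]
    have key := hasSum_antidiagonal (h.hasSum_conv h' hl hl' hζ hs)
    have e1 : (fun n => (Chain.mul P.k e e').1 n * borelMono (P.k 0) n ζ) = fun n =>
        ∑ p ∈ Finset.HasAntidiagonal.antidiagonal n,
          e.1 p.1 * e'.1 p.2 * borelMono (P.k 0) (p.1 + p.2) ζ := by
      funext n
      simp only [Chain.mul]
      rw [Finset.sum_mul]
      refine Finset.sum_congr rfl fun p hp => ?_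
      rw [Finset.HasAntidiagonal.mem_antidiagonal.1 hp]
    rw [e1]
    exact key
  · have e1 : (Chain.mul P.k e e').2 j.castSucc =
        levelConv (P.k j.castSucc) (e.2 j.castSucc) (e'.2 j.castSucc) := funext fun ζ => hb _ ζ
    rw [hb, e1]
    exact h.accel_conv h' hl hl' j hφ hψ hgap hs

theorem mul (h : P.Good l B e) (hl : l ≠ 0) (h' : P.Good l' B' e') :
    P.Good (l + l') (B * B') (Chain.mul P.k e e') := by
  rcases eq_or_ne l' 0 with rfl | hl'
  · exact h.mul_const h'
  · exact h.mul_pos_grade h' hl hl'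

end Good

end SectorData
end

/-! ### Holomorphic families of chains and their directional derivatives. -/

noncomputable section

open MeasureTheory Filter Topology Set Metric
open scoped Interval

namespace SectorData

variable {q : ℕ} (P : SectorData q)
variable {E : Type*} [NormedAddCommGroup E] [NormedSpace ℂ E]

/-- A holomorphic family of good chains. -/
structure GoodOn (Ω : Set E) (l : ℕ) (B : E → ℝ) (e : E → Chain q) : Prop where
  good : ∀ Y ∈ Ω, P.Good l (B Y) (e Y)
  bound : ContinuousOn B Ω
  coef : ∀ n, DifferentiableOn ℂ (fun Y => (e Y).1 n) Ω
  brl : ∀ j, DifferentiableOn ℂ (fun p : ℂ × E => (e p.2).2 j p.1) (P.sector j ×ˢ Ω)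

lemma isOpen_sector (j : Fin (q + 1)) : IsOpen (P.sector j) := isOpen_logSector _ _

/-- Directional derivative of a family of chains. -/
def dirDeriv (v : E) (e : E → Chain q) (Y : E) : Chain q :=
  (fun n => lineDeriv ℂ (fun Y => (e Y).1 n) Y v, fun j ζ => lineDeriv ℂ (fun Y => (e Y).2 j ζ) Y v)

namespace GoodOn

variable {P} {Ω : Set E} {l l' : ℕ} {B B' : E → ℝ} {e e' : E → Chain q}

lemma mono (h : P.GoodOn Ω l B e) (hc : ContinuousOn B' Ω) (hB : ∀ Y ∈ Ω, B Y ≤ B' Y) :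
    P.GoodOn Ω l B' e :=
  ⟨fun Y hY => (h.good Y hY).mono (hB Y hY), hc, h.coef, h.brl⟩

lemma subset (h : P.GoodOn Ω l B e) {Ω' : Set E} (hs : Ω' ⊆ Ω) : P.GoodOn Ω' l B e :=
  ⟨fun Y hY => h.good Y (hs hY), h.bound.mono hs, fun n => (h.coef n).mono hs,
    fun j => (h.brl j).mono (prod_mono_right hs)⟩

lemma zero (Ω : Set E) (l : ℕ) : P.GoodOn Ω l 0 (0 : E → Chain q) :=
  ⟨fun _ _ => Good.zero l, continuousOn_const, fun _ => differentiableOn_const _,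
    fun _ => differentiableOn_const _⟩

lemma add (h : P.GoodOn Ω l B e) (h' : P.GoodOn Ω l B' e') : P.GoodOn Ω l (B + B') (e + e') :=
  ⟨fun Y hY => (h.good Y hY).add (h'.good Y hY), h.bound.add h'.bound,
    fun n => (h.coef n).add (h'.coef n), fun j => (h.brl j).add (h'.brl j)⟩

lemma smul (h : P.GoodOn Ω l B e) (a : ℂ) : P.GoodOn Ω l (fun Y => ‖a‖ * B Y) (a • e) :=
  ⟨fun Y hY => (h.good Y hY).smul a, continuousOn_const.mul h.bound,
    fun n => (h.coef n).const_smul a, fun j => (h.brl j).const_smul a⟩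

lemma sum {ι : Type*} (t : Finset ι) {B : ι → E → ℝ} {e : ι → E → Chain q}
    (h : ∀ i ∈ t, P.GoodOn Ω l (B i) (e i)) : P.GoodOn Ω l (∑ i ∈ t, B i) (∑ i ∈ t, e i) := by
  classical
  induction t using Finset.induction_on with
  | empty => simpa using zero Ω l
  | insert a t ha ih =>
    rw [Finset.sum_insert ha, Finset.sum_insert ha]
    exact (h a (Finset.mem_insert_self _ _)).add
      (ih fun i hi => h i (Finset.mem_insert_of_mem hi))

lemma comp {E' : Type*} [NormedAddCommGroup E'] [NormedSpace ℂ E'] (h : P.GoodOn Ω l B e)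
    {Ω' : Set E'} {π : E' → E} (hπ : Differentiable ℂ π) (hm : MapsTo π Ω' Ω) :
    P.GoodOn Ω' l (B ∘ π) (e ∘ π) :=
  ⟨fun _ hY => h.good _ (hm hY), h.bound.comp hπ.continuous.continuousOn hm,
    fun n => (h.coef n).comp hπ.differentiableOn hm, fun j =>
    (h.brl j).comp (f := fun p : ℂ × E' => (p.1, π p.2))
      (differentiable_fst.prodMk (hπ.comp differentiable_snd)).differentiableOn
      fun _ hp => ⟨hp.1, hm hp.2⟩⟩

lemma dil [FiniteDimensional ℂ E] (hΩ : IsOpen Ω) (h : P.GoodOn Ω l B e) :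
    P.GoodOn Ω l (fun Y => B Y / (l + 1)) (fun Y => Chain.dil P.k (e Y)) :=
  ⟨fun Y hY => (h.good Y hY).dil, h.bound.div_const _, fun n => by
      simpa only [Chain.dil, div_eq_mul_inv] using (h.coef n).mul_const (((n : ℂ) + 1)⁻¹), fun j =>
    differentiableOn_levelDil (P.pos j) (P.order_nonneg j) P.c_pos.le hΩ (h.brl j) h.bound
      (fun Y hY => (h.good Y hY).nonneg) fun ζ hζ Y hY => (h.good Y hY).norm_le j ζ hζ⟩

lemma mul [FiniteDimensional ℂ E] (hΩ : IsOpen Ω) (h : P.GoodOn Ω l B e) (hl : l ≠ 0)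
    (h' : P.GoodOn Ω l' B' e') :
    P.GoodOn Ω (l + l') (fun Y => B Y * B' Y) (fun Y => Chain.mul P.k (e Y) (e' Y)) := by
  refine ⟨fun Y hY => (h.good Y hY).mul hl (h'.good Y hY), h.bound.mul h'.bound, fun n => ?_,
    fun j => ?_⟩
  · change DifferentiableOn ℂ (fun Y => ∑ p ∈ Finset.HasAntidiagonal.antidiagonal n,
      (e Y).1 p.1 * (e' Y).1 p.2) Ω
    exact DifferentiableOn.fun_sum fun p _ => (h.coef p.1).mul (h'.coef p.2)
  · refine DifferentiableOn.add (DifferentiableOn.mul ?_ (h.brl j)) ?_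
    · exact (h'.coef 0).comp differentiableOn_snd fun p hp => hp.2
    · rcases eq_or_ne l' 0 with rfl | hl'
      · refine (differentiableOn_const (0 : ℂ)).congr fun p hp => ?_
        rw [levelConv, integral_eq_zero_of_ae, mul_zero]
        refine Eventually.of_forall fun τ => ?_
        simp only [(h'.good _ hp.2).brl_eq_zero j (add_ofReal_mem_logSector hp.1 _), mul_zero]
        rfl
      · exact differentiableOn_levelConv (P.pos j) (P.le_order j) P.c_pos.le hl hl' hΩ
          (h.brl j) (h'.brl j) h.bound h'.bound (fun Y hY => (h.good Y hY).nonneg)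
          (fun Y hY => (h'.good Y hY).nonneg) (fun ζ hζ Y hY => (h.good Y hY).norm_le j ζ hζ)
          (fun ζ hζ Y hY => (h'.good Y hY).norm_le j ζ hζ)

lemma var (Ω : Set E) : P.GoodOn Ω 1 (fun _ => 1) (fun _ => Chain.var P.k) :=
  ⟨fun _ _ => Good.var, continuousOn_const, fun _ => differentiableOn_const _, fun j =>
    ((Good.var (P := P)).holo j).comp differentiableOn_fst fun _ hp => hp.1⟩

lemma differentiableOn_circle (h : P.GoodOn Ω l B e) {Y v : E} {δ : ℝ}
    (hm : ∀ z : ℂ, ‖z‖ ≤ δ → Y + z • v ∈ Ω) {j : Fin (q + 1)} {ζ : ℂ} (hζ : ζ ∈ P.sector j) :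
    DifferentiableOn ℂ (fun z : ℂ => (e (Y + z • v)).2 j ζ) (ball 0 δ) :=
  (h.brl j).comp (f := fun z : ℂ => (ζ, Y + z • v)) (by fun_prop)
    fun z hz => ⟨hζ, hm z (by simpa using (mem_ball.1 hz).le)⟩

lemma differentiableOn_section' (h : P.GoodOn Ω l B e) {j : Fin (q + 1)} {ζ : ℂ}
    (hζ : ζ ∈ P.sector j) : DifferentiableOn ℂ (fun Y => (e Y).2 j ζ) Ω :=
  (h.brl j).comp (f := fun Y => (ζ, Y)) (by fun_prop) fun _ hY => ⟨hζ, hY⟩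

/-- A sum of moduli is linearized: with coefficients `σ n` of modulus at most `1` such that `σ n * D
n = ‖D n‖`, Cauchy's estimate for one scalar function bounds the whole sum, with no loss depending
on the number of terms. -/
lemma sum_norm_lineDeriv_le (h : P.GoodOn Ω l B e) {Y v : E} {δ C : ℝ} (hδ : 0 < δ)
    (hm : ∀ z : ℂ, ‖z‖ ≤ δ → Y + z • v ∈ Ω ∧ B (Y + z • v) ≤ δ * C) {s : ℝ} (hs : s < P.lam)
    (T : Finset ℕ) :
    ∑ n ∈ T, ‖lineDeriv ℂ (fun Y => (e Y).1 n) Y v‖ * P.monoWeight n s ≤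
      C * P.weight 0 l s := by
  set D : ℕ → ℂ := fun n => lineDeriv ℂ (fun Y => (e Y).1 n) Y v with hD
  have hY : Y ∈ Ω := by simpa using (hm 0 (by simpa using hδ.le)).1
  have hda : ∀ n, HasDerivAt (fun z : ℂ => (e (Y + z • v)).1 n) (D n) 0 := by
    intro n
    have hd : DifferentiableOn ℂ (fun z : ℂ => (e (Y + z • v)).1 n) (ball 0 δ) :=
      (h.coef n).comp (f := fun z : ℂ => Y + z • v) (by fun_prop)
        fun z hz => (hm z (by simpa using (mem_ball.1 hz).le)).1
    exact (hd.differentiableAt (ball_mem_nhds 0 hδ)).hasDerivAt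
  let σ : ℕ → ℂ := fun n => (starRingEnd ℂ (D n)) / (‖D n‖ : ℂ)
  have hσ : ∀ n, ‖σ n‖ ≤ 1 := by
    intro n
    simp only [σ, norm_div, RCLike.norm_conj, Complex.norm_real, norm_norm]
    exact div_self_le_one _
  have hσD : ∀ n, σ n * D n = ‖D n‖ := by
    intro n
    rcases eq_or_ne (D n) 0 with h0 | h0
    · simp [h0]
    · have : (‖D n‖ : ℂ) ≠ 0 := by exact_mod_cast norm_ne_zero_iff.2 h0
      simp only [σ]
      rw [div_mul_eq_mul_div, mul_comm, Complex.mul_conj, Complex.normSq_eq_norm_sq]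
      push_cast
      field_simp
  let g : E → ℂ := fun Y => ∑ n ∈ T, σ n * (P.monoWeight n s : ℂ) * (e Y).1 n
  have hg : DifferentiableOn ℂ g Ω :=
    DifferentiableOn.fun_sum fun n _ => (h.coef n).const_mul _
  have hgd : lineDeriv ℂ g Y v = ((∑ n ∈ T, ‖D n‖ * P.monoWeight n s : ℝ) : ℂ) := by
    have := HasDerivAt.fun_sum (u := T) fun n _ =>
      (hda n).const_mul (σ n * (P.monoWeight n s : ℂ))
    refine this.deriv.trans ?_
    push_cast
    refine Finset.sum_congr rfl fun n _ => ?_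
    rw [← hσD]; ring
  have hle := norm_lineDeriv_le hδ hg (fun z hz => (hm z hz).1) (C := δ * C * P.weight 0 l s)
    fun z hz => by
      obtain ⟨h1, h2⟩ := hm z hz.le
      calc ‖g (Y + z • v)‖ ≤ ∑ n ∈ T, ‖(e (Y + z • v)).1 n‖ * P.monoWeight n s := by
            refine (norm_sum_le _ _).trans (Finset.sum_le_sum fun n _ => ?_)
            rw [norm_mul, norm_mul, Complex.norm_real, Real.norm_of_nonneg (P.monoWeight_nonneg _ _)]
            have := hσ n
            have := P.monoWeight_nonneg n s
            calc _ ≤ 1 * P.monoWeight n s * ‖(e (Y + z • v)).1 n‖ := by gcongr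
              _ = _ := by ring
        _ ≤ B (Y + z • v) * P.weight 0 l s := (h.good _ h1).sum_le s hs T
        _ ≤ _ := mul_le_mul_of_nonneg_right h2 (P.weight_nonneg _ _ _)
  rw [hgd, Complex.norm_real, Real.norm_of_nonneg (Finset.sum_nonneg fun n _ =>
    mul_nonneg (norm_nonneg _) (P.monoWeight_nonneg _ _))] at hle
  refine hle.trans (le_of_eq ?_)
  field_simp

/-- The bound at an intermediate radius `exp s` gives a geometric majorant at `ζ`, uniform over the
complex disc in the direction `v`; the series can then be differentiated term by term. -/
lemma hasSum_lineDeriv (h : P.GoodOn Ω l B e) {Y v : E} {δ C : ℝ} (hδ : 0 < δ)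
    (hm : ∀ z : ℂ, ‖z‖ ≤ δ → Y + z • v ∈ Ω ∧ B (Y + z • v) ≤ δ * C) {ζ : ℂ}
    (hζ : ζ ∈ P.sector 0) (hs : ζ.re < P.lam) :
    HasSum (fun n => lineDeriv ℂ (fun Y => (e Y).1 n) Y v * borelMono (P.k 0) n ζ)
      (lineDeriv ℂ (fun Y => (e Y).2 0 ζ) Y v) := by
  obtain ⟨s, hs1, hs2⟩ := exists_between hs
  have hgeo : Summable fun n : ℕ => δ * C * P.weight 0 l s *
      (Real.exp (-P.k 0 * (ζ.re - s)) * Real.exp (ζ.re - s) ^ n) :=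
    ((summable_geometric_of_lt_one (Real.exp_pos _).le
      (by rw [← Real.exp_zero]; exact Real.exp_lt_exp.2 (by linarith))).mul_left _).mul_left _
  have hb : ∀ (n : ℕ) (z : ℂ), z ∈ ball (0 : ℂ) δ →
      ‖(e (Y + z • v)).1 n * borelMono (P.k 0) n ζ‖ ≤ δ * C * P.weight 0 l s *
      (Real.exp (-P.k 0 * (ζ.re - s)) * Real.exp (ζ.re - s) ^ n) := by
    intro n z hz
    obtain ⟨h1, h2⟩ := hm z (by simpa using (mem_ball.1 hz).le)
    have h3 := (h.good _ h1).sum_le s hs2 {n}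
    rw [Finset.sum_singleton] at h3
    rw [norm_mul, P.norm_mono, P.monoWeight_shift n ζ.re s, ← mul_assoc]
    refine mul_le_mul_of_nonneg_right (h3.trans ?_) (by positivity)
    exact mul_le_mul_of_nonneg_right h2 (P.weight_nonneg _ _ _)
  have hd : ∀ n : ℕ, DifferentiableOn ℂ
      (fun z : ℂ => (e (Y + z • v)).1 n * borelMono (P.k 0) n ζ) (ball 0 δ) := fun n =>
    ((h.coef n).comp (f := fun z : ℂ => Y + z • v) (by fun_prop)
        fun z hz => (hm z (by simpa using (mem_ball.1 hz).le)).1).mul_const _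
  have key := Complex.hasSum_deriv_of_summable_norm hgeo hd isOpen_ball hb (mem_ball_self hδ)
  have e1 : deriv (fun z : ℂ => ∑' n, (e (Y + z • v)).1 n * borelMono (P.k 0) n ζ) 0 =
      lineDeriv ℂ (fun Y => (e Y).2 0 ζ) Y v := by
    refine Filter.EventuallyEq.deriv_eq ?_
    filter_upwards [ball_mem_nhds (0 : ℂ) hδ] with z hz
    exact ((h.good _ (hm z (by simpa using (mem_ball.1 hz).le)).1).hasSum ζ hζ hs).tsum_eq
  rw [e1] at key
  simp only [deriv_mul_const_field] at key
  exact key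

/-- On the disc in the direction `v` all Borel functions obey one and the same weight bound, so
differentiation under the acceleration integral is allowed. In grade `0` everything vanishes. -/
lemma accel_lineDeriv (h : P.GoodOn Ω l B e) {Y v : E} {δ C : ℝ} (hδ : 0 < δ)
    (hm : ∀ z : ℂ, ‖z‖ ≤ δ → Y + z • v ∈ Ω ∧ B (Y + z • v) ≤ δ * C)
    (j : Fin q) {φ ψ s : ℝ} (hφ : |φ - P.θ j.castSucc| < P.ε j.castSucc)
    (hψ : |ψ - P.θ j.succ| < P.ε j.succ)
    (hgap : |ψ - φ| < Real.pi / 2 * ((P.k j.castSucc)⁻¹ - (P.k j.succ)⁻¹))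
    (hs : 2 * P.c * Real.exp (accelOrder (P.k j.castSucc) (P.k j.succ) * s) ≤
      accelRate (P.k j.castSucc) (P.k j.succ) (ψ - φ)) :
    lineDeriv ℂ (fun Y => (e Y).2 j.succ (s + ψ * Complex.I)) Y v =
      accel (P.k j.castSucc) (P.k j.succ) φ
        (fun η => lineDeriv ℂ (fun Y => (e Y).2 j.castSucc η) Y v) (s + ψ * Complex.I) := by
  have hm' : ∀ z ∈ ball (0 : ℂ) δ, Y + z • v ∈ Ω ∧ B (Y + z • v) ≤ δ * C := fun z hz =>
    hm z (by simpa using (mem_ball.1 hz).le)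
  have e1 : lineDeriv ℂ (fun Y => (e Y).2 j.succ (s + ψ * Complex.I)) Y v =
      deriv (fun z : ℂ => accel (P.k j.castSucc) (P.k j.succ) φ ((e (Y + z • v)).2 j.castSucc)
        (s + ψ * Complex.I)) 0 := by
    refine Filter.EventuallyEq.deriv_eq ?_
    filter_upwards [ball_mem_nhds (0 : ℂ) hδ] with z hz
    exact (h.good _ (hm' z hz).1).accel_eq j φ ψ s hφ hψ hgap hs
  rw [e1]
  rcases eq_or_ne l 0 with rfl | hl
  · have e2 : ∀ z ∈ ball (0 : ℂ) δ, ∀ t : ℝ,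
        (e (Y + z • v)).2 j.castSucc (t + φ * Complex.I) = 0 := fun z hz t =>
      (h.good _ (hm' z hz).1).brl_eq_zero _ (ray_mem_logSector hφ t)
    have e3 : deriv (fun z : ℂ => accel (P.k j.castSucc) (P.k j.succ) φ
        ((e (Y + z • v)).2 j.castSucc) (s + ψ * Complex.I)) 0 = 0 := by
      have : (fun z : ℂ => accel (P.k j.castSucc) (P.k j.succ) φ
        ((e (Y + z • v)).2 j.castSucc) (s + ψ * Complex.I)) =ᶠ[𝓝 0] fun _ => 0 := by
        filter_upwards [ball_mem_nhds (0 : ℂ) hδ] with z hz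
        simp [accel, e2 z hz]
      rw [this.deriv_eq, deriv_const]
    have e4 : ∀ t : ℝ, lineDeriv ℂ (fun Y => (e Y).2 j.castSucc (t + φ * Complex.I)) Y v = 0 := by
      intro t
      have : (fun z : ℂ => (e (Y + z • v)).2 j.castSucc (t + φ * Complex.I)) =ᶠ[𝓝 0]
          fun _ => 0 := by
        filter_upwards [ball_mem_nhds (0 : ℂ) hδ] with z hz
        exact e2 z hz t
      rw [lineDeriv, this.deriv_eq, deriv_const]
    rw [e3]
    simp [accel, e4]
  · refine deriv_accel (P.pos _) (P.lt j) hl hδ (G := fun z => (e (Y + z • v)).2 j.castSucc)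
      (B := δ * C) (fun z hz => ?_) (fun t => ?_) hgap hs
    · exact ((h.good _ (hm' z hz).1).mono (hm' z hz).2).rayBounded j hφ
    · exact h.differentiableOn_circle (fun z hz => (hm z hz).1) (ray_mem_logSector hφ t)

/-- Directional derivatives of good families, with the Cauchy estimate. -/
theorem dirDeriv [FiniteDimensional ℂ E] (hΩ : IsOpen Ω) (h : P.GoodOn Ω l B e) {v : E}
    (hB' : ContinuousOn B' Ω)
    (hδ : ∀ Y ∈ Ω, ∃ δ > 0, ∀ z : ℂ, ‖z‖ ≤ δ → Y + z • v ∈ Ω ∧ B (Y + z • v) ≤ δ * B' Y) :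
    P.GoodOn Ω l B' (SectorData.dirDeriv v e) := by
  have hbrl : ∀ j, DifferentiableOn ℂ
      (fun p : ℂ × E => (SectorData.dirDeriv v e p.2).2 j p.1) (P.sector j ×ˢ Ω) := by
    intro j
    have := differentiableOn_lineDeriv ((P.isOpen_sector j).prod hΩ) (h.brl j) ((0 : ℂ), v)
    refine this.congr fun p hp => ?_
    simp [SectorData.dirDeriv, lineDeriv]
  refine ⟨fun Y hY => ?_, hB', fun n => differentiableOn_lineDeriv hΩ (h.coef n) v, hbrl⟩
  obtain ⟨δ, hδ0, hm⟩ := hδ Y hY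
  have hnn : 0 ≤ B' Y := by
    have h1 := hm 0 (by simpa using hδ0.le)
    simp only [zero_smul, add_zero] at h1
    have := (h.good Y hY).nonneg.trans h1.2
    exact nonneg_of_mul_nonneg_right this hδ0
  -- Cauchy's estimate on the disc attached to `Y`. Its radius may depend on the point, as bounds
  -- which blow up at the boundary require.
  have hbound : ∀ {f : E → ℂ} {w : ℝ}, DifferentiableOn ℂ f Ω → 0 ≤ w →
      (∀ Z ∈ Ω, ‖f Z‖ ≤ B Z * w) → ‖lineDeriv ℂ f Y v‖ ≤ B' Y * w := by
    intro f w hf hw hle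
    have := norm_lineDeriv_le hδ0 hf (fun z hz => (hm z hz).1) (C := δ * B' Y * w)
      fun z hz => (hle _ (hm z hz.le).1).trans (mul_le_mul_of_nonneg_right (hm z hz.le).2 hw)
    refine this.trans (le_of_eq ?_)
    field_simp
  refine ⟨hnn, fun n hn => ?_, ?_, fun s hs T => h.sum_norm_lineDeriv_le hδ0 hm hs T, fun j => ?_,
    fun j ζ hζ => ?_, fun ζ hζ hs => h.hasSum_lineDeriv hδ0 hm hζ hs,
    fun j φ ψ s hφ hψ hgap hs => h.accel_lineDeriv hδ0 hm j hφ hψ hgap hs⟩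
  · have := hbound (w := 0) (h.coef n) le_rfl fun Z hZ => by
      rw [(h.good Z hZ).coef_eq_zero n hn]; simp
    rw [mul_zero] at this
    exact norm_le_zero_iff.1 this
  · have := hbound (w := 1) (h.coef 0) zero_le_one fun Z hZ => by
      rw [mul_one]; exact (h.good Z hZ).norm_coef_zero
    rwa [mul_one] at this
  · exact (hbrl j).comp (f := fun ζ : ℂ => (ζ, Y)) (by fun_prop) fun ζ hζ => ⟨hζ, hY⟩
  · exact hbound (h.differentiableOn_section' hζ) (P.weight_nonneg _ _ _) fun Z hZ =>
      (h.good Z hZ).norm_le j ζ hζ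

end GoodOn

end SectorData
end

noncomputable section

open MeasureTheory Filter Topology Set Metric
open scoped Interval

/-! ### Formal Taylor expansion of a composition. -/

section TaylorSeries

open PowerSeries

/-- The Taylor series at `0`. -/
def taylorAtZero (F : ℂ → ℂ) : PowerSeries ℂ :=
  PowerSeries.mk fun n => ((n.factorial : ℕ) : ℂ)⁻¹ * iteratedDeriv n F 0

lemma taylorAtZero_congr {F G : ℂ → ℂ} (h : F =ᶠ[𝓝 0] G) : taylorAtZero F = taylorAtZero G := by
  ext n
  simp only [taylorAtZero, coeff_mk]
  rw [h.iteratedDeriv_eq]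

lemma taylorAtZero_mul {F G : ℂ → ℂ} (hF : AnalyticAt ℂ F 0) (hG : AnalyticAt ℂ G 0) :
    taylorAtZero (F * G) = taylorAtZero F * taylorAtZero G := by
  ext n
  rw [coeff_mul]
  simp only [taylorAtZero, coeff_mk]
  rw [iteratedDeriv_mul hF.contDiffAt hG.contDiffAt, Finset.mul_sum,
    Finset.Nat.sum_antidiagonal_eq_sum_range_succ_mk]
  refine Finset.sum_congr rfl fun i hi => ?_
  have hin : i ≤ n := Nat.lt_succ_iff.1 (Finset.mem_range.1 hi)
  have h1 : ((n.choose i : ℕ) : ℂ) * (i.factorial : ℂ) * ((n - i).factorial : ℂ) =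
      (n.factorial : ℂ) := by exact_mod_cast Nat.choose_mul_factorial_mul_factorial hin
  have h2 : (i.factorial : ℂ) ≠ 0 := by exact_mod_cast i.factorial_ne_zero
  have h3 : ((n - i).factorial : ℂ) ≠ 0 := by exact_mod_cast (n - i).factorial_ne_zero
  have h4 : (n.factorial : ℂ) ≠ 0 := by exact_mod_cast n.factorial_ne_zero
  rw [← h1] at h4 ⊢
  have h5 : ((n.choose i : ℕ) : ℂ) ≠ 0 := fun h => h4 (by rw [h]; simp)
  field_simp

lemma taylorAtZero_add {F G : ℂ → ℂ} (hF : AnalyticAt ℂ F 0) (hG : AnalyticAt ℂ G 0) :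
    taylorAtZero (F + G) = taylorAtZero F + taylorAtZero G := by
  ext n
  simp only [taylorAtZero, coeff_mk, map_add]
  rw [iteratedDeriv_add hF.contDiffAt hG.contDiffAt, mul_add]

lemma taylorAtZero_const (a : ℂ) : taylorAtZero (fun _ => a) = C a := by
  ext n
  simp only [taylorAtZero, coeff_mk, coeff_C, iteratedDeriv_const]
  split_ifs with h
  · simp [h]
  · simp

lemma taylorAtZero_sum {ι : Type*} (s : Finset ι) {F : ι → ℂ → ℂ}
    (hF : ∀ i ∈ s, AnalyticAt ℂ (F i) 0) :
    taylorAtZero (∑ i ∈ s, F i) = ∑ i ∈ s, taylorAtZero (F i) := by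
  classical
  induction s using Finset.induction_on with
  | empty =>
    exact (taylorAtZero_const 0).trans (map_zero _)
  | insert a s ha ih =>
    rw [Finset.sum_insert ha, Finset.sum_insert ha, taylorAtZero_add
      (hF a (Finset.mem_insert_self _ _)) (Finset.analyticAt_sum _ fun i hi =>
        hF i (Finset.mem_insert_of_mem hi)), ih fun i hi => hF i (Finset.mem_insert_of_mem hi)]

lemma derivative_taylorAtZero (F : ℂ → ℂ) :
    derivative ℂ (taylorAtZero F) = taylorAtZero (deriv F) := by
  ext n
  rw [coeff_derivative]
  simp only [taylorAtZero, coeff_mk]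
  rw [iteratedDeriv_succ', Nat.factorial_succ]
  have h2 : (n.factorial : ℂ) ≠ 0 := by exact_mod_cast n.factorial_ne_zero
  have h3 : (n : ℂ) + 1 ≠ 0 := by exact_mod_cast Nat.succ_ne_zero n
  push_cast
  field_simp

lemma taylorAtZero_id : taylorAtZero (fun t => t) = X := by
  have h : derivative ℂ (taylorAtZero (fun t => t)) = derivative ℂ X := by
    rw [derivative_taylorAtZero, derivative_X]
    have : deriv (fun t : ℂ => t) = fun _ => 1 := by funext t; simp
    rw [this, taylorAtZero_const, map_one]
  refine derivative.ext h ?_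
  simp [taylorAtZero, ← coeff_zero_eq_constantCoeff_apply]

lemma taylorAtZero_pow (m : ℕ) : taylorAtZero (fun t => t ^ m) = X ^ m := by
  induction m with
  | zero => simpa using taylorAtZero_const 1
  | succ m ih =>
    have : (fun t : ℂ => t ^ (m + 1)) = (fun t => t ^ m) * fun t => t := by
      funext t; simp [pow_succ]
    rw [this, taylorAtZero_mul (by fun_prop) (by fun_prop), ih, taylorAtZero_id, pow_succ]

/-- The polynomial truncation, without constant term, of a power series. -/
def truncFun (p : PowerSeries ℂ) (N : ℕ) (t : ℂ) : ℂ :=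
  ∑ j ∈ Finset.range N, t ^ (j + 1) * coeff (j + 1) p

lemma coeff_taylorAtZero_truncFun {p : PowerSeries ℂ} (hp : constantCoeff p = 0) {N n : ℕ}
    (hn : n ≤ N) : coeff n (taylorAtZero (truncFun p N)) = coeff n p := by
  have h1 : truncFun p N = ∑ j ∈ Finset.range N,
      (fun t : ℂ => t ^ (j + 1)) * fun _ => coeff (j + 1) p := by
    funext t; simp [truncFun]
  rw [h1, taylorAtZero_sum _ fun i _ => by
    refine AnalyticAt.mul ?_ ?_ <;> fun_prop]
  have h2 : ∀ j ∈ Finset.range N, taylorAtZero ((fun t : ℂ => t ^ (j + 1)) *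
      fun _ => coeff (j + 1) p) = X ^ (j + 1) * C (coeff (j + 1) p) := by
    intro j _
    rw [taylorAtZero_mul (by fun_prop) (by fun_prop), taylorAtZero_pow, taylorAtZero_const]
  rw [Finset.sum_congr rfl h2, map_sum]
  simp only [coeff_mul_C, coeff_X_pow]
  rcases n with _ | n
  · rw [coeff_zero_eq_constantCoeff_apply, hp]
    simp
  · rw [Finset.sum_eq_single n]
    · simp
    · intro j _ hj
      rw [if_neg (by omega), zero_mul]
    · intro h
      simp only [Finset.mem_range, not_lt] at h
      omega

lemma differentiable_truncFun (p : PowerSeries ℂ) (N : ℕ) : Differentiable ℂ (truncFun p N) := by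
  unfold truncFun; fun_prop

lemma truncFun_zero (p : PowerSeries ℂ) (N : ℕ) : truncFun p N 0 = 0 := by
  simp [truncFun]

end TaylorSeries

section TaylorTerms

open PowerSeries

variable {E : Type*} [NormedAddCommGroup E] [NormedSpace ℂ E]
variable {ι : Type*} [Fintype ι]

/-- The term of degree `d` in the expansion of `g (Y + ∑ p_i b_i)`. -/
def taylorTerm (b : ι → E) (p : ι → PowerSeries ℂ) : ℕ → (E → ℂ) → E → PowerSeries ℂ
  | 0, g, Y => C (g Y)
  | d + 1, g, Y => C (((d : ℂ) + 1)⁻¹) *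
      ∑ i, p i * taylorTerm b p d (fun Z => lineDeriv ℂ g Z (b i)) Y

/-- The term of degree `d` in the expansion of `∑ t ^ n f_n (Y + ∑ p_i b_i)`. -/
def jetTerm (b : ι → E) (p : ι → PowerSeries ℂ) : ℕ → (ℕ → E → ℂ) → E → PowerSeries ℂ
  | 0, f, Y => PowerSeries.mk fun n => f n Y
  | d + 1, f, Y => C (((d : ℂ) + 1)⁻¹) *
      ∑ i, p i * jetTerm b p d (fun n Z => lineDeriv ℂ (f n) Z (b i)) Y

variable {b : ι → E} {p : ι → PowerSeries ℂ}

lemma taylorTerm_congr {Ω : Set E} (hΩ : IsOpen Ω) (d : ℕ) {g g' : E → ℂ} (h : EqOn g g' Ω) {Y : E}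
    (hY : Y ∈ Ω) : taylorTerm b p d g Y = taylorTerm b p d g' Y := by
  induction d generalizing g g' with
  | zero => simp only [taylorTerm]; rw [h hY]
  | succ d ih =>
    simp only [taylorTerm]
    congr 1
    refine Finset.sum_congr rfl fun i _ => ?_
    rw [ih fun Z hZ => lineDeriv_congr_of_eqOn hΩ h hZ (b i)]

lemma jetTerm_congr {Ω : Set E} (hΩ : IsOpen Ω) (d : ℕ) {f f' : ℕ → E → ℂ}
    (h : ∀ n, EqOn (f n) (f' n) Ω) {Y : E}
    (hY : Y ∈ Ω) : jetTerm b p d f Y = jetTerm b p d f' Y := by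
  induction d generalizing f f' with
  | zero =>
    simp only [jetTerm]
    congr 1
    funext n
    exact h n hY
  | succ d ih =>
    simp only [jetTerm]
    congr 1
    refine Finset.sum_congr rfl fun i _ => ?_
    rw [ih fun n Z hZ => lineDeriv_congr_of_eqOn hΩ (h n) hZ (b i)]

/-- Each of the `d` factors `p i` is divisible by `X`, so only finitely many degrees `d` contribute
to a given coefficient. -/
lemma coeff_taylorTerm_eq_zero (hp : ∀ i, constantCoeff (p i) = 0) {d M : ℕ} (hM : M < d)
    (g : E → ℂ) (Y : E) : coeff M (taylorTerm b p d g Y) = 0 := by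
  have : X ^ d ∣ taylorTerm b p d g Y := by
    clear hM
    induction d generalizing g with
    | zero => simp
    | succ d ih =>
      simp only [taylorTerm]
      refine Dvd.dvd.mul_left (Finset.dvd_sum fun i _ => ?_) _
      rw [pow_succ, mul_comm]
      exact mul_dvd_mul (X_dvd_iff.2 (hp i)) (ih _)
  exact (X_pow_dvd_iff.1 this) M hM

lemma coeff_mul_congr {a a' c c' : PowerSeries ℂ} {N : ℕ} (h : ∀ M ≤ N, coeff M a = coeff M a')
    (h' : ∀ M ≤ N, coeff M c = coeff M c') : ∀ M ≤ N, coeff M (a * c) = coeff M (a' * c') := by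
  intro M hM
  rw [coeff_mul, coeff_mul]
  refine Finset.sum_congr rfl fun x hx => ?_
  have := Finset.HasAntidiagonal.mem_antidiagonal.1 hx
  rw [h _ (by omega), h' _ (by omega)]

lemma coeff_taylorTerm_congr {p' : ι → PowerSeries ℂ} {N : ℕ}
    (h : ∀ i, ∀ M ≤ N, coeff M (p i) = coeff M (p' i)) (d : ℕ) (g : E → ℂ) (Y : E) :
    ∀ M ≤ N, coeff M (taylorTerm b p d g Y) = coeff M (taylorTerm b p' d g Y) := by
  induction d generalizing g with
  | zero => intro M _; rfl
  | succ d ih =>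
    simp only [taylorTerm]
    refine coeff_mul_congr (fun _ _ => rfl) fun M hM => ?_
    rw [map_sum, map_sum]
    exact Finset.sum_congr rfl fun i _ => coeff_mul_congr (h i) (ih _) M hM

lemma coeff_jetTerm (d : ℕ) (f : ℕ → E → ℂ) (Y : E) (N : ℕ) : ∀ M ≤ N,
    coeff M (jetTerm b p d f Y) =
      coeff M (∑ n ∈ Finset.range (N + 1), X ^ n * taylorTerm b p d (f n) Y) := by
  induction d generalizing f with
  | zero =>
    intro M hM
    simp only [jetTerm, taylorTerm, coeff_mk, map_sum, coeff_mul_C, coeff_X_pow]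
    rw [Finset.sum_eq_single M]
    · simp
    · intro n _ hn
      rw [if_neg (Ne.symm hn), zero_mul]
    · intro h
      simp only [Finset.mem_range, not_lt] at h
      omega
  | succ d ih =>
    intro M hM
    have e : ∑ n ∈ Finset.range (N + 1), X ^ n * taylorTerm b p (d + 1) (f n) Y =
        C (((d : ℂ) + 1)⁻¹) * ∑ i, p i * ∑ n ∈ Finset.range (N + 1),
          X ^ n * taylorTerm b p d (fun Z => lineDeriv ℂ (f n) Z (b i)) Y := by
      simp only [taylorTerm, Finset.mul_sum]
      rw [Finset.sum_comm]
      refine Finset.sum_congr rfl fun i _ => Finset.sum_congr rfl fun n _ => ?_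
      ring
    rw [e]
    simp only [jetTerm]
    refine coeff_mul_congr (fun _ _ => rfl) (fun M hM => ?_) M hM
    rw [map_sum, map_sum]
    exact Finset.sum_congr rfl fun i _ => coeff_mul_congr (fun _ _ => rfl) (ih _) M hM

lemma coeff_jetTerm_succ (d : ℕ) (f : ℕ → E → ℂ) (Y : E) (M : ℕ) :
    coeff M (jetTerm b p (d + 1) f Y) = ((d : ℂ) + 1)⁻¹ *
      ∑ i, ∑ x ∈ Finset.HasAntidiagonal.antidiagonal M, coeff x.1 (p i) *
        coeff x.2 (jetTerm b p d (fun n Z => lineDeriv ℂ (f n) Z (b i)) Y) := by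
  rw [jetTerm, coeff_C_mul, map_sum]
  simp only [coeff_mul]

lemma coeff_jetTerm_congr {p' : ι → PowerSeries ℂ} {N : ℕ}
    (h : ∀ i, ∀ M ≤ N, coeff M (p i) = coeff M (p' i)) (d : ℕ) (f : ℕ → E → ℂ) (Y : E) :
    ∀ M ≤ N, coeff M (jetTerm b p d f Y) = coeff M (jetTerm b p' d f Y) := by
  induction d generalizing f with
  | zero => intro M _; rfl
  | succ d ih =>
    simp only [jetTerm]
    refine coeff_mul_congr (fun _ _ => rfl) fun M hM => ?_
    rw [map_sum, map_sum]
    exact Finset.sum_congr rfl fun i _ => coeff_mul_congr (h i) (ih _) M hM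

variable [FiniteDimensional ℂ E]

/-- In the induction step the inner terms give `d + 1` copies of the sum, because directional
derivatives commute, and the outer factors `p i` give one more. The total of `d + 2` copies is
cancelled by the prefactor. -/
lemma derivative_taylorTerm_succ {Ω : Set E} (hΩ : IsOpen Ω) (d : ℕ) {g : E → ℂ}
    (hg : DifferentiableOn ℂ g Ω) {Y : E} (hY : Y ∈ Ω) :
    derivative ℂ (taylorTerm b p (d + 1) g Y) =
      ∑ i, taylorTerm b p d (fun Z => lineDeriv ℂ g Z (b i)) Y * derivative ℂ (p i) := by
  induction d generalizing g with
  | zero =>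
    simp [taylorTerm, Derivation.leibniz, smul_eq_mul]
  | succ d ih =>
    have hd : ∀ i, DifferentiableOn ℂ (fun Z => lineDeriv ℂ g Z (b i)) Ω := fun i =>
      differentiableOn_lineDeriv hΩ hg (b i)
    have e1 : ∑ i, p i * ∑ j, taylorTerm b p d
        (fun Z => lineDeriv ℂ (fun W => lineDeriv ℂ g W (b i)) Z (b j)) Y * derivative ℂ (p j) =
        ((d : PowerSeries ℂ) + 1) * ∑ j, taylorTerm b p (d + 1) (fun Z => lineDeriv ℂ g Z (b j)) Y *
          derivative ℂ (p j) := by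
      have hC : ((d : PowerSeries ℂ) + 1) * C (((d : ℂ) + 1)⁻¹) = 1 := by
        have h3 : (d : ℂ) + 1 ≠ 0 := by exact_mod_cast Nat.succ_ne_zero d
        have : ((d : PowerSeries ℂ) + 1) = C ((d : ℂ) + 1) := by simp
        rw [this, ← map_mul, mul_inv_cancel₀ h3, map_one]
      simp only [Finset.mul_sum]
      rw [Finset.sum_comm]
      refine Finset.sum_congr rfl fun j _ => ?_
      rw [← mul_assoc]
      conv_rhs => rw [taylorTerm, ← mul_assoc, hC, one_mul, Finset.sum_mul]
      refine Finset.sum_congr rfl fun i _ => ?_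
      rw [taylorTerm_congr hΩ d (fun Z hZ => lineDeriv_comm hΩ hg hZ (b i) (b j)) hY]
      ring
    rw [taylorTerm, Derivation.leibniz, derivative_C, map_sum]
    simp only [Derivation.leibniz, smul_eq_mul, ih (hd _), mul_zero, add_zero]
    rw [Finset.sum_add_distrib, e1]
    have h3 : ((d + 1 : ℕ) : ℂ) + 1 ≠ 0 := by exact_mod_cast Nat.succ_ne_zero (d + 1)
    have hC : C ((((d + 1 : ℕ) : ℂ) + 1)⁻¹) * ((d : PowerSeries ℂ) + 1 + 1) = 1 := by
      have : ((d : PowerSeries ℂ) + 1 + 1) = C (((d + 1 : ℕ) : ℂ) + 1) := by simp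
      rw [this, ← map_mul, inv_mul_cancel₀ h3, map_one]
    have e2 : ∀ S : PowerSeries ℂ, ((d : PowerSeries ℂ) + 1) * S + S =
      ((d : PowerSeries ℂ) + 1 + 1) * S := fun S => by ring
    rw [e2, ← mul_assoc, hC, one_mul]

/-- The formal Taylor formula for `g (Y + ∑ P_i b_i)`. -/
theorem coeff_taylorAtZero_comp {Ω : Set E} (hΩ : IsOpen Ω) {P : ι → ℂ → ℂ}
    (hP : ∀ i, Differentiable ℂ (P i)) (hP0 : ∀ i, P i 0 = 0) {Y : E} (hY : Y ∈ Ω)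
    {g : E → ℂ} (hg : DifferentiableOn ℂ g Ω) (M D : ℕ) (hMD : M ≤ D) :
    coeff M (taylorAtZero fun t => g (Y + ∑ i, P i t • b i)) =
      ∑ d ∈ Finset.range (D + 1), coeff M (taylorTerm b (fun i => taylorAtZero (P i)) d g Y) := by
  set p : ι → PowerSeries ℂ := fun i => taylorAtZero (P i) with hp
  have hp0 : ∀ i, constantCoeff (p i) = 0 := by
    intro i
    simp [hp, taylorAtZero, hP0, ← coeff_zero_eq_constantCoeff_apply]
  set γ : ℂ → E := fun t => Y + ∑ i, P i t • b i with hγ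
  have hγd : Differentiable ℂ γ := by
    exact (differentiable_const _).add (Differentiable.fun_sum fun i _ => (hP i).smul_const _)
  have hγ0 : γ 0 = Y := by simp [hγ, hP0]
  have hev : ∀ᶠ t in 𝓝 (0 : ℂ), γ t ∈ Ω :=
    hγd.continuous.continuousAt.eventually_mem (by rw [hγ0]; exact hΩ.mem_nhds hY)
  have hana : ∀ {g : E → ℂ}, DifferentiableOn ℂ g Ω → AnalyticAt ℂ (fun t => g (γ t)) 0 := by
    intro g hg
    refine DifferentiableOn.analyticAt (s := {t | γ t ∈ Ω}) ?_ hev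
    exact hg.comp hγd.differentiableOn fun t ht => ht
  induction M using Nat.strong_induction_on generalizing g D with
  | _ M ih =>
  rcases M with _ | M
  · rw [Finset.sum_eq_single 0]
    · simp [taylorAtZero, taylorTerm, hP0]
    · intro d _ hd
      exact coeff_taylorTerm_eq_zero hp0 (Nat.pos_of_ne_zero hd) g Y
    · simp
  · obtain ⟨D, rfl⟩ : ∃ D', D = D' + 1 := ⟨D - 1, by omega⟩
    have hM1 : ((M : ℂ) + 1) ≠ 0 := by exact_mod_cast Nat.succ_ne_zero M
    -- A coefficient of positive index is read off from the derivative. The chain rule and its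
    -- formal counterpart express both sides by the same quantities for the functions `∂_i g`, at a
    -- smaller index.
    refine mul_right_cancel₀ hM1 ?_
    have hd : ∀ i, DifferentiableOn ℂ (fun Z => lineDeriv ℂ g Z (b i)) Ω := fun i =>
      differentiableOn_lineDeriv hΩ hg (b i)
    have hder : deriv (fun t => g (γ t)) =ᶠ[𝓝 0]
        ∑ i, (fun t => lineDeriv ℂ g (γ t) (b i)) * deriv (P i) := by
      filter_upwards [hev] with t ht
      have h1 : HasFDerivAt g (fderiv ℂ g (γ t)) (γ t) :=
        (hg.differentiableAt (hΩ.mem_nhds ht)).hasFDerivAt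
      have h2 : HasDerivAt γ (∑ i, deriv (P i) t • b i) t := by
        refine HasDerivAt.const_add _ (HasDerivAt.fun_sum fun i _ => ?_)
        exact ((hP i) t).hasDerivAt.smul_const _
      have h3 := (h1.comp_hasDerivAt t h2).deriv
      change deriv (fun t => g (γ t)) t = _ at h3
      rw [h3, map_sum]
      simp only [Finset.sum_apply, Pi.mul_apply, map_smul, smul_eq_mul]
      refine Finset.sum_congr rfl fun i _ => ?_
      rw [lineDeriv_eq_fderiv_of_open hΩ hg ht]
      ring
    have hPa : ∀ i, AnalyticAt ℂ (deriv (P i)) 0 := fun i =>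
      ((hP i).analyticAt 0).deriv
    have hL : derivative ℂ (taylorAtZero fun t => g (γ t)) =
        ∑ i, taylorAtZero (fun t => lineDeriv ℂ g (γ t) (b i)) * derivative ℂ (p i) := by
      rw [derivative_taylorAtZero, taylorAtZero_congr hder,
        taylorAtZero_sum _ fun i _ => (hana (hd i)).mul (hPa i)]
      refine Finset.sum_congr rfl fun i _ => ?_
      rw [taylorAtZero_mul (hana (hd i)) (hPa i), hp, derivative_taylorAtZero]
    rw [← coeff_derivative, hL, Finset.sum_mul, Finset.sum_range_succ']
    have e0 : coeff (M + 1) (taylorTerm b p 0 g Y) * ((M : ℂ) + 1) = 0 := by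
      simp [taylorTerm]
    rw [e0, add_zero, map_sum]
    have e1 : ∀ d ∈ Finset.range (D + 1),
        coeff (M + 1) (taylorTerm b p (d + 1) g Y) * ((M : ℂ) + 1) =
        ∑ i, ∑ x ∈ Finset.HasAntidiagonal.antidiagonal M,
          coeff x.1 (taylorTerm b p d (fun Z => lineDeriv ℂ g Z (b i)) Y) *
            coeff x.2 (derivative ℂ (p i)) := by
      intro d _
      rw [← coeff_derivative, derivative_taylorTerm_succ hΩ d hg hY, map_sum]
      exact Finset.sum_congr rfl fun i _ => coeff_mul _ _ _
    rw [Finset.sum_congr rfl e1, Finset.sum_comm]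
    refine Finset.sum_congr rfl fun i _ => ?_
    rw [coeff_mul, Finset.sum_comm]
    refine Finset.sum_congr rfl fun x hx => ?_
    have hx' := Finset.HasAntidiagonal.mem_antidiagonal.1 hx
    rw [← Finset.sum_mul]
    congr 1
    exact ih x.1 (by omega) (hd i) D (by omega)

/-- Coefficients up to degree `N` do not distinguish the series `p i` from the truncations used by
`formalSubst`, and terms of degree `d > N` cannot contribute. -/
theorem formalSubst_eq_sum_jetTerm {Ω : Set E} (hΩ : IsOpen Ω) {f : ℕ → E → ℂ}
    (hf : ∀ n, DifferentiableOn ℂ (f n) Ω) {Y : E} (hY : Y ∈ Ω) {Z : ℕ → E}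
    (hp : ∀ i, constantCoeff (p i) = 0) (h0 : Z 0 = Y)
    (hZ : ∀ j, Z (j + 1) = ∑ i, coeff (j + 1) (p i) • b i) (N : ℕ) :
    formalSubst f Z N = ∑ d ∈ Finset.range (N + 1), coeff N (jetTerm b p d f Y) := by
  have e1 : ∀ t : ℂ, ∑ j ∈ Finset.range (N + 1), t ^ j • Z j =
      Y + ∑ i, truncFun (p i) N t • b i := by
    intro t
    rw [Finset.sum_range_succ', add_comm]
    simp only [pow_zero, one_smul, h0, hZ, truncFun, Finset.smul_sum, Finset.sum_smul, smul_smul]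
    rw [Finset.sum_comm]
  have e2 : ∀ d ∈ Finset.range (N + 1), coeff N (jetTerm b p d f Y) =
      ∑ n ∈ Finset.range (N + 1), coeff (N - n) (taylorTerm b p d (f n) Y) := by
    intro d _
    rw [coeff_jetTerm d f Y N N le_rfl, map_sum]
    refine Finset.sum_congr rfl fun n hn => ?_
    rw [coeff_X_pow_mul', if_pos (Nat.lt_succ_iff.1 (Finset.mem_range.1 hn))]
  rw [Finset.sum_congr rfl e2, Finset.sum_comm]
  refine Finset.sum_congr rfl fun n hn => ?_
  have h := coeff_taylorAtZero_comp (b := b) hΩ (P := fun i => truncFun (p i) N)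
    (fun i => differentiable_truncFun (p i) N) (fun i => truncFun_zero (p i) N) hY (hf n)
    (N - n) N (Nat.sub_le _ _)
  simp only [e1]
  rw [taylorAtZero, coeff_mk] at h
  rw [h]
  refine Finset.sum_congr rfl fun d _ => ?_
  exact coeff_taylorTerm_congr (N := N)
    (fun i M hM => coeff_taylorAtZero_truncFun (hp i) hM) d (f n) Y _ (Nat.sub_le _ _)

lemma differentiableOn_coeff_jetTerm {Ω : Set E} (hΩ : IsOpen Ω) {p : E → ι → PowerSeries ℂ}
    {N : ℕ} (hp : ∀ i, ∀ j ≤ N, DifferentiableOn ℂ (fun Y => coeff j (p Y i)) Ω) (d : ℕ)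
    {f : ℕ → E → ℂ} (hf : ∀ n, DifferentiableOn ℂ (f n) Ω) :
    ∀ M ≤ N, DifferentiableOn ℂ (fun Y => coeff M (jetTerm b (p Y) d f Y)) Ω := by
  induction d generalizing f with
  | zero =>
    intro M _
    simpa only [jetTerm, coeff_mk] using hf M
  | succ d ih =>
    intro M hM
    simp only [coeff_jetTerm_succ]
    refine DifferentiableOn.const_mul (DifferentiableOn.fun_sum fun i _ =>
      DifferentiableOn.fun_sum fun x hx => ?_) _
    have := Finset.HasAntidiagonal.mem_antidiagonal.1 hx
    exact (hp i _ (by omega)).mul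
      (ih (fun n => differentiableOn_lineDeriv hΩ (hf n) (b i)) _ (by omega))

/-- The series `p` is held fixed, so only `f` is differentiated; `v` is moved past the inner
directions by commutation of derivatives. -/
lemma hasDerivAt_coeff_jetTerm {Ω : Set E} (hΩ : IsOpen Ω) (d : ℕ)
    {f : ℕ → E → ℂ} (hf : ∀ n, DifferentiableOn ℂ (f n) Ω) {Y : E} (hY : Y ∈ Ω) (v : E) (M : ℕ) :
    HasDerivAt (fun z : ℂ => coeff M (jetTerm b p d f (Y + z • v)))
      (coeff M (jetTerm b p d (fun n Z => lineDeriv ℂ (f n) Z v) Y)) 0 := by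
  induction d generalizing f M with
  | zero =>
    simp only [jetTerm, coeff_mk]
    exact ((hf M).differentiableAt (hΩ.mem_nhds hY)).lineDifferentiableAt.hasLineDerivAt
  | succ d ih =>
    simp only [coeff_jetTerm_succ]
    refine HasDerivAt.const_mul _ (HasDerivAt.fun_sum fun i _ => HasDerivAt.fun_sum fun x _ =>
      HasDerivAt.const_mul _ ?_)
    rw [jetTerm_congr hΩ d (fun n Z hZ => lineDeriv_comm hΩ (hf n) hZ v (b i)) hY]
    exact ih (fun n => differentiableOn_lineDeriv hΩ (hf n) (b i)) x.2

end TaylorTerms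
end

/-! ### The formal Cauchy problem as a recursion. -/

noncomputable section

open MeasureTheory Filter Topology Set Metric
open scoped Interval

/-- A map of sequences whose `n`-th component depends only on the terms of index `< n` of its
argument has a fixed point. -/
lemma exists_causal_fixedPoint {α : Type*} [Inhabited α] (T : (ℕ → α) → ℕ → α)
    (hT : ∀ u u' n, (∀ k < n, u k = u' k) → T u n = T u' n) : ∃ u, ∀ n, u n = T u n := by
  -- The `n`-th component of the iterates is stationary from the iterate of order `n + 1` on.
  have key : ∀ n N M, n < N → n < M → T^[N] default n = T^[M] default n := by
    intro n
    induction n using Nat.strong_induction_on with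
    | _ n ih =>
      intro N M hN hM
      obtain ⟨N, rfl⟩ : ∃ N', N = N' + 1 := ⟨N - 1, by omega⟩
      obtain ⟨M, rfl⟩ : ∃ M', M = M' + 1 := ⟨M - 1, by omega⟩
      rw [Function.iterate_succ_apply', Function.iterate_succ_apply']
      exact hT _ _ n fun k hk => ih k hk N M (by omega) (by omega)
  refine ⟨fun n => T^[n + 1] default n, fun n => ?_⟩
  change T^[n + 1] default n = _
  rw [Function.iterate_succ_apply']
  exact hT _ _ n fun k hk => key k _ _ hk (by omega)

section FormalSolution

open PowerSeries

variable {m n : ℕ}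

/-- The space of the variables `(x, U, P)`. -/
abbrev JetSpace (m n : ℕ) := (Fin n → ℂ) × (Fin m → ℂ) × (Fin m → Fin n → ℂ)

/-- Indices of the coordinates of `(U, P)`. -/
abbrev JetIndex (m n : ℕ) := Fin m ⊕ (Fin m × Fin n)

/-- Coordinate directions of `(U, P)`. -/
def jetDir : JetIndex m n → JetSpace m n
  | .inl i => (0, Pi.single i 1, 0)
  | .inr (i, c) => (0, 0, Pi.single i (Pi.single c 1))

/-- The formal series `u_i(t, x)` and `∂_{x_c} u_i(t, x)`. -/
def jetSeries (u : Fin m → ℕ → (Fin n → ℂ) → ℂ) (x : Fin n → ℂ) : JetIndex m n → PowerSeries ℂ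
  | .inl i => PowerSeries.mk fun N => u i N x
  | .inr (i, c) => PowerSeries.mk fun N => lineDeriv ℂ (u i N) x (Pi.single c 1)

/-- The base point `(x, 0, 0)`. -/
def jetBase (x : Fin n → ℂ) : JetSpace m n := (x, 0, 0)

variable {U : Set (Fin n → ℂ)} {Ω : Set (JetSpace m n)}
variable {f : Fin m → ℕ → JetSpace m n → ℂ} {u u' : Fin m → ℕ → (Fin n → ℂ) → ℂ}

lemma sum_jetDir (a : JetIndex m n → ℂ) : ∑ i, a i • (jetDir i : JetSpace m n) =
    (0, fun i => a (.inl i), fun i c => a (.inr (i, c))) := by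
  classical
  rw [Fintype.sum_sum_type]
  refine Prod.ext ?_ (Prod.ext ?_ ?_)
  · simp [jetDir, Prod.fst_sum]
  · funext i
    simp [jetDir, Prod.fst_sum, Prod.snd_sum, Finset.sum_apply, Pi.single_apply]
  · funext i c
    simp only [jetDir, Prod.snd_sum, Prod.snd_add, Finset.sum_apply, Pi.add_apply, Prod.smul_snd,
      Pi.smul_apply, smul_zero, Pi.zero_apply, Finset.sum_const_zero, zero_add]
    rw [Finset.sum_eq_single (i, c)]
    · simp
    · rintro ⟨i', c'⟩ _ h
      by_cases hi : i = i'
      · subst hi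
        have : c ≠ c' := fun h' => h (by rw [h'])
        simp [this]
      · simp [hi]
    · simp

lemma lineDeriv_eq_zero_of_eqOn_zero (hU : IsOpen U) {g : (Fin n → ℂ) → ℂ} (hg : ∀ x ∈ U, g x = 0)
    {x : Fin n → ℂ} (hx : x ∈ U) (v : Fin n → ℂ) : lineDeriv ℂ g x v = 0 := by
  rw [lineDeriv_congr_of_eqOn hU (g := fun _ => 0) hg hx v]
  simp [lineDeriv]

lemma constantCoeff_jetSeries (hU : IsOpen U) (h0 : ∀ i, ∀ x ∈ U, u i 0 x = 0) {x : Fin n → ℂ}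
    (hx : x ∈ U) (i : JetIndex m n) : constantCoeff (jetSeries u x i) = 0 := by
  rcases i with i | ⟨i, c⟩
  · simpa [jetSeries, ← coeff_zero_eq_constantCoeff_apply] using h0 i x hx
  · simpa [jetSeries, ← coeff_zero_eq_constantCoeff_apply] using
      lineDeriv_eq_zero_of_eqOn_zero hU (h0 i) hx _

theorem formalSubst_jetCoeff (hU : IsOpen U) (hΩ : IsOpen Ω) {f : ℕ → JetSpace m n → ℂ}
    (hf : ∀ N, DifferentiableOn ℂ (f N) Ω) (hu : ∀ i N, DifferentiableOn ℂ (u i N) U)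
    (h0 : ∀ i, ∀ x ∈ U, u i 0 x = 0) {x : Fin n → ℂ} (hx : x ∈ U) (hxΩ : jetBase x ∈ Ω) (N : ℕ) :
    formalSubst f (jetCoeff u x) N = ∑ d ∈ Finset.range (N + 1),
      coeff N (jetTerm jetDir (jetSeries u x) d f (jetBase x)) := by
  refine formalSubst_eq_sum_jetTerm hΩ hf hxΩ (fun i => constantCoeff_jetSeries hU h0 hx i) ?_ ?_ N
  · refine Prod.ext (by simp [jetCoeff, jetBase]) (Prod.ext ?_ ?_)
    · funext i
      exact h0 i x hx
    · funext i c
      change fderiv ℂ (u i 0) x (Pi.single c 1) = 0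
      rw [← lineDeriv_eq_fderiv_of_open hU (hu i 0) hx]
      exact lineDeriv_eq_zero_of_eqOn_zero hU (h0 i) hx _
  · intro j
    rw [sum_jetDir]
    refine Prod.ext (by simp [jetCoeff]) (Prod.ext ?_ ?_)
    · funext i
      simp [jetCoeff, jetSeries]
    · funext i c
      simp only [jetCoeff, jetSeries, coeff_mk]
      rw [lineDeriv_eq_fderiv_of_open hU (hu i _) hx]

lemma coeff_jetSeries_congr (hU : IsOpen U) {N : ℕ}
    (h : ∀ i, ∀ j ≤ N, EqOn (u i j) (u' i j) U) {x : Fin n → ℂ} (hx : x ∈ U) (i : JetIndex m n) :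
    ∀ j ≤ N, coeff j (jetSeries u x i) = coeff j (jetSeries u' x i) := by
  intro j hj
  rcases i with i | ⟨i, c⟩
  · simpa [jetSeries] using h i j hj hx
  · simpa [jetSeries] using lineDeriv_congr_of_eqOn hU (h i j hj) hx _

lemma differentiableOn_coeff_jetSeries (hU : IsOpen U) {N : ℕ}
    (h : ∀ i, ∀ j ≤ N, DifferentiableOn ℂ (u i j) U) (i : JetIndex m n) :
    ∀ j ≤ N, DifferentiableOn ℂ (fun x => coeff j (jetSeries u x i)) U := by
  intro j hj
  rcases i with i | ⟨i, c⟩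
  · simpa [jetSeries] using h i j hj
  · simpa [jetSeries] using differentiableOn_lineDeriv hU (h i j hj) _

/-- The formal Cauchy problem, in terms of the Taylor expansions at `(x, 0, 0)`. -/
structure IsJetSolution (U : Set (Fin n → ℂ)) (f : Fin m → ℕ → JetSpace m n → ℂ)
    (u : Fin m → ℕ → (Fin n → ℂ) → ℂ) : Prop where
  holomorphic : ∀ i N, DifferentiableOn ℂ (u i N) U
  initial : ∀ i, ∀ x ∈ U, u i 0 x = 0
  equation : ∀ (i : Fin m) (N : ℕ), ∀ x ∈ U, ((N : ℂ) + 1) * u i (N + 1) x = ∑ d ∈ Finset.range (N + 1),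
      coeff N (jetTerm jetDir (jetSeries u x) d (f i) (jetBase x))

theorem isFormalSolution_iff_isJetSolution (hU : IsOpen U) (hΩ : IsOpen Ω)
    (hf : ∀ i N, DifferentiableOn ℂ (f i N) Ω) (hUΩ : ∀ x ∈ U, jetBase x ∈ Ω) :
    IsFormalSolution U f u ↔ IsJetSolution U f u := by
  constructor
  · intro h
    refine ⟨h.holomorphic, h.initial, fun i N x hx => ?_⟩
    rw [h.equation i N x hx,
      formalSubst_jetCoeff hU hΩ (hf i) h.holomorphic h.initial hx (hUΩ x hx)]
  · intro h
    refine ⟨h.holomorphic, h.initial, fun i N x hx => ?_⟩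
    rw [h.equation i N x hx,
      formalSubst_jetCoeff hU hΩ (hf i) h.holomorphic h.initial hx (hUΩ x hx)]

lemma IsJetSolution.mono (h : IsJetSolution U f u) {U' : Set (Fin n → ℂ)} (hU' : U' ⊆ U) :
    IsJetSolution U' f u :=
  ⟨fun i N => (h.holomorphic i N).mono hU', fun i x hx => h.initial i x (hU' hx),
    fun i N x hx => h.equation i N x (hU' hx)⟩

/-- The right-hand side at index `N` involves only the coefficients of index at most `N` and their
derivatives, so it determines the coefficient of index `N + 1`. -/
theorem IsJetSolution.eqOn (hU : IsOpen U) (h : IsJetSolution U f u) (h' : IsJetSolution U f u')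
    (N : ℕ) : ∀ i, EqOn (u i N) (u' i N) U := by
  induction N using Nat.strong_induction_on with
  | _ N ih =>
    intro i x hx
    rcases N with _ | N
    · rw [h.initial i x hx, h'.initial i x hx]
    · have hN : ((N : ℂ) + 1) ≠ 0 := by exact_mod_cast Nat.succ_ne_zero N
      refine mul_left_cancel₀ hN ?_
      rw [h.equation i N x hx, h'.equation i N x hx]
      refine Finset.sum_congr rfl fun d _ => ?_
      exact coeff_jetTerm_congr (fun j => coeff_jetSeries_congr hU
        (fun i j hj => ih j (by omega) i) hx j) d (f i) _ N le_rfl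

/-- The recursion is causal, hence solvable for arbitrary functions; holomorphy of the solution is
established afterwards, by induction on the index. -/
theorem exists_isJetSolution (hU : IsOpen U) (hΩ : IsOpen Ω)
    (hf : ∀ i N, DifferentiableOn ℂ (f i N) Ω) (hUΩ : ∀ x ∈ U, jetBase x ∈ Ω) :
    ∃ u, IsJetSolution U f u := by
  let T : (ℕ → Fin m → (Fin n → ℂ) → ℂ) → ℕ → Fin m → (Fin n → ℂ) → ℂ := fun u N =>
    match N with
    | 0 => 0
    | N + 1 => fun i x => ((N : ℂ) + 1)⁻¹ * ∑ d ∈ Finset.range (N + 1),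
      coeff N (jetTerm jetDir (jetSeries (fun i N => u N i) x) d (f i) (jetBase x))
  obtain ⟨u, hu⟩ := exists_causal_fixedPoint T (by
    intro u u' N h
    rcases N with _ | N
    · rfl
    · funext i x
      simp only [T]
      congr 1
      refine Finset.sum_congr rfl fun d _ => ?_
      refine coeff_jetTerm_congr (fun j => coeff_jetSeries_congr isOpen_univ
        (fun i j hj => ?_) (mem_univ x) j) d (f i) _ N le_rfl
      intro y _
      rw [h j (by omega)])
  have hd : ∀ N i, DifferentiableOn ℂ (u N i) U := by
    intro N
    induction N using Nat.strong_induction_on with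
    | _ N ih =>
      intro i
      rw [hu]
      rcases N with _ | N
      · exact differentiableOn_const 0
      · refine DifferentiableOn.const_mul (DifferentiableOn.fun_sum fun d _ => ?_) _
        -- The jet terms differentiate `f` in the variables `(U, P)`, so holomorphy is proved on an
        -- open set of jets above `U` and then restricted to the section `jetBase`.
        have hV : IsOpen (Ω ∩ Prod.fst ⁻¹' U) := hΩ.inter (hU.preimage continuous_fst)
        have := differentiableOn_coeff_jetTerm (b := jetDir) hV (N := N)
          (p := fun Y => jetSeries (fun i N => u N i) Y.1) (fun i j hj =>
            (differentiableOn_coeff_jetSeries hU (fun i j hj => ih j (by omega) i) i j hj).comp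
              differentiableOn_fst fun Y hY => hY.2) d
          (fun k => (hf i k).mono inter_subset_left) N le_rfl
        refine this.comp (f := fun x => jetBase x) ?_ fun x hx => ⟨hUΩ x hx, hx⟩
        exact (differentiable_id.prodMk (differentiable_const _)).differentiableOn
  refine ⟨fun i N => u N i, fun i N => hd N i, fun i x _ => by rw [hu]; rfl, fun i N x _ => ?_⟩
  have hN : ((N : ℂ) + 1) ≠ 0 := by exact_mod_cast Nat.succ_ne_zero N
  rw [hu]
  simp only [T]
  rw [mul_inv_cancel_left₀ hN]

end FormalSolution
end

noncomputable section

open MeasureTheory Filter Topology Set Metric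
open scoped Interval

/-! ### Acceleration near the origin. -/

section AccelNearZero

variable {k₁ k₂ : ℝ}

/-- The acceleration of a function of grade `l` is of grade `l` near the origin, uniformly for
angles between rays staying away from the critical one. -/
theorem exists_norm_accel_le (h1 : 0 < k₁) (h2 : k₁ < k₂) {d : ℝ} (hd0 : 0 ≤ d)
    (hd : d < Real.pi / 2 * (k₁⁻¹ - k₂⁻¹)) {l : ℕ} (hl : l ≠ 0) :
    ∃ C : ℝ, 0 ≤ C ∧ ∀ (φ c B : ℝ) (f : ℂ → ℂ) (ζ : ℂ),
      RayBounded k₁ (accelOrder k₁ k₂) c l φ B f → |ζ.im - φ| ≤ d →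
      2 * c * Real.exp (accelOrder k₁ k₂ * ζ.re) ≤ accelRate k₁ k₂ d →
      ‖accel k₁ k₂ φ f ζ‖ ≤ B * C * Real.exp ((l - k₂) * ζ.re) := by
  have hκ := accelOrder_pos h1 h2
  have hd' : |d| < Real.pi / 2 * (k₁⁻¹ - k₂⁻¹) := by rwa [abs_of_nonneg hd0]
  have hR := accelRate_pos h1 h2 hd'
  have hcp := cosGap_pos (ratio_pos h1 h2) (gap_aperture h1 h2 hd')
  have hG : 0 ≤ Real.Gamma (l / k₁) := Real.Gamma_nonneg_of_nonneg (by positivity)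
  -- Half of the decay absorbs the growth of `f` by the smallness condition. With the remaining
  -- half, the translation by `ζ.re` exhibits the factor `exp (l * ζ.re)`, since the kernel depends
  -- only on the quotient `η / ξ`.
  set A := accelRate k₁ k₂ d / 2 with hA
  set C₀ := (Real.Gamma (l / k₁))⁻¹ * (4 / cosGap (k₁ / k₂) (k₁ * d)) * k₁ with hC
  have hC0 : 0 ≤ C₀ := by positivity
  set g : ℝ → ℝ := fun t => Real.exp (l * t) *
      Real.exp (-A * Real.exp (accelOrder k₁ k₂ * t)) with hg
  have hint : Integrable g :=
    integrable_exp_mul_exp_neg_exp (by exact_mod_cast Nat.pos_of_ne_zero hl) hκ (by positivity)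
  have hI0 : 0 ≤ ∫ t, g t := integral_nonneg fun t => by positivity
  refine ⟨C₀ * ∫ t, g t, mul_nonneg hC0 hI0, fun φ c B f ζ hf hζ hs => ?_⟩
  have hB0 : ∀ t : ℝ, 0 ≤ B * expWeight k₁ (accelOrder k₁ k₂) c l t := fun t =>
    (norm_nonneg _).trans (hf.bound t)
  have hmain : ∀ t : ℝ, ‖accelIntegrand k₁ k₂ φ f ζ t‖ ≤
      B * C₀ * Real.exp (l * ζ.re) * g (t - ζ.re) := by
    intro t
    have hk := norm_accelKernel_le_of_le h1 h2 (w := t + φ * Complex.I - ζ) (t := t - ζ.re) hd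
      (by have : |(t + φ * Complex.I - ζ).im| = |ζ.im - φ| := by
            rw [abs_sub_comm]; simp
          rw [this]; exact hζ) (by simp)
    refine (hf.norm_accelIntegrand_le h1 k₂ ζ t).trans ?_
    rw [← mul_assoc B]
    have hexp : Real.exp (c * Real.exp (accelOrder k₁ k₂ * t)) *
        Real.exp (-accelRate k₁ k₂ d * Real.exp (accelOrder k₁ k₂ * (t - ζ.re))) ≤
        Real.exp (-A * Real.exp (accelOrder k₁ k₂ * (t - ζ.re))) := by
      rw [← Real.exp_add, Real.exp_le_exp]
      have e1 : Real.exp (accelOrder k₁ k₂ * t) = Real.exp (accelOrder k₁ k₂ * ζ.re) *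
          Real.exp (accelOrder k₁ k₂ * (t - ζ.re)) := by
        rw [← Real.exp_add]; congr 1; ring
      have e2 : c * Real.exp (accelOrder k₁ k₂ * ζ.re) ≤ A := by rw [hA]; linarith
      have e3 := mul_le_mul_of_nonneg_right e2
        (Real.exp_pos (accelOrder k₁ k₂ * (t - ζ.re))).le
      rw [e1]
      have e4 : accelRate k₁ k₂ d = 2 * A := by rw [hA]; ring
      rw [e4]
      linarith
    have hBG : 0 ≤ B * C₀ * (Real.exp ((l - k₁) * t) * Real.exp (k₁ * t)) := by
      have e5 := hB0 t
      have e6 : B * expWeight k₁ (accelOrder k₁ k₂) c l t = (B * (Real.Gamma (l / k₁))⁻¹) *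
          (Real.exp ((l - k₁) * t) * Real.exp (c * Real.exp (accelOrder k₁ k₂ * t))) := by
        rw [expWeight]; ring
      rw [e6] at e5
      have e7 := nonneg_of_mul_nonneg_left e5 (by positivity)
      have : B * C₀ = (B * (Real.Gamma (l / k₁))⁻¹) *
        ((4 / cosGap (k₁ / k₂) (k₁ * d)) * k₁) := by rw [hC]; ring
      rw [this]
      positivity
    calc _ ≤ B * expWeight k₁ (accelOrder k₁ k₂) c l t * (4 / cosGap (k₁ / k₂) (k₁ * d) *
        Real.exp (-accelRate k₁ k₂ d * Real.exp (accelOrder k₁ k₂ * (t - ζ.re))) *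
        (k₁ * Real.exp (k₁ * t))) := by gcongr; exact hB0 t
      _ = B * C₀ * (Real.exp ((l - k₁) * t) * Real.exp (k₁ * t)) *
        (Real.exp (c * Real.exp (accelOrder k₁ k₂ * t)) *
        Real.exp (-accelRate k₁ k₂ d * Real.exp (accelOrder k₁ k₂ * (t - ζ.re)))) := by
          rw [hC, expWeight]; ring
      _ ≤ B * C₀ * (Real.exp ((l - k₁) * t) * Real.exp (k₁ * t)) *
        Real.exp (-A * Real.exp (accelOrder k₁ k₂ * (t - ζ.re))) :=
          mul_le_mul_of_nonneg_left hexp hBG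
      _ = _ := by
        have : Real.exp ((l - k₁) * t) * Real.exp (k₁ * t) =
            Real.exp (l * ζ.re) * Real.exp (l * (t - ζ.re)) := by
          rw [← Real.exp_add, ← Real.exp_add]; congr 1; ring
        rw [this, hg]; ring
  have hsh : ∫ t, g (t - ζ.re) = ∫ t, g t := integral_sub_right_eq_self g ζ.re
  have hbd := norm_integral_le_of_norm_le ((hint.comp_sub_right ζ.re).const_mul
    (B * C₀ * Real.exp (l * ζ.re))) (Eventually.of_forall hmain)
  rw [integral_const_mul, hsh] at hbd
  rw [accel_eq, norm_mul, Complex.norm_exp]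
  have e8 : (-(k₂ : ℂ) * ζ).re = -k₂ * ζ.re := by simp
  rw [e8]
  calc _ ≤ Real.exp (-k₂ * ζ.re) * (B * C₀ * Real.exp (l * ζ.re) * ∫ t, g t) := by gcongr
    _ = B * (C₀ * ∫ t, g t) * (Real.exp (-k₂ * ζ.re) * Real.exp (l * ζ.re)) := by ring
    _ = _ := by rw [← Real.exp_add]; congr 2; ring

/-- A ray close enough to a given direction, for directions within the critical angle. -/
lemma exists_ray {θ₁ θ₂ ε₁ ε₂ G : ℝ} (hG : 0 < G) (hθ : |θ₁ - θ₂| ≤ G) (hε0 : 0 < ε₁)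
    (hε : ε₂ < ε₁) :
    ∃ d, 0 ≤ d ∧ d < G ∧ ∀ ψ, |ψ - θ₂| < ε₂ → ∃ φ, |φ - θ₁| < ε₁ ∧ |ψ - φ| ≤ d := by
  -- The angle stays strictly below `G` even if `|θ₁ - θ₂| = G`: the first sector is wider than the
  -- second, so the ray can be turned towards `ψ`, and half of `ε₁ - ε₂` is gained.
  refine ⟨max 0 (G - (ε₁ - ε₂) / 2), le_max_left _ _, max_lt hG (by linarith), fun ψ hψ => ?_⟩
  set d := max 0 (G - (ε₁ - ε₂) / 2) with hd
  have hd0 : 0 ≤ d := le_max_left _ _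
  have hd1 : G - (ε₁ - ε₂) / 2 ≤ d := le_max_right _ _
  have h1 := abs_lt.1 hψ
  have h2 := abs_le.1 hθ
  rcases le_total ψ θ₁ with h | h
  · rcases le_total (θ₁ - d) ψ with h' | h'
    · exact ⟨θ₁, by simpa using hε0, abs_le.2 ⟨by linarith, by linarith⟩⟩
    · exact ⟨ψ + d, abs_lt.2 ⟨by linarith, by linarith⟩, by simp [abs_of_nonneg hd0]⟩
  · rcases le_total ψ (θ₁ + d) with h' | h'
    · exact ⟨θ₁, by simpa using hε0, abs_le.2 ⟨by linarith, by linarith⟩⟩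
    · exact ⟨ψ - d, abs_lt.2 ⟨by linarith, by linarith⟩, by simp [abs_of_nonneg hd0]⟩

lemma continuousAt_accelRate (h1 : 0 < k₁) (h2 : k₁ < k₂) {δ : ℝ}
    (hδ : |δ| < Real.pi / 2 * (k₁⁻¹ - k₂⁻¹)) : ContinuousAt (accelRate k₁ k₂) δ := by
  have := cosGap_pos (ratio_pos h1 h2) (gap_aperture h1 h2 hδ)
  unfold accelRate kernelRate
  refine ContinuousAt.rpow_const ?_ (Or.inl (by positivity))
  unfold cosGap
  fun_prop

/-- The identity between a holomorphic function and an acceleration integral, in the region where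
the integral converges with a margin. -/
theorem eq_accel_of_margin (h1 : 0 < k₁) (h2 : k₁ < k₂) {φ c B θ ε : ℝ} {l : ℕ}
    (hl : l ≠ 0) (hc : 0 < c) {f g : ℂ → ℂ} (hf : RayBounded k₁ (accelOrder k₁ k₂) c l φ B f)
    (hg : DifferentiableOn ℂ g (logSector θ ε)) {ψ : ℝ} (hψ : |ψ - θ| < ε)
    (hgap : |ψ - φ| < Real.pi / 2 * (k₁⁻¹ - k₂⁻¹))
    (hev : ∀ᶠ s : ℝ in atBot, g (s + ψ * Complex.I) = accel k₁ k₂ φ f (s + ψ * Complex.I))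
    {s : ℝ} (hs : 2 * c * Real.exp (accelOrder k₁ k₂ * s) ≤ accelRate k₁ k₂ (ψ - φ)) :
    g (s + ψ * Complex.I) = accel k₁ k₂ φ f (s + ψ * Complex.I) := by
  set δ := |ψ - φ| with hδ
  have e0 : accelRate k₁ k₂ (ψ - φ) = accelRate k₁ k₂ δ := by
    unfold accelRate kernelRate cosGap
    rw [hδ, abs_mul, abs_mul, abs_abs]
  have hlt : c * Real.exp (accelOrder k₁ k₂ * s) < accelRate k₁ k₂ δ := by
    rw [e0] at hs
    have : 0 < c * Real.exp (accelOrder k₁ k₂ * s) := by positivity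
    linarith
  -- The factor `2` in the hypothesis makes the inequality without it strict. By continuity it
  -- persists at the angle `δ + x` and radius `exp (s + x)`, giving an open region around the point
  -- on which the identity theorem applies.
  have hcont : ContinuousAt (fun x : ℝ => accelRate k₁ k₂ (δ + x) -
      c * Real.exp (accelOrder k₁ k₂ * (s + x))) 0 := by
    refine ContinuousAt.sub ?_ (by fun_prop)
    refine ContinuousAt.comp (g := accelRate k₁ k₂) ?_ (by fun_prop)
    rw [add_zero]
    exact continuousAt_accelRate h1 h2 (by rwa [hδ, abs_abs])
  have hev1 : ∀ᶠ x : ℝ in 𝓝 0, c * Real.exp (accelOrder k₁ k₂ * (s + x)) <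
      accelRate k₁ k₂ (δ + x) := by
    have := hcont.eventually (lt_mem_nhds (a := 0) (by simpa using hlt))
    exact this.mono fun x hx => sub_pos.1 hx
  have hev2 : ∀ᶠ x : ℝ in 𝓝 0, δ + x < Real.pi / 2 * (k₁⁻¹ - k₂⁻¹) := by
    have : ContinuousAt (fun x : ℝ => δ + x) 0 := by fun_prop
    exact this.eventually_lt continuousAt_const (by simpa using hgap)
  obtain ⟨x, ⟨hx1, hx2⟩, hx⟩ := (((hev1.and hev2).filter_mono nhdsWithin_le_nhds).and
    (self_mem_nhdsWithin : Ioi (0 : ℝ) ∈ 𝓝[>] 0)).exists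
  have hx0 : (0 : ℝ) < x := hx
  refine eq_accel_of_eventually h1 h2 hl hf hg hx2 hx1 hψ (by linarith) hev
    (ray_mem_logSector hψ s) ?_ ?_
  · have : |((s : ℂ) + ψ * Complex.I).im - φ| = δ := by simp [hδ]
    rw [this]; linarith
  · simpa using hx0

end AccelNearZero

/-! ### From the definition of multisummability to weight bounds. -/

section PowerSeriesBounds

/-- Cauchy's estimate for the coefficients of a convergent power series. -/
lemma norm_coeff_le_of_hasSum {a : ℕ → ℂ} {h : ℂ → ℂ} {r A : ℝ} (hr : 0 < r)
    (hd : DifferentiableOn ℂ h (closedBall 0 r)) (hA : ∀ ξ ∈ sphere (0 : ℂ) r, ‖h ξ‖ ≤ A)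
    (hs : ∀ ξ ∈ ball (0 : ℂ) r, HasSum (fun n => a n * ξ ^ n) (h ξ)) (n : ℕ) :
    ‖a n‖ ≤ A / r ^ n := by
  have h1 : HasFPowerSeriesAt h (FormalMultilinearSeries.ofScalars ℂ a) 0 := by
    rw [hasFPowerSeriesAt_iff]
    filter_upwards [ball_mem_nhds (0 : ℂ) hr] with ξ hξ
    simpa [mul_comm] using hs ξ hξ
  have h4 : iteratedDeriv n h 0 = n.factorial * a n := by
    have := h1.eq_formalMultilinearSeries (AnalyticAt.hasFPowerSeriesAt h1.analyticAt)
    have h5 := congrArg (fun p => p.coeff n) this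
    simp only [FormalMultilinearSeries.coeff_ofScalars] at h5
    have h6 : (n.factorial : ℂ) ≠ 0 := by exact_mod_cast n.factorial_ne_zero
    rw [h5]
    field_simp
  have h5 := Complex.norm_iteratedDeriv_le_of_forall_mem_sphere_norm_le n hr
    (hd.diffContOnCl_ball subset_rfl) hA
  rw [h4, norm_mul, Complex.norm_natCast, mul_div_assoc] at h5
  exact le_of_mul_le_mul_left h5 (by exact_mod_cast n.factorial_pos)

end PowerSeriesBounds

section Base

variable {q : ℕ} {E : Type*} [NormedAddCommGroup E] [NormedSpace ℂ E]

/-- The chain of a formal series deprived of its constant term. -/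
def baseChain (a : ℕ → E → ℂ) (F : Fin (q + 1) → ℂ × E → ℂ) (Y : E) : Chain q :=
  (fun n => if n = 0 then 0 else a n Y, fun j ζ => F j (ζ, Y))

/-- Nested sectors. -/
def shrink (e : ℝ) (j : Fin (q + 1)) : ℝ := e / (j + 1)

lemma shrink_pos {e : ℝ} (he : 0 < e) (j : Fin (q + 1)) : 0 < shrink e j := by
  unfold shrink; positivity

lemma shrink_le {e : ℝ} (he : 0 < e) (j : Fin (q + 1)) : shrink e j ≤ e :=
  div_le_self he.le (by linarith [(Nat.cast_nonneg (j : ℕ) : (0 : ℝ) ≤ _)])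

lemma shrink_succ_lt {e : ℝ} (he : 0 < e) (j : Fin q) : shrink e j.succ < shrink e j.castSucc := by
  unfold shrink
  refine div_lt_div_of_pos_left he (by positivity) ?_
  simp

/-- From a bound near the origin and at infinity, on a compact set of parameters, to a bound by the
weight of grade `1`. -/
lemma exists_weight_bound {E : Type*} [NormedAddCommGroup E] {κ k c c₁ M₁ A s₀ θ ε ε' : ℝ} (hk : 0 < k) (hκ : k ≤ κ) (hε : ε < ε')
    (hc : c₁ + 1 ≤ c) (hc₁ : 0 < c₁) (hM₁ : 0 < M₁) {K : Set E} (hK : IsCompact K)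
    {F : ℂ × E → ℂ} (hF : ContinuousOn F (logSector θ ε' ×ˢ K))
    (h0 : ∀ ζ ∈ logSector θ ε, ζ.re < s₀ → ∀ Y ∈ K, ‖F (ζ, Y)‖ ≤ A * Real.exp ((1 - k) * ζ.re))
    (hinf : ∀ ζ ∈ logSector θ ε, 0 ≤ ζ.re → ∀ Y ∈ K,
      ‖F (ζ, Y)‖ ≤ M₁ * Real.exp (c₁ * Real.exp (κ * ζ.re))) :
    ∃ M, 0 ≤ M ∧ ∀ ζ ∈ logSector θ ε, ∀ Y ∈ K, ‖F (ζ, Y)‖ ≤ M * expWeight k κ c 1 ζ.re := by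
  have hG : 0 < Real.Gamma ((1 : ℕ) / k) := Real.Gamma_pos_of_pos (by positivity)
  set G := Real.Gamma ((1 : ℕ) / k) with hGdef
  -- Between the two asymptotic regions the closed strip is compact and lies in the larger sector of
  -- half-opening `ε'`, so continuity alone gives a bound there.
  have hcomp : IsCompact ((Icc s₀ 0 ×ℂ Icc (θ - ε) (θ + ε)) ×ˢ K) :=
    (isCompact_Icc.reProdIm isCompact_Icc).prod hK
  have hsub : (Icc s₀ 0 ×ℂ Icc (θ - ε) (θ + ε)) ×ˢ K ⊆ logSector θ ε' ×ˢ K := by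
    rintro ⟨ζ, Y⟩ ⟨⟨-, h2, h3⟩, hY⟩
    simp only at h2 h3
    exact ⟨show |ζ.im - θ| < ε' from abs_lt.2 ⟨by linarith, by linarith⟩, hY⟩
  have hcw : Continuous fun p : ℂ × E => Real.exp (-((1 - k) * p.1.re)) := by fun_prop
  obtain ⟨C, hC⟩ := (hcomp.image_of_continuousOn
    ((hF.mono hsub).norm.mul hcw.continuousOn)).bddAbove
  have hw : ∀ s, Real.exp ((1 - k) * s) / G ≤ expWeight k κ c 1 s := by
    intro s
    unfold expWeight
    refine (le_mul_of_one_le_right (by rw [← hGdef]; push_cast; positivity)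
      (Real.one_le_exp (mul_nonneg (by linarith) (Real.exp_pos _).le))).trans' (le_of_eq ?_)
    rw [← hGdef]; push_cast; rfl
  refine ⟨G * (|A| + |C| + M₁), by positivity, fun ζ hζ Y hY => ?_⟩
  have hw' : G * Real.exp ((1 - k) * ζ.re) / G = Real.exp ((1 - k) * ζ.re) := by field_simp
  have key : ∀ D, ‖F (ζ, Y)‖ ≤ D * Real.exp ((1 - k) * ζ.re) → D ≤ |A| + |C| + M₁ →
      ‖F (ζ, Y)‖ ≤ G * (|A| + |C| + M₁) * expWeight k κ c 1 ζ.re := by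
    intro D h1 h2
    calc _ ≤ (|A| + |C| + M₁) * Real.exp ((1 - k) * ζ.re) := h1.trans (by gcongr)
      _ = G * (|A| + |C| + M₁) * (Real.exp ((1 - k) * ζ.re) / G) := by field_simp
      _ ≤ _ := by gcongr; exact hw _
  rcases lt_or_ge ζ.re s₀ with hs | hs
  · exact key A (h0 ζ hζ hs Y hY) (by
      have := le_abs_self A; have := abs_nonneg C; linarith)
  rcases le_total 0 ζ.re with hp | hp
  · refine (hinf ζ hζ hp Y hY).trans ?_
    -- The factor `|ξ| ^ (k - 1)` costs one unit of exponential type; hence the requirement `c₁ + 1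
    -- ≤ c`.
    have e1 : Real.exp (-((1 - k) * ζ.re)) ≤ Real.exp (Real.exp (κ * ζ.re)) := by
      rw [Real.exp_le_exp]
      calc -((1 - k) * ζ.re) ≤ k * ζ.re := by linarith
        _ ≤ κ * ζ.re := by gcongr
        _ ≤ _ := by linarith [Real.add_one_le_exp (κ * ζ.re)]
    have e2 : Real.exp (c₁ * Real.exp (κ * ζ.re)) ≤
        Real.exp ((1 - k) * ζ.re) * Real.exp (c * Real.exp (κ * ζ.re)) := by
      calc _ = Real.exp ((1 - k) * ζ.re) * (Real.exp (-((1 - k) * ζ.re)) *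
            Real.exp (c₁ * Real.exp (κ * ζ.re))) := by
            rw [← mul_assoc, ← Real.exp_add]; simp
        _ ≤ Real.exp ((1 - k) * ζ.re) * (Real.exp (Real.exp (κ * ζ.re)) *
            Real.exp (c₁ * Real.exp (κ * ζ.re))) := by gcongr
        _ = Real.exp ((1 - k) * ζ.re) * Real.exp ((c₁ + 1) * Real.exp (κ * ζ.re)) := by
            rw [← Real.exp_add]; congr 2; ring
        _ ≤ _ := by gcongr
    have e3 : expWeight k κ c 1 ζ.re =
        Real.exp ((1 - k) * ζ.re) / G * Real.exp (c * Real.exp (κ * ζ.re)) := by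
      unfold expWeight; rw [← hGdef]; push_cast; rfl
    rw [e3]
    have e4 : G * (|A| + |C| + M₁) * (Real.exp ((1 - k) * ζ.re) / G *
        Real.exp (c * Real.exp (κ * ζ.re))) = (|A| + |C| + M₁) * (Real.exp ((1 - k) * ζ.re) *
        Real.exp (c * Real.exp (κ * ζ.re))) := by field_simp
    rw [e4]
    have : M₁ ≤ |A| + |C| + M₁ := by have := abs_nonneg A; have := abs_nonneg C; linarith
    gcongr
  · refine key C ?_ (by have := le_abs_self C; have := abs_nonneg A; linarith)
    have h2 := abs_lt.1 (show |ζ.im - θ| < ε from hζ)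
    have := hC (mem_image_of_mem _ (show (ζ, Y) ∈ (Icc s₀ 0 ×ℂ Icc (θ - ε) (θ + ε)) ×ˢ K from
      ⟨⟨⟨hs, hp⟩, ⟨by linarith, by linarith⟩⟩, hY⟩))
    calc ‖F (ζ, Y)‖ = ‖F (ζ, Y)‖ * Real.exp (-((1 - k) * ζ.re)) * Real.exp ((1 - k) * ζ.re) := by
          rw [mul_assoc, ← Real.exp_add]; simp
      _ ≤ _ := by gcongr; exact this

namespace SectorData

variable (P : SectorData q)

lemma re_add_im_mul_I (ζ : ℂ) : (ζ.re : ℂ) + (ζ.im : ℂ) * Complex.I = ζ := Complex.re_add_im ζ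

variable {P}

/-- Data of a multisummable family, on sectors larger than those of `P`. -/
structure Extends (P : SectorData q) (ε₀ : Fin (q + 1) → ℝ) (Ω : Set E)
    (F : Fin (q + 1) → ℂ × E → ℂ) : Prop where
  lt : ∀ j, P.ε j < ε₀ j
  holo : ∀ j, DifferentiableOn ℂ (F j) (logSector (P.θ j) (ε₀ j) ×ˢ Ω)
  accel : ∀ j : Fin q, IsAcceleration (P.k j.castSucc) (P.k j.succ) (P.θ j.castSucc) (ε₀ j.castSucc)
      (P.θ j.succ) (ε₀ j.succ) Ω (F j.castSucc) (F j.succ)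

namespace Extends

variable {ε₀ : Fin (q + 1) → ℝ} {Ω : Set E} {F : Fin (q + 1) → ℂ × E → ℂ}

lemma holo_section (h : P.Extends ε₀ Ω F) (j : Fin (q + 1)) {Y : E} (hY : Y ∈ Ω) :
    DifferentiableOn ℂ (fun ζ => F j (ζ, Y)) (P.sector j) :=
  (h.holo j).comp (f := fun ζ => (ζ, Y)) (by fun_prop) fun _ hζ => ⟨lt_trans hζ (h.lt j), hY⟩

lemma rayBounded (h : P.Extends ε₀ Ω F) {j : Fin q} {Y : E} (hY : Y ∈ Ω) {M : ℝ}
    (hM : ∀ ζ ∈ P.sector j.castSucc, ‖F j.castSucc (ζ, Y)‖ ≤ M * P.weight j.castSucc 1 ζ.re)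
    {φ : ℝ} (hφ : |φ - P.θ j.castSucc| < P.ε j.castSucc) :
    RayBounded (P.k j.castSucc) (accelOrder (P.k j.castSucc) (P.k j.succ)) P.c 1 φ M
      (fun ζ => F j.castSucc (ζ, Y)) := by
  refine ⟨(h.holo_section j.castSucc hY).continuousOn.comp_continuous (by fun_prop)
    fun t => ray_mem_logSector hφ t, fun s => ?_⟩
  have := hM _ (ray_mem_logSector hφ s)
  rw [weight, order_castSucc] at this
  simpa using this

lemma accel_eq (h : P.Extends ε₀ Ω F) {j : Fin q} {Y : E} (hY : Y ∈ Ω) {M : ℝ}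
    (hM : ∀ ζ ∈ P.sector j.castSucc, ‖F j.castSucc (ζ, Y)‖ ≤ M * P.weight j.castSucc 1 ζ.re)
    {φ ψ s : ℝ} (hφ : |φ - P.θ j.castSucc| < P.ε j.castSucc)
    (hψ : |ψ - P.θ j.succ| < P.ε j.succ)
    (hgap : |ψ - φ| < Real.pi / 2 * ((P.k j.castSucc)⁻¹ - (P.k j.succ)⁻¹))
    (hs : 2 * P.c * Real.exp (accelOrder (P.k j.castSucc) (P.k j.succ) * s) ≤
      accelRate (P.k j.castSucc) (P.k j.succ) (ψ - φ)) :
    F j.succ (s + ψ * Complex.I, Y) = _root_.accel (P.k j.castSucc) (P.k j.succ) φ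
      (fun ζ => F j.castSucc (ζ, Y)) (s + ψ * Complex.I) :=
  eq_accel_of_margin (P.pos _) (P.lt j) one_ne_zero P.c_pos (h.rayBounded hY hM hφ)
    (g := fun ζ => F j.succ (ζ, Y)) (h.holo_section j.succ hY) hψ hgap
    (h.accel j φ ψ (hφ.trans (h.lt _)) (hψ.trans (h.lt _)) hgap Y hY) hs

/-- Induction on the level. After the first level nothing is assumed directly about the size near
the origin; there the function is the acceleration of the previous one, which preserves grade `1`.
The strictly decreasing openings provide, for every direction, a ray at an angle uniformly below the
critical one. -/
theorem exists_bound (h : P.Extends ε₀ Ω F) (hθ : IsMultidirection P.k P.θ)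
    (hε : ∀ j, 0 < P.ε j) (hεs : ∀ j : Fin q, P.ε j.succ < P.ε j.castSucc)
    {K : Set E} (hK : IsCompact K) (hKΩ : K ⊆ Ω) {c₁ M₁ : ℝ} (hc : c₁ + 1 ≤ P.c) (hc₁ : 0 < c₁)
    (hM₁ : 0 < M₁) (hinf : ∀ j, ∀ ζ ∈ logSector (P.θ j) (ε₀ j), 0 ≤ ζ.re → ∀ Y ∈ K,
      ‖F j (ζ, Y)‖ ≤ M₁ * Real.exp (c₁ * Real.exp (P.order j * ζ.re)))
    {A s₀ : ℝ} (h0 : ∀ ζ ∈ P.sector 0, ζ.re < s₀ → ∀ Y ∈ K,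
      ‖F 0 (ζ, Y)‖ ≤ A * Real.exp ((1 - P.k 0) * ζ.re)) (j : Fin (q + 1)) :
    ∃ M, 0 ≤ M ∧ ∀ ζ ∈ P.sector j, ∀ Y ∈ K, ‖F j (ζ, Y)‖ ≤ M * P.weight j 1 ζ.re := by
  have hstep : ∀ j (A s₀ : ℝ), (∀ ζ ∈ P.sector j, ζ.re < s₀ → ∀ Y ∈ K,
      ‖F j (ζ, Y)‖ ≤ A * Real.exp ((1 - P.k j) * ζ.re)) →
      ∃ M, 0 ≤ M ∧ ∀ ζ ∈ P.sector j, ∀ Y ∈ K, ‖F j (ζ, Y)‖ ≤ M * P.weight j 1 ζ.re := by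
    intro j A s₀ h0
    exact exists_weight_bound (P.pos j) (P.le_order j) (h.lt j) hc hc₁ hM₁ hK
      ((h.holo j).continuousOn.mono (prod_mono_right hKΩ)) h0
      fun ζ hζ => hinf j ζ (lt_trans hζ (h.lt j))
  induction j using Fin.induction with
  | zero => exact hstep 0 A s₀ h0
  | succ j ih =>
    obtain ⟨M, hM0, hM⟩ := ih
    have hk1 := P.pos j.castSucc
    have hk2 := P.lt j
    have hgap : 0 < Real.pi / 2 * ((P.k j.castSucc)⁻¹ - (P.k j.succ)⁻¹) :=
      mul_pos (by positivity) (inv_sub_inv_pos hk1 hk2)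
    have hθj : |P.θ j.castSucc - P.θ j.succ| ≤
        Real.pi / 2 * ((P.k j.castSucc)⁻¹ - (P.k j.succ)⁻¹) := by
      refine (hθ j).trans (le_of_eq ?_)
      simp only [levelOrder, Fin.snoc_castSucc]
      have := (inv_sub_inv_pos hk1 hk2).ne'
      rw [div_mul_eq_div_div, div_inv_eq_mul]
    obtain ⟨d, hd0, hd, hray⟩ := exists_ray hgap hθj (hε j.castSucc) (hεs j)
    obtain ⟨C, hC0, hC⟩ := exists_norm_accel_le hk1 hk2 hd0 hd one_ne_zero
    have hd' : |d| < Real.pi / 2 * ((P.k j.castSucc)⁻¹ - (P.k j.succ)⁻¹) := by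
      rwa [abs_of_nonneg hd0]
    have hR := accelRate_pos hk1 hk2 hd'
    have hκ := accelOrder_pos hk1 hk2
    have hcp := P.c_pos
    refine hstep j.succ (M * C) (Real.log (accelRate (P.k j.castSucc) (P.k j.succ) d /
      (2 * P.c)) / accelOrder (P.k j.castSucc) (P.k j.succ)) fun ζ hζ hs Y hY => ?_
    obtain ⟨φ, hφ, hψφ⟩ := hray ζ.im hζ
    have hs' : 2 * P.c * Real.exp (accelOrder (P.k j.castSucc) (P.k j.succ) * ζ.re) ≤
        accelRate (P.k j.castSucc) (P.k j.succ) d := by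
      rw [lt_div_iff₀ hκ, mul_comm] at hs
      have := Real.exp_le_exp.2 hs.le
      rw [Real.exp_log (by positivity), le_div_iff₀ (by positivity)] at this
      linarith
    have hanti : accelRate (P.k j.castSucc) (P.k j.succ) d ≤
        accelRate (P.k j.castSucc) (P.k j.succ) (ζ.im - φ) := by
      refine kernelRate_anti (ratio_pos hk1 hk2) (ratio_lt_one hk1 hk2)
        (gap_aperture hk1 hk2 hd') ?_
      rw [abs_mul, abs_mul, abs_of_nonneg hd0]
      gcongr
    have e := h.accel_eq (hKΩ hY) (fun ζ hζ => hM ζ hζ Y hY) hφ hζ (hψφ.trans_lt hd)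
      (hs'.trans hanti)
    rw [re_add_im_mul_I] at e
    rw [e]
    simpa using hC φ P.c M _ ζ (h.rayBounded (hKΩ hY) (fun ζ hζ => hM ζ hζ Y hY) hφ) hψφ hs'

end Extends

end SectorData

end Base
end

noncomputable section

open MeasureTheory Filter Topology Set Metric
open scoped Interval

/-! ### Multisummable data as good families of chains. -/

section BaseTheorem

variable {q : ℕ} {E : Type*} [NormedAddCommGroup E] [NormedSpace ℂ E]

/-- The index is shifted by one: the series for `h` begins with the coefficient of `t`, and the
constant term has no Borel transform. -/
lemma hasSum_borelMono {k : ℝ} {a : ℕ → ℂ} {ζ S : ℂ}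
    (h : HasSum (fun n : ℕ => a (n + 1) / (Real.Gamma (((n : ℝ) + 1) / k) : ℂ) *
      Complex.exp ζ ^ n) S) :
    HasSum (fun n : ℕ => (if n = 0 then 0 else a n) * borelMono k n ζ)
      (Complex.exp ((1 - (k : ℂ)) * ζ) * S) := by
  rw [← hasSum_nat_add_iff' 1]
  simp only [Finset.range_one, Finset.sum_singleton, if_true, zero_mul, sub_zero]
  refine (h.mul_left (Complex.exp ((1 - (k : ℂ)) * ζ))).congr_fun fun n => ?_
  simp only [Nat.succ_ne_zero, if_false, borelMono]
  have e : Complex.exp ((((n + 1 : ℕ) : ℂ) - k) * ζ) =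
      Complex.exp ((1 - (k : ℂ)) * ζ) * Complex.exp ζ ^ n := by
    rw [← Complex.exp_nat_mul, ← Complex.exp_add]; congr 1; push_cast; ring
  rw [e]
  push_cast
  ring

lemma SectorData.monoWeight_succ (P : SectorData q) (n : ℕ) (s : ℝ) :
    P.monoWeight (n + 1) s = Real.exp ((1 - P.k 0) * s) *
      (Real.exp s ^ n / Real.Gamma (((n : ℝ) + 1) / P.k 0)) := by
  have e : Real.exp ((((n + 1 : ℕ) : ℝ) - P.k 0) * s) =
      Real.exp ((1 - P.k 0) * s) * Real.exp s ^ n := by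
    rw [← Real.exp_nat_mul, ← Real.exp_add]; congr 1; push_cast; ring
  unfold SectorData.monoWeight expWeight
  rw [e]
  push_cast
  simp
  ring

lemma SectorData.exp_le_weight (P : SectorData q) (s : ℝ) :
    Real.exp ((1 - P.k 0) * s) ≤ Real.Gamma (1 / P.k 0) * P.weight 0 1 s := by
  have hG : 0 < Real.Gamma (1 / P.k 0) := Real.Gamma_pos_of_pos (by have := P.k_pos; positivity)
  have := Real.one_le_exp (mul_nonneg P.c_pos.le (Real.exp_pos (P.order 0 * s)).le)
  have e : Real.Gamma (1 / P.k 0) * P.weight 0 1 s =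
      Real.exp ((1 - P.k 0) * s) * Real.exp (P.c * Real.exp (P.order 0 * s)) := by
    unfold SectorData.weight expWeight
    push_cast
    field_simp
  rw [e]
  exact le_mul_of_one_le_right (Real.exp_pos _).le this

/-- At radius at most `r / 2` the coefficient bounds at radius `r` give a geometric series of ratio
`1 / 2`. Its sum contributes one factor `2`, the shift of index the other. -/
lemma sum_monoWeight_le (P : SectorData q) {a : ℕ → ℂ} {A r : ℝ} (hr : 0 < r) (hA : 0 ≤ A)
    (ha : ∀ n : ℕ, ‖a (n + 1) / (Real.Gamma (((n : ℝ) + 1) / P.k 0) : ℂ)‖ ≤ A / r ^ n)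
    {s : ℝ} (hs : Real.exp s ≤ r / 2) (T : Finset ℕ) :
    ∑ n ∈ T, ‖if n = 0 then 0 else a n‖ * P.monoWeight n s ≤
      4 * A * Real.Gamma (1 / P.k 0) * P.weight 0 1 s := by
  have hterm : ∀ n ∈ T, ‖if n = 0 then 0 else a n‖ * P.monoWeight n s ≤
      2 * A * Real.exp ((1 - P.k 0) * s) * (1 / 2) ^ n := by
    intro n _
    rcases n with _ | n
    · simp; positivity
    · rw [if_neg (Nat.succ_ne_zero n), P.monoWeight_succ]
      have hG : 0 < Real.Gamma (((n : ℝ) + 1) / P.k 0) :=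
        Real.Gamma_pos_of_pos (by have := P.k_pos; positivity)
      have h1 := ha n
      rw [norm_div, Complex.norm_real, Real.norm_of_nonneg hG.le] at h1
      have h2 : Real.exp s ^ n ≤ (r / 2) ^ n := by gcongr
      calc _ = Real.exp ((1 - P.k 0) * s) * (‖a (n + 1)‖ / Real.Gamma (((n : ℝ) + 1) / P.k 0) *
            Real.exp s ^ n) := by ring
        _ ≤ Real.exp ((1 - P.k 0) * s) * (A / r ^ n * (r / 2) ^ n) := by gcongr
        _ = _ := by rw [div_pow, pow_succ]; field_simp; simp
  refine (Finset.sum_le_sum hterm).trans ?_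
  rw [← Finset.mul_sum]
  have h3 : ∑ n ∈ T, (1 / 2 : ℝ) ^ n ≤ 2 :=
    (summable_geometric_two.sum_le_tsum T fun n _ => by positivity).trans tsum_geometric_two.le
  calc _ ≤ 2 * A * Real.exp ((1 - P.k 0) * s) * 2 := by gcongr
    _ = 4 * A * Real.exp ((1 - P.k 0) * s) := by ring
    _ ≤ 4 * A * (Real.Gamma (1 / P.k 0) * P.weight 0 1 s) := by
        gcongr; exact P.exp_le_weight s
    _ = _ := by ring

/-- A multisummable series, on small enough parameter sets and sectors, is the sum of its constant
term and of a family of good chains of grade `1`. -/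
theorem eventually_goodOn_baseChain [FiniteDimensional ℂ E] {k θ : Fin (q + 1) → ℝ} (hk0 : 0 < k 0)
    (hk : StrictMono k) (hθ : IsMultidirection k θ) {Ω : Set E} (hΩ : IsOpen Ω) (h0 : (0 : E) ∈ Ω)
    {a : ℕ → E → ℂ} (ha : IsMultisummable k θ Ω a) :
    ∃ F : Fin (q + 1) → ℂ × E → ℂ, ∀ᶠ e : ℝ in 𝓝[>] 0, ∀ᶠ R : ℝ in 𝓝[>] 0, ∀ᶠ c : ℝ in atTop,
      ∀ᶠ lam : ℝ in atBot, ∀ᶠ M : ℝ in atTop, ∀ hc : 0 < c,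
      (SectorData.mk k θ (shrink e) c lam hk0 hk hc).GoodOn (ball 0 R) 0 (fun _ => M)
        (fun Y => Chain.const q (a 0 Y)) ∧
      (SectorData.mk k θ (shrink e) c lam hk0 hk hc).GoodOn (ball 0 R) 1 (fun _ => M)
        (baseChain a F) := by
  obtain ⟨hcoef, ε₀, F, hε₀, ⟨r, h, hr, hh, hsum, hF0⟩, hExp, hacc⟩ := ha
  choose hF M₁ c₁ hM₁ hc₁ hbd using hExp
  refine ⟨F, ?_⟩
  have he1 : ∀ᶠ e : ℝ in 𝓝[>] 0, ∀ j, e < ε₀ j :=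
    (eventually_all.2 fun j => gt_mem_nhds (hε₀ j)).filter_mono nhdsWithin_le_nhds
  filter_upwards [he1, self_mem_nhdsWithin] with e he hepos
  have hR1 : ∀ᶠ R : ℝ in 𝓝[>] 0, closedBall (0 : E) R ⊆ Ω := by
    obtain ⟨δ, hδ, hδΩ⟩ := Metric.isOpen_iff.1 hΩ 0 h0
    filter_upwards [mem_nhdsWithin_of_mem_nhds (gt_mem_nhds hδ)] with R hR
    exact (closedBall_subset_ball hR).trans hδΩ
  filter_upwards [hR1] with R hR
  have hK : IsCompact (closedBall (0 : E) R) := by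
    have := FiniteDimensional.proper ℂ E
    exact isCompact_closedBall 0 R
  have hb : ball (0 : E) R ⊆ closedBall 0 R := ball_subset_closedBall
  filter_upwards [eventually_ge_atTop ((∑ j, c₁ j) + 1)] with c hc
  -- Cauchy's estimates are taken on the circle of radius `r / 2`, and half of that radius is kept
  -- for the geometric series.
  filter_upwards [eventually_le_atBot (Real.log (r / 4))] with lam hlam
  have hr4 : 0 < r / 4 := by positivity
  have hlam' : Real.exp lam ≤ r / 4 := by
    rw [← Real.exp_log hr4]; exact Real.exp_le_exp.2 hlam
  have hsub : closedBall (0 : ℂ) (r / 2) ⊆ ball 0 r := closedBall_subset_ball (by linarith)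
  obtain ⟨A, hA⟩ := ((isCompact_closedBall (0 : ℂ) (r / 2)).prod hK).exists_bound_of_continuousOn
    (hh.continuousOn.mono (prod_mono hsub hR))
  obtain ⟨A₀, hA₀⟩ := hK.exists_bound_of_continuousOn ((hcoef 0).continuousOn.mono hR)
  by_cases hcp : 0 < c
  swap
  · exact Eventually.of_forall fun M hc => absurd hc hcp
  set P := SectorData.mk k θ (shrink e) c lam hk0 hk hcp with hP
  have hext : P.Extends ε₀ Ω F := ⟨fun j => (shrink_le hepos j).trans_lt (he j), hF, hacc⟩
  have hhY : ∀ Y ∈ Ω, DifferentiableOn ℂ (fun ξ => h (ξ, Y)) (ball 0 r) := fun Y hY =>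
    hh.comp (f := fun ξ => (ξ, Y)) (by fun_prop) fun ξ hξ => ⟨hξ, hY⟩
  have hlevel : ∀ j, ∃ M, 0 ≤ M ∧ ∀ ζ ∈ P.sector j, ∀ Y ∈ closedBall (0 : E) R,
      ‖F j (ζ, Y)‖ ≤ M * P.weight j 1 ζ.re := by
    refine hext.exists_bound hθ (fun j => shrink_pos hepos j) (fun j => shrink_succ_lt hepos j)
      hK hR (c₁ := ∑ j, c₁ j) (M₁ := ∑ j, M₁ j) hc (Finset.sum_pos (fun j _ => hc₁ j) ⟨0, by simp⟩)
      (Finset.sum_pos (fun j _ => hM₁ j) ⟨0, by simp⟩) (fun j ζ hζ hp Y hY => ?_)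
      (A := A) (s₀ := Real.log (r / 2)) fun ζ hζ hs Y hY => ?_
    · have h1 : c₁ j ≤ ∑ j, c₁ j :=
        Finset.single_le_sum (fun i _ => (hc₁ i).le) (Finset.mem_univ j)
      have h2 : M₁ j ≤ ∑ j, M₁ j :=
        Finset.single_le_sum (fun i _ => (hM₁ i).le) (Finset.mem_univ j)
      refine (hbd j ζ hζ hp Y (hR hY)).trans ?_
      have := (hM₁ j).le
      change _ ≤ _ * Real.exp (_ * Real.exp (levelOrder k j * ζ.re))
      gcongr
      exact this.trans h2
    · have h3 : Real.exp ζ.re < r / 2 := (Real.lt_log_iff_exp_lt (by positivity)).1 hs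
      have h4 : Complex.exp ζ ∈ closedBall (0 : ℂ) (r / 2) := by
        rw [mem_closedBall_zero_iff, Complex.norm_exp]; exact h3.le
      rw [hF0 ζ (lt_trans hζ (hext.lt 0)) (by linarith) Y (hR hY), norm_mul, Complex.norm_exp,
        mul_comm]
      have h5 : ((1 - (k 0 : ℂ)) * ζ).re = (1 - k 0) * ζ.re := by simp
      rw [h5]
      exact mul_le_mul_of_nonneg_right (hA (Complex.exp ζ, Y) ⟨h4, hY⟩) (Real.exp_pos _).le
  choose M₂ hM₂0 hM₂ using hlevel
  filter_upwards [eventually_ge_atTop (∑ j, M₂ j), eventually_ge_atTop A₀, eventually_ge_atTop 0,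
    eventually_ge_atTop (4 * |A| * Real.Gamma (1 / P.k 0))] with M hMa hMb hM0 hMd hc'
  have hM₂' : ∀ j, ∀ ζ ∈ P.sector j, ∀ Y ∈ closedBall (0 : E) R,
      ‖F j (ζ, Y)‖ ≤ M * P.weight j 1 ζ.re := fun j ζ hζ Y hY =>
    (hM₂ j ζ hζ Y hY).trans (mul_le_mul_of_nonneg_right
      ((Finset.single_le_sum (fun i _ => hM₂0 i) (Finset.mem_univ j)).trans hMa)
      (P.weight_nonneg _ _ _))
  constructor
  · exact ⟨fun Y hY => (SectorData.Good.const (a 0 Y)).mono ((hA₀ Y (hb hY)).trans hMb),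
      continuousOn_const, fun n => by
        rcases n with _ | n
        · simpa [Chain.const] using (hcoef 0).mono (hb.trans hR)
        · simp [Chain.const],
      fun j => by simp [Chain.const]⟩
  · refine ⟨fun Y hY => ?_, continuousOn_const, fun n => ?_, fun j => ?_⟩
    · have hYK := hb hY
      have hYΩ := hR hYK
      refine ⟨hM0, fun n hn => ?_, ?_, fun s hs T => ?_, fun j => hext.holo_section j hYΩ,
        fun j ζ hζ => hM₂' j ζ hζ Y hYK, fun ζ hζ hs => ?_, fun j φ ψ s hφ hψ hgap hs =>
        hext.accel_eq hYΩ (fun ζ hζ => hM₂' j.castSucc ζ hζ Y hYK) hφ hψ hgap hs⟩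
      · obtain rfl : n = 0 := by omega
        simp [baseChain]
      · simpa [baseChain] using hM0
      · have hs' : Real.exp s ≤ r / 2 / 2 := by
          have := Real.exp_le_exp.2 (show s ≤ lam from hs.le)
          linarith
        refine (sum_monoWeight_le P (r := r / 2) (A := |A|) (a := fun n => a n Y) (by positivity)
          (abs_nonneg A) (fun n => ?_) hs' T).trans
          (mul_le_mul_of_nonneg_right hMd (P.weight_nonneg _ _ _))
        exact norm_coeff_le_of_hasSum (a := fun n : ℕ => a (n + 1) Y /
          (Real.Gamma (((n : ℝ) + 1) / P.k 0) : ℂ)) (by positivity) ((hhY Y hYΩ).mono hsub)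
          (fun ξ hξ => (hA (ξ, Y) ⟨sphere_subset_closedBall hξ, hYK⟩).trans (le_abs_self A))
          (fun ξ hξ => hsum ξ (ball_subset_ball (by linarith) hξ) Y hYΩ) n
      · have h3 : Real.exp ζ.re < r := by
          have := Real.exp_le_exp.2 (show ζ.re ≤ lam from hs.le)
          linarith
        have h4 : Complex.exp ζ ∈ ball (0 : ℂ) r := by
          rw [mem_ball_zero_iff, Complex.norm_exp]; exact h3
        change HasSum _ (F 0 (ζ, Y))
        rw [hF0 ζ (lt_trans hζ (hext.lt 0)) h3 Y hYΩ]
        exact hasSum_borelMono (a := fun n => a n Y) (hsum _ h4 Y hYΩ)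
    · rcases n with _ | n
      · simp [baseChain]
      · simpa [baseChain] using (hcoef (n + 1)).mono (hb.trans hR)
    · exact (hF j).mono (prod_mono (fun ζ hζ => lt_trans hζ (hext.lt j)) (hb.trans hR))

/-- Common data for finitely many multisummable series. -/
theorem exists_sectorData [FiniteDimensional ℂ E] {k θ : Fin (q + 1) → ℝ} (hk0 : 0 < k 0)
    (hk : StrictMono k) (hθ : IsMultidirection k θ) {Ω : Set E} (hΩ : IsOpen Ω) (h0 : (0 : E) ∈ Ω)
    {m : ℕ} {a : Fin m → ℕ → E → ℂ} (ha : ∀ i, IsMultisummable k θ Ω (a i)) :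
    ∃ (P : SectorData q) (F : Fin m → Fin (q + 1) → ℂ × E → ℂ) (R M : ℝ), P.k = k ∧ P.θ = θ ∧
      (∀ j, 0 < P.ε j) ∧ 0 < R ∧ R ≤ 1 ∧ 1 ≤ M ∧ ball 0 R ⊆ Ω ∧ ∀ i,
      P.GoodOn (ball 0 R) 0 (fun _ => M) (fun Y => Chain.const q (a i 0 Y)) ∧
      P.GoodOn (ball 0 R) 1 (fun _ => M) (baseChain (a i) (F i)) := by
  choose F hF using fun i => eventually_goodOn_baseChain hk0 hk hθ hΩ h0 (ha i)
  -- Each parameter is admissible eventually, once the preceding ones are fixed, so finitely many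
  -- series can share the opening, radius, type, Borel radius and bound.
  rw [← eventually_all] at hF
  obtain ⟨e, he, hepos⟩ := (hF.and self_mem_nhdsWithin).exists
  rw [← eventually_all] at he
  have hR1 : ∀ᶠ R : ℝ in 𝓝[>] 0, ball (0 : E) R ⊆ Ω := by
    obtain ⟨δ, hδ, hδΩ⟩ := Metric.isOpen_iff.1 hΩ 0 h0
    filter_upwards [mem_nhdsWithin_of_mem_nhds (gt_mem_nhds hδ)] with R hR
    exact (ball_subset_ball (le_of_lt hR)).trans hδΩ
  have hR2 : ∀ᶠ R : ℝ in 𝓝[>] 0, R < 1 := mem_nhdsWithin_of_mem_nhds (gt_mem_nhds one_pos)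
  obtain ⟨R, ⟨⟨hR, hRpos⟩, hRΩ⟩, hRlt⟩ :=
    (((he.and self_mem_nhdsWithin).and hR1).and hR2).exists
  rw [← eventually_all] at hR
  obtain ⟨c, hc, hcpos⟩ := (hR.and (eventually_gt_atTop 0)).exists
  rw [← eventually_all] at hc
  obtain ⟨lam, hlam⟩ := hc.exists
  rw [← eventually_all] at hlam
  obtain ⟨M, hM, hM1⟩ := (hlam.and (eventually_ge_atTop 1)).exists
  exact ⟨SectorData.mk k θ (shrink e) c lam hk0 hk hcpos, F, R, M, rfl, rfl,
    fun j => shrink_pos hepos j, hRpos, hRlt.le, hM1, hRΩ, fun i => hM i hcpos⟩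

end BaseTheorem
end

noncomputable section

open MeasureTheory Filter Topology Set Metric
open scoped Interval

/-! ### Scalar majorants and Nagumo's estimate. -/

section Majorant

/-- Constants bounding the graded Taylor terms. -/
def majorant (K : ℝ) (D : ℕ → ℝ) : ℕ → ℕ → ℝ
  | 0, l => if l ≤ 1 then 1 else 0
  | _ + 1, 0 => 0
  | d + 1, l + 1 => K * ∑ x ∈ Finset.HasAntidiagonal.antidiagonal l, D x.1 * majorant K D d x.2

lemma majorant_congr {K : ℝ} {D D' : ℕ → ℝ} (d l : ℕ) (h : ∀ a < l, D a = D' a) :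
    majorant K D d l = majorant K D' d l := by
  induction d generalizing l with
  | zero => rfl
  | succ d ih =>
    rcases l with _ | l
    · rfl
    · simp only [majorant]
      congr 1
      refine Finset.sum_congr rfl fun x hx => ?_
      have := Finset.HasAntidiagonal.mem_antidiagonal.1 hx
      rw [h _ (by omega), ih _ fun a ha => h a (by omega)]

lemma majorant_nonneg {K : ℝ} (hK : 0 ≤ K) {D : ℕ → ℝ} (d l : ℕ) (hD : ∀ a < l, 0 ≤ D a) :
    0 ≤ majorant K D d l := by
  induction d generalizing l with
  | zero => simp only [majorant]; split_ifs <;> norm_num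
  | succ d ih =>
    rcases l with _ | l
    · simp [majorant]
    · simp only [majorant]
      refine mul_nonneg hK (Finset.sum_nonneg fun x hx => ?_)
      have := Finset.HasAntidiagonal.mem_antidiagonal.1 hx
      exact mul_nonneg (hD _ (by omega)) (ih _ fun a ha => hD a (by omega))

lemma sum_range_antidiagonal_eq {α : Type*} [AddCommMonoid α] (N : ℕ) (F : ℕ × ℕ → α) :
    ∑ l ∈ Finset.range N, ∑ x ∈ Finset.HasAntidiagonal.antidiagonal l, F x =
      ∑ x ∈ Finset.range N ×ˢ Finset.range N, if x.1 + x.2 < N then F x else 0 := by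
  have h1 : ∀ l ∈ Finset.range N, ∑ x ∈ Finset.HasAntidiagonal.antidiagonal l, F x =
      ∑ x ∈ Finset.range N ×ˢ Finset.range N, if x.1 + x.2 = l then F x else 0 := by
    intro l hl
    rw [← Finset.sum_filter]
    refine Finset.sum_congr (Finset.ext fun x => ?_) fun _ _ => rfl
    have := Finset.mem_range.1 hl
    simp only [Finset.HasAntidiagonal.mem_antidiagonal, Finset.mem_filter, Finset.mem_product,
      Finset.mem_range]
    omega
  rw [Finset.sum_congr rfl h1, Finset.sum_comm]
  refine Finset.sum_congr rfl fun x _ => ?_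
  rw [Finset.sum_ite_eq]
  simp

lemma sum_range_antidiagonal_le {f g : ℕ → ℝ} (N : ℕ) (hf : ∀ a < N, 0 ≤ f a)
    (hg : ∀ a < N, 0 ≤ g a) :
    ∑ l ∈ Finset.range N, ∑ x ∈ Finset.HasAntidiagonal.antidiagonal l, f x.1 * g x.2 ≤
      (∑ a ∈ Finset.range N, f a) * ∑ a ∈ Finset.range N, g a := by
  rw [sum_range_antidiagonal_eq N fun x => f x.1 * g x.2, Finset.sum_mul_sum,
    ← Finset.sum_product']
  refine Finset.sum_le_sum fun x hx => ?_
  simp only [Finset.mem_product, Finset.mem_range] at hx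
  have := mul_nonneg (hf _ hx.1) (hg _ hx.2)
  split_ifs
  · exact le_rfl
  · exact this

/-- In terms of truncated generating functions, raising `d` by one multiplies the bound by `K ε S`,
with `S` the partial sum of `D a ε ^ a`; the initial one is at most `1 + ε ≤ 2`. Nonnegativity makes
the truncations harmless. -/
lemma sum_majorant_le {K ε : ℝ} (hK : 0 ≤ K) (hε : 0 ≤ ε) (hε1 : ε ≤ 1) {D : ℕ → ℝ}
    (hD : ∀ a, 0 ≤ D a) (d N : ℕ) :
    ∑ l ∈ Finset.range (N + 1), majorant K D d l * ε ^ l ≤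
      2 * (K * ε * ∑ a ∈ Finset.range N, D a * ε ^ a) ^ d := by
  induction d generalizing N with
  | zero =>
    have h1 : ∀ l ∈ Finset.range (N + 1), majorant K D 0 l * ε ^ l ≤
        (if l = 0 then 1 else 0) + (if l = 1 then 1 else 0) := by
      intro l _
      rcases l with _ | _ | l
      · simp [majorant]
      · simpa [majorant] using hε1
      · simp [majorant]
    refine (Finset.sum_le_sum h1).trans ?_
    rw [Finset.sum_add_distrib, Finset.sum_ite_eq', Finset.sum_ite_eq']
    split_ifs <;> norm_num
  | succ d ih =>
    have hm : ∀ d l, 0 ≤ majorant K D d l := fun d l => majorant_nonneg hK d l fun a _ => hD a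
    rw [Finset.sum_range_succ']
    have e : ∀ l ∈ Finset.range N, majorant K D (d + 1) (l + 1) * ε ^ (l + 1) =
        K * ε * ∑ x ∈ Finset.HasAntidiagonal.antidiagonal l,
          (D x.1 * ε ^ x.1) * (majorant K D d x.2 * ε ^ x.2) := by
      intro l _
      simp only [majorant]
      rw [Finset.mul_sum, Finset.mul_sum, Finset.sum_mul]
      refine Finset.sum_congr rfl fun x hx => ?_
      rw [← Finset.HasAntidiagonal.mem_antidiagonal.1 hx]
      ring
    rw [Finset.sum_congr rfl e, ← Finset.mul_sum]
    simp only [majorant, zero_mul, add_zero]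
    set S := ∑ a ∈ Finset.range N, D a * ε ^ a with hS
    have hS0 : 0 ≤ S := Finset.sum_nonneg fun a _ => mul_nonneg (hD a) (by positivity)
    have h2 := sum_range_antidiagonal_le N (f := fun a => D a * ε ^ a)
      (g := fun a => majorant K D d a * ε ^ a) (fun a _ => mul_nonneg (hD a) (by positivity))
      (fun a _ => mul_nonneg (hm d a) (by positivity))
    have h3 : ∑ a ∈ Finset.range N, majorant K D d a * ε ^ a ≤ 2 * (K * ε * S) ^ d := by
      refine le_trans ?_ (ih N)
      rw [Finset.sum_range_succ]
      have := mul_nonneg (hm d N) (pow_nonneg hε N)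
      linarith
    calc _ ≤ K * ε * (S * (2 * (K * ε * S) ^ d)) := by
          gcongr
          exact h2.trans (by gcongr)
      _ = _ := by ring

/-- The majorant sequence grows at most geometrically. -/
theorem exists_majorant_solution {K M R : ℝ} (hK : 0 ≤ K) (hM : 1 ≤ M) (hR : 0 < R) :
    ∃ D : ℕ → ℝ, (∀ l, 0 ≤ D l) ∧
      (∀ l, D l = M * ∑ d ∈ Finset.range (l + 1), majorant K D d l * R⁻¹ ^ d) ∧
      ∃ C, 1 ≤ C ∧ ∀ l, D l ≤ 4 * M * C ^ l := by
  obtain ⟨D, hD⟩ := exists_causal_fixedPoint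
    (fun D l => M * ∑ d ∈ Finset.range (l + 1), majorant K D d l * R⁻¹ ^ d) (by
      intro u u' n h
      congr 1
      exact Finset.sum_congr rfl fun d _ => by rw [majorant_congr d n h])
  have hD0 : ∀ l, 0 ≤ D l := by
    intro l
    induction l using Nat.strong_induction_on with
    | _ l ih =>
      rw [hD]
      exact mul_nonneg (by linarith) (Finset.sum_nonneg fun d _ =>
        mul_nonneg (majorant_nonneg hK d l ih) (by positivity))
  refine ⟨D, hD0, hD, ?_⟩
  -- Chosen so that `4 K M ε / R ≤ 1 / 2`. As long as a partial sum is at most `4 M`, the geometric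
  -- series over `d` bounds the next one by `M * 2 * 2 = 4 M` again.
  set ε := (1 + 8 * K * M / R)⁻¹ with hεdef
  have hpos : 0 ≤ 8 * K * M / R := by positivity
  have hε : 0 < ε := by positivity
  have hε1 : ε ≤ 1 := inv_le_one_of_one_le₀ (by linarith)
  have hεK : K * ε * (4 * M) * R⁻¹ ≤ 1 / 2 := by
    have h1 : (1 + 8 * K * M / R) * ε = 1 := mul_inv_cancel₀ (by positivity)
    have h2 : K * ε * (4 * M) * R⁻¹ = (8 * K * M / R * ε) / 2 := by field_simp; ring
    rw [h2]
    linarith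
  have hS : ∀ N, ∑ a ∈ Finset.range N, D a * ε ^ a ≤ 4 * M := by
    intro N
    induction N with
    | zero => simp; linarith
    | succ N ih =>
      set S := ∑ a ∈ Finset.range N, D a * ε ^ a with hSdef
      have hS0 : 0 ≤ S := Finset.sum_nonneg fun a _ => mul_nonneg (hD0 a) (by positivity)
      have hx : K * ε * S * R⁻¹ ≤ 1 / 2 := by
        refine le_trans ?_ hεK
        gcongr
      have h1 : ∑ a ∈ Finset.range (N + 1), D a * ε ^ a ≤ M * ∑ d ∈ Finset.range (N + 1),
          R⁻¹ ^ d * ∑ a ∈ Finset.range (N + 1), majorant K D d a * ε ^ a := by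
        simp only [Finset.mul_sum]
        rw [Finset.sum_comm]
        refine Finset.sum_le_sum fun a ha => ?_
        have ha' := Finset.mem_range.1 ha
        conv_lhs => rw [hD a, Finset.mul_sum, Finset.sum_mul]
        have hle : Finset.range (a + 1) ⊆ Finset.range (N + 1) :=
          Finset.range_subset_range.2 (by omega)
        calc _ = ∑ d ∈ Finset.range (a + 1), M * (R⁻¹ ^ d * (majorant K D d a * ε ^ a)) :=
              Finset.sum_congr rfl fun d _ => by ring
          _ ≤ _ := Finset.sum_le_sum_of_subset_of_nonneg hle fun d _ _ => by
              have := majorant_nonneg hK d a (D := D) fun a _ => hD0 a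
              positivity
      have h2 : ∀ d ∈ Finset.range (N + 1), R⁻¹ ^ d *
          ∑ a ∈ Finset.range (N + 1), majorant K D d a * ε ^ a ≤ 2 * (1 / 2) ^ d := by
        intro d _
        calc _ ≤ R⁻¹ ^ d * (2 * (K * ε * S) ^ d) := by
              gcongr; exact sum_majorant_le hK hε.le hε1 hD0 d N
          _ = 2 * (K * ε * S * R⁻¹) ^ d := by rw [mul_pow _ R⁻¹]; ring
          _ ≤ _ := by gcongr
      have h3 : ∑ d ∈ Finset.range (N + 1), (1 / 2 : ℝ) ^ d ≤ 2 :=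
        (summable_geometric_two.sum_le_tsum _ fun n _ => by positivity).trans
          tsum_geometric_two.le
      refine h1.trans ?_
      calc _ ≤ M * ∑ d ∈ Finset.range (N + 1), 2 * (1 / 2 : ℝ) ^ d := by
            gcongr ?_ * ?_; exact Finset.sum_le_sum h2
        _ = M * (2 * ∑ d ∈ Finset.range (N + 1), (1 / 2 : ℝ) ^ d) := by rw [← Finset.mul_sum]
        _ ≤ M * (2 * 2) := by gcongr
        _ = _ := by ring
  refine ⟨ε⁻¹, (one_le_inv₀ hε).2 hε1, fun l => ?_⟩
  have h1 : D l * ε ^ l ≤ 4 * M := (Finset.single_le_sum (f := fun a => D a * ε ^ a)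
    (fun a _ => mul_nonneg (hD0 a) (by positivity)) (Finset.self_mem_range_succ l)).trans (hS _)
  rw [inv_pow, ← div_eq_mul_inv, le_div_iff₀ (by positivity)]
  exact h1

/-- Nagumo's choice of radius: `t` and `t'` are the distances to the boundary at the centre and on a
circle of radius `t / (d + 2)`. The loss `(1 + 1 / (d + 1)) ^ d` is below `3`, and `d + 2 ≤ 2 (d +
1)`; this gives the constant `6`. -/
lemma nagumo {t t' : ℝ} (ht : 0 < t) (d : ℕ) (h : t - t / (d + 2) ≤ t') :
    t'⁻¹ ^ d ≤ t / (d + 2) * (6 * (d + 1) * t⁻¹ ^ (d + 1)) := by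
  have hd : (0 : ℝ) < d + 1 := by positivity
  have hd2 : (0 : ℝ) < d + 2 := by positivity
  have e1 : t - t / (d + 2) = t * ((d + 1) / (d + 2)) := by field_simp; ring
  rw [e1] at h
  have h1 : t'⁻¹ ≤ t⁻¹ * (1 / (d + 1) + 1) := by
    have h2 : (t * ((d + 1) / (d + 2)))⁻¹ = t⁻¹ * (1 / (d + 1 : ℝ) + 1) := by field_simp; ring
    rw [← h2]
    exact inv_anti₀ (by positivity) h
  have h0 : 0 ≤ t'⁻¹ := inv_nonneg.2 (le_trans (by positivity) h)
  have h3 : (1 / (d + 1 : ℝ) + 1) ^ d ≤ 3 := by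
    calc _ ≤ Real.exp (1 / (d + 1 : ℝ)) ^ d := by
          gcongr; exact Real.add_one_le_exp _
      _ = Real.exp (d / (d + 1)) := by rw [← Real.exp_nat_mul]; congr 1; ring
      _ ≤ Real.exp 1 := Real.exp_le_exp.2 ((div_le_one hd).2 (by linarith))
      _ ≤ 3 := by have := Real.exp_one_lt_d9; linarith
  calc t'⁻¹ ^ d ≤ (t⁻¹ * (1 / (d + 1) + 1)) ^ d := by gcongr
    _ = t⁻¹ ^ d * (1 / (d + 1 : ℝ) + 1) ^ d := mul_pow _ _ _
    _ ≤ t⁻¹ ^ d * 3 := by gcongr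
    _ ≤ t⁻¹ ^ d * (6 * (d + 1) / (d + 2)) := by
        gcongr
        rw [le_div_iff₀ hd2]
        have : (0 : ℝ) ≤ d := Nat.cast_nonneg d
        linarith
    _ = _ := by rw [pow_succ]; field_simp

end Majorant
end

noncomputable section

open MeasureTheory Filter Topology Set Metric
open scoped Interval

/-! ### The graded scheme for the equation and its bounds. -/

section Scheme

variable {q m n : ℕ}

/-- Graded pieces of the terms of degree `d` in the Taylor expansion of `∑ g_l` along
`∑_a ∑_i y_{a,i} b_i`, where `y_{a,i}` has grade `a + 1`. -/
def gradedTerm {E ι : Type*} [NormedAddCommGroup E] [NormedSpace ℂ E] [Fintype ι]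
    (k : Fin (q + 1) → ℝ) (b : ι → E)
    (y : ℕ → ι → E → Chain q) (g : ℕ → E → Chain q) : ℕ → ℕ → E → Chain q
  | 0, l => g l
  | _ + 1, 0 => 0
  | d + 1, l + 1 => ((d : ℂ) + 1)⁻¹ • ∑ i, ∑ x ∈ Finset.HasAntidiagonal.antidiagonal l,
      fun Y => Chain.mul k (y x.1 i Y) (SectorData.dirDeriv (b i) (gradedTerm k b y g d x.2) Y)

lemma gradedTerm_congr {E ι : Type*} [NormedAddCommGroup E] [NormedSpace ℂ E] [Fintype ι]
    {k : Fin (q + 1) → ℝ} {b : ι → E} {y y' : ℕ → ι → E → Chain q} {g : ℕ → E → Chain q}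
    (d l : ℕ) (h : ∀ a < l, y a = y' a) :
    gradedTerm k b y g d l = gradedTerm k b y' g d l := by
  induction d generalizing l with
  | zero => rfl
  | succ d ih =>
    rcases l with _ | l
    · rfl
    · simp only [gradedTerm]
      congr 1
      refine Finset.sum_congr rfl fun i _ => Finset.sum_congr rfl fun x hx => ?_
      have := Finset.HasAntidiagonal.mem_antidiagonal.1 hx
      rw [h _ (by omega), ih _ fun a ha => h a (by omega)]

/-- The chains of the jet `(U, ∇_x U)`. -/
def jetChain (U : ℕ → Fin m → (Fin n → ℂ) → Chain q) (a : ℕ) :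
    JetIndex m n → JetSpace m n → Chain q
  | .inl i => fun Y => U a i Y.1
  | .inr (i, c) => fun Y => SectorData.dirDeriv (Pi.single c 1) (U a i) Y.1

/-- The chain of grade `l` of the right-hand side of the equation, integrated and divided by `t`. -/
def nextChain (k : Fin (q + 1) → ℝ) (g : ℕ → JetSpace m n → Chain q)
    (U : ℕ → Fin m → (Fin n → ℂ) → Chain q) (l : ℕ) (x : Fin n → ℂ) : Chain q :=
  Chain.dil k ((∑ d ∈ Finset.range (l + 1), gradedTerm k jetDir (jetChain U) g d l) (jetBase x))

lemma nextChain_congr {k : Fin (q + 1) → ℝ} {g : ℕ → JetSpace m n → Chain q}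
    {U U' : ℕ → Fin m → (Fin n → ℂ) → Chain q} (l : ℕ) (h : ∀ a < l, U a = U' a) :
    nextChain k g U l = nextChain k g U' l := by
  have : ∀ d, gradedTerm k jetDir (jetChain U) g d l = gradedTerm k jetDir (jetChain U') g d l := by
    intro d
    refine gradedTerm_congr d l fun a ha => ?_
    funext i
    rcases i with i | ⟨i, c⟩ <;> simp only [jetChain, h a ha]
  funext x
  simp only [nextChain, this]

/-- The graded fixed point. -/
theorem exists_chain_solution (k : Fin (q + 1) → ℝ) (g : Fin m → ℕ → JetSpace m n → Chain q) :
    ∃ U : ℕ → Fin m → (Fin n → ℂ) → Chain q, ∀ l i,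
      U l i = fun x => Chain.mul k (Chain.var k) (nextChain k (g i) U l x) := by
  obtain ⟨U, hU⟩ := exists_causal_fixedPoint
    (fun (U : ℕ → Fin m → (Fin n → ℂ) → Chain q) l i x =>
      Chain.mul k (Chain.var k) (nextChain k (g i) U l x)) (by
      intro U U' l h
      funext i x
      rw [nextChain_congr l h])
  exact ⟨U, fun l i => by rw [hU l]⟩

variable {P : SectorData q} {R M : ℝ}

lemma norm_jetDir_snd_le (i : JetIndex m n) : ‖(jetDir i : JetSpace m n).2‖ ≤ 1 := by
  rcases i with i | ⟨i, c⟩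
  · simp only [jetDir, Prod.norm_def, norm_zero]
    rw [Pi.norm_single]
    simp
  · simp only [jetDir, Prod.norm_def, norm_zero]
    rw [Pi.norm_single, Pi.norm_single]
    simp

lemma jetDir_fst (i : JetIndex m n) : (jetDir i : JetSpace m n).1 = 0 := by
  rcases i with i | ⟨i, c⟩ <;> rfl

lemma mem_jetBall {Y : JetSpace m n} : Y ∈ ball (0 : JetSpace m n) R ↔ ‖Y.1‖ < R ∧ ‖Y.2‖ < R := by
  rw [mem_ball_zero_iff, Prod.norm_def, max_lt_iff]

lemma continuousOn_inv_pow {X : Type*} [TopologicalSpace X] {s : Set X} {h : X → ℝ}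
    (hc : Continuous h) (hs : ∀ x ∈ s, h x < R) (d : ℕ) :
    ContinuousOn (fun x => (R - h x)⁻¹ ^ d) s :=
  ((continuous_const.sub hc).continuousOn.inv₀ fun x hx => by
    have := hs x hx
    exact (sub_pos.2 this).ne').pow d

lemma one_le_inv_pow {t : ℝ} (ht : 0 < t) (ht1 : t ≤ 1) (d : ℕ) : 1 ≤ t⁻¹ ^ d :=
  one_le_pow₀ ((one_le_inv₀ ht).2 ht1)

/-- Bounds for the jet. -/
lemma goodOn_jetChain (hR1 : R ≤ 1) {U : ℕ → Fin m → (Fin n → ℂ) → Chain q}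
    {a : ℕ} {D : ℝ} (hD : 0 ≤ D) (hU : ∀ i, P.GoodOn (ball 0 R) (a + 1)
      (fun x => D / (a + 1) * (R - ‖x‖)⁻¹ ^ a) (U a i)) (i : JetIndex m n) :
    P.GoodOn (ball 0 R) (a + 1) (fun Y => 6 * D * (R - ‖Y.1‖)⁻¹ ^ (a + 1)) (jetChain U a i) := by
  have ho : IsOpen (ball (0 : Fin n → ℂ) R) := isOpen_ball
  have hm : MapsTo (Prod.fst : JetSpace m n → _) (ball 0 R) (ball 0 R) := fun Y hY => by
    rw [mem_ball_zero_iff]; exact (mem_jetBall.1 hY).1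
  have hcont : ContinuousOn (fun x : Fin n → ℂ => 6 * D * (R - ‖x‖)⁻¹ ^ (a + 1)) (ball 0 R) :=
    continuousOn_const.mul (continuousOn_inv_pow continuous_norm (fun x hx => by simpa using hx) _)
  rcases i with i | ⟨i, c⟩
  · refine SectorData.GoodOn.comp (B := fun x => 6 * D * (R - ‖x‖)⁻¹ ^ (a + 1))
      ((hU i).mono hcont fun x hx => ?_) differentiable_fst hm
    have h1 : 0 < R - ‖x‖ := sub_pos.2 (by simpa using hx)
    have h2 : 1 ≤ (R - ‖x‖)⁻¹ := (one_le_inv₀ h1).2 (by linarith [norm_nonneg x])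
    calc D / (a + 1) * (R - ‖x‖)⁻¹ ^ a ≤ D * (R - ‖x‖)⁻¹ ^ (a + 1) := by
          gcongr
          · exact div_le_self hD (by linarith [(Nat.cast_nonneg a : (0 : ℝ) ≤ a)])
          · omega
      _ ≤ _ := by
          have := mul_nonneg hD (pow_nonneg (zero_le_one.trans h2) (a + 1))
          linarith
  · refine SectorData.GoodOn.comp (B := fun x => 6 * D * (R - ‖x‖)⁻¹ ^ (a + 1))
      ((hU i).dirDeriv ho hcont fun x hx => ?_) differentiable_fst hm
    have h1 : 0 < R - ‖x‖ := sub_pos.2 (by simpa using hx)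
    have hlt : (R - ‖x‖) / (a + 2) < R - ‖x‖ :=
      div_lt_self h1 (by linarith [(Nat.cast_nonneg a : (0 : ℝ) ≤ a)])
    refine ⟨(R - ‖x‖) / (a + 2), by positivity, fun z hz => ?_⟩
    have h3 : ‖x + z • (Pi.single c 1 : Fin n → ℂ)‖ ≤ ‖x‖ + (R - ‖x‖) / (a + 2) := by
      refine (norm_add_le _ _).trans ?_
      rw [norm_smul, Pi.norm_single, norm_one, mul_one]
      gcongr
    refine ⟨by rw [mem_ball_zero_iff]; linarith, ?_⟩
    -- The factor `a + 1` lost in Cauchy's estimate is cancelled by the `1 / (a + 1)` in the bound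
    -- for `U`, so the constant `6` does not depend on `a`.
    have h4 := nagumo h1 a (t' := R - ‖x + z • (Pi.single c 1 : Fin n → ℂ)‖) (by linarith)
    calc _ ≤ D / (a + 1) * ((R - ‖x‖) / (a + 2) * (6 * (a + 1) * (R - ‖x‖)⁻¹ ^ (a + 1))) := by
          gcongr
      _ = _ := by field_simp

/-- Bounds for the graded Taylor terms. -/
lemma goodOn_gradedTerm (hR1 : R ≤ 1) (hM : 0 ≤ M)
    {g : ℕ → JetSpace m n → Chain q} (hg0 : P.GoodOn (ball 0 R) 0 (fun _ => M) (g 0))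
    (hg1 : P.GoodOn (ball 0 R) 1 (fun _ => M) (g 1)) (hg : ∀ l, g (l + 2) = 0)
    {y : ℕ → JetIndex m n → JetSpace m n → Chain q} {D : ℕ → ℝ} (hD : ∀ a, 0 ≤ D a) {L : ℕ}
    (hy : ∀ a < L, ∀ i, P.GoodOn (ball 0 R) (a + 1)
      (fun Y => 6 * D a * (R - ‖Y.1‖)⁻¹ ^ (a + 1)) (y a i)) (d l : ℕ) (hl : l ≤ L) :
    P.GoodOn (ball 0 R) l (fun Y => M * majorant (36 * Fintype.card (JetIndex m n)) D d l *
      ((R - ‖Y.1‖)⁻¹ ^ l * (R - ‖Y.2‖)⁻¹ ^ d)) (gradedTerm P.k jetDir y g d l) := by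
  -- One `6` comes from the bounds on the jet, the other from differentiation in the jet directions;
  -- the cardinality accounts for the sum over directions. The remaining factor `d + 1` is cancelled
  -- by the inverse of `d + 1` in `gradedTerm`.
  set K : ℝ := 36 * Fintype.card (JetIndex m n) with hK
  have hK0 : 0 ≤ K := by positivity
  have hcont : ∀ (a : ℝ) (d l : ℕ), ContinuousOn (fun Y : JetSpace m n =>
      a * ((R - ‖Y.1‖)⁻¹ ^ l * (R - ‖Y.2‖)⁻¹ ^ d)) (ball 0 R) := fun a d l =>
    continuousOn_const.mul ((continuousOn_inv_pow (by fun_prop) (fun Y hY => (mem_jetBall.1 hY).1)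
      l).mul (continuousOn_inv_pow (by fun_prop) (fun Y hY => (mem_jetBall.1 hY).2) d))
  induction d generalizing l with
  | zero =>
    have hb : ∀ l ≤ 1, ∀ Y ∈ ball (0 : JetSpace m n) R, M ≤ M * majorant K D 0 l *
        ((R - ‖Y.1‖)⁻¹ ^ l * (R - ‖Y.2‖)⁻¹ ^ 0) := by
      intro l hl Y hY
      have h1 := sub_pos.2 (mem_jetBall.1 hY).1
      simp only [majorant, if_pos hl, mul_one, pow_zero]
      exact le_mul_of_one_le_right hM (one_le_inv_pow h1 (by linarith [norm_nonneg Y.1]) _)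
    rcases l with _ | _ | l
    · exact hg0.mono (hcont _ _ _) (hb 0 (by norm_num))
    · exact hg1.mono (hcont _ _ _) (hb 1 le_rfl)
    · simp only [gradedTerm, hg]
      refine (SectorData.GoodOn.zero _ _).mono (hcont _ _ _) fun Y _ => ?_
      simp [majorant]
  | succ d ih =>
    rcases l with _ | l
    · simp only [gradedTerm]
      refine (SectorData.GoodOn.zero _ _).mono (hcont _ _ _) fun Y _ => ?_
      simp [majorant]
    · have hterm : ∀ (i : JetIndex m n), ∀ x ∈ Finset.HasAntidiagonal.antidiagonal l,
          P.GoodOn (ball 0 R) (l + 1) (fun Y => 6 * D x.1 * (R - ‖Y.1‖)⁻¹ ^ (x.1 + 1) *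
            (6 * (d + 1) * (M * majorant K D d x.2) *
              ((R - ‖Y.1‖)⁻¹ ^ x.2 * (R - ‖Y.2‖)⁻¹ ^ (d + 1)))) (fun Y => Chain.mul P.k (y x.1 i Y)
              (SectorData.dirDeriv (jetDir i) (gradedTerm P.k jetDir y g d x.2) Y)) := by
        intro i x hx
        have hx' := Finset.HasAntidiagonal.mem_antidiagonal.1 hx
        have hder : P.GoodOn (ball 0 R) x.2 (fun Y => 6 * (d + 1) * (M * majorant K D d x.2) *
            ((R - ‖Y.1‖)⁻¹ ^ x.2 * (R - ‖Y.2‖)⁻¹ ^ (d + 1)))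
            (SectorData.dirDeriv (jetDir i) (gradedTerm P.k jetDir y g d x.2)) := by
          refine (ih x.2 (by omega)).dirDeriv isOpen_ball (hcont _ _ _) fun Y hY => ?_
          obtain ⟨hY1, hY2⟩ := mem_jetBall.1 hY
          have h1 := sub_pos.2 hY1
          have h2 := sub_pos.2 hY2
          have hlt : (R - ‖Y.2‖) / (d + 2) < R - ‖Y.2‖ :=
            div_lt_self h2 (by linarith [(Nat.cast_nonneg d : (0 : ℝ) ≤ d)])
          refine ⟨(R - ‖Y.2‖) / (d + 2), by positivity, fun z hz => ?_⟩
          -- These directions have no component along `x`, so only the power of `R - ‖Y.2‖` is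
          -- affected.
          have e1 : (Y + z • jetDir i).1 = Y.1 := by
            rw [Prod.fst_add, Prod.smul_fst, jetDir_fst, smul_zero, add_zero]
          have h3 : ‖(Y + z • jetDir i).2‖ ≤ ‖Y.2‖ + (R - ‖Y.2‖) / (d + 2) := by
            rw [Prod.snd_add, Prod.smul_snd]
            refine (norm_add_le _ _).trans ?_
            rw [norm_smul]
            gcongr
            calc _ ≤ ‖z‖ * 1 := by gcongr; exact norm_jetDir_snd_le i
              _ ≤ _ := by rwa [mul_one]
          refine ⟨mem_jetBall.2 ⟨by rwa [e1], by linarith⟩, ?_⟩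
          have h4 := nagumo h2 d (t' := R - ‖(Y + z • jetDir i).2‖) (by linarith)
          have hm := majorant_nonneg hK0 d x.2 (D := D) fun a _ => hD a
          rw [e1]
          calc _ ≤ M * majorant K D d x.2 * ((R - ‖Y.1‖)⁻¹ ^ x.2 *
                ((R - ‖Y.2‖) / (d + 2) * (6 * (d + 1) * (R - ‖Y.2‖)⁻¹ ^ (d + 1)))) := by
                gcongr
            _ = _ := by ring
        have h5 := (hy x.1 (by omega) i).mul isOpen_ball (Nat.succ_ne_zero _) hder
        have e2 : x.1 + 1 + x.2 = l + 1 := by omega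
        rw [e2] at h5
        exact h5
      simp only [gradedTerm]
      refine ((SectorData.GoodOn.sum Finset.univ fun i _ => SectorData.GoodOn.sum _
        fun x hx => hterm i x hx).smul _).mono (hcont _ _ _) fun Y hY => le_of_eq ?_
      simp only [Finset.sum_apply, Finset.sum_const, Finset.card_univ, nsmul_eq_mul, majorant]
      have e3 : ‖((d : ℂ) + 1)⁻¹‖ = ((d : ℝ) + 1)⁻¹ := by
        rw [norm_inv]
        congr 1
        exact_mod_cast Complex.norm_natCast (d + 1)
      rw [e3, Finset.mul_sum, Finset.mul_sum, Finset.mul_sum, Finset.mul_sum, Finset.sum_mul]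
      refine Finset.sum_congr rfl fun x hx => ?_
      rw [← Finset.HasAntidiagonal.mem_antidiagonal.1 hx, hK]
      have hd : (d : ℝ) + 1 ≠ 0 := by positivity
      field_simp
      ring

/-- Bounds for the graded fixed point. -/
theorem goodOn_nextChain (hR : 0 < R) (hR1 : R ≤ 1) (hM : 0 ≤ M)
    {g : Fin m → ℕ → JetSpace m n → Chain q}
    (hg0 : ∀ i, P.GoodOn (ball 0 R) 0 (fun _ => M) (g i 0))
    (hg1 : ∀ i, P.GoodOn (ball 0 R) 1 (fun _ => M) (g i 1)) (hg : ∀ i l, g i (l + 2) = 0)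
    {U : ℕ → Fin m → (Fin n → ℂ) → Chain q}
    (hU : ∀ l i, U l i = fun x => Chain.mul P.k (Chain.var P.k) (nextChain P.k (g i) U l x))
    {D : ℕ → ℝ} (hD0 : ∀ l, 0 ≤ D l) (hD : ∀ l, D l = M * ∑ d ∈ Finset.range (l + 1),
      majorant (36 * Fintype.card (JetIndex m n)) D d l * R⁻¹ ^ d) (l : ℕ) :
    (∀ i d, P.GoodOn (ball 0 R) l (fun Y => M * majorant
      (36 * Fintype.card (JetIndex m n)) D d l * ((R - ‖Y.1‖)⁻¹ ^ l * (R - ‖Y.2‖)⁻¹ ^ d))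
      (gradedTerm P.k jetDir (jetChain U) (g i) d l)) ∧
    (∀ i, P.GoodOn (ball 0 R) l (fun x => D l / (l + 1) * (R - ‖x‖)⁻¹ ^ l)
      (nextChain P.k (g i) U l)) ∧
    (∀ i, P.GoodOn (ball 0 R) (l + 1) (fun x => D l / (l + 1) * (R - ‖x‖)⁻¹ ^ l) (U l i)) := by
  induction l using Nat.strong_induction_on with
  | _ l ih =>
    have hy : ∀ a < l, ∀ i, P.GoodOn (ball 0 R) (a + 1)
        (fun Y => 6 * D a * (R - ‖Y.1‖)⁻¹ ^ (a + 1)) (jetChain U a i) := fun a ha i =>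
      goodOn_jetChain hR1 (hD0 a) (ih a ha).2.2 i
    have hT := fun i d => goodOn_gradedTerm hR1 hM (hg0 i) (hg1 i) (hg i) hD0 hy d l le_rfl
    have hmaps : MapsTo (jetBase : (Fin n → ℂ) → JetSpace m n) (ball 0 R) (ball 0 R) :=
      fun x hx => mem_jetBall.2 ⟨by simpa [jetBase] using hx, by simpa [jetBase] using hR⟩
    have hbase : Differentiable ℂ (jetBase : (Fin n → ℂ) → JetSpace m n) :=
      differentiable_id.prodMk (differentiable_const _)
    have hcont : ContinuousOn (fun x : Fin n → ℂ => D l / (l + 1) * (R - ‖x‖)⁻¹ ^ l) (ball 0 R) :=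
      continuousOn_const.mul
        (continuousOn_inv_pow continuous_norm (fun x hx => by simpa using hx) _)
    have hN : ∀ i, P.GoodOn (ball 0 R) l (fun x => D l / (l + 1) * (R - ‖x‖)⁻¹ ^ l)
        (nextChain P.k (g i) U l) := by
      intro i
      refine (((SectorData.GoodOn.sum (Finset.range (l + 1)) fun d _ => hT i d).comp hbase
        hmaps).dil isOpen_ball).mono hcont fun x hx => le_of_eq ?_
      simp only [Function.comp, Finset.sum_apply, jetBase]
      -- At the base point the second component vanishes, so its power becomes `R⁻¹ ^ d` and the sum
      -- over `d` is exactly the recursion defining `D`.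
      have e : ‖((0, 0) : (Fin m → ℂ) × (Fin m → Fin n → ℂ))‖ = 0 := norm_zero
      rw [e, sub_zero, hD l, Finset.mul_sum, Finset.sum_div, Finset.sum_div, Finset.sum_mul]
      refine Finset.sum_congr rfl fun d _ => ?_
      ring
    refine ⟨hT, hN, fun i => ?_⟩
    rw [hU l i, add_comm l 1]
    exact ((SectorData.GoodOn.var (ball 0 R)).mul isOpen_ball one_ne_zero (hN i)).mono hcont
      fun x _ => by rw [one_mul]

end Scheme
end

noncomputable section

open MeasureTheory Filter Topology Set Metric
open scoped Interval

/-! ### Summation over all grades. -/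

section WeightSums

/-- In the integral for `Γ(s + 1)` only `t ≥ y` is kept, where `t ^ s ≥ y ^ s`. -/
lemma rpow_le_exp_mul_Gamma {y s : ℝ} (hy : 0 ≤ y) (hs : 0 ≤ s) :
    y ^ s ≤ Real.exp y * Real.Gamma (s + 1) := by
  have hs1 : 0 < s + 1 := by linarith
  rw [Real.Gamma_eq_integral hs1, add_sub_cancel_right]
  have hint := Real.GammaIntegral_convergent hs1
  rw [add_sub_cancel_right] at hint
  have h1 : ∫ t in Ioi y, Real.exp (-t) * y ^ s ≤ ∫ t in Ioi 0, Real.exp (-t) * t ^ s := by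
    have hsub : Ioi y ⊆ Ioi 0 := Ioi_subset_Ioi hy
    refine (setIntegral_mono_on ((integrableOn_exp_neg_Ioi y).mul_const _) (hint.mono_set hsub)
      measurableSet_Ioi fun t ht => ?_).trans (setIntegral_mono_set hint ?_ hsub.eventuallyLE)
    · have : y ≤ t := le_of_lt ht
      gcongr
    · filter_upwards [ae_restrict_mem measurableSet_Ioi] with t ht
      have : 0 < t := ht
      positivity
  rw [integral_mul_const, integral_exp_neg_Ioi] at h1
  calc y ^ s = Real.exp y * (Real.exp (-y) * y ^ s) := by
        rw [← mul_assoc, ← Real.exp_add]; simp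
    _ ≤ _ := by gcongr

/-- The factor `1 / Γ(l / k)` makes a power series in `Z` of exponential order `k`. Comparison at `2
* max Z 1` produces the geometric factor `(1 / 2) ^ l`, while one factor `Z` is kept outside so that
the result retains grade `1`. -/
lemma pow_div_Gamma_le {k Z : ℝ} (hk : 0 < k) (hZ : 0 ≤ Z) (l : ℕ) :
    Z ^ l / Real.Gamma (l / k) ≤
      l / k * (1 / 2) ^ l * (Z * Real.exp (2 ^ k * (1 + Z ^ k))) := by
  rcases Nat.eq_zero_or_pos l with rfl | hl
  · simp [Real.Gamma_zero]
  have hl' : (0 : ℝ) < l := by exact_mod_cast hl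
  have hG : 0 < Real.Gamma (l / k) := Real.Gamma_pos_of_pos (by positivity)
  set W := max Z 1 with hW
  have hW1 : 1 ≤ W := le_max_right _ _
  have hW0 : 0 < W := by linarith
  have h1 := rpow_le_exp_mul_Gamma (y := (2 * W) ^ k) (s := l / k) (by positivity) (by positivity)
  have e1 : ((2 * W) ^ k) ^ ((l : ℝ) / k) = 2 ^ l * W ^ l := by
    rw [← Real.rpow_mul (by positivity), mul_div_cancel₀ _ hk.ne', Real.rpow_natCast, mul_pow]
  rw [e1, Real.Gamma_add_one (by positivity)] at h1
  have h2 : Z ^ l ≤ Z * W ^ l := by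
    obtain ⟨l, rfl⟩ : ∃ l', l = l' + 1 := ⟨l - 1, by omega⟩
    rw [pow_succ']
    gcongr
    calc Z ^ l ≤ W ^ l := by gcongr; exact le_max_left _ _
      _ ≤ _ := pow_le_pow_right₀ hW1 (by omega)
  have h3 : (2 * W) ^ k ≤ 2 ^ k * (1 + Z ^ k) := by
    rw [Real.mul_rpow (by norm_num) hW0.le]
    gcongr
    rcases le_total Z 1 with h | h
    · rw [hW, max_eq_right h, Real.one_rpow]
      have := Real.rpow_nonneg hZ k
      linarith
    · rw [hW, max_eq_left h]; linarith
  have h4 : W ^ l ≤ Real.exp (2 ^ k * (1 + Z ^ k)) * (l / k * Real.Gamma (l / k)) * (1 / 2) ^ l := by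
    have : W ^ l = 2 ^ l * W ^ l * (1 / 2) ^ l := by
      rw [one_div, inv_pow]; field_simp
    rw [this]
    refine mul_le_mul_of_nonneg_right (h1.trans ?_) (by positivity)
    gcongr
  rw [div_le_iff₀ hG]
  calc Z ^ l ≤ Z * W ^ l := h2
    _ ≤ Z * (Real.exp (2 ^ k * (1 + Z ^ k)) * (l / k * Real.Gamma (l / k)) * (1 / 2) ^ l) := by
        gcongr
    _ = _ := by ring

/-- Geometric sums of weights of all grades are bounded by a weight of grade `1`. -/
lemma exists_sum_weight_bound {k κ c C : ℝ} (hk : 0 < k) (hκ : k ≤ κ) (hC : 0 < C) :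
    ∃ A c' : ℝ, 0 ≤ A ∧ c ≤ c' ∧ ∀ c'' ≥ c', ∀ (l : ℕ) (s : ℝ), C ^ l * expWeight k κ c l s ≤
      A * (l * (1 / 2) ^ l) * expWeight k κ c'' 1 s := by
  have hG : 0 < Real.Gamma ((1 : ℕ) / k) := Real.Gamma_pos_of_pos (by positivity)
  refine ⟨C / k * Real.exp (2 ^ k * (1 + C ^ k)) * Real.Gamma ((1 : ℕ) / k), c + 2 ^ k * C ^ k,
    by positivity, by have : 0 ≤ (2 : ℝ) ^ k * C ^ k := by positivity
                      linarith, fun c'' hc'' l s => ?_⟩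
  have h1 := pow_div_Gamma_le hk (Z := C * Real.exp s) (by positivity) l
  have e1 : C ^ l * expWeight k κ c l s = Real.exp (-k * s) * ((C * Real.exp s) ^ l /
      Real.Gamma (l / k)) * Real.exp (c * Real.exp (κ * s)) := by
    have : Real.exp ((l - k) * s) = Real.exp (-k * s) * Real.exp s ^ l := by
      rw [← Real.exp_nat_mul, ← Real.exp_add]; congr 1; ring
    rw [expWeight, this, mul_pow]; ring
  -- Because `k ≤ κ`, the exponential of order `k` created by the summation is absorbed into that of
  -- order `κ` by enlarging `c`.
  have h2 : Real.exp (k * s) ≤ 1 + Real.exp (κ * s) := by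
    rcases le_total 0 s with h | h
    · have : Real.exp (k * s) ≤ Real.exp (κ * s) := Real.exp_le_exp.2 (by gcongr)
      linarith
    · have : Real.exp (k * s) ≤ 1 :=
        Real.exp_le_one_iff.2 (mul_nonpos_of_nonneg_of_nonpos hk.le h)
      linarith [Real.exp_pos (κ * s)]
  have e2 : (C * Real.exp s) ^ k = C ^ k * Real.exp (k * s) := by
    rw [Real.mul_rpow hC.le (Real.exp_pos _).le, ← Real.exp_mul, mul_comm s]
  have h3 : Real.exp (2 ^ k * (1 + (C * Real.exp s) ^ k)) * Real.exp (c * Real.exp (κ * s)) ≤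
      Real.exp (2 ^ k * (1 + C ^ k)) * Real.exp (c'' * Real.exp (κ * s)) := by
    rw [← Real.exp_add, ← Real.exp_add, Real.exp_le_exp, e2]
    have h4 : (2 : ℝ) ^ k * C ^ k * Real.exp (k * s) ≤ 2 ^ k * C ^ k * (1 + Real.exp (κ * s)) := by
      gcongr
    have h5 : (c + 2 ^ k * C ^ k) * Real.exp (κ * s) ≤ c'' * Real.exp (κ * s) := by gcongr
    linarith
  have e3 : expWeight k κ c'' 1 s = Real.exp (-k * s) * Real.exp s / Real.Gamma ((1 : ℕ) / k) *
      Real.exp (c'' * Real.exp (κ * s)) := by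
    rw [expWeight, ← Real.exp_add]; congr 3; push_cast; ring
  rw [e1, e3]
  calc _ ≤ Real.exp (-k * s) * (l / k * (1 / 2) ^ l * (C * Real.exp s *
        Real.exp (2 ^ k * (1 + (C * Real.exp s) ^ k)))) * Real.exp (c * Real.exp (κ * s)) := by
        gcongr
    _ = Real.exp (-k * s) * (l / k * (1 / 2) ^ l * (C * Real.exp s)) *
        (Real.exp (2 ^ k * (1 + (C * Real.exp s) ^ k)) * Real.exp (c * Real.exp (κ * s))) := by
        ring
    _ ≤ Real.exp (-k * s) * (l / k * (1 / 2) ^ l * (C * Real.exp s)) *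
        (Real.exp (2 ^ k * (1 + C ^ k)) * Real.exp (c'' * Real.exp (κ * s))) := by gcongr
    _ = _ := by field_simp

lemma summable_coe_mul_half_pow : Summable fun l : ℕ => (l : ℝ) * (1 / 2 : ℝ) ^ l :=
  (hasSum_coe_mul_geometric_of_norm_lt_one (r := (1 / 2 : ℝ)) (by norm_num)).summable

lemma tsum_coe_mul_half_pow : ∑' l : ℕ, (l : ℝ) * (1 / 2 : ℝ) ^ l = 2 := by
  rw [tsum_coe_mul_geometric_of_norm_lt_one (by norm_num)]; norm_num

end WeightSums

section GradedSum

variable {q : ℕ} {E : Type*} [NormedAddCommGroup E] [NormedSpace ℂ E] {P : SectorData q}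

/-- Absolute summability over pairs allows the sums over the grade `l` and the degree `n` to be
interchanged. For fixed `n` only the grades `l ≤ n` contribute, so the inner sum is finite. -/
lemma hasSum_graded_swap {a : ℕ → ℕ → ℂ} {b : ℕ → ℂ} {w : ℕ → ℝ} {S : ℕ → ℂ} {u : ℕ → ℝ}
    (ha : ∀ l, ∀ n < l, a l n = 0) (hw : ∀ n, ‖b n‖ ≤ w n)
    (hb : ∀ l (T : Finset ℕ), ∑ n ∈ T, ‖a l n‖ * w n ≤ u l) (hu : Summable u)
    (hS : ∀ l, HasSum (fun n => a l n * b n) (S l)) :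
    HasSum (fun n => (∑ l ∈ Finset.range (n + 1), a l n) * b n) (∑' l, S l) := by
  have hw0 : ∀ n, 0 ≤ w n := fun n => (norm_nonneg _).trans (hw n)
  have hs1 : ∀ l, Summable fun n => ‖a l n‖ * w n := fun l =>
    summable_of_sum_le (fun n => mul_nonneg (norm_nonneg _) (hw0 n)) (hb l)
  have hs2 : Summable fun p : ℕ × ℕ => ‖a p.1 p.2‖ * w p.2 := by
    refine (summable_prod_of_nonneg fun p => mul_nonneg (norm_nonneg _) (hw0 p.2)).2
      ⟨hs1, Summable.of_nonneg_of_le (fun l => tsum_nonneg fun n =>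
        mul_nonneg (norm_nonneg _) (hw0 n)) (fun l => ?_) hu⟩
    exact (hs1 l).tsum_le_of_sum_le (hb l)
  have hG : Summable fun p : ℕ × ℕ => a p.1 p.2 * b p.2 := by
    refine Summable.of_norm_bounded hs2 fun p => ?_
    rw [norm_mul]
    gcongr
    exact hw _
  have h1 := hG.hasSum.prod_fiberwise hS
  have h2 := ((Equiv.prodComm ℕ ℕ).hasSum_iff.2 hG.hasSum).prod_fiberwise
    (g := fun n => (∑ l ∈ Finset.range (n + 1), a l n) * b n) fun n => by
      rw [Finset.sum_mul]
      refine hasSum_sum_of_ne_finset_zero fun l hl => ?_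
      have : n < l := by simpa using hl
      simp [ha l n this]
  rw [h1.tsum_eq]
  exact h2

/-- The sum of a graded family of good chains with geometric bounds is multisummable. -/
theorem isMultisummable_of_graded {Ω : Set E} (hΩ : IsOpen Ω) (hε : ∀ j, 0 < P.ε j)
    {V : ℕ → E → Chain q} {B C : ℝ} (hB : 0 ≤ B) (hC : 0 < C)
    (hV : ∀ l, P.GoodOn Ω l (fun _ => B * C ^ l) (V l)) :
    IsMultisummable P.k P.θ Ω fun N Y => ∑ l ∈ Finset.range (N + 1), (V l Y).1 N := by
  choose A c' hA hc' hw using fun j => exists_sum_weight_bound (c := P.c) (P.pos j)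
    (P.le_order j) hC
  have hc'0 : ∀ j, 0 ≤ c' j := fun j => P.c_pos.le.trans (hc' j)
  set c := ∑ j, c' j with hcdef
  have hc : ∀ j, c' j ≤ c := fun j =>
    Finset.single_le_sum (fun i _ => hc'0 i) (Finset.mem_univ j)
  have hPc : P.c ≤ c := (hc' 0).trans (hc 0)
  have hcpos : 0 < c := P.c_pos.trans_le hPc
  set u : ℕ → ℝ := fun l => l * (1 / 2) ^ l with hu
  have hu0 : ∀ l, 0 ≤ u l := fun l => by positivity
  have hus : Summable u := summable_coe_mul_half_pow
  have hut : ∑' l, u l = 2 := tsum_coe_mul_half_pow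
  set Φ : Fin (q + 1) → ℝ → ℝ := fun j s => B * A j * expWeight (P.k j) (P.order j) c 1 s with hΦ
  have hΦc : ∀ j, Continuous (Φ j) := fun j => (continuous_expWeight _ _ _ _).const_mul _
  have hΦ0 : ∀ j s, 0 ≤ Φ j s := fun j s =>
    mul_nonneg (mul_nonneg hB (hA j)) (expWeight_nonneg (P.pos j) _ _ _ _)
  have hweight : ∀ j l s, B * C ^ l * P.weight j l s ≤ Φ j s * u l := by
    intro j l s
    have := mul_le_mul_of_nonneg_left (hw j c (hc j) l s) hB
    rw [mul_assoc]
    refine this.trans (le_of_eq ?_)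
    simp only [hΦ, hu]; ring
  have hbound : ∀ j l, ∀ ζ ∈ P.sector j, ∀ Y ∈ Ω, ‖(V l Y).2 j ζ‖ ≤ Φ j ζ.re * u l :=
    fun j l ζ hζ Y hY => (((hV l).good Y hY).norm_le j ζ hζ).trans (hweight j l ζ.re)
  have hsummable : ∀ j, ∀ ζ ∈ P.sector j, ∀ Y ∈ Ω, Summable fun l => (V l Y).2 j ζ :=
    fun j ζ hζ Y hY => Summable.of_norm_bounded (hus.mul_left _) fun l => hbound j l ζ hζ Y hY
  have hnorm : ∀ j, ∀ ζ ∈ P.sector j, ∀ Y ∈ Ω, ‖∑' l, (V l Y).2 j ζ‖ ≤ Φ j ζ.re * 2 := by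
    intro j ζ hζ Y hY
    rw [← hut, ← tsum_mul_left]
    exact tsum_of_norm_bounded (hus.mul_left _).hasSum fun l => hbound j l ζ hζ Y hY
  have hzero : ∀ l, ∀ Y ∈ Ω, ∀ n < l, (V l Y).1 n = 0 := fun l Y hY n hn =>
    ((hV l).good Y hY).coef_eq_zero n hn
  have hcoef : ∀ s < P.lam, ∀ l, ∀ Y ∈ Ω, ∀ T : Finset ℕ,
      ∑ n ∈ T, ‖(V l Y).1 n‖ * P.monoWeight n s ≤ Φ 0 s * u l := fun s hs l Y hY T =>
    (((hV l).good Y hY).sum_le s hs T).trans (hweight 0 l s)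
  set a : ℕ → E → ℂ := fun N Y => ∑ l ∈ Finset.range (N + 1), (V l Y).1 N with ha
  have hnorma : ∀ s < P.lam, ∀ Y ∈ Ω, ∀ n, ‖a n Y‖ * P.monoWeight n s ≤ Φ 0 s * 2 := by
    intro s hs Y hY n
    calc ‖a n Y‖ * P.monoWeight n s
        ≤ (∑ l ∈ Finset.range (n + 1), ‖(V l Y).1 n‖) * P.monoWeight n s :=
          mul_le_mul_of_nonneg_right (norm_sum_le _ _) (P.monoWeight_nonneg n s)
      _ = ∑ l ∈ Finset.range (n + 1), ‖(V l Y).1 n‖ * P.monoWeight n s := Finset.sum_mul _ _ _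
      _ ≤ ∑ l ∈ Finset.range (n + 1), Φ 0 s * u l := Finset.sum_le_sum fun l _ => by
          simpa using hcoef s hs l Y hY {n}
      _ ≤ ∑' l, Φ 0 s * u l := (hus.mul_left _).sum_le_tsum _ fun l _ =>
          mul_nonneg (hΦ0 0 s) (hu0 l)
      _ = _ := by rw [tsum_mul_left, hut]
  have hadiff : ∀ n, DifferentiableOn ℂ (a n) Ω := fun n =>
    DifferentiableOn.fun_sum fun l _ => (hV l).coef n
  -- A radius strictly inside the region controlled by the chains; halving it once more gives the
  -- geometric convergence of the first-level series.
  set s₀ := P.lam - 1 with hs₀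
  have hs₀lt : s₀ < P.lam := by rw [hs₀]; linarith
  set A' := Φ 0 s₀ * 2 * Real.exp (-((1 - P.k 0) * s₀)) with hA'
  have hA'0 : 0 ≤ A' := mul_nonneg (mul_nonneg (hΦ0 _ _) zero_le_two) (Real.exp_pos _).le
  set t : ℕ → E → ℂ := fun n Y => a (n + 1) Y / (Real.Gamma (((n : ℝ) + 1) / P.k 0) : ℂ) with ht
  have htn : ∀ n, ∀ Y ∈ Ω, ‖t n Y‖ * Real.exp s₀ ^ n ≤ A' := by
    intro n Y hY
    have h1 := hnorma s₀ hs₀lt Y hY (n + 1)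
    have hG : 0 < Real.Gamma (((n : ℝ) + 1) / P.k 0) :=
      Real.Gamma_pos_of_pos (by have := P.k_pos; positivity)
    rw [P.monoWeight_succ] at h1
    rw [ht, norm_div, Complex.norm_real, Real.norm_of_nonneg hG.le, hA']
    calc _ = ‖a (n + 1) Y‖ * (Real.exp ((1 - P.k 0) * s₀) * (Real.exp s₀ ^ n /
          Real.Gamma (((n : ℝ) + 1) / P.k 0))) * Real.exp (-((1 - P.k 0) * s₀)) := by
          rw [Real.exp_neg]
          field_simp
      _ ≤ _ := by gcongr
  have hterm : ∀ n, ∀ p ∈ ball (0 : ℂ) (Real.exp s₀ / 2) ×ˢ Ω,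
      ‖t n p.2 * p.1 ^ n‖ ≤ A' * (1 / 2) ^ n := by
    intro n p hp
    have h1 : ‖p.1‖ ≤ Real.exp s₀ * (1 / 2) := by
      have := mem_ball_zero_iff.1 hp.1
      linarith
    rw [norm_mul, norm_pow]
    calc _ ≤ ‖t n p.2‖ * (Real.exp s₀ * (1 / 2)) ^ n := by gcongr
      _ = ‖t n p.2‖ * Real.exp s₀ ^ n * (1 / 2) ^ n := by rw [mul_pow]; ring
      _ ≤ _ := by gcongr; exact htn n p.2 hp.2
  have hhsum : ∀ p ∈ ball (0 : ℂ) (Real.exp s₀ / 2) ×ˢ Ω,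
      HasSum (fun n => t n p.2 * p.1 ^ n) (∑' n, t n p.2 * p.1 ^ n) := fun p hp =>
    (Summable.of_norm_bounded (summable_geometric_two.mul_left A') fun n => hterm n p hp).hasSum
  refine ⟨hadiff, P.ε, fun j p => ∑' l, (V l p.2).2 j p.1, hε,
    ⟨Real.exp s₀ / 2, fun p => ∑' n, t n p.2 * p.1 ^ n, by positivity, ?_, ?_, ?_⟩, ?_, ?_⟩
  · refine differentiableOn_tsum_of_norm_le_mul (isOpen_ball.prod hΩ) (fun n => ?_)
      (Φ := fun _ => A') continuousOn_const summable_geometric_two (fun n => by positivity) hterm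
    refine DifferentiableOn.mul ?_ (by fun_prop)
    have hdt : DifferentiableOn ℂ (t n) Ω := by
      simp only [ht, div_eq_mul_inv]
      exact (hadiff (n + 1)).mul_const _
    exact hdt.comp (f := fun p : ℂ × E => p.2) differentiableOn_snd fun p hp => hp.2
  · exact fun ξ hξ Y hY => hhsum (ξ, Y) ⟨hξ, hY⟩
  · intro ζ hζ hr Y hY
    have hs : ζ.re < P.lam := by
      refine lt_trans ?_ hs₀lt
      rw [← Real.exp_lt_exp]
      have := Real.exp_pos s₀
      linarith
    have h1 := hasSum_graded_swap (fun l n hn => hzero l Y hY n hn)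
      (fun n => (P.norm_mono n ζ).le) (fun l T => hcoef ζ.re hs l Y hY T) (hus.mul_left _)
      fun l => ((hV l).good Y hY).hasSum ζ hζ hs
    have h2 := hasSum_borelMono (k := P.k 0) (a := fun n => a n Y)
      (hhsum (Complex.exp ζ, Y) ⟨by rw [mem_ball_zero_iff, Complex.norm_exp]; exact hr, hY⟩)
    refine h1.unique (h2.congr_fun fun n => ?_)
    rcases n with _ | n
    · simp [borelMono_zero]
    · rw [if_neg (Nat.succ_ne_zero n)]
  · intro j
    have hd := differentiableOn_tsum_of_norm_le_mul ((P.isOpen_sector j).prod hΩ)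
      (fun l => (hV l).brl j) (Φ := fun p => Φ j p.1.re) (u := u)
      ((hΦc j).comp (by fun_prop)).continuousOn hus hu0
      fun l p hp => hbound j l p.1 hp.1 p.2 hp.2
    have hκ : 0 < P.order j := (P.pos j).trans_le (P.le_order j)
    have hG : 0 < Real.Gamma ((1 : ℕ) / P.k j) := Real.Gamma_pos_of_pos (by
      have := P.pos j; positivity)
    refine ⟨hd, B * A j / Real.Gamma ((1 : ℕ) / P.k j) * 2 + 1, c + (P.order j)⁻¹, ?_,
      by positivity, fun ζ hζ hp Y hY => (hnorm j ζ hζ Y hY).trans ?_⟩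
    · have := hA j
      positivity
    · have h1 : Real.exp ((1 - P.k j) * ζ.re) ≤
          Real.exp ((P.order j)⁻¹ * Real.exp (P.order j * ζ.re)) := by
        rw [Real.exp_le_exp]
        have h2 : ζ.re ≤ (P.order j)⁻¹ * Real.exp (P.order j * ζ.re) := by
          rw [inv_mul_eq_div, le_div_iff₀ hκ]
          linarith [Real.add_one_le_exp (P.order j * ζ.re)]
        have h3 := mul_nonneg (P.pos j).le hp
        linarith
      have e1 : Φ j ζ.re * 2 = B * A j / Real.Gamma ((1 : ℕ) / P.k j) * 2 *
          (Real.exp ((1 - P.k j) * ζ.re) * Real.exp (c * Real.exp (P.order j * ζ.re))) := by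
        simp only [hΦ, expWeight]; push_cast; ring
      have hA1 := hA j
      have hA2 : 0 ≤ B * A j / Real.Gamma ((1 : ℕ) / P.k j) * 2 := by positivity
      rw [e1]
      calc _ ≤ (B * A j / Real.Gamma ((1 : ℕ) / P.k j) * 2 + 1) *
            (Real.exp ((P.order j)⁻¹ * Real.exp (P.order j * ζ.re)) *
              Real.exp (c * Real.exp (P.order j * ζ.re))) := by
            gcongr
            linarith
        _ = _ := by
            rw [← Real.exp_add, ← add_mul, add_comm c]
            rfl
  · intro j φ ψ hφ hψ hgap Y hY
    have hk1 := P.pos j.castSucc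
    have hk2 := P.lt j
    have hR := accelRate_pos hk1 hk2 hgap
    have hκ := accelOrder_pos hk1 hk2
    have hlim : Tendsto (fun s : ℝ => 2 * c *
        Real.exp (accelOrder (P.k j.castSucc) (P.k j.succ) * s)) atBot (𝓝 0) := by
      have h1 := (Real.tendsto_exp_atBot.comp (tendsto_id.const_mul_atBot hκ)).const_mul (2 * c)
      simpa using h1
    filter_upwards [hlim.eventually_le_const hR] with s hs
    -- The sum has the larger type `c`; its region of convergence lies inside the one for `P.c`,
    -- where every chain satisfies the acceleration identity.
    have hs' : 2 * P.c * Real.exp (accelOrder (P.k j.castSucc) (P.k j.succ) * s) ≤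
        accelRate (P.k j.castSucc) (P.k j.succ) (ψ - φ) := le_trans (by gcongr) hs
    have h1 := hasSum_accel hk1 hk2 (l := 1) (φ := φ) (ψ := ψ) (c := c)
      (B := 2 * (B * A j.castSucc)) one_ne_zero
      (f := fun l => (V l Y).2 j.castSucc) (F := fun ζ => ∑' l, (V l Y).2 j.castSucc ζ)
      (fun l => (((hV l).good Y hY).cont j.castSucc).comp_continuous (by fun_prop)
        fun t => ray_mem_logSector hφ t) (b := fun l t => Φ j.castSucc t * u l)
      (fun l t => by
        have := hbound j.castSucc l _ (ray_mem_logSector hφ t) Y hY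
        simpa using this)
      (fun t => hus.mul_left _) (fun t => le_of_eq ?_) ?_
      (fun t => (hsummable j.castSucc _ (ray_mem_logSector hφ t) Y hY).hasSum) hgap hs
    · refine HasSum.tsum_eq ?_
      refine h1.congr_fun fun l => ?_
      exact ((hV l).good Y hY).accel_eq j φ ψ s hφ hψ hgap hs'
    · rw [tsum_mul_left, hut]
      simp only [hΦ, P.order_castSucc]
      ring
    · simp only [tsum_mul_left]
      exact ((hΦc _).mul continuous_const).measurable

end GradedSum
end

noncomputable section

open MeasureTheory Filter Topology Set Metric
open scoped Interval

/-! ### The total of the graded scheme solves the formal problem. -/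

section Total

variable {q m n : ℕ}

/-- A piece of grade `a` begins in degree `a`. All sums may therefore be extended to a full square,
since pairs of total grade above `N` contribute nothing in degree `N`. -/
lemma sum_antidiagonal_graded {e e' : ℕ → ℕ → ℂ} (he : ∀ a, ∀ n < a, e a n = 0)
    (he' : ∀ a, ∀ n < a, e' a n = 0) (N : ℕ) :
    ∑ l ∈ Finset.range (N + 1), ∑ x ∈ Finset.HasAntidiagonal.antidiagonal l,
      ∑ p ∈ Finset.HasAntidiagonal.antidiagonal N, e x.1 p.1 * e' x.2 p.2 =
    ∑ p ∈ Finset.HasAntidiagonal.antidiagonal N, (∑ a ∈ Finset.range (p.1 + 1), e a p.1) *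
      ∑ a ∈ Finset.range (p.2 + 1), e' a p.2 := by
  have hsub : ∀ {e : ℕ → ℕ → ℂ}, (∀ a, ∀ n < a, e a n = 0) → ∀ r ≤ N,
      ∑ a ∈ Finset.range (r + 1), e a r = ∑ a ∈ Finset.range (N + 1), e a r := by
    intro e he r hr
    refine Finset.sum_subset (Finset.range_subset_range.2 (by omega)) fun a _ ha => ?_
    exact he a r (by simpa using ha)
  rw [sum_range_antidiagonal_eq (N + 1) fun x =>
    ∑ p ∈ Finset.HasAntidiagonal.antidiagonal N, e x.1 p.1 * e' x.2 p.2]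
  have h1 : ∀ x ∈ Finset.range (N + 1) ×ˢ Finset.range (N + 1), (if x.1 + x.2 < N + 1 then
      ∑ p ∈ Finset.HasAntidiagonal.antidiagonal N, e x.1 p.1 * e' x.2 p.2 else 0) =
      ∑ p ∈ Finset.HasAntidiagonal.antidiagonal N, e x.1 p.1 * e' x.2 p.2 := by
    intro x _
    split_ifs with h
    · rfl
    · refine (Finset.sum_eq_zero fun p hp => ?_).symm
      have := Finset.HasAntidiagonal.mem_antidiagonal.1 hp
      rcases lt_or_ge p.1 x.1 with h' | h'
      · rw [he _ _ h', zero_mul]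
      · rw [he' _ _ (by omega), mul_zero]
  rw [Finset.sum_congr rfl h1, Finset.sum_comm]
  refine Finset.sum_congr rfl fun p hp => ?_
  have := Finset.HasAntidiagonal.mem_antidiagonal.1 hp
  rw [hsub he p.1 (by omega), hsub he' p.2 (by omega), Finset.sum_mul_sum, ← Finset.sum_product']

variable {E ι : Type*} [NormedAddCommGroup E] [NormedSpace ℂ E] [Fintype ι]

/-- Each of the `d` jet factors raises the grade by at least one. -/
lemma coef_gradedTerm_of_lt {k : Fin (q + 1) → ℝ} {b : ι → E} {y : ℕ → ι → E → Chain q}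
    {g : ℕ → E → Chain q} {d l : ℕ} (h : l < d) (Y : E) (N : ℕ) :
    (gradedTerm k b y g d l Y).1 N = 0 := by
  induction d generalizing l Y N with
  | zero => omega
  | succ d ih =>
    rcases l with _ | l
    · rfl
    · simp only [gradedTerm, Pi.smul_apply, Finset.sum_apply, Prod.smul_fst, Prod.fst_sum,
        Chain.mul, SectorData.dirDeriv]
      rw [Finset.sum_eq_zero, smul_zero]
      intro i _
      refine Finset.sum_eq_zero fun x hx => Finset.sum_eq_zero fun p _ => ?_
      have := Finset.HasAntidiagonal.mem_antidiagonal.1 hx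
      have h0 : (fun Y => (gradedTerm k b y g d x.2 Y).1 p.2) = fun _ => 0 :=
        funext fun Y => ih (by omega) Y p.2
      rw [h0]
      simp [lineDeriv]

/-- The total of the graded Taylor terms is the Taylor term of the total. -/
theorem sum_coef_gradedTerm [FiniteDimensional ℂ E] {k : Fin (q + 1) → ℝ} {b : ι → E}
    {y : ℕ → ι → E → Chain q} {g : ℕ → E → Chain q} {Ω : Set E} (hΩ : IsOpen Ω) {f : ℕ → E → ℂ}
    {p : E → ι → PowerSeries ℂ}
    (hfd : ∀ N, DifferentiableOn ℂ (f N) Ω)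
    (hf : ∀ N, ∀ Y ∈ Ω, ∑ l ∈ Finset.range (N + 1), (g l Y).1 N = f N Y)
    (hp : ∀ i N, ∀ Y ∈ Ω, PowerSeries.coeff N (p Y i) =
      ∑ a ∈ Finset.range (N + 1), (y a i Y).1 N)
    (hpb : ∀ i Y (z : ℂ), p (Y + z • b i) = p Y)
    (hy : ∀ a i, ∀ Y ∈ Ω, ∀ N < a + 1, (y a i Y).1 N = 0)
    (hg : ∀ d l, ∀ Y ∈ Ω, ∀ N < l, (gradedTerm k b y g d l Y).1 N = 0)
    (hgd : ∀ d l N, DifferentiableOn ℂ (fun Y => (gradedTerm k b y g d l Y).1 N) Ω) (d N : ℕ) :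
    ∀ Y ∈ Ω, ∑ l ∈ Finset.range (N + 1), (gradedTerm k b y g d l Y).1 N =
      PowerSeries.coeff N (jetTerm b (p Y) d f Y) := by
  induction d generalizing N with
  | zero =>
    intro Y hY
    simp only [gradedTerm, jetTerm, PowerSeries.coeff_mk]
    exact hf N Y hY
  | succ d ih =>
    intro Y hY
    -- The induction hypothesis is differentiated in the direction `b i`; along this direction `p`
    -- is constant, so only `f` is differentiated.
    have hlin : ∀ i M, ∑ a ∈ Finset.range (M + 1),
        lineDeriv ℂ (fun Y => (gradedTerm k b y g d a Y).1 M) Y (b i) =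
        PowerSeries.coeff M (jetTerm b (p Y) d (fun N Z => lineDeriv ℂ (f N) Z (b i)) Y) := by
      intro i M
      have h1 : HasLineDerivAt ℂ
          (fun Y => ∑ a ∈ Finset.range (M + 1), (gradedTerm k b y g d a Y).1 M)
          (∑ a ∈ Finset.range (M + 1),
            lineDeriv ℂ (fun Y => (gradedTerm k b y g d a Y).1 M) Y (b i)) Y (b i) :=
        HasDerivAt.fun_sum fun a _ =>
          ((hgd d a M).differentiableAt (hΩ.mem_nhds hY)).lineDifferentiableAt.hasLineDerivAt
      rw [← h1.lineDeriv, lineDeriv_congr_of_eqOn hΩ (ih M) hY (b i)]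
      have h2 := hasDerivAt_coeff_jetTerm (b := b) (p := p Y) hΩ d hfd hY (b i) M
      refine HasDerivAt.deriv (h2.congr_of_eventuallyEq (Eventually.of_forall fun z => ?_))
      simp only [hpb]
    have hzero : ∀ i, ∀ a, ∀ M < a,
        lineDeriv ℂ (fun Y => (gradedTerm k b y g d a Y).1 M) Y (b i) = 0 := by
      intro i a M hM
      rw [lineDeriv_congr_of_eqOn hΩ (g := fun _ => 0) (fun Y hY => hg d a Y hY M hM) hY (b i)]
      simp [lineDeriv]
    rw [coeff_jetTerm_succ, Finset.sum_range_succ']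
    have e0 : (gradedTerm k b y g (d + 1) 0 Y).1 N = 0 := rfl
    -- The term of grade `N + 1` vanishes in degree `N`. It replaces the lost term of grade `0`, so
    -- that after the shift the sum again runs over `range (N + 1)`.
    rw [e0, add_zero, ← add_zero (∑ l ∈ Finset.range N, _),
      ← hg (d + 1) (N + 1) Y hY N (Nat.lt_succ_self N),
      ← Finset.sum_range_succ fun l => (gradedTerm k b y g (d + 1) (l + 1) Y).1 N]
    simp only [gradedTerm, Pi.smul_apply, Finset.sum_apply, Prod.smul_fst, Prod.fst_sum,
        Chain.mul, SectorData.dirDeriv, smul_eq_mul]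
    rw [← Finset.mul_sum, Finset.sum_comm]
    congr 1
    refine Finset.sum_congr rfl fun i _ => ?_
    rw [sum_antidiagonal_graded (e := fun a M => (y a i Y).1 M)
      (e' := fun a M => lineDeriv ℂ (fun Y => (gradedTerm k b y g d a Y).1 M) Y (b i))
      (fun a M hM => hy a i Y hY M (by omega)) (hzero i) N]
    exact Finset.sum_congr rfl fun x _ => by rw [hlin, hp i _ Y hY]

lemma coef_mul_var (k : Fin (q + 1) → ℝ) (e : Chain q) (N : ℕ) :
    (Chain.mul k (Chain.var k) e).1 (N + 1) = e.1 N := by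
  simp only [Chain.mul, Chain.var]
  rw [Finset.sum_eq_single (1, N)]
  · simp
  · rintro ⟨a, b⟩ hx hne
    have := Finset.HasAntidiagonal.mem_antidiagonal.1 hx
    simp only at this ⊢
    rw [if_neg, zero_mul]
    rintro rfl
    exact hne (Prod.ext rfl (by simp only; omega))
  · intro h
    exact absurd (Finset.HasAntidiagonal.mem_antidiagonal.2 (by simp only; omega)) h

lemma IsMultisummable.congr {k θ : Fin (q + 1) → ℝ} {Ω : Set E} {a a' : ℕ → E → ℂ}
    (h : IsMultisummable k θ Ω a) (haa : ∀ N, EqOn (a N) (a' N) Ω) :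
    IsMultisummable k θ Ω a' := by
  obtain ⟨h1, ε, F, h2, ⟨r, H, h3, h4, h5, h6⟩, h7, h8⟩ := h
  refine ⟨fun N => (h1 N).congr fun Y hY => (haa N hY).symm, ε, F, h2,
    ⟨r, H, h3, h4, fun ξ hξ Y hY => ?_, h6⟩, h7, h8⟩
  have := h5 ξ hξ Y hY
  simp only [haa _ hY] at this
  exact this

end Total

section Main

variable {q m n : ℕ} {P : SectorData q} {R M : ℝ}

/-- The total of the graded fixed point solves the formal Cauchy problem. -/
theorem isJetSolution_total (hR : 0 < R) {f : Fin m → ℕ → JetSpace m n → ℂ}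
    (hfd : ∀ i N, DifferentiableOn ℂ (f i N) (ball 0 R))
    {g : Fin m → ℕ → JetSpace m n → Chain q}
    (hf : ∀ i N, ∀ Y ∈ ball (0 : JetSpace m n) R,
      ∑ l ∈ Finset.range (N + 1), (g i l Y).1 N = f i N Y)
    {U : ℕ → Fin m → (Fin n → ℂ) → Chain q}
    (hU : ∀ l i, U l i = fun x => Chain.mul P.k (Chain.var P.k) (nextChain P.k (g i) U l x))
    {B : ℕ → ℕ → JetSpace m n → ℝ} (hT : ∀ i d l, P.GoodOn (ball 0 R) l (B d l)
      (gradedTerm P.k jetDir (jetChain U) (g i) d l))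
    {B' : ℕ → (Fin n → ℂ) → ℝ} (hUg : ∀ i l, P.GoodOn (ball 0 R) (l + 1) (B' l) (U l i)) :
    IsJetSolution (ball 0 R) f
      fun i N x => ∑ l ∈ Finset.range (N + 1), (U l i x).1 N := by
  have hzero : ∀ l i, ∀ x ∈ ball (0 : Fin n → ℂ) R, ∀ N < l + 1, (U l i x).1 N = 0 :=
    fun l i x hx N hN => ((hUg i l).good x hx).coef_eq_zero N hN
  have hbase : ∀ x ∈ ball (0 : Fin n → ℂ) R, (jetBase x : JetSpace m n) ∈ ball 0 R := fun x hx =>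
    mem_jetBall.2 ⟨by simpa [jetBase] using hx, by simpa [jetBase] using hR⟩
  refine ⟨fun i N => DifferentiableOn.fun_sum fun l _ => (hUg i l).coef N, fun i x hx => ?_,
    fun i N x hx => ?_⟩
  · simp [hzero 0 i x hx 0 (by omega)]
  have hN : ((N : ℂ) + 1) ≠ 0 := by exact_mod_cast Nat.succ_ne_zero N
  have hmain : ∀ d, ∑ l ∈ Finset.range (N + 1),
      (gradedTerm P.k jetDir (jetChain U) (g i) d l (jetBase x)).1 N =
      PowerSeries.coeff N (jetTerm jetDir (jetSeries (fun i N x =>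
        ∑ l ∈ Finset.range (N + 1), (U l i x).1 N) x) d (f i) (jetBase x)) := by
    intro d
    refine sum_coef_gradedTerm (p := fun Y => jetSeries (fun i N x =>
        ∑ l ∈ Finset.range (N + 1), (U l i x).1 N) Y.1) isOpen_ball (hfd i) (hf i)
      (fun j N Y hY => ?_) (fun j Y z => ?_) (fun a j Y hY N hN' => ?_)
      (fun d l Y hY N hN' => ((hT i d l).good Y hY).coef_eq_zero N hN')
      (fun d l N => (hT i d l).coef N) d N (jetBase x) (hbase x hx)
    · have hY1 : Y.1 ∈ ball (0 : Fin n → ℂ) R := mem_ball_zero_iff.2 (mem_jetBall.1 hY).1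
      rcases j with j | ⟨j, c⟩
      · simp [jetSeries, jetChain]
      · simp only [jetSeries, jetChain, PowerSeries.coeff_mk, SectorData.dirDeriv]
        have h1 : HasLineDerivAt ℂ (fun x => ∑ l ∈ Finset.range (N + 1), (U l j x).1 N)
            (∑ l ∈ Finset.range (N + 1),
              lineDeriv ℂ (fun x => (U l j x).1 N) Y.1 (Pi.single c 1)) Y.1 (Pi.single c 1) :=
          HasDerivAt.fun_sum fun l _ => (((hUg j l).coef N).differentiableAt
            (isOpen_ball.mem_nhds hY1)).lineDifferentiableAt.hasLineDerivAt
        exact h1.lineDeriv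
    · simp only [Prod.fst_add, Prod.smul_fst, jetDir_fst, smul_zero, add_zero]
    · have hY1 : Y.1 ∈ ball (0 : Fin n → ℂ) R := mem_ball_zero_iff.2 (mem_jetBall.1 hY).1
      rcases j with j | ⟨j, c⟩
      · exact hzero a j Y.1 hY1 N hN'
      · exact lineDeriv_eq_zero_of_eqOn_zero isOpen_ball (fun x hx => hzero a j x hx N hN') hY1 _
  -- `U (N + 1)` has grade `N + 2` and does not reach degree `N + 1`, so its term can be dropped.
  rw [Finset.sum_range_succ, hzero (N + 1) i x hx (N + 1) (by omega), add_zero]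
  simp only [← hmain]
  rw [Finset.sum_comm, Finset.mul_sum]
  refine Finset.sum_congr rfl fun l hl => ?_
  have hl' := Finset.mem_range.1 hl
  rw [hU l i]
  simp only [coef_mul_var, nextChain, Chain.dil, Finset.sum_apply, Prod.fst_sum]
  -- The factor `N + 1` from `∂_t` meets the denominator of `dil`: `dil` followed by multiplication
  -- by `t` is integration from `0`. The terms with `d > l` added afterwards are zero.
  rw [mul_div_cancel₀ _ hN]
  refine Finset.sum_subset (Finset.range_subset_range.2 (by omega)) fun d _ hd => ?_
  exact coef_gradedTerm_of_lt (by simpa using hd) _ _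

end Main
end

/-! ### Assembly: local multisummability and the theorem. -/

noncomputable section

open MeasureTheory Filter Topology Set Metric
open scoped Interval

/-- The graded right-hand side: constant term and remainder. -/
def gradedRhs {q : ℕ} {E : Type*} (a : ℕ → E → ℂ) (G : E → Chain q) : ℕ → E → Chain q
  | 0 => fun Y => Chain.const q (a 0 Y)
  | 1 => G
  | _ + 2 => 0

lemma sum_coef_gradedRhs {q : ℕ} {E : Type*} (a : ℕ → E → ℂ) (F : Fin (q + 1) → ℂ × E → ℂ)
    (N : ℕ) (Y : E) :
    ∑ l ∈ Finset.range (N + 1), (gradedRhs a (baseChain a F) l Y).1 N = a N Y := by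
  rcases N with _ | N
  · simp [gradedRhs, Chain.const]
  · rw [Finset.sum_range_succ', Finset.sum_range_succ']
    have h : ∑ l ∈ Finset.range N, (gradedRhs a (baseChain a F) (l + 1 + 1) Y).1 (N + 1) = 0 :=
      Finset.sum_eq_zero fun l _ => rfl
    rw [h]
    simp [gradedRhs, Chain.const, baseChain]

/-- Local multisummability: near the origin, a formal solution divided by `t` is multisummable. -/
theorem exists_isMultisummable {m n q : ℕ} {k θ : Fin (q + 1) → ℝ} (hk0 : 0 < k 0)
    (hk : StrictMono k) (hθ : IsMultidirection k θ) {Ω : Set (JetSpace m n)} (hΩ : IsOpen Ω)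
    (h0 : (0 : JetSpace m n) ∈ Ω) {f : Fin m → ℕ → JetSpace m n → ℂ}
    (hf : ∀ i, IsMultisummable k θ Ω (f i)) {R₀ : ℝ} (hR₀ : 0 < R₀)
    {u : Fin m → ℕ → (Fin n → ℂ) → ℂ} (hu : IsJetSolution (ball 0 R₀) f u) :
    ∃ r : ℝ, 0 < r ∧ r ≤ R₀ ∧
      ∀ i, IsMultisummable k θ (ball (0 : Fin n → ℂ) r) fun N => u i (N + 1) := by
  obtain ⟨P, F, R, M, rfl, rfl, hε, hR, hR1, hM, hRΩ, hG⟩ :=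
    exists_sectorData hk0 hk hθ hΩ h0 hf
  set g : Fin m → ℕ → JetSpace m n → Chain q := fun i => gradedRhs (f i) (baseChain (f i) (F i))
    with hg
  obtain ⟨U, hU⟩ := exists_chain_solution P.k g
  obtain ⟨D, hD0, hD, C, hC1, hDC⟩ := exists_majorant_solution
    (K := 36 * Fintype.card (JetIndex m n)) (by positivity) hM hR
  have hbounds := goodOn_nextChain hR hR1 (zero_le_one.trans hM) (g := g) (fun i => (hG i).1)
    (fun i => (hG i).2) (fun i l => rfl) hU hD0 hD
  have hsol : IsJetSolution (ball 0 R) f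
      fun i N x => ∑ l ∈ Finset.range (N + 1), (U l i x).1 N :=
    isJetSolution_total hR (fun i N => ((hf i).1 N).mono hRΩ)
      (fun i N Y _ => sum_coef_gradedRhs (f i) (F i) N Y) hU
      (fun i d l => (hbounds l).1 i d) fun i l => (hbounds l).2.2 i
  -- On half of the ball `(R - ‖x‖)⁻¹ ≤ 2 / R`, which turns the bounds with boundary blow-up into
  -- uniform geometric ones.
  set r := min (R / 2) R₀ with hr
  have hr0 : 0 < r := lt_min (by positivity) hR₀
  have hrR : r ≤ R / 2 := min_le_left _ _
  refine ⟨r, hr0, min_le_right _ _, fun i => ?_⟩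
  have hsub : ball (0 : Fin n → ℂ) r ⊆ ball 0 R := ball_subset_ball (by linarith)
  -- The total and `u` solve the same recursion on the small ball, so uniqueness identifies them.
  have heq := fun N => (hsol.mono hsub).eqOn isOpen_ball
    (hu.mono (ball_subset_ball (min_le_right _ _))) N i
  -- The chains summed are those before multiplication by `t`; their total represents `u / t`.
  refine (isMultisummable_of_graded (P := P) (V := nextChain P.k (g i) U) (B := 4 * M)
    (C := C * (2 / R)) isOpen_ball hε (by linarith) (by positivity) fun l => ?_).congr
    fun N x hx => ?_
  · refine (((hbounds l).2.1 i).subset hsub).mono continuousOn_const fun x hx => ?_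
    have hx' : ‖x‖ < R / 2 := (mem_ball_zero_iff.1 hx).trans_le hrR
    have h1 : (R - ‖x‖)⁻¹ ≤ 2 / R := by
      rw [inv_le_comm₀ (by linarith) (by positivity), inv_div]
      linarith
    have h2 : 0 ≤ (R - ‖x‖)⁻¹ := inv_nonneg.2 (by linarith)
    calc D l / (l + 1) * (R - ‖x‖)⁻¹ ^ l ≤ D l * (2 / R) ^ l := by
          gcongr
          · exact hD0 l
          · exact div_le_self (hD0 l) (by linarith [(Nat.cast_nonneg l : (0 : ℝ) ≤ l)])
      _ ≤ 4 * M * C ^ l * (2 / R) ^ l := by gcongr; exact hDC l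
      _ = _ := by rw [mul_pow]; ring
  · rw [← heq (N + 1) hx]
    have htop : (U (N + 1) i x).1 (N + 1) = 0 :=
      (((hbounds (N + 1)).2.2 i).good x (hsub hx)).coef_eq_zero (N + 1) (Nat.lt_succ_self _)
    beta_reduce
    rw [Finset.sum_range_succ _ (N + 1), htop, add_zero]
    refine Finset.sum_congr rfl fun l _ => ?_
    rw [hU l i]
    exact (coef_mul_var _ _ _).symm

end

theorem theorem5p2 {m n q : ℕ} (k θ : Fin (q + 1) → ℝ)
    (hk0 : 0 < k 0) (hk : StrictMono k) (hθ : IsMultidirection k θ)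
    (R₀ R₁ : ℝ) (hR₀ : 0 < R₀) (hR₁ : 0 < R₁)
    (f : Fin m → ℕ → (Fin n → ℂ) × (Fin m → ℂ) × (Fin m → Fin n → ℂ) → ℂ)
    (hf : ∀ i, IsMultisummable k θ
      (Metric.ball (0 : Fin n → ℂ) R₀ ×ˢ
        (Metric.ball (0 : Fin m → ℂ) R₁ ×ˢ Metric.ball (0 : Fin m → Fin n → ℂ) R₁)) (f i)) :
    ∃ u : Fin m → ℕ → (Fin n → ℂ) → ℂ,
      IsFormalSolution (Metric.ball (0 : Fin n → ℂ) R₀) f u ∧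
      (∀ u' : Fin m → ℕ → (Fin n → ℂ) → ℂ,
        IsFormalSolution (Metric.ball (0 : Fin n → ℂ) R₀) f u' →
          ∀ i N, Set.EqOn (u' i N) (u i N) (Metric.ball (0 : Fin n → ℂ) R₀)) ∧
      ∃ r : ℝ, 0 < r ∧ r ≤ R₀ ∧
        ∀ i, IsMultisummable k θ (Metric.ball (0 : Fin n → ℂ) r) (fun N => u i (N + 1)) := by
  have hΩ : IsOpen (Metric.ball (0 : Fin n → ℂ) R₀ ×ˢ
      (Metric.ball (0 : Fin m → ℂ) R₁ ×ˢ Metric.ball (0 : Fin m → Fin n → ℂ) R₁)) :=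
    Metric.isOpen_ball.prod (Metric.isOpen_ball.prod Metric.isOpen_ball)
  have hbase : ∀ x ∈ Metric.ball (0 : Fin n → ℂ) R₀, jetBase x ∈
      Metric.ball (0 : Fin n → ℂ) R₀ ×ˢ
      (Metric.ball (0 : Fin m → ℂ) R₁ ×ˢ Metric.ball (0 : Fin m → Fin n → ℂ) R₁) := fun x hx =>
    ⟨hx, Metric.mem_ball_self hR₁, Metric.mem_ball_self hR₁⟩
  have hiff := fun u => isFormalSolution_iff_isJetSolution (u := u) Metric.isOpen_ball hΩ
    (fun i N => (hf i).1 N) hbase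
  obtain ⟨u, hu⟩ := exists_isJetSolution Metric.isOpen_ball hΩ (fun i N => (hf i).1 N) hbase
  exact ⟨u, (hiff u).2 hu, fun u' hu' i N =>
    ((hiff u').1 hu').eqOn Metric.isOpen_ball hu N i,
    exists_isMultisummable hk0 hk hθ hΩ (hbase 0 (Metric.mem_ball_self hR₀)) hf hR₀ hu⟩
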